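/- Let $\omega$ be a real number such that two $n\times n$ matrices over a prime field can be multiplied with $O(n^{\omega})$ arithmetic operations (by one uniform arithmetic program for all primes $p$ and all $n\ge 1$, whose $O(\log n)$-bit index computations are counted as well). Time below is the number of steps of a randomized word RAM with words of $w=\Theta(\log N)$ bits, $N$ the size of the whole input (more generally, of any number $w\ge\kappa\log_2 N$ of bits for a suitable constant $\kappa$), and unit-cost arithmetic, comparison, memory access and drawing of a uniformly random word. For every constant $c\in\mathbb{N}$ there are two programs, one for preprocessing and one for queries, with the following properties. Given the adjacency matrix of any directed graph $G$ with $n$ nodes, the preprocessing always halts within $\tilde{O}(n^{\omega})$ steps. Then, given any batch of $f$ edge insertions and deletions together with a pair $(u,v)$ of nodes, the query program, started in the memory state left by the preprocessing, always halts within $\tilde{O}((f+1)^{\omega})$ steps. For each fixed $G$, batch of updates and pair $(u,v)$, with probability at least $1-n^{-c}$ over the random words drawn by both programs, it correctly reports whether there is a directed path (possibly of length $0$) from $u$ to $v$ in the updated graph. Here $\tilde{O}(g(m))$ means $O(g(m)\log^{k}(m+2))$ for a constant $k$, with $m=n$ for the preprocessing and $m=f$ for the query; the constants may depend only on $\omega$,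 on the multiplication program and on $c$. -/

import Mathlib

open MeasureTheory

namespace SensReach

/-! ## Structured random access programs

A program is a finite text built from unit-cost instructions of a type `I` by sequencing, branching
and looping; branches and loops test whether a word register is nonzero. -/

inductive Prog (I : Type) : Type
  | skip : Prog I
  | instr (i : I) : Prog I
  | seq (P Q : Prog I) : Prog I
  | ite (r : ℕ) (P Q : Prog I) : Prog I
  | loop (r : ℕ) (P : Prog I) : Prog I

/-- `Exec reg act P s t s'`: started in the state `s`, the program `P` halts in the state `s'` after
exactly `t` steps.  Every executed instruction and every evaluated test counts as one step.
`reg s r` is the content of word register `r` in `s`, and `act i s` is the effect of `i` on `s`. -/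
inductive Exec {I S : Type} (reg : S → ℕ → ℕ) (act : I → S → S) : Prog I → S → ℕ → S → Prop
  | skip (s : S) : Exec reg act .skip s 0 s
  | instr (i : I) (s : S) : Exec reg act (.instr i) s 1 (act i s)
  | seq {P Q : Prog I} {s s' s'' : S} {t t' : ℕ}
      (hP : Exec reg act P s t s') (hQ : Exec reg act Q s' t' s'') :
      Exec reg act (.seq P Q) s (t + t') s''
  | ite_true {r : ℕ} {P Q : Prog I} {s s' : S} {t : ℕ}
      (hr : reg s r ≠ 0) (hP : Exec reg act P s t s') :
      Exec reg act (.ite r P Q) s (t + 1) s'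
  | ite_false {r : ℕ} {P Q : Prog I} {s s' : S} {t : ℕ}
      (hr : reg s r = 0) (hQ : Exec reg act Q s t s') :
      Exec reg act (.ite r P Q) s (t + 1) s'
  | loop_done {r : ℕ} {P : Prog I} {s : S} (hr : reg s r = 0) :
      Exec reg act (.loop r P) s 1 s
  | loop_step {r : ℕ} {P : Prog I} {s s' s'' : S} {t t' : ℕ}
      (hr : reg s r ≠ 0) (hP : Exec reg act P s t s') (hL : Exec reg act (.loop r P) s' t' s'') :
      Exec reg act (.loop r P) s (t + t' + 1) s''

/-- Executions are deterministic: the final state and the number of steps are determined. -/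
theorem Exec.unique {I S : Type} {reg : S → ℕ → ℕ} {act : I → S → S} {P : Prog I}
    {s s₁ s₂ : S} {t₁ t₂ : ℕ} (h₁ : Exec reg act P s t₁ s₁) (h₂ : Exec reg act P s t₂ s₂) :
    t₁ = t₂ ∧ s₁ = s₂ := by
  induction h₁ generalizing t₂ s₂ with
  | skip s => cases h₂; exact ⟨rfl, rfl⟩
  | instr i s => cases h₂; exact ⟨rfl, rfl⟩
  | seq _ _ ihP ihQ =>
    cases h₂ with
    | seq hP hQ =>
      obtain ⟨rfl, rfl⟩ := ihP hP
      obtain ⟨rfl, rfl⟩ := ihQ hQ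
      exact ⟨rfl, rfl⟩
  | ite_true hr _ ih =>
    cases h₂ with
    | ite_true _ h => obtain ⟨rfl, rfl⟩ := ih h; exact ⟨rfl, rfl⟩
    | ite_false h0 _ => exact absurd h0 hr
  | ite_false hr _ ih =>
    cases h₂ with
    | ite_true h0 _ => exact absurd hr h0
    | ite_false _ h => obtain ⟨rfl, rfl⟩ := ih h; exact ⟨rfl, rfl⟩
  | loop_done hr =>
    cases h₂ with
    | loop_done _ => exact ⟨rfl, rfl⟩
    | loop_step h0 _ _ => exact absurd hr h0
  | loop_step hr _ _ ihP ihL =>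
    cases h₂ with
    | loop_done h0 => exact absurd h0 hr
    | loop_step _ hP hL =>
      obtain ⟨rfl, rfl⟩ := ihP hP
      obtain ⟨rfl, rfl⟩ := ihL hL
      exact ⟨rfl, rfl⟩

/-! ## The randomized word RAM

Words are natural numbers below `2 ^ w`.  A program has finitely many word registers and finitely
many word arrays that are accessed by a computed index, and it can draw uniformly random words. -/

structure WordState : Type where
  /-- the word registers -/
  reg : ℕ → ℕ
  /-- `mem a i` is the cell with index `i` of array `a` -/
  mem : ℕ → ℕ → ℕ
  /-- the random words that have not been drawn yet -/
  coins : ℕ → ℕ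

inductive WordOp : Type
  | add | sub | mul | div | mod | lt | eq

/-- Word arithmetic modulo `2 ^ w`.  On words, `sub` is truncated at `0`, and the comparisons
`lt`, `eq` return `1` or `0`. -/
def WordOp.eval (w : ℕ) : WordOp → ℕ → ℕ → ℕ
  | add, x, y => (x + y) % 2 ^ w
  | sub, x, y => (x - y) % 2 ^ w
  | mul, x, y => (x * y) % 2 ^ w
  | div, x, y => (x / y) % 2 ^ w
  | mod, x, y => (x % y) % 2 ^ w
  | lt, x, y => (if x < y then 1 else 0) % 2 ^ w
  | eq, x, y => (if x = y then 1 else 0) % 2 ^ w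

inductive WordInstr : Type
  /-- register `d` := the constant `k` -/
  | const (d k : ℕ)
  /-- register `d` := `o` applied to the registers `a` and `b` -/
  | op (o : WordOp) (d a b : ℕ)
  /-- register `d` := the cell of array `a` whose index is in register `i` -/
  | load (d a i : ℕ)
  /-- the cell of array `a` whose index is in register `i` := register `r` -/
  | store (a i r : ℕ)
  /-- register `d` := a fresh random word -/
  | rand (d : ℕ)

def WordState.setReg (s : WordState) (d x : ℕ) : WordState :=
  { s with reg := Function.update s.reg d x }

def WordInstr.act (w : ℕ) : WordInstr → WordState → WordState
  | const d k, s => s.setReg d (k % 2 ^ w)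
  | op o d a b, s => s.setReg d (o.eval w (s.reg a) (s.reg b))
  | load d a i, s => s.setReg d (s.mem a (s.reg i))
  | store a i r, s =>
      { s with mem := Function.update s.mem a (Function.update (s.mem a) (s.reg i) (s.reg r)) }
  | rand d, s => { s.setReg d (s.coins 0) with coins := fun k => s.coins (k + 1) }

abbrev WordProg : Type := Prog WordInstr

/-- `Runs w P s t s'`: on the word RAM with `w`-bit words, `P` takes `s` to `s'` in `t` steps. -/
def Runs (w : ℕ) (P : WordProg) (s : WordState) (t : ℕ) (s' : WordState) : Prop :=
  Exec WordState.reg (WordInstr.act w) P s t s'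

/-- The distribution of an infinite sequence of independent uniformly random `w`-bit words. -/
noncomputable def randomWords (w : ℕ) : Measure (ℕ → Fin (2 ^ w)) :=
  Measure.infinitePi fun _ : ℕ => (PMF.uniformOfFintype (Fin (2 ^ w))).toMeasure

/-! ## Arithmetic programs over a field, and the exponent of matrix multiplication

Arithmetic programs additionally have registers and arrays of field elements, on which the only
operations are field arithmetic, the test for zero, and moving elements around.  The word part is
used for control and indexing, and its operations are counted too. -/

structure ArithState (K : Type) : Type where
  word : WordState
  freg : ℕ → K
  fmem : ℕ → ℕ → K

inductive FieldOp : Type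
  | add | sub | mul | div

def FieldOp.eval {K : Type} [Field K] : FieldOp → K → K → K
  | add, x, y => x + y
  | sub, x, y => x - y
  | mul, x, y => x * y
  | div, x, y => x / y

inductive ArithInstr : Type
  | word (i : WordInstr)
  /-- field register `d` := the integer constant `k` -/
  | const (d : ℕ) (k : ℤ)
  /-- field register `d` := `o` applied to the field registers `a` and `b` -/
  | op (o : FieldOp) (d a b : ℕ)
  /-- field register `d` := the cell of field array `a` whose index is in word register `i` -/
  | load (d a i : ℕ)
  /-- the cell of field array `a` whose index is in word register `i` := field register `r` -/
  | store (a i r : ℕ)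
  /-- word register `d` := `1` if field register `a` is zero, and `0` otherwise -/
  | isZero (d a : ℕ)

open Classical in
noncomputable def ArithInstr.act {K : Type} [Field K] (w : ℕ) :
    ArithInstr → ArithState K → ArithState K
  | word i, s => { s with word := i.act w s.word }
  | const d k, s => { s with freg := Function.update s.freg d (k : K) }
  | op o d a b, s => { s with freg := Function.update s.freg d (o.eval (s.freg a) (s.freg b)) }
  | load d a i, s => { s with freg := Function.update s.freg d (s.fmem a (s.word.reg i)) }
  | store a i r, s =>
      { s with fmem :=
          Function.update s.fmem a (Function.update (s.fmem a) (s.word.reg i) (s.freg r)) }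
  | isZero d a, s =>
      { s with word := s.word.setReg d ((if s.freg a = 0 then 1 else 0) % 2 ^ w) }

/-- Row-major layout of an `n × n` array, filled up with zeros. -/
def rowMajor {R : Type} [Zero R] {n : ℕ} (A : Fin n → Fin n → R) (k : ℕ) : R :=
  if h : k < n * n then
    A ⟨k / n, Nat.div_lt_of_lt_mul h⟩
      ⟨k % n, Nat.mod_lt _ (Nat.pos_of_ne_zero fun h0 => by simp [h0] at h)⟩
  else 0

/-- The input state for the multiplication of `A` and `B`: word register `0` holds `n`, the field
arrays `0` and `1` hold `A` and `B`, and everything else is zero. -/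
def mulInput {K : Type} [Field K] {n : ℕ} (A B : Matrix (Fin n) (Fin n) K) (coins : ℕ → ℕ) :
    ArithState K where
  word := { reg := fun r => if r = 0 then n else 0, mem := fun _ _ => 0, coins := coins }
  freg := fun _ => 0
  fmem := fun a => if a = 0 then rowMajor A else if a = 1 then rowMajor B else fun _ => 0

/-- Two `n × n` matrices over a prime field can be multiplied with `O(n ^ ω)` arithmetic operations:
one arithmetic program does this for all primes `p` and all `n ≥ 1`, with index words of
`O(log n)` bits.  The product is written to field array `2`.  The bound depends neither
on `p` nor on the random words, so that the program is in effect deterministic. -/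
def IsMatMulExponent (ω : ℝ) : Prop :=
  ∃ (P : Prog ArithInstr) (κ : ℕ) (C : ℝ),
    ∀ (p : ℕ) [Fact p.Prime] (n w : ℕ), 1 ≤ n → (n + 2) ^ κ ≤ 2 ^ w →
      ∀ (A B : Matrix (Fin n) (Fin n) (ZMod p)) (coins : ℕ → Fin (2 ^ w)),
        ∃ (t : ℕ) (s : ArithState (ZMod p)),
          Exec (fun s => s.word.reg) (ArithInstr.act w) P (mulInput A B fun k => coins k) t s ∧
          (∀ i j : Fin n, s.fmem 2 (i * n + j) = (A * B) i j) ∧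
          (t : ℝ) ≤ C * (n : ℝ) ^ ω

/-! ## Edge updates, reachability, and the input format -/

/-- `(i, j, true)` inserts the edge `(i, j)`, and `(i, j, false)` deletes it. -/
abbrev EdgeUpdate (n : ℕ) : Type := Fin n × Fin n × Bool

def applyUpdate {n : ℕ} (G : Digraph (Fin n)) (e : EdgeUpdate n) : Digraph (Fin n) where
  Adj x y := if x = e.1 ∧ y = e.2.1 then e.2.2 = true else G.Adj x y

/-- The updates take effect in the order of the list. -/
def applyUpdates {n : ℕ} (G : Digraph (Fin n)) (ups : List (EdgeUpdate n)) : Digraph (Fin n) :=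
  ups.foldl applyUpdate G

/-- There is a directed path, possibly of length `0`, from `u` to `v`. -/
def Reachable {n : ℕ} (G : Digraph (Fin n)) (u v : Fin n) : Prop :=
  Relation.ReflTransGen G.Adj u v

open Classical in
/-- The input of the preprocessing: register `0` holds `n`, array `0` holds the adjacency matrix,
and everything else is zero. -/
noncomputable def graphInput {n : ℕ} (G : Digraph (Fin n)) (coins : ℕ → ℕ) : WordState where
  reg := fun r => if r = 0 then n else 0
  mem := fun a =>
    if a = 0 then rowMajor (fun i j => if G.Adj i j then 1 else 0) else fun _ => 0
  coins := coins

/-- The input of the query is added to the state that the preprocessing left behind: the registers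
`0, 1, 2` receive the number of updates, `u` and `v`, and array `1` receives the updates, three
words for each of them.  All else is kept. -/
def queryInput {n : ℕ} (s : WordState) (ups : List (EdgeUpdate n)) (u v : Fin n) : WordState where
  reg := fun r =>
    if r = 0 then ups.length else if r = 1 then (u : ℕ) else if r = 2 then (v : ℕ) else s.reg r
  mem := Function.update s.mem 1 fun k =>
    (ups.flatMap fun e => [(e.1 : ℕ), (e.2.1 : ℕ), if e.2.2 then 1 else 0]).getD k 0
  coins := s.coins

open Classical in
/-- With the given random words, the preprocessing of `G` followed by the query leaves the correct
answer for `(u, v)` in the updated graph in register `0`: `1` for reachable, `0` for not. -/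
def AnswersCorrectly (w : ℕ) (pre query : WordProg) {n : ℕ} (G : Digraph (Fin n))
    (ups : List (EdgeUpdate n)) (u v : Fin n) (coins : ℕ → ℕ) : Prop :=
  ∃ (t t' : ℕ) (s s' : WordState),
    Runs w pre (graphInput G coins) t s ∧ Runs w query (queryInput s ups u v) t' s' ∧
      s'.reg 0 = if Reachable (applyUpdates G ups) u v then 1 else 0

end SensReach

/-! Give every potential edge a random weight in a prime field and let A be the identity minus the
weighted adjacency matrix (`walkMat`). Border A by the column e_v, the row e_u and a zero corner
(`borderMat`). The determinant of the bordered matrix is, up to sign, the entry (u, v) of the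
adjugate of A, and as a polynomial in the weights it is nonzero exactly when v is reachable from u.
If v is not reachable, vectors supported on the nodes that reach v, together with the border
unknown, have one unknown more than equations, so the bordered matrix is singular for all weights
(`exists_ker_of_not_reachable`). If v is reachable, weights 0 and 1 that make every node point to
its successor on a shortest path to v give a regular matrix (`exists_det_borderMat_ne_zero`). A
nonzero determinant thus certifies reachability, and errors are one-sided.

The preprocessing computes N = A⁻¹ for the original graph. An update changes A by a rank-one term,
and the border acts like one further rank-one term. As in the Woodbury formula, the bordered matrix
of the updated graph is singular if and only if a matrix of size f + 1 with entries read off from N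
is singular (`hasKernel_queryMat_iff`). A query therefore performs one singularity test of this
size, padded to a power of two, per repetition.

Inversion and singularity test share one program, an in-place Gauss-Jordan elimination without row
exchanges (`gjP`). The elimination of h consecutive columns acts on every other column by a single
linear formula (`gjMat_block`), so the action can be postponed and then be carried out for h columns
at once by m / h products of h × h matrices. Whenever an aligned block of 2 ^ k columns is finished,
it is applied to its sibling block. Level k costs (m / 2 ^ k) ^ 2 multiplications of size 2 ^ k,
which is O(m ^ ω) because ω ≥ 2, and there are log m levels (`elimTime_le`). The bound ω ≥ 2 holds
because the n ^ 2 entries of a product have to be written (`two_le_of_isMatMulExponent`).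

The prime and its table of inverses must be found within O(n ^ 2) steps. Let q be the least positive
integer with n ≤ q ^ 3; the prime p lies between 9 q ^ 4 and 18 q ^ 4, and trial division costs
about q ^ 4 · q ^ 2 = O(n ^ 2). By Schwartz-Zippel (`card_not_goodWeights`), and with a factor 3
lost by reducing words modulo p, random weights are bad with probability at most 1 / q. With 3 c
independent repetitions all are bad with probability at most q ^ (-3 c) ≤ n ^ (-c)
(`randomWords_bad_le`).

On the machine side, programs are verified by timed Hoare triples (`HT`). The multiplication program
expects zeroed memory, and clearing it before every call would be too expensive. Each of its cells
carries a stamp with the number of a call, and a cell with an old stamp counts as zero (`Sim`,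
`HT.mulP`). -/

namespace SensReach

/-! ## Expressions and structured programs over word registers

Registers below `63` are variables, register `63` is a counter of subroutine calls, and registers
from `64` on are scratch space. Arrays below `32` are visible to the programs, the other ones
belong to the matrix multiplication subroutine. -/

/-- All words of a state are below `2 ^ w`. -/
structure WordBounded (w : ℕ) (s : WordState) : Prop where
  reg : ∀ r, s.reg r < 2 ^ w
  mem : ∀ a i, s.mem a i < 2 ^ w
  coins : ∀ i, s.coins i < 2 ^ w

theorem WordOp.eval_lt (w : ℕ) (o : WordOp) (x y : ℕ) : o.eval w x y < 2 ^ w := by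
  cases o <;> exact Nat.mod_lt _ (by positivity)

theorem WordBounded.setReg {w : ℕ} {s : WordState} (h : WordBounded w s) (d : ℕ) {x : ℕ}
    (hx : x < 2 ^ w) : WordBounded w (s.setReg d x) := by
  refine ⟨fun r => ?_, h.mem, h.coins⟩
  by_cases hr : r = d
  · subst hr; simpa [WordState.setReg] using hx
  · simpa [WordState.setReg, hr] using h.reg r

theorem WordBounded.act {w : ℕ} {s : WordState} (h : WordBounded w s) (i : WordInstr) :
    WordBounded w (i.act w s) := by
  cases i with
  | const d k => exact h.setReg d (Nat.mod_lt _ (by positivity))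
  | op o d a b => exact h.setReg d (o.eval_lt w _ _)
  | load d a i => exact h.setReg d (h.mem _ _)
  | store a i r =>
    refine ⟨h.reg, fun a' i' => ?_, h.coins⟩
    by_cases ha : a' = a
    · subst ha
      by_cases hi : i' = s.reg i
      · subst hi; simpa [WordInstr.act] using h.reg r
      · simpa [WordInstr.act, hi] using h.mem _ _
    · simpa [WordInstr.act, ha] using h.mem _ _
  | rand d =>
    have := h.setReg d (h.coins 0)
    exact ⟨this.reg, this.mem, fun i => h.coins (i + 1)⟩

theorem Runs.wordBounded {w : ℕ} {P : WordProg} {s s' : WordState} {t : ℕ} (h : Runs w P s t s')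
    (hs : WordBounded w s) : WordBounded w s' := by
  unfold Runs at h
  induction h with
  | skip s => exact hs
  | instr i s => exact hs.act i
  | seq _ _ ih1 ih2 => exact ih2 (ih1 hs)
  | ite_true _ _ ih => exact ih hs
  | ite_false _ _ ih => exact ih hs
  | loop_done _ => exact hs
  | loop_step _ _ _ ih1 ih2 => exact ih2 (ih1 hs)

/-- The visible part of a word state. -/
structure St : Type where
  v : ℕ → ℕ
  arr : ℕ → ℕ → ℕ
  coins : ℕ → ℕ

def St.set (s : St) (x k : ℕ) : St := { s with v := Function.update s.v x k }

def St.put (s : St) (a i k : ℕ) : St :=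
  { s with arr := Function.update s.arr a (Function.update (s.arr a) i k) }

theorem St.set_v (s : St) (x k r : ℕ) : (s.set x k).v r = if r = x then k else s.v r := by
  simp [St.set, Function.update_apply]

@[simp] theorem St.set_v_self (s : St) (x k : ℕ) : (s.set x k).v x = k := by simp [St.set]

theorem St.set_v_ne (s : St) {x r : ℕ} (k : ℕ) (h : r ≠ x) : (s.set x k).v r = s.v r := by
  simp [St.set, h]

@[simp] theorem St.set_arr (s : St) (x k : ℕ) : (s.set x k).arr = s.arr := rfl
@[simp] theorem St.set_coins (s : St) (x k : ℕ) : (s.set x k).coins = s.coins := rfl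
@[simp] theorem St.put_v (s : St) (a i k : ℕ) : (s.put a i k).v = s.v := rfl
@[simp] theorem St.put_coins (s : St) (a i k : ℕ) : (s.put a i k).coins = s.coins := rfl

theorem St.put_arr (s : St) (a i k b : ℕ) : (s.put a i k).arr b =
    if b = a then Function.update (s.arr a) i k else s.arr b := by
  by_cases h : b = a
  · subst h; simp [St.put]
  · simp [St.put, h]

@[simp] theorem St.put_arr_self (s : St) (a i k : ℕ) :
    (s.put a i k).arr a = Function.update (s.arr a) i k := by simp [St.put]

theorem St.put_arr_ne (s : St) {a b : ℕ} (i k : ℕ) (h : b ≠ a) :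
    (s.put a i k).arr b = s.arr b := by simp [St.put, h]

/-- Operations without wrap-around. -/
def WordOp.nat : WordOp → ℕ → ℕ → ℕ
  | add, x, y => x + y
  | sub, x, y => x - y
  | mul, x, y => x * y
  | div, x, y => x / y
  | mod, x, y => x % y
  | lt, x, y => if x < y then 1 else 0
  | eq, x, y => if x = y then 1 else 0

/-- Only addition and multiplication can overflow: subtraction, division and remainder never exceed
the left operand. Comparisons need `0 < w`, since modulo `2 ^ 0` the answer `1` would become `0`. -/
def WordOp.safe (w : ℕ) : WordOp → ℕ → ℕ → Prop
  | add, x, y => x + y < 2 ^ w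
  | mul, x, y => x * y < 2 ^ w
  | lt, _, _ => 0 < w
  | eq, _, _ => 0 < w
  | _, _, _ => True

theorem WordOp.eval_eq_nat {w : ℕ} (o : WordOp) {x y : ℕ} (hx : x < 2 ^ w)
    (h : o.safe w x y) : o.eval w x y = o.nat x y := by
  cases o with
  | add => exact Nat.mod_eq_of_lt h
  | sub => exact Nat.mod_eq_of_lt ((Nat.sub_le _ _).trans_lt hx)
  | mul => exact Nat.mod_eq_of_lt h
  | div => exact Nat.mod_eq_of_lt ((Nat.div_le_self _ _).trans_lt hx)
  | mod => exact Nat.mod_eq_of_lt ((Nat.mod_le _ _).trans_lt hx)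
  | lt =>
    have : 2 ≤ 2 ^ w := Nat.le_self_pow (Nat.pos_iff_ne_zero.mp h) 2
    simp only [WordOp.eval, WordOp.nat]; split_ifs <;> exact Nat.mod_eq_of_lt (by omega)
  | eq =>
    have : 2 ≤ 2 ^ w := Nat.le_self_pow (Nat.pos_iff_ne_zero.mp h) 2
    simp only [WordOp.eval, WordOp.nat]; split_ifs <;> exact Nat.mod_eq_of_lt (by omega)

inductive Ex : Type
  | var (r : ℕ)
  | lit (k : ℕ)
  | bin (o : WordOp) (a b : Ex)
  | get (a : ℕ) (i : Ex)

namespace Ex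

def ev (s : St) : Ex → ℕ
  | var r => s.v r
  | lit k => k
  | bin o a b => o.nat (a.ev s) (b.ev s)
  | get a i => s.arr a (i.ev s)

/-- With `full` the arrays from `32` on may be read as well; only the copying code around the
multiplication subroutine does so. -/
def ok (full : Bool) (w : ℕ) (s : St) : Ex → Prop
  | var r => r < 64
  | lit k => k < 2 ^ w
  | bin o a b => a.ok full w s ∧ b.ok full w s ∧ o.safe w (a.ev s) (b.ev s)
  | get a i => (full = true ∨ a < 32) ∧ i.ok full w s

/-- Evaluates an expression into the scratch register `d`. -/
def code : Ex → ℕ → WordProg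
  | var r, d => .seq (.instr (.const d 0)) (.instr (.op .add d d r))
  | lit k, d => .instr (.const d k)
  | bin o a b, d => .seq (.seq (a.code d) (b.code (d + 1))) (.instr (.op o d d (d + 1)))
  | get a i, d => .seq (i.code d) (.instr (.load d a d))

end Ex

/-- The time of a loop-free program. -/
def Prog.sz {I : Type} : Prog I → ℕ
  | .skip => 0
  | .instr _ => 1
  | .seq P Q => P.sz + Q.sz
  | .ite _ P Q => P.sz + Q.sz + 1
  | .loop _ _ => 0

/-- Two views of one machine. In the full view all arrays and the random words are known. The
restricted view hides the private arrays and the random words, both of which a multiplication may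
change in an uncontrolled way. All that it keeps about them is that the stamps, which are the odd
arrays from `32` on, never exceed the call counter in register `63`. -/
structure Rel (full : Bool) (w : ℕ) (s : St) (ws : WordState) : Prop where
  bdd : WordBounded w ws
  reg : ∀ r < 64, ws.reg r = s.v r
  mem : ∀ a, (full = true ∨ a < 32) → ws.mem a = s.arr a
  coins : full = true → ws.coins = s.coins
  stamp : full = false → ∀ a, 32 ≤ a → a % 2 = 1 → ∀ i, ws.mem a i ≤ ws.reg 63

theorem Ex.ev_lt {full : Bool} {w : ℕ} {s : St} {ws : WordState} (h : Rel full w s ws) :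
    ∀ e : Ex, e.ok full w s → e.ev s < 2 ^ w
  | var r, hr => by simpa [Ex.ev, ← h.reg r hr] using h.bdd.reg r
  | lit k, hk => hk
  | bin o a b, ho => by
    rw [Ex.ev, ← o.eval_eq_nat (Ex.ev_lt h a ho.1) ho.2.2]
    exact o.eval_lt w _ _
  | get a i, ho => by simpa [Ex.ev, ← h.mem a ho.1] using h.bdd.mem a _

/-- The code for target `d` writes only to registers from `d` on. The first operand, in `d`, thus
survives the evaluation of the second one in `d + 1`. -/
theorem Ex.runs_code {full : Bool} {w : ℕ} {s : St} : ∀ (e : Ex) (d : ℕ) (ws : WordState),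
    Rel full w s ws → e.ok full w s → 64 ≤ d → ∃ ws', Runs w (e.code d) ws (e.code d).sz ws' ∧
      ws'.reg d = e.ev s ∧ (∀ r < d, ws'.reg r = ws.reg r) ∧ ws'.mem = ws.mem ∧
      ws'.coins = ws.coins ∧ Rel full w s ws'
  | var r, d, ws, h, ho, hd => by
    have hrun : Runs w ((var r).code d) ws 2 _ := Exec.seq (Exec.instr _ _) (Exec.instr _ _)
    have hr : r < 64 := ho
    have hrd : r ≠ d := by omega
    refine ⟨_, hrun, ?_, fun r' hr' => ?_, rfl, rfl, ⟨hrun.wordBounded h.bdd, fun r' hr' => ?_,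
      h.mem, h.coins, ?_⟩⟩
    · simp [WordInstr.act, WordState.setReg, WordOp.eval, hrd, Ex.ev, h.reg r hr]
      rw [← h.reg r hr]; exact Nat.mod_eq_of_lt (h.bdd.reg r)
    · simp [WordInstr.act, WordState.setReg, hr'.ne]
    · have : r' ≠ d := by omega
      simp [WordInstr.act, WordState.setReg, this, h.reg r' hr']
    · have : (63 : ℕ) ≠ d := by omega
      simpa [WordInstr.act, WordState.setReg, this] using h.stamp
  | lit k, d, ws, h, ho, hd => by
    have hrun : Runs w ((lit k).code d) ws 1 _ := Exec.instr _ _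
    have hk : k < 2 ^ w := ho
    refine ⟨_, hrun, ?_, fun r' hr' => ?_, rfl, rfl, ⟨hrun.wordBounded h.bdd, fun r' hr' => ?_,
      h.mem, h.coins, ?_⟩⟩
    · simp [WordInstr.act, WordState.setReg, Ex.ev, Nat.mod_eq_of_lt hk]
    · simp [WordInstr.act, WordState.setReg, hr'.ne]
    · have : r' ≠ d := by omega
      simp [WordInstr.act, WordState.setReg, this, h.reg r' hr']
    · have : (63 : ℕ) ≠ d := by omega
      simpa [WordInstr.act, WordState.setReg, this] using h.stamp
  | bin o a b, d, ws, h, ho, hd => by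
    obtain ⟨ws1, r1, e1, f1, m1, c1, h1⟩ := Ex.runs_code a d ws h ho.1 hd
    obtain ⟨ws2, r2, e2, f2, m2, c2, h2⟩ := Ex.runs_code b (d + 1) ws1 h1 ho.2.1 (by omega)
    have hrun : Runs w ((bin o a b).code d) ws ((bin o a b).code d).sz _ :=
      Exec.seq (Exec.seq r1 r2) (Exec.instr _ _)
    refine ⟨_, hrun, ?_, fun r' hr' => ?_, ?_, ?_, ⟨hrun.wordBounded h.bdd, fun r' hr' => ?_,
      ?_, ?_, ?_⟩⟩
    · simp [WordInstr.act, WordState.setReg, Ex.ev, e2, f2 d (by omega), e1]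
      exact o.eval_eq_nat (Ex.ev_lt h a ho.1) ho.2.2
    · simp [WordInstr.act, WordState.setReg, hr'.ne, f2 r' (by omega), f1 r' hr']
    · simp [WordInstr.act, WordState.setReg, m1, m2]
    · simp [WordInstr.act, WordState.setReg, c1, c2]
    · have : r' ≠ d := by omega
      simp [WordInstr.act, WordState.setReg, this, h2.reg r' hr']
    · simpa [WordInstr.act, WordState.setReg] using h2.mem
    · simpa [WordInstr.act, WordState.setReg] using h2.coins
    · have : (63 : ℕ) ≠ d := by omega
      simpa [WordInstr.act, WordState.setReg, this] using h2.stamp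
  | get a i, d, ws, h, ho, hd => by
    obtain ⟨ws1, r1, e1, f1, m1, c1, h1⟩ := Ex.runs_code i d ws h ho.2 hd
    have hrun : Runs w ((get a i).code d) ws ((get a i).code d).sz _ :=
      Exec.seq r1 (Exec.instr _ _)
    refine ⟨_, hrun, ?_, fun r' hr' => ?_, ?_, ?_, ⟨hrun.wordBounded h.bdd, fun r' hr' => ?_,
      ?_, ?_, ?_⟩⟩
    · simp [WordInstr.act, WordState.setReg, Ex.ev, e1, h1.mem a ho.1]
    · simp [WordInstr.act, WordState.setReg, hr'.ne, f1 r' hr']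
    · simp [WordInstr.act, WordState.setReg, m1]
    · simp [WordInstr.act, WordState.setReg, c1]
    · have : r' ≠ d := by omega
      simp [WordInstr.act, WordState.setReg, this, h1.reg r' hr']
    · simpa [WordInstr.act, WordState.setReg] using h1.mem
    · simpa [WordInstr.act, WordState.setReg] using h1.coins
    · have : (63 : ℕ) ≠ d := by omega
      simpa [WordInstr.act, WordState.setReg, this] using h1.stamp

infixr:65 " ;; " => Prog.seq

/-- Register `x` := `e`. -/
def asg (x : ℕ) (e : Ex) : WordProg :=
  e.code 64 ;; .instr (.const 65 0) ;; .instr (.op .add x 64 65)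

/-- The cell of array `a` with index `i` := `e`. -/
def sto (a : ℕ) (i e : Ex) : WordProg :=
  i.code 64 ;; e.code 65 ;; .instr (.store a 64 65)

/-- The cell of array `a` with index `i` := a random word. -/
def stoRand (a : ℕ) (i : Ex) : WordProg :=
  i.code 64 ;; .instr (.rand 65) ;; .instr (.store a 64 65)

def ifP (e : Ex) (P Q : WordProg) : WordProg := e.code 64 ;; .ite 64 P Q

/-- Executes `P` for `x = 0, 1, …`, as long as `x` is less than the content of register `l`. -/
def forP (x l : ℕ) (P : WordProg) : WordProg :=
  asg x (.lit 0) ;; (Ex.bin .lt (.var x) (.var l)).code 64 ;;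
    .loop 64 (P ;; asg x (.bin .add (.var x) (.lit 1)) ;; (Ex.bin .lt (.var x) (.var l)).code 64)

/-- Started in a state with visible part `s`, the program `P` halts within `T` steps in a state
whose visible part satisfies `Q`. -/
def HT (full : Bool) (w : ℕ) (P : WordProg) (s : St) (T : ℕ) (Q : St → Prop) : Prop :=
  ∀ ws, Rel full w s ws → ws.reg 63 + T < 2 ^ w → ∃ t ws' s', Runs w P ws t ws' ∧ t ≤ T ∧
    ws'.reg 63 ≤ ws.reg 63 + t ∧ Rel full w s' ws' ∧ Q s'

/-! ### Proof rules for timed Hoare triples. -/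

namespace HT

variable {full : Bool} {w : ℕ} {P P' : WordProg} {s : St} {T T' : ℕ} {Q Q' : St → Prop}

theorem mono (h : HT full w P s T Q) (hT : T ≤ T') (hQ : ∀ s', Q s' → Q' s') :
    HT full w P s T' Q' := by
  intro ws hr he
  obtain ⟨t, ws', s', h1, h2, h3, h4, h5⟩ := h ws hr (by omega)
  exact ⟨t, ws', s', h1, by omega, h3, h4, hQ _ h5⟩

theorem time_le (h : HT full w P s T Q) (hT : T ≤ T') : HT full w P s T' Q :=
  h.mono hT fun _ h => h

/-- Every machine state consists of words below `2 ^ w`, so a triple may be proved under this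
assumption on the visible part; for other visible states it is vacuous. -/
theorem bdd (h : (∀ r < 64, s.v r < 2 ^ w) → (∀ a < 32, ∀ i, s.arr a i < 2 ^ w) →
    HT full w P s T Q) : HT full w P s T Q := by
  intro ws hr he
  exact h (fun r h => by rw [← hr.reg r h]; exact hr.bdd.reg r)
    (fun a h i => by rw [← hr.mem a (.inr h)]; exact hr.bdd.mem a i) ws hr he

theorem skip (h : Q s) : HT full w .skip s 0 Q := fun ws hr _ =>
  ⟨0, ws, s, Exec.skip ws, le_rfl, le_rfl, hr, h⟩

/-- The postcondition of the first program is itself a triple for the rest. A proof can thus follow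
the program text without stating intermediate assertions. -/
theorem seq (h : HT full w P s T fun s' => HT full w P' s' T' Q) :
    HT full w (P ;; P') s (T + T') Q := by
  intro ws hr he
  obtain ⟨t, ws', s', h1, h2, h3, h4, h5⟩ := h ws hr (by omega)
  obtain ⟨t', ws'', s'', g1, g2, g3, g4, g5⟩ := h5 ws' h4 (by omega)
  exact ⟨t + t', ws'', s'', Exec.seq h1 g1, by omega, by omega, g4, g5⟩

theorem asg {x : ℕ} {e : Ex} (ho : e.ok full w s) (hx : x < 63) (h : Q (s.set x (e.ev s))) :
    HT full w (asg x e) s (SensReach.asg x e).sz Q := by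
  intro ws hr he
  obtain ⟨ws1, r1, e1, f1, m1, c1, h1⟩ := e.runs_code 64 ws hr ho le_rfl
  have hrun : Runs w (SensReach.asg x e) ws (SensReach.asg x e).sz _ :=
    Exec.seq r1 (Exec.seq (Exec.instr _ _) (Exec.instr _ _))
  have hlt := e.ev_lt hr ho
  have h63 : (63 : ℕ) ≠ x := by omega
  have h63' := f1 63 (by omega)
  refine ⟨_, _, s.set x (e.ev s), hrun, le_rfl, ?_, ⟨hrun.wordBounded hr.bdd, fun r hr' => ?_, ?_,
    ?_, ?_⟩, h⟩
  · simp [WordInstr.act, WordState.setReg, h63, h63']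
  · by_cases hrx : r = x
    · subst hrx
      simp [WordInstr.act, WordState.setReg, WordOp.eval, e1, Nat.mod_eq_of_lt hlt]
    · have : r ≠ 65 := by omega
      simp [WordInstr.act, WordState.setReg, hrx, this, St.set_v, h1.reg r hr']
  · simpa [WordInstr.act, WordState.setReg] using h1.mem
  · simpa [WordInstr.act, WordState.setReg] using h1.coins
  · simpa [WordInstr.act, WordState.setReg, h63] using h1.stamp

theorem sto {a : ℕ} {i e : Ex} (hi : i.ok full w s) (ho : e.ok full w s)
    (ha : full = true ∨ a < 32) (h : Q (s.put a (i.ev s) (e.ev s))) :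
    HT full w (sto a i e) s (SensReach.sto a i e).sz Q := by
  intro ws hr he
  obtain ⟨ws1, r1, e1, f1, m1, c1, h1⟩ := i.runs_code 64 ws hr hi le_rfl
  obtain ⟨ws2, r2, e2, f2, m2, c2, h2⟩ := e.runs_code 65 ws1 h1 ho (by omega)
  have hrun : Runs w (SensReach.sto a i e) ws (SensReach.sto a i e).sz _ :=
    Exec.seq r1 (Exec.seq r2 (Exec.instr _ _))
  refine ⟨_, _, s.put a (i.ev s) (e.ev s), hrun, le_rfl, ?_, ⟨hrun.wordBounded hr.bdd,
    fun r hr' => ?_, fun b hb => ?_, ?_, ?_⟩, h⟩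
  · simp [WordInstr.act, f2 63, f1 63]
  · simp [WordInstr.act, h2.reg r hr']
  · by_cases hba : b = a
    · subst hba
      simp [WordInstr.act, f2 64, e1, e2, h2.mem b hb]
    · simp [WordInstr.act, St.put_arr, hba, h2.mem b hb]
  · simpa [WordInstr.act] using h2.coins
  · intro hf b hb1 hb2 j
    have hba : b ≠ a := by
      rintro rfl
      rcases ha with ha | ha
      · simp [hf] at ha
      · omega
    simpa [WordInstr.act, hba] using h2.stamp hf b hb1 hb2 j

theorem stoRand {a : ℕ} {i : Ex} (hi : i.ok true w s)
    (h : Q ({ s.put a (i.ev s) (s.coins 0) with coins := fun k => s.coins (k + 1) })) :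
    HT true w (stoRand a i) s (SensReach.stoRand a i).sz Q := by
  intro ws hr he
  obtain ⟨ws1, r1, e1, f1, m1, c1, h1⟩ := i.runs_code 64 ws hr hi le_rfl
  have hrun : Runs w (SensReach.stoRand a i) ws (SensReach.stoRand a i).sz _ :=
    Exec.seq r1 (Exec.seq (Exec.instr _ _) (Exec.instr _ _))
  have hc := h1.coins rfl
  refine ⟨_, _, _, hrun, le_rfl, ?_, ⟨hrun.wordBounded hr.bdd,
    fun r hr' => ?_, fun b hb => ?_, ?_, ?_⟩, h⟩
  · simp [WordInstr.act, WordState.setReg, f1 63]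
  · have : r ≠ 65 := by omega
    simp [WordInstr.act, WordState.setReg, h1.reg r hr', this]
  · by_cases hba : b = a
    · subst hba
      simp [WordInstr.act, WordState.setReg, e1, h1.mem b hb, hc, St.put]
    · simp [WordInstr.act, WordState.setReg, St.put, hba, h1.mem b hb]
  · simp [WordInstr.act, WordState.setReg, hc]
  · simp

theorem ifP {e : Ex} (ho : e.ok full w s) (h1 : e.ev s ≠ 0 → HT full w P s T Q)
    (h2 : e.ev s = 0 → HT full w P' s T' Q) :
    HT full w (ifP e P P') s ((e.code 64).sz + (T + T' + 1)) Q := by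
  intro ws hr he
  obtain ⟨ws1, r1, e1, f1, m1, c1, g1⟩ := e.runs_code 64 ws hr ho le_rfl
  have h63 := f1 63 (by omega)
  by_cases h0 : e.ev s = 0
  · obtain ⟨t, ws', s', k1, k2, k3, k4, k5⟩ := h2 h0 ws1 g1 (by omega)
    exact ⟨_, ws', s', Exec.seq r1 (Exec.ite_false (by rw [e1, h0]) k1), by omega, by omega, k4, k5⟩
  · obtain ⟨t, ws', s', k1, k2, k3, k4, k5⟩ := h1 h0 ws1 g1 (by omega)
    exact ⟨_, ws', s', Exec.seq r1 (Exec.ite_true (by rwa [e1]) k1), by omega, by omega, k4, k5⟩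

/-- A round costs 12 extra steps: 6 for the increment, 5 for the comparison, 1 for the test. The
constant 9 is 3 for the initialization, 5 for the first comparison and 1 for the final test. -/
theorem forP {x l N : ℕ} {T : ℕ → ℕ} (Inv : ℕ → St → Prop) (hx : x < 63) (hl : l < 63)
    (hxl : l ≠ x) (hN : s.v l = N) (hw : 0 < w) (h0 : Inv 0 (s.set x 0))
    (hstep : ∀ i < N, ∀ s', Inv i s' → s'.v x = i → s'.v l = N →
      HT full w P s' (T i) fun s'' => s''.v x = i ∧ s''.v l = N ∧ Inv (i + 1) (s''.set x (i + 1)))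
    (hQ : ∀ s', Inv N s' → s'.v x = N → Q s') :
    HT full w (forP x l P) s (∑ i ∈ Finset.range N, (T i + 12) + 9) Q := by
  have h2w : 2 ≤ 2 ^ w := Nat.le_self_pow hw.ne' 2
  -- Induction on the number `k` of remaining rounds. The call counter is carried along, because the
  -- bodies may contain multiplications.
  have key : ∀ k i, i + k = N → ∀ ws s', Rel full w s' ws → s'.v x = i → s'.v l = N → Inv i s' →
      ws.reg 64 = (if i < N then 1 else 0) →
      ws.reg 63 + (∑ j ∈ Finset.Ico i N, (T j + 12) + 1) < 2 ^ w →
      ∃ t ws' s'', Runs w (.loop 64 (P ;; SensReach.asg x (.bin .add (.var x) (.lit 1)) ;;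
        (Ex.bin .lt (.var x) (.var l)).code 64)) ws t ws' ∧
        t ≤ ∑ j ∈ Finset.Ico i N, (T j + 12) + 1 ∧ ws'.reg 63 ≤ ws.reg 63 + t ∧
        Rel full w s'' ws' ∧ Inv N s'' ∧ s''.v x = N := by
    intro k
    induction k with
    | zero =>
      intro i hi ws s' hr hxi hlN hI h64 he
      have hi : i = N := by omega
      subst hi
      exact ⟨1, ws, s', Exec.loop_done (by rw [h64]; simp), by simp, by omega, hr, hI, hxi⟩
    | succ k ih =>
      intro i hi ws s' hr hxi hlN hI h64 he
      have hiN : i < N := by omega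
      rw [Finset.sum_eq_sum_Ico_succ_bot hiN] at he ⊢
      obtain ⟨t1, ws1, s1, a1, a2, a3, a4, a5, a6, a7⟩ := hstep i hiN s' hI hxi hlN ws hr (by omega)
      have hNw : N < 2 ^ w := by rw [← a6, ← a4.reg l (by omega)]; exact a4.bdd.reg l
      obtain ⟨t2, ws2, s2, b1, b2, b3, b4, rfl⟩ :=
        HT.asg (e := .bin .add (.var x) (.lit 1)) (Q := fun s' => s' = s1.set x (i + 1)) (x := x)
          (full := full) (w := w) (s := s1)
          (by refine ⟨(by simp [Ex.ok]; omega), (by simp [Ex.ok]; omega), ?_⟩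
              simp [WordOp.safe, Ex.ev, a5]; omega) hx
          (by simp [Ex.ev, WordOp.nat, a5]) ws1 a4
          (by simp [SensReach.asg, Prog.sz, Ex.code]; omega)
      have hsz : (SensReach.asg x (.bin .add (.var x) (.lit 1))).sz = 6 := rfl
      obtain ⟨ws3, r3, e3, f3, m3, c3, g3⟩ :=
        (Ex.bin .lt (.var x) (.var l)).runs_code 64 ws2 b4
          (by refine ⟨(by simp [Ex.ok]; omega), (by simp [Ex.ok]; omega), ?_⟩
              simpa [WordOp.safe] using hw) le_rfl
      have hsz3 : ((Ex.bin .lt (.var x) (.var l)).code 64).sz = 5 := rfl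
      have f63 := f3 63 (by omega)
      obtain ⟨t4, ws4, s4, d1, d2, d3, d4, d5⟩ := ih (i + 1) (by omega) ws3 _ g3 (by simp)
        (by rw [St.set_v_ne _ _ hxl, a6]) a7
        (by simp [e3, Ex.ev, WordOp.nat, St.set_v_ne _ _ hxl, a6]) (by omega)
      exact ⟨_, ws4, s4, Exec.loop_step (by rw [h64]; simp [hiN]) (Exec.seq a1 (Exec.seq b1 r3)) d1,
        by omega, by omega, d4, d5⟩
  intro ws hr he
  rw [Finset.range_eq_Ico] at he ⊢
  obtain ⟨t2, ws2, s2, b1, b2, b3, b4, rfl⟩ :=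
    HT.asg (e := .lit 0) (Q := fun s' => s' = s.set x 0) (x := x)
      (full := full) (w := w) (s := s) (by simp [Ex.ok]) hx rfl ws hr
      (by simp [SensReach.asg, Prog.sz, Ex.code]; omega)
  have hsz : (SensReach.asg x (.lit 0)).sz = 3 := rfl
  obtain ⟨ws3, r3, e3, f3, m3, c3, g3⟩ :=
    (Ex.bin .lt (.var x) (.var l)).runs_code 64 ws2 b4
      (by refine ⟨(by simp [Ex.ok]; omega), (by simp [Ex.ok]; omega), ?_⟩
          simpa [WordOp.safe] using hw) le_rfl
  have hsz3 : ((Ex.bin .lt (.var x) (.var l)).code 64).sz = 5 := rfl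
  have f63 := f3 63 (by omega)
  obtain ⟨t4, ws4, s4, d1, d2, d3, d4, d5, d6⟩ := key N 0 (by omega) ws3 _ g3 (by simp)
    (by rw [St.set_v_ne _ _ hxl, hN]) h0
    (by simp [e3, Ex.ev, WordOp.nat, St.set_v_ne _ _ hxl, hN]) (by omega)
  exact ⟨_, ws4, s4, Exec.seq b1 (Exec.seq r3 d1), by omega, by omega, d4, hQ _ d5 d6⟩

end HT

/-- `s'` agrees with `s` outside the registers `R` and the arrays `A`. -/
structure Agree (R A : List ℕ) (s s' : St) : Prop where
  v : ∀ r, r ∉ R → s'.v r = s.v r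
  arr : ∀ a, a ∉ A → s'.arr a = s.arr a

namespace Agree

variable {R A R' A' : List ℕ} {s s' s'' : St}

theorem refl (s : St) : Agree R A s s := ⟨fun _ _ => rfl, fun _ _ => rfl⟩

theorem trans (h : Agree R A s s') (h' : Agree R' A' s' s'') (hR : R' ⊆ R) (hA : A' ⊆ A) :
    Agree R A s s'' :=
  ⟨fun r hr => (h'.v r fun h => hr (hR h)).trans (h.v r hr),
    fun a ha => (h'.arr a fun h => ha (hA h)).trans (h.arr a ha)⟩

theorem mono (h : Agree R' A' s s') (hR : R' ⊆ R) (hA : A' ⊆ A) : Agree R A s s' :=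
  (refl s).trans h hR hA

theorem set {x : ℕ} (h : Agree R A s s') (hx : x ∈ R) (k : ℕ) : Agree R A s (s'.set x k) :=
  ⟨fun r hr => (s'.set_v_ne k fun e => hr (by rwa [e])).trans (h.v r hr), h.arr⟩

theorem put {a : ℕ} (h : Agree R A s s') (ha : a ∈ A) (i k : ℕ) : Agree R A s (s'.put a i k) :=
  ⟨h.v, fun b hb => (s'.put_arr_ne i k fun e => hb (by rwa [e])).trans (h.arr b hb)⟩

end Agree

/-- Assigns a value to the cell `ix` of array `a` for every `i` below the content of `li`. -/
def fill1 (i li a : ℕ) (ix e : Ex) : WordProg := forP i li (sto a ix e)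

def fill2 (i j li lj a : ℕ) (ix e : Ex) : WordProg := forP i li (forP j lj (sto a ix e))

/-- Since `f` is injective, no store destroys an earlier one, and the cell for `x` still has its old
content when `x` is processed. The expression may therefore read the cell that it overwrites, which
allows updates in place. -/
theorem HT.fill1 {full : Bool} {w : ℕ} {s : St} {Q : St → Prop} {i li a n : ℕ} {ix e : Ex}
    (f val : ℕ → ℕ) (hw : 0 < w) (hi : i < 63) (hli : li < 63) (hil : li ≠ i) (hn : s.v li = n)
    (ha : full = true ∨ a < 32) (hf : ∀ x < n, ∀ x' < n, f x = f x' → x = x')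
    (hstep : ∀ x < n, ∀ s', Agree [i] [a] s s' → s'.v i = x →
      (∀ x' < n, s'.arr a (f x') = if x' < x then val x' else s.arr a (f x')) →
      (∀ k, (∀ x' < n, f x' ≠ k) → s'.arr a k = s.arr a k) →
      ix.ok full w s' ∧ e.ok full w s' ∧ ix.ev s' = f x ∧ e.ev s' = val x)
    (hQ : ∀ s', Agree [i] [a] s s' → (∀ x < n, s'.arr a (f x) = val x) →
      (∀ k, (∀ x < n, f x ≠ k) → s'.arr a k = s.arr a k) → s'.coins = s.coins → Q s') :
    HT full w (fill1 i li a ix e) s (n * ((SensReach.sto a ix e).sz + 12) + 9) Q := by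
  refine (HT.forP (N := n) (T := fun _ => (SensReach.sto a ix e).sz)
    (fun x s' => Agree [i] [a] s s' ∧
      (∀ x' < n, s'.arr a (f x') = if x' < x then val x' else s.arr a (f x')) ∧
      (∀ k, (∀ x' < n, f x' ≠ k) → s'.arr a k = s.arr a k) ∧ s'.coins = s.coins)
    hi hli hil hn hw ⟨(Agree.refl s).set (by simp) _, by simp, by simp, by simp⟩ ?_ ?_).time_le
    (by simp)
  · rintro x hx s' ⟨h1, h2, h3, h4⟩ hxi hl
    obtain ⟨o1, o2, e1, e2⟩ := hstep x hx s' h1 hxi h2 h3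
    refine HT.sto o1 o2 ha ⟨hxi, hl, (h1.put (by simp) _ _).set (by simp) _, fun x' hx' => ?_,
      fun k hk => ?_, h4⟩
    · rw [e1, e2]
      by_cases hxx : x' = x
      · subst hxx; simp
      · have : f x' ≠ f x := fun h => hxx (hf _ hx' _ hx h)
        simp only [St.set_arr, St.put_arr_self, Function.update_of_ne this, h2 x' hx']
        congr 1; simp; omega
    · rw [e1]
      simp only [St.set_arr, St.put_arr_self]
      rw [Function.update_of_ne (hk x hx).symm, h3 k hk]
  · rintro s' ⟨h1, h2, h3, h4⟩ -
    exact hQ s' h1 (fun x hx => by rw [h2 x hx, if_pos hx]) h3 h4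

theorem HT.fill2 {full : Bool} {w : ℕ} {s : St} {Q : St → Prop} {i j li lj a n m : ℕ} {ix e : Ex}
    (f val : ℕ → ℕ → ℕ) (hw : 0 < w) (hi : i < 63) (hj : j < 63) (hij : i ≠ j) (hli : li < 63)
    (hlj : lj < 63) (hil : li ≠ i) (hil' : li ≠ j) (hjl : lj ≠ j) (hjl' : lj ≠ i)
    (hn : s.v li = n) (hm : s.v lj = m)
    (ha : full = true ∨ a < 32)
    (hf : ∀ x < n, ∀ y < m, ∀ x' < n, ∀ y' < m, f x y = f x' y' → x = x' ∧ y = y')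
    (hstep : ∀ x < n, ∀ y < m, ∀ s', Agree [i, j] [a] s s' → s'.v i = x → s'.v j = y →
      s'.arr a (f x y) = s.arr a (f x y) →
      ix.ok full w s' ∧ e.ok full w s' ∧ ix.ev s' = f x y ∧ e.ev s' = val x y)
    (hQ : ∀ s', Agree [i, j] [a] s s' → (∀ x < n, ∀ y < m, s'.arr a (f x y) = val x y) →
      (∀ k, (∀ x < n, ∀ y < m, f x y ≠ k) → s'.arr a k = s.arr a k) → s'.coins = s.coins → Q s') :
    HT full w (fill2 i j li lj a ix e) s
      (n * (m * ((SensReach.sto a ix e).sz + 12) + 21) + 9) Q := by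
  let I : ℕ → ℕ → St → Prop := fun x y s' => Agree [i, j] [a] s s' ∧
    (∀ x' < n, ∀ y' < m, s'.arr a (f x' y') =
      if x' < x ∨ x' = x ∧ y' < y then val x' y' else s.arr a (f x' y')) ∧
    (∀ k, (∀ x' < n, ∀ y' < m, f x' y' ≠ k) → s'.arr a k = s.arr a k) ∧ s'.coins = s.coins
  refine (HT.forP (N := n) (T := fun _ => m * ((SensReach.sto a ix e).sz + 12) + 9)
    (fun x s' => I x 0 s')
    hi hli hil hn hw ⟨(Agree.refl s).set (by simp) _, by simp, by simp, by simp⟩ ?_ ?_).time_le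
    (by simp [mul_add]; omega)
  · rintro x hx s' hI hxi hl
    have hsm : s'.v lj = m := (hI.1.v lj (by simp [hjl, hjl'])).trans hm
    refine (HT.forP (N := m) (T := fun _ => (SensReach.sto a ix e).sz)
      (fun y s'' => I x y s'' ∧ s''.v i = x) hj hlj hjl hsm hw
      ⟨⟨hI.1.set (by simp) _, by simpa using hI.2.1, by simpa using hI.2.2.1,
        by simpa using hI.2.2.2⟩, by rw [St.set_v_ne _ _ hij, hxi]⟩ ?_ ?_).time_le
      (by simp)
    · rintro y hy s'' ⟨⟨h1, h2, h3, h4⟩, hxi'⟩ hyj hl'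
      obtain ⟨o1, o2, e1, e2⟩ := hstep x hx y hy s'' h1 hxi' hyj (by simp [h2 x hx y hy])
      refine HT.sto o1 o2 ha ⟨hyj, hl', ⟨(h1.put (by simp) _ _).set (by simp) _,
        fun x' hx' y' hy' => ?_, fun k hk => ?_, h4⟩, by
          rw [St.set_v_ne _ _ hij, St.put_v, hxi']⟩
      · rw [e1, e2]
        by_cases hxx : x' = x ∧ y' = y
        · obtain ⟨rfl, rfl⟩ := hxx; simp
        · have : f x' y' ≠ f x y := fun h => hxx (hf _ hx' _ hy' _ hx _ hy h)
          simp only [St.set_arr, St.put_arr_self, Function.update_of_ne this, h2 x' hx' y' hy']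
          congr 1
          simp only [eq_iff_iff]; omega
      · rw [e1]
        simp only [St.set_arr, St.put_arr_self]
        rw [Function.update_of_ne (hk x hx y hy).symm, h3 k hk]
    · rintro s'' ⟨⟨h1, h2, h3, h4⟩, hxi'⟩ hm'
      refine ⟨hxi', (h1.v li (by simp [hil, hil'])).trans hn, h1.set (by simp) _,
        fun x' hx' y' hy' => ?_, h3, h4⟩
      rw [St.set_arr, h2 x' hx' y' hy']
      congr 1
      simp only [eq_iff_iff]; omega
  · rintro s' ⟨h1, h2, h3, h4⟩ -
    exact hQ s' h1 (fun x hx y hy => by rw [h2 x hx y hy, if_pos (.inl hx)]) h3 h4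

/-! ## Running arithmetic programs on the word RAM

Field elements are represented by words below `p`. Register `3` holds `p` and array `4` the table
of inverses. The memory of the arithmetic program lives in arrays from `32` on; a cell is valid only
if its stamp, in the next array, equals the current value of register `63`. -/

theorem mod_eq_val {p : ℕ} {x : ℕ} {y : ZMod p} (h : (x : ZMod p) = y) :
    x % p = y.val := by rw [← h, ZMod.val_natCast]

/-- Subtraction adds `p - b`, so that truncation never occurs. Division multiplies by the tabulated
inverse; the table entry `0` at `0` agrees with the convention `x / 0 = 0`. -/
def FieldOp.code : FieldOp → ℕ → ℕ → ℕ → WordProg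
  | add, d, a, b => .instr (.op .add 64 a b) ;; .instr (.op .mod d 64 3)
  | sub, d, a, b =>
    .instr (.op .sub 64 3 b) ;; .instr (.op .add 64 a 64) ;; .instr (.op .mod d 64 3)
  | mul, d, a, b => .instr (.op .mul 64 a b) ;; .instr (.op .mod d 64 3)
  | div, d, a, b =>
    .instr (.load 64 4 b) ;; .instr (.op .mul 64 a 64) ;; .instr (.op .mod d 64 3)

/-- Loads the cell of a stamped array. -/
def loadStamped (d a i : ℕ) : WordProg :=
  .instr (.load 64 (a + 1) i) ;; .instr (.op .eq 64 64 63) ;; .instr (.load 65 a i) ;;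
    .instr (.op .mul d 64 65)

def storeStamped (a i r : ℕ) : WordProg :=
  .instr (.store a i r) ;; .instr (.store (a + 1) i 63)

/-- Word and field registers are interleaved as `72 + 2 * d` and `73 + 2 * d`. Word array `a`
occupies `32 + 4 * a` with stamps in the next array, and field array `a` occupies `34 + 4 * a` with
stamps in the next array, so stamps sit exactly in the odd arrays. -/
def ArithInstr.code : ArithInstr → WordProg
  | word (.const d k) => .instr (.const (72 + 2 * d) k)
  | word (.op o d a b) => .instr (.op o (72 + 2 * d) (72 + 2 * a) (72 + 2 * b))
  | word (.load d a i) => loadStamped (72 + 2 * d) (32 + 4 * a) (72 + 2 * i)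
  | word (.store a i r) => storeStamped (32 + 4 * a) (72 + 2 * i) (72 + 2 * r)
  | word (.rand d) => .instr (.rand (72 + 2 * d))
  | const d k => if 0 ≤ k then
      .instr (.const 64 k.natAbs) ;; .instr (.op .mod (73 + 2 * d) 64 3)
    else .instr (.const 64 k.natAbs) ;; .instr (.op .mod 64 64 3) ;; .instr (.op .sub 64 3 64) ;;
      .instr (.op .mod (73 + 2 * d) 64 3)
  | op o d a b => o.code (73 + 2 * d) (73 + 2 * a) (73 + 2 * b)
  | load d a i => loadStamped (73 + 2 * d) (34 + 4 * a) (72 + 2 * i)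
  | store a i r => storeStamped (34 + 4 * a) (72 + 2 * i) (73 + 2 * r)
  | isZero d a => .instr (.const 64 0) ;; .instr (.op .eq (72 + 2 * d) (73 + 2 * a) 64)

def arithCode : Prog ArithInstr → WordProg
  | .skip => .skip
  | .instr i => i.code
  | .seq P Q => .seq (arithCode P) (arithCode Q)
  | .ite r P Q => .ite (72 + 2 * r) (arithCode P) (arithCode Q)
  | .loop r P => .loop (72 + 2 * r) (arithCode P)

/-- All registers and constants of the instruction are below `N`. -/
def ArithInstr.Below (N : ℕ) : ArithInstr → Prop
  | word (.const d _) => d < N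
  | word (.op _ d a b) => d < N ∧ a < N ∧ b < N
  | word (.load d _ i) => d < N ∧ i < N
  | word (.store _ i r) => i < N ∧ r < N
  | word (.rand d) => d < N
  | const d k => d < N ∧ k.natAbs < N
  | op _ d a b => d < N ∧ a < N ∧ b < N
  | load d _ i => d < N ∧ i < N
  | store _ i r => i < N ∧ r < N
  | isZero d a => d < N ∧ a < N

def ArithBelow (N : ℕ) : Prog ArithInstr → Prop
  | .skip => True
  | .instr i => i.Below N
  | .seq P Q => ArithBelow N P ∧ ArithBelow N Q
  | .ite r P Q => r < N ∧ ArithBelow N P ∧ ArithBelow N Q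
  | .loop r P => r < N ∧ ArithBelow N P

theorem ArithInstr.exists_below (i : ArithInstr) : ∃ N, ∀ N' ≥ N, i.Below N' := by
  rcases i with (⟨d, k⟩ | ⟨o, d, a, b⟩ | ⟨d, a, i⟩ | ⟨a, i, r⟩ | ⟨d⟩) | ⟨d, k⟩ | ⟨o, d, a, b⟩ |
    ⟨d, a, i⟩ | ⟨a, i, r⟩ | ⟨d, a⟩
  · exact ⟨d + 1, fun N' h => by simp only [Below]; omega⟩
  · exact ⟨d + a + b + 1, fun N' h => by simp only [Below]; omega⟩
  · exact ⟨d + i + 1, fun N' h => by simp only [Below]; omega⟩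
  · exact ⟨i + r + 1, fun N' h => by simp only [Below]; omega⟩
  · exact ⟨d + 1, fun N' h => by simp only [Below]; omega⟩
  · exact ⟨d + k.natAbs + 1, fun N' h => by simp only [Below]; omega⟩
  · exact ⟨d + a + b + 1, fun N' h => by simp only [Below]; omega⟩
  · exact ⟨d + i + 1, fun N' h => by simp only [Below]; omega⟩
  · exact ⟨i + r + 1, fun N' h => by simp only [Below]; omega⟩
  · exact ⟨d + a + 1, fun N' h => by simp only [Below]; omega⟩

theorem exists_arithBelow (P : Prog ArithInstr) : ∃ N, ∀ N' ≥ N, ArithBelow N' P := by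
  induction P with
  | skip => exact ⟨0, fun _ _ => trivial⟩
  | instr i => exact i.exists_below
  | seq P Q ihP ihQ =>
    obtain ⟨N, hN⟩ := ihP
    obtain ⟨M, hM⟩ := ihQ
    exact ⟨N + M, fun N' h => ⟨hN N' (by omega), hM N' (by omega)⟩⟩
  | ite r P Q ihP ihQ =>
    obtain ⟨N, hN⟩ := ihP
    obtain ⟨M, hM⟩ := ihQ
    exact ⟨r + 1 + N + M, fun N' h => ⟨by omega, hN N' (by omega), hM N' (by omega)⟩⟩
  | loop r P ihP =>
    obtain ⟨N, hN⟩ := ihP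
    exact ⟨r + 1 + N, fun N' h => ⟨by omega, hN N' (by omega)⟩⟩

/-- The word state `ws` represents the state `as` of an arithmetic program; its visible part is that
of `base`. -/
structure Sim {p : ℕ} (w N : ℕ) (base : WordState) (as : ArithState (ZMod p))
    (ws : WordState) : Prop where
  bdd : WordBounded w ws
  reg : ∀ r < N, ws.reg (72 + 2 * r) = as.word.reg r
  freg : ∀ r < N, ws.reg (73 + 2 * r) = (as.freg r).val
  mem : ∀ a i, as.word.mem a i =
    if ws.mem (33 + 4 * a) i = base.reg 63 then ws.mem (32 + 4 * a) i else 0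
  fmem : ∀ a i, (as.fmem a i).val =
    if ws.mem (35 + 4 * a) i = base.reg 63 then ws.mem (34 + 4 * a) i else 0
  coins : ws.coins = as.word.coins
  ureg : ∀ r < 64, ws.reg r = base.reg r
  umem : ∀ a < 32, ws.mem a = base.mem a
  stamp : ∀ a, 32 ≤ a → a % 2 = 1 → ∀ i, ws.mem a i ≤ base.reg 63

section

variable {p w N : ℕ} {base ws : WordState} {as : ArithState (ZMod p)}

theorem Sim.setTemp (h : Sim w N base as ws) {d x : ℕ} (hd : 64 ≤ d) (hd' : d < 72)
    (hx : x < 2 ^ w) : Sim w N base as (ws.setReg d x) := by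
  refine ⟨h.bdd.setReg d hx, fun r hr => ?_, fun r hr => ?_, h.mem, h.fmem, h.coins,
    fun r hr => ?_, h.umem, h.stamp⟩
  · rw [← h.reg r hr]; simp [WordState.setReg, show 72 + 2 * r ≠ d by omega]
  · rw [← h.freg r hr]; simp [WordState.setReg, show 73 + 2 * r ≠ d by omega]
  · rw [← h.ureg r hr]; simp [WordState.setReg, show r ≠ d by omega]

theorem Sim.setWord (h : Sim w N base as ws) (d : ℕ) {x : ℕ} (hx : x < 2 ^ w) :
    Sim w N base { as with word := as.word.setReg d x } (ws.setReg (72 + 2 * d) x) := by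
  refine ⟨h.bdd.setReg _ hx, fun r hr => ?_, fun r hr => ?_, h.mem, h.fmem, h.coins,
    fun r hr => ?_, h.umem, h.stamp⟩
  · by_cases hrd : r = d
    · subst hrd; simp [WordState.setReg]
    · simp [WordState.setReg, hrd, h.reg r hr]
  · rw [← h.freg r hr]; simp [WordState.setReg, show 73 + 2 * r ≠ 72 + 2 * d by omega]
  · rw [← h.ureg r hr]; simp [WordState.setReg, show r ≠ 72 + 2 * d by omega]

theorem Sim.setField [NeZero p] (h : Sim w N base as ws) (d : ℕ) {x : ℕ} {y : ZMod p}
    (hx : x < 2 ^ w) (hy : x = y.val) :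
    Sim w N base { as with freg := Function.update as.freg d y } (ws.setReg (73 + 2 * d) x) := by
  refine ⟨h.bdd.setReg _ hx, fun r hr => ?_, fun r hr => ?_, h.mem, h.fmem, h.coins,
    fun r hr => ?_, h.umem, h.stamp⟩
  · rw [← h.reg r hr]; simp [WordState.setReg, show 72 + 2 * r ≠ 73 + 2 * d by omega]
  · by_cases hrd : r = d
    · subst hrd; simp [WordState.setReg, hy]
    · simp [WordState.setReg, hrd, h.freg r hr]
  · rw [← h.ureg r hr]; simp [WordState.setReg, show r ≠ 73 + 2 * d by omega]

theorem eval_mod {w x y : ℕ} (hx : x < 2 ^ w) : WordOp.mod.eval w x y = x % y :=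
  Nat.mod_eq_of_lt ((Nat.mod_le _ _).trans_lt hx)

theorem WordState.setReg_reg_self (s : WordState) (d x : ℕ) : (s.setReg d x).reg d = x := by
  simp [WordState.setReg]

theorem WordState.setReg_reg_ne (s : WordState) {d r : ℕ} (x : ℕ) (h : r ≠ d) :
    (s.setReg d x).reg r = s.reg r := by
  simp [WordState.setReg, h]

theorem Sim.runs_fieldOp [Fact p.Prime] (h : Sim w N base as ws) (hp : base.reg 3 = p)
    (hpw : p * p < 2 ^ w) (hinv : ∀ x : ZMod p, base.mem 4 x.val = (x⁻¹).val) (o : FieldOp)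
    {d a b : ℕ} (ha : a < N) (hb : b < N) : ∃ t ws',
      Runs w (o.code (73 + 2 * d) (73 + 2 * a) (73 + 2 * b)) ws t ws' ∧ t ≤ 4 ∧
      Sim w N base ((ArithInstr.op o d a b).act w as) ws' := by
  have h3 : ws.reg 3 = p := by rw [h.ureg 3 (by norm_num), hp]
  have hp2 : 2 ≤ p := (Fact.out : p.Prime).two_le
  have ha1 := h.freg a ha
  have hb1 := h.freg b hb
  have hav := ZMod.val_lt (as.freg a)
  have hbv := ZMod.val_lt (as.freg b)
  have hadd : p + p ≤ p * p := by nlinarith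
  cases o with
  | add =>
    refine ⟨2, _, Exec.seq (Exec.instr _ _) (Exec.instr _ _), by norm_num,
      (h.setTemp (d := 64) le_rfl (by norm_num) (WordOp.eval_lt _ _ _ _)).setField d
        (WordOp.eval_lt _ _ _ _) ?_⟩
    have : WordOp.add.eval w (ws.reg (73 + 2 * a)) (ws.reg (73 + 2 * b)) =
        (as.freg a).val + (as.freg b).val := by
      rw [ha1, hb1]; exact Nat.mod_eq_of_lt (by omega)
    rw [WordInstr.act, WordState.setReg_reg_self, WordState.setReg_reg_ne _ _ (by omega), h3,
      eval_mod (WordOp.eval_lt _ _ _ _), this]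
    exact mod_eq_val (by simp [FieldOp.eval])
  | sub =>
    refine ⟨3, _, Exec.seq (Exec.instr _ _) (Exec.seq (Exec.instr _ _) (Exec.instr _ _)),
      by norm_num, ((h.setTemp (d := 64) le_rfl (by norm_num) (WordOp.eval_lt _ _ _ _)).setTemp
        (d := 64) le_rfl (by norm_num) (WordOp.eval_lt _ _ _ _)).setField d
        (WordOp.eval_lt _ _ _ _) ?_⟩
    have e1 : WordOp.sub.eval w p (as.freg b).val = p - (as.freg b).val :=
      Nat.mod_eq_of_lt (by omega)
    have e2 : WordOp.add.eval w (as.freg a).val (p - (as.freg b).val) =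
      (as.freg a).val + (p - (as.freg b).val) := Nat.mod_eq_of_lt (by omega)
    have n1 : 3 ≠ 64 := by norm_num
    have n2 : 73 + 2 * a ≠ 64 := by omega
    simp only [WordInstr.act, WordState.setReg_reg_self, WordState.setReg_reg_ne _ _ n1,
      WordState.setReg_reg_ne _ _ n2]
    rw [h3, ha1, hb1, e1, e2, eval_mod (by omega)]
    exact mod_eq_val (by simp [FieldOp.eval, Nat.cast_sub hbv.le, sub_eq_add_neg])
  | mul =>
    refine ⟨2, _, Exec.seq (Exec.instr _ _) (Exec.instr _ _), by norm_num,
      (h.setTemp (d := 64) le_rfl (by norm_num) (WordOp.eval_lt _ _ _ _)).setField d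
        (WordOp.eval_lt _ _ _ _) ?_⟩
    have : WordOp.mul.eval w (ws.reg (73 + 2 * a)) (ws.reg (73 + 2 * b)) =
        (as.freg a).val * (as.freg b).val := by
      rw [ha1, hb1]; exact Nat.mod_eq_of_lt (by nlinarith)
    rw [WordInstr.act, WordState.setReg_reg_self, WordState.setReg_reg_ne _ _ (by omega), h3,
      eval_mod (WordOp.eval_lt _ _ _ _), this]
    exact mod_eq_val (by simp [FieldOp.eval])
  | div =>
    refine ⟨3, _, Exec.seq (Exec.instr _ _) (Exec.seq (Exec.instr _ _) (Exec.instr _ _)),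
      by norm_num, ((h.setTemp (d := 64) le_rfl (by norm_num) (h.bdd.mem _ _)).setTemp
        (d := 64) le_rfl (by norm_num) (WordOp.eval_lt _ _ _ _)).setField d
        (WordOp.eval_lt _ _ _ _) ?_⟩
    have hiv := ZMod.val_lt (as.freg b)⁻¹
    have e2 : WordOp.mul.eval w (as.freg a).val (as.freg b)⁻¹.val =
      (as.freg a).val * (as.freg b)⁻¹.val := Nat.mod_eq_of_lt (by nlinarith)
    have n1 : 3 ≠ 64 := by norm_num
    have n2 : 73 + 2 * a ≠ 64 := by omega
    simp only [WordInstr.act, WordState.setReg_reg_self, WordState.setReg_reg_ne _ _ n1,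
      WordState.setReg_reg_ne _ _ n2]
    rw [h3, ha1, hb1, h.umem 4 (by norm_num), hinv, e2, eval_mod (by nlinarith)]
    exact mod_eq_val (by simp [FieldOp.eval, div_eq_mul_inv])

/-- The cell is multiplied by the truth value of "the stamp is current"; no branch is needed. The
word `x` is a scratch value whose size alone matters. -/
theorem runs_loadStamped (hw : 0 < w) (hb : WordBounded w ws) {d a i : ℕ} (hi : 66 ≤ i) :
    ∃ x, Runs w (loadStamped d a i) ws 4
      (((((ws.setReg 64 (ws.mem (a + 1) (ws.reg i))).setReg 64 x).setReg 65
        (ws.mem a (ws.reg i)))).setReg d (if ws.mem (a + 1) (ws.reg i) = ws.reg 63 then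
          ws.mem a (ws.reg i) else 0)) ∧ x < 2 ^ w := by
  have h2 : 2 ≤ 2 ^ w := Nat.le_self_pow hw.ne' 2
  refine ⟨if ws.mem (a + 1) (ws.reg i) = ws.reg 63 then 1 else 0, ?_, by split_ifs <;> omega⟩
  have hrun : Runs w (loadStamped d a i) ws 4 _ :=
    Exec.seq (Exec.instr _ _) (Exec.seq (Exec.instr _ _) (Exec.seq (Exec.instr _ _)
      (Exec.instr _ _)))
  convert hrun using 1
  have e : WordOp.eq.eval w (ws.mem (a + 1) (ws.reg i)) (ws.reg 63) =
      if ws.mem (a + 1) (ws.reg i) = ws.reg 63 then 1 else 0 := by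
    simp only [WordOp.eval]; split_ifs <;> exact Nat.mod_eq_of_lt (by omega)
  have hi4 : i ≠ 64 := by omega
  simp only [WordInstr.act, WordState.setReg_reg_self]
  rw [WordState.setReg_reg_ne _ _ (show 63 ≠ 64 by omega), e]
  simp only [WordState.setReg, Function.update_self, ne_eq, hi4, not_false_eq_true,
    Function.update_of_ne, Nat.reduceEqDiff]
  congr 2
  have hm := hb.mem a (ws.reg i)
  split_ifs <;> simp [WordOp.eval, Nat.mod_eq_of_lt hm]

theorem Sim.runs_instr [Fact p.Prime] (h : Sim w N base as ws) (hw : 0 < w) (hp : base.reg 3 = p)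
    (hpw : p * p < 2 ^ w) (hinv : ∀ x : ZMod p, base.mem 4 x.val = (x⁻¹).val) (hN : N ≤ 2 ^ w)
    (i : ArithInstr) (hi : i.Below N) : ∃ t ws', Runs w i.code ws t ws' ∧ t ≤ 4 ∧
      Sim w N base (i.act w as) ws' := by
  have h3 : ws.reg 3 = p := by rw [h.ureg 3 (by norm_num), hp]
  have h63 := h.ureg 63 (by norm_num)
  have hp2 : 2 ≤ p := (Fact.out : p.Prime).two_le
  have hmod : ∀ x, x % 2 ^ w < 2 ^ w := fun x => Nat.mod_lt _ (by positivity)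
  have hpw' : p < 2 ^ w := by nlinarith
  rcases i with (⟨d, k⟩ | ⟨o, d, a, b⟩ | ⟨d, a, i⟩ | ⟨a, i, r⟩ | ⟨d⟩) | ⟨d, k⟩ | ⟨o, d, a, b⟩ |
    ⟨d, a, i⟩ | ⟨a, i, r⟩ | ⟨d, a⟩
  · exact ⟨1, _, Exec.instr _ _, by norm_num, h.setWord d (hmod k)⟩
  · refine ⟨1, _, Exec.instr _ _, by norm_num, ?_⟩
    rw [WordInstr.act, h.reg a hi.2.1, h.reg b hi.2.2]
    exact h.setWord d (WordOp.eval_lt _ _ _ _)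
  · obtain ⟨x, hr, hx⟩ := runs_loadStamped (d := 72 + 2 * d) (a := 32 + 4 * a) (i := 72 + 2 * i)
      hw h.bdd (by omega)
    refine ⟨4, _, hr, le_rfl, ?_⟩
    have := h.mem a (as.word.reg i)
    rw [h.reg i hi.2, h63, show 32 + 4 * a + 1 = 33 + 4 * a by ring, ← this]
    refine (((h.setTemp le_rfl (by norm_num) (h.bdd.mem _ _)).setTemp le_rfl (by norm_num)
      hx).setTemp (by norm_num) (by norm_num) (h.bdd.mem _ _)).setWord d ?_
    rw [this]; split_ifs
    · exact h.bdd.mem _ _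
    · positivity
  · have hr : Runs w (storeStamped (32 + 4 * a) (72 + 2 * i) (72 + 2 * r)) ws 2 _ :=
      Exec.seq (Exec.instr _ _) (Exec.instr _ _)
    refine ⟨2, _, hr, by norm_num, hr.wordBounded h.bdd, h.reg, h.freg, fun b j => ?_,
      fun b j => ?_, h.coins, h.ureg, fun b hb => ?_, fun b hb hb2 j => ?_⟩
    · have hir := h.reg i hi.1
      have hrr := h.reg r hi.2
      by_cases hba : b = a
      · subst hba
        have e0 : 32 + 4 * b + 1 = 33 + 4 * b := by ring
        by_cases hj : j = as.word.reg i
        · subst hj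
          simp [WordInstr.act, ArithInstr.act, hir, hrr, h63, e0]
        · simp [WordInstr.act, ArithInstr.act, hj, hir, h.mem, e0]
      · have e1 : 33 + 4 * b ≠ 32 + 4 * a := by omega
        have e2 : 33 + 4 * b ≠ 32 + 4 * a + 1 := by omega
        have e3 : 32 + 4 * b ≠ 32 + 4 * a := by omega
        have e4 : 32 + 4 * b ≠ 32 + 4 * a + 1 := by omega
        simp only [WordInstr.act, ArithInstr.act, ne_eq, hba, not_false_eq_true,
          Function.update_of_ne, e1, e2, e3, e4, h.mem]
    · have e1 : 35 + 4 * b ≠ 32 + 4 * a := by omega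
      have e2 : 35 + 4 * b ≠ 32 + 4 * a + 1 := by omega
      have e3 : 34 + 4 * b ≠ 32 + 4 * a := by omega
      have e4 : 34 + 4 * b ≠ 32 + 4 * a + 1 := by omega
      simp only [WordInstr.act, ArithInstr.act, ne_eq, not_false_eq_true,
          Function.update_of_ne, e1, e2, e3, e4, h.fmem]
    · have e1 : b ≠ 32 + 4 * a := by omega
      have e2 : b ≠ 32 + 4 * a + 1 := by omega
      simp [WordInstr.act, e1, e2, h.umem b hb]
    · have e1 : b ≠ 32 + 4 * a := by omega
      by_cases e2 : b = 32 + 4 * a + 1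
      · subst e2
        by_cases hj : j = ws.reg (72 + 2 * i)
        · subst hj; simp [WordInstr.act, h63]
        · simp [WordInstr.act, hj]
          exact h.stamp _ hb hb2 j
      · simpa [WordInstr.act, e1, e2] using h.stamp b hb hb2 j
  · have hc := h.coins
    have := h.setWord d (h.bdd.coins 0)
    have hr : Runs w (.instr (.rand (72 + 2 * d))) ws 1 _ := Exec.instr _ _
    refine ⟨1, _, hr, by norm_num, hr.wordBounded h.bdd, fun r hr => ?_, fun r hr => ?_, this.mem,
      this.fmem, ?_, this.ureg, this.umem, this.stamp⟩
    · have := this.reg r hr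
      simpa [WordInstr.act, ArithInstr.act, hc] using this
    · have := this.freg r hr
      simpa [WordInstr.act, ArithInstr.act, hc] using this
    · simp [WordInstr.act, ArithInstr.act, hc]
  · have hk : k.natAbs < 2 ^ w := hi.2.trans_le hN
    simp only [ArithInstr.code]
    split_ifs with h0
    · refine ⟨2, _, Exec.seq (Exec.instr _ _) (Exec.instr _ _), by norm_num,
        (h.setTemp (d := 64) le_rfl (by norm_num) (hmod _)).setField d
          (WordOp.eval_lt _ _ _ _) ?_⟩
      simp only [WordInstr.act, WordState.setReg_reg_self]
      rw [WordState.setReg_reg_ne _ _ (by omega), h3, eval_mod (hmod _), Nat.mod_eq_of_lt hk]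
      refine mod_eq_val ?_
      rw [Nat.cast_natAbs, abs_of_nonneg h0]
    · refine ⟨4, _, Exec.seq (Exec.instr _ _) (Exec.seq (Exec.instr _ _) (Exec.seq (Exec.instr _ _)
        (Exec.instr _ _))), le_rfl, (((h.setTemp (d := 64) le_rfl (by norm_num) (hmod _)).setTemp
        (d := 64) le_rfl (by norm_num) (WordOp.eval_lt _ _ _ _)).setTemp
        (d := 64) le_rfl (by norm_num) (WordOp.eval_lt _ _ _ _)).setField d
          (WordOp.eval_lt _ _ _ _) ?_⟩
      simp only [WordInstr.act, WordState.setReg_reg_self]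
      have h43 : 3 ≠ 64 := by norm_num
      have hkp : k.natAbs % p < p := Nat.mod_lt _ (by omega)
      have e : WordOp.sub.eval w p (k.natAbs % p) = p - k.natAbs % p := Nat.mod_eq_of_lt (by omega)
      simp only [WordState.setReg_reg_ne _ _ h43, h3]
      rw [eval_mod (hmod _), Nat.mod_eq_of_lt hk, e, eval_mod (by omega)]
      refine mod_eq_val ?_
      rw [Nat.cast_sub hkp.le, ZMod.natCast_mod, Nat.cast_natAbs, abs_of_neg (by omega)]
      simp
  · exact h.runs_fieldOp hp hpw hinv o hi.2.1 hi.2.2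
  · obtain ⟨x, hr, hx⟩ := runs_loadStamped (d := 73 + 2 * d) (a := 34 + 4 * a) (i := 72 + 2 * i)
      hw h.bdd (by omega)
    refine ⟨4, _, hr, le_rfl, ?_⟩
    have := h.fmem a (as.word.reg i)
    rw [h.reg i hi.2, h63, show 34 + 4 * a + 1 = 35 + 4 * a by ring, ← this]
    refine (((h.setTemp le_rfl (by norm_num) (h.bdd.mem _ _)).setTemp le_rfl (by norm_num)
      hx).setTemp (by norm_num) (by norm_num) (h.bdd.mem _ _)).setField d ?_ rfl
    exact (ZMod.val_lt _).trans hpw'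
  · have hr : Runs w (storeStamped (34 + 4 * a) (72 + 2 * i) (73 + 2 * r)) ws 2 _ :=
      Exec.seq (Exec.instr _ _) (Exec.instr _ _)
    refine ⟨2, _, hr, by norm_num, hr.wordBounded h.bdd, h.reg, h.freg, fun b j => ?_,
      fun b j => ?_, h.coins, h.ureg, fun b hb => ?_, fun b hb hb2 j => ?_⟩
    · have e1 : 33 + 4 * b ≠ 34 + 4 * a := by omega
      have e2 : 33 + 4 * b ≠ 34 + 4 * a + 1 := by omega
      have e3 : 32 + 4 * b ≠ 34 + 4 * a := by omega
      have e4 : 32 + 4 * b ≠ 34 + 4 * a + 1 := by omega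
      simp only [WordInstr.act, ArithInstr.act, ne_eq, not_false_eq_true,
          Function.update_of_ne, e1, e2, e3, e4, h.mem]
    · have hir := h.reg i hi.1
      have hrr := h.freg r hi.2
      by_cases hba : b = a
      · subst hba
        have e0 : 34 + 4 * b + 1 = 35 + 4 * b := by ring
        by_cases hj : j = as.word.reg i
        · subst hj
          simp [WordInstr.act, ArithInstr.act, hir, hrr, h63, e0]
        · simp [WordInstr.act, ArithInstr.act, hj, hir, h.fmem, e0]
      · have e1 : 35 + 4 * b ≠ 34 + 4 * a := by omega
        have e2 : 35 + 4 * b ≠ 34 + 4 * a + 1 := by omega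
        have e3 : 34 + 4 * b ≠ 34 + 4 * a := by omega
        have e4 : 34 + 4 * b ≠ 34 + 4 * a + 1 := by omega
        simp only [WordInstr.act, ArithInstr.act, ne_eq, hba, not_false_eq_true,
          Function.update_of_ne, e1, e2, e3, e4, h.fmem]
    · have e1 : b ≠ 34 + 4 * a := by omega
      have e2 : b ≠ 34 + 4 * a + 1 := by omega
      simp [WordInstr.act, e1, e2, h.umem b hb]
    · have e1 : b ≠ 34 + 4 * a := by omega
      by_cases e2 : b = 34 + 4 * a + 1
      · subst e2
        by_cases hj : j = ws.reg (72 + 2 * i)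
        · subst hj; simp [WordInstr.act, h63]
        · simp [WordInstr.act, hj]
          exact h.stamp _ hb hb2 j
      · simpa [WordInstr.act, e1, e2] using h.stamp b hb hb2 j
  · refine ⟨2, _, Exec.seq (Exec.instr _ _) (Exec.instr _ _), by norm_num, ?_⟩
    simp only [WordInstr.act, WordState.setReg_reg_self]
    rw [WordState.setReg_reg_ne _ _ (by omega), h.freg a hi.2]
    have := (h.setTemp (d := 64) (x := 0 % 2 ^ w) le_rfl (by norm_num) (hmod _)).setWord d
      (WordOp.eval_lt w .eq (as.freg a).val (0 % 2 ^ w))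
    convert this using 1
    by_cases h0 : as.freg a = 0 <;> simp [ArithInstr.act, WordOp.eval, h0]

/-- The control structure is copied literally and tests read the image of the same register, so only
the factor 4 for single instructions is lost. -/
theorem Sim.runs_arithCode [Fact p.Prime] (hw : 0 < w) (hp : base.reg 3 = p)
    (hpw : p * p < 2 ^ w) (hinv : ∀ x : ZMod p, base.mem 4 x.val = (x⁻¹).val) (hN : N ≤ 2 ^ w)
    {P : Prog ArithInstr} {t : ℕ} {as' : ArithState (ZMod p)}
    (hex : Exec (fun s => s.word.reg) (ArithInstr.act w) P as t as') (hP : ArithBelow N P)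
    (h : Sim w N base as ws) :
    ∃ t' ws', Runs w (arithCode P) ws t' ws' ∧ t' ≤ 4 * t ∧ Sim w N base as' ws' := by
  induction hex generalizing ws with
  | skip s => exact ⟨0, ws, Exec.skip _, le_rfl, h⟩
  | instr i s => exact h.runs_instr hw hp hpw hinv hN i hP
  | seq _ _ ih1 ih2 =>
    obtain ⟨t1, ws1, r1, l1, h1⟩ := ih1 hP.1 h
    obtain ⟨t2, ws2, r2, l2, h2⟩ := ih2 hP.2 h1
    exact ⟨_, ws2, Exec.seq r1 r2, by omega, h2⟩
  | ite_true hr _ ih =>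
    obtain ⟨t1, ws1, r1, l1, h1⟩ := ih hP.2.1 h
    exact ⟨_, ws1, Exec.ite_true (by rwa [h.reg _ hP.1]) r1, by omega, h1⟩
  | ite_false hr _ ih =>
    obtain ⟨t1, ws1, r1, l1, h1⟩ := ih hP.2.2 h
    exact ⟨_, ws1, Exec.ite_false (by rwa [h.reg _ hP.1]) r1, by omega, h1⟩
  | loop_done hr => exact ⟨_, ws, Exec.loop_done (by rwa [h.reg _ hP.1]), by omega, h⟩
  | loop_step hr _ _ ih1 ih2 =>
    obtain ⟨t1, ws1, r1, l1, h1⟩ := ih1 hP.2 h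
    obtain ⟨t2, ws2, r2, l2, h2⟩ := ih2 hP h1
    exact ⟨_, ws2, Exec.loop_step (by rwa [h.reg _ hP.1]) r1 r2, by omega, h2⟩

end

/-! ## The matrix multiplication subroutine -/

/-- Only the finitely many registers mentioned by the program are cleared explicitly; its memory is
cleared implicitly by the stamps. -/
def zeroRegs : ℕ → WordProg
  | 0 => .skip
  | n + 1 => zeroRegs n ;; .instr (.const (72 + 2 * n) 0) ;; .instr (.const (73 + 2 * n) 0)

theorem runs_zeroRegs (w n : ℕ) (ws : WordState) : ∃ ws', Runs w (zeroRegs n) ws (2 * n) ws' ∧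
    (∀ r < 72, ws'.reg r = ws.reg r) ∧ (∀ r < n, ws'.reg (72 + 2 * r) = 0 ∧
      ws'.reg (73 + 2 * r) = 0) ∧ ws'.mem = ws.mem ∧ ws'.coins = ws.coins := by
  induction n with
  | zero => exact ⟨ws, Exec.skip _, fun _ _ => rfl, by simp, rfl, rfl⟩
  | succ n ih =>
    obtain ⟨ws', h1, h2, h3, h4, h5⟩ := ih
    refine ⟨_, Exec.seq h1 (Exec.seq (Exec.instr _ _) (Exec.instr _ _)), fun r hr => ?_,
      fun r hr => ?_, h4, h5⟩
    · simp [WordInstr.act, WordState.setReg, show r ≠ 72 + 2 * n by omega,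
        show r ≠ 73 + 2 * n by omega, h2 r hr]
    · have e1 : 72 + 2 * r ≠ 73 + 2 * n := by omega
      have e2 : 73 + 2 * r ≠ 72 + 2 * n := by omega
      by_cases hrn : r = n
      · subst hrn; simp [WordInstr.act, WordState.setReg]
      · simp [WordInstr.act, WordState.setReg, e1, e2, hrn, h3 r (by omega)]

/-- Copies the factors from arrays `6` and `7`. -/
def mulCopyIn : WordProg :=
  asg 60 (.bin .mul (.var 4) (.var 4)) ;;
  fill1 62 60 34 (.var 62) (.get 6 (.var 62)) ;; fill1 62 60 35 (.var 62) (.var 63) ;;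
  fill1 62 60 38 (.var 62) (.get 7 (.var 62)) ;; fill1 62 60 39 (.var 62) (.var 63)

/-- Copies the valid entries of the product to array `8`. -/
def mulCopyOut : WordProg :=
  fill1 62 60 8 (.var 62)
    (.bin .mul (.bin .eq (.get 43 (.var 62)) (.var 63)) (.get 42 (.var 62)))

/-- Multiplies the square matrices in the arrays `6` and `7`, whose size is in register `4`; the
product is written to array `8`. -/
def mulP (P : Prog ArithInstr) (N : ℕ) : WordProg :=
  .instr (.const 64 1) ;; .instr (.op .add 63 63 64) ;; mulCopyIn ;; zeroRegs N ;;
  .instr (.const 64 0) ;; .instr (.op .add 72 4 64) ;; arithCode P ;; mulCopyOut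

theorem HT.mulCopyIn {w : ℕ} {s : St} {h : ℕ} (hw : 0 < w) (hh : s.v 4 = h)
    (hhw : h * h < 2 ^ w) {Q : St → Prop}
    (hQ : ∀ s', Agree [60, 62] [34, 35, 38, 39] s s' → s'.v 60 = h * h → s'.coins = s.coins →
      (∀ k, s'.arr 34 k = if k < h * h then s.arr 6 k else s.arr 34 k) →
      (∀ k, s'.arr 35 k = if k < h * h then s.v 63 else s.arr 35 k) →
      (∀ k, s'.arr 38 k = if k < h * h then s.arr 7 k else s.arr 38 k) →
      (∀ k, s'.arr 39 k = if k < h * h then s.v 63 else s.arr 39 k) → Q s') :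
    HT true w mulCopyIn s (100 * (h * h) + 60) Q := by
  have aux : ∀ (a : ℕ) (e : Ex) (val : ℕ → ℕ) (s0 : St), s0.v 60 = h * h →
      (∀ x < h * h, ∀ s', Agree [62] [a] s0 s' → s'.v 62 = x → e.ok true w s' ∧ e.ev s' = val x) →
      HT true w (SensReach.fill1 62 60 a (.var 62) e) s0
        (h * h * ((SensReach.sto a (.var 62) e).sz + 12) + 9)
        fun s' => Agree [62] [a] s0 s' ∧ s'.coins = s0.coins ∧
          ∀ k, s'.arr a k = if k < h * h then val k else s0.arr a k := by
    intro a e val s0 h60 hstep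
    refine HT.fill1 (n := h * h) (fun x => x) val hw (by norm_num) (by norm_num) (by norm_num) h60
      (.inl rfl) (fun _ _ _ _ h => h) (fun x hx s' h1 h2 _ _ => ?_) fun s' h1 h2 h3 h4 =>
        ⟨h1, h4, fun k => ?_⟩
    · obtain ⟨g1, g2⟩ := hstep x hx s' h1 h2
      exact ⟨by simp [Ex.ok], g1, h2, g2⟩
    · split_ifs with hk
      · exact h2 k hk
      · exact h3 k fun x hx e => hk (e ▸ hx)
  apply HT.time_le
  case h =>
    apply HT.seq
    refine HT.asg (by simp [Ex.ok, WordOp.safe, Ex.ev, hh, hhw]) (by norm_num) ?_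
    apply HT.seq
    refine (aux 34 _ (s.arr 6) _ (by simp [Ex.ev, WordOp.nat, hh]) fun x hx s' h1 h2 =>
      ⟨by simp [Ex.ok], by simp [Ex.ev, h2, h1.arr 6]⟩).mono le_rfl ?_
    rintro s1 ⟨a1, c1, v1⟩
    apply HT.seq
    refine (aux 35 _ (fun _ => s.v 63) _
      (by simp [a1.v 60, Ex.ev, WordOp.nat, hh]) fun x hx s' h1 h2 =>
      ⟨by simp [Ex.ok], by simp [Ex.ev, h1.v 63, a1.v 63, St.set_v]⟩).mono le_rfl ?_
    rintro s2 ⟨a2, c2, v2⟩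
    apply HT.seq
    refine (aux 38 _ (s.arr 7) _
      (by simp [a1.v 60, a2.v 60, Ex.ev, WordOp.nat, hh]) fun x hx s' h1 h2 =>
      ⟨by simp [Ex.ok], by simp [Ex.ev, h2, h1.arr 7, a1.arr 7, a2.arr 7]⟩).mono le_rfl ?_
    rintro s3 ⟨a3, c3, v3⟩
    refine ((aux 39 _ (fun _ => s.v 63) _
      (by simp [a1.v 60, a2.v 60, a3.v 60, Ex.ev, WordOp.nat, hh]) fun x hx s' h1 h2 =>
      ⟨by simp [Ex.ok], by simp [Ex.ev, h1.v 63, a1.v 63, a2.v 63, a3.v 63, St.set_v]⟩).mono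
        le_rfl ?_)
    rintro s4 ⟨a4, c4, v4⟩
    have A1 : Agree [60, 62] [34, 35, 38, 39] s s1 :=
      ((Agree.refl s).set (by simp) _).trans a1 (by simp) (by simp)
    have A4 := ((A1.trans a2 (by simp) (by simp)).trans a3 (by simp) (by simp)).trans a4
      (by simp) (by simp)
    refine hQ s4 A4 (by simp [a1.v 60, a2.v 60, a3.v 60, a4.v 60, Ex.ev, WordOp.nat, hh])
      (by simp [c1, c2, c3, c4]) (fun k => ?_) (fun k => ?_) (fun k => ?_) (fun k => ?_)
    · simp [a4.arr 34, a3.arr 34, a2.arr 34, v1]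
    · simp [a4.arr 35, a3.arr 35, a1.arr 35, v2]
    · simp [a4.arr 38, a2.arr 38, a1.arr 38, v3]
    · simp [a3.arr 39, a2.arr 39, a1.arr 39, v4]
  simp only [SensReach.asg, SensReach.sto, Prog.sz, Ex.code]
  omega

theorem HT.mulCopyOut {w : ℕ} {s : St} {n : ℕ} (hw : 0 < w) (hn : s.v 60 = n)
    (hb : ∀ k, s.arr 42 k < 2 ^ w) {Q : St → Prop}
    (hQ : ∀ s', Agree [62] [8] s s' → s'.coins = s.coins →
      (∀ k < n, s'.arr 8 k = if s.arr 43 k = s.v 63 then s.arr 42 k else 0) → Q s') :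
    HT true w mulCopyOut s (25 * n + 9) Q := by
  apply HT.time_le
  case h =>
    refine HT.fill1 (n := n) (fun x => x) (fun k => if s.arr 43 k = s.v 63 then s.arr 42 k else 0)
      hw (by norm_num) (by norm_num) (by norm_num) hn (.inl rfl) (fun _ _ _ _ h => h)
      (fun x hx s' h1 h2 _ _ => ?_) fun s' h1 h2 h3 h4 => hQ s' h1 h4 h2
    refine ⟨by simp [Ex.ok], ?_, h2, ?_⟩
    · simp only [Ex.ok, WordOp.safe, Ex.ev, WordOp.nat, h2, h1.v 63 (by simp), h1.arr 42 (by simp),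
        h1.arr 43 (by simp)]
      have := hb x
      split_ifs <;> simp [this, hw]
    · simp only [Ex.ev, WordOp.nat, h2, h1.v 63 (by simp), h1.arr 42 (by simp),
        h1.arr 43 (by simp)]
      split_ifs <;> simp
  simp only [SensReach.sto, Prog.sz, Ex.code]
  omega

/-- The visible part of a state, if everything is visible. -/
def WordState.toSt (ws : WordState) : St := ⟨ws.reg, ws.mem, ws.coins⟩

theorem WordBounded.rel_toSt {w : ℕ} {ws : WordState} (h : WordBounded w ws) :
    Rel true w ws.toSt ws :=
  ⟨h, fun _ _ => rfl, fun _ _ => rfl, fun _ => rfl, fun h => by simp at h⟩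

theorem rowMajor_lt {R : Type} [Zero R] {n : ℕ} (A : Fin n → Fin n → R) {i j : ℕ} (hi : i < n)
    (hj : j < n) : rowMajor A (i * n + j) = A ⟨i, hi⟩ ⟨j, hj⟩ := by
  have h : i * n + j < n * n := by nlinarith
  have hn : 0 < n := by omega
  rw [rowMajor, dif_pos h]
  congr 2
  · rw [mul_comm, Nat.mul_add_div hn, Nat.div_eq_of_lt hj, add_zero]
  · rw [mul_comm, Nat.mul_add_mod, Nat.mod_eq_of_lt hj]

/-- All stamps are at most the counter, so raising the counter by one makes every private cell count
as zero. The factors are then copied in with current stamps and become the only nonzero contents,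
which is exactly the required input state. The time bound holds for all random words, so it does not
matter which of them the subroutine draws. -/
theorem HT.mulP {P : Prog ArithInstr} {N w p h τ : ℕ} [Fact p.Prime] {s : St} {Q : St → Prop}
    (hP : ∀ (A B : Matrix (Fin h) (Fin h) (ZMod p)) (coins : ℕ → Fin (2 ^ w)),
      ∃ (t : ℕ) (s : ArithState (ZMod p)),
        Exec (fun s => s.word.reg) (ArithInstr.act w) P (mulInput A B fun k => coins k) t s ∧
        (∀ i j : Fin h, s.fmem 2 (i * h + j) = (A * B) i j) ∧ t ≤ τ)
    (hPN : ArithBelow N P) (hN0 : 0 < N) (hN : N ≤ 2 ^ w) (hw : 0 < w) (hp : s.v 3 = p)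
    (hpw : p * p < 2 ^ w) (hinv : ∀ x : ZMod p, s.arr 4 x.val = (x⁻¹).val)
    (hh : s.v 4 = h) (hhw : h * h < 2 ^ w)
    (h6 : ∀ k < h * h, s.arr 6 k < p) (h7 : ∀ k < h * h, s.arr 7 k < p)
    (hQ : ∀ s', Agree [60, 62, 63] [8] s s' →
      (∀ i < h, ∀ j < h, s'.arr 8 (i * h + j) =
        (∑ k ∈ Finset.range h, (s.arr 6 (i * h + k) * s.arr 7 (k * h + j) : ZMod p)).val) → Q s') :
    HT false w (mulP P N) s (4 * τ + 125 * (h * h) + 2 * N + 100) Q := by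
  intro ws hr he
  have h2w : 2 ≤ 2 ^ w := Nat.le_self_pow hw.ne' 2
  -- the counter of calls
  obtain ⟨ws1, hws1⟩ : ∃ ws1, ws1 =
    (WordInstr.op .add 63 63 64).act w ((WordInstr.const 64 1).act w ws) := ⟨_, rfl⟩
  have r1 : Runs w (.instr (.op .add 63 63 64)) ((WordInstr.const 64 1).act w ws) 1 ws1 := by
    rw [hws1]; exact Exec.instr _ _
  have r0 : Runs w (.instr (.const 64 1)) ws 1 _ := Exec.instr _ _
  have b1 : WordBounded w ws1 := r1.wordBounded (r0.wordBounded hr.bdd)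
  have v1 : ∀ r < 63, ws1.reg r = s.v r := fun r hr' => by
    rw [hws1, ← hr.reg r (by omega)]
    simp [WordInstr.act, WordState.setReg, show r ≠ 63 by omega, show r ≠ 64 by omega]
  have m1 : ws1.mem = ws.mem := by rw [hws1]; rfl
  have e1 : ws1.reg 63 = ws.reg 63 + 1 := by
    rw [hws1]
    simp [WordInstr.act, WordState.setReg, WordOp.eval, Nat.mod_eq_of_lt (show 1 < 2 ^ w by omega)]
    exact Nat.mod_eq_of_lt (by omega)
  -- the factors
  obtain ⟨t2, ws2, s2, r2, l2, g2, rel2, A2, q60, qc, q34, q35, q38, q39⟩ :=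
    HT.mulCopyIn (w := w) (s := ws1.toSt) (h := h) (Q := fun s' =>
      Agree [60, 62] [34, 35, 38, 39] ws1.toSt s' ∧ s'.v 60 = h * h ∧ s'.coins = ws1.coins ∧
      (∀ k, s'.arr 34 k = if k < h * h then ws1.mem 6 k else ws1.mem 34 k) ∧
      (∀ k, s'.arr 35 k = if k < h * h then ws1.reg 63 else ws1.mem 35 k) ∧
      (∀ k, s'.arr 38 k = if k < h * h then ws1.mem 7 k else ws1.mem 38 k) ∧
      (∀ k, s'.arr 39 k = if k < h * h then ws1.reg 63 else ws1.mem 39 k))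
      hw ((v1 4 (by norm_num)).trans hh) hhw
      (fun s' a b c d e f g => ⟨a, b, c, d, e, f, g⟩) ws1 b1.rel_toSt (by omega)
  -- the registers of the subroutine
  obtain ⟨ws3, r3, f3, z3, m3, c3⟩ := runs_zeroRegs w N ws2
  have b3 := r3.wordBounded rel2.bdd
  obtain ⟨ws4, hws4⟩ : ∃ ws4, ws4 =
    (WordInstr.op .add 72 4 64).act w ((WordInstr.const 64 0).act w ws3) := ⟨_, rfl⟩
  have r4 : Runs w (.instr (.op .add 72 4 64)) ((WordInstr.const 64 0).act w ws3) 1 ws4 := by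
    rw [hws4]; exact Exec.instr _ _
  have r4' : Runs w (.instr (.const 64 0)) ws3 1 _ := Exec.instr _ _
  have b4 : WordBounded w ws4 := r4.wordBounded (r4'.wordBounded b3)
  have v4 : ∀ r < 64, ws4.reg r = ws2.reg r := fun r hr' => by
    rw [hws4, ← f3 r (by omega)]
    simp [WordInstr.act, WordState.setReg, show r ≠ 72 by omega, show r ≠ 64 by omega]
  have m4 : ws4.mem = ws2.mem := by rw [hws4, ← m3]; rfl
  have c4 : ws4.coins = ws2.coins := by rw [hws4, ← c3]; rfl
  have v4' : ∀ r < 63, r ≠ 60 → r ≠ 62 → ws4.reg r = s.v r := fun r hr' h60 h62 => by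
    rw [v4 r (by omega), rel2.reg r (by omega), A2.v r (by simp [h60, h62])]
    exact v1 r hr'
  have e4 : ws4.reg 63 = ws.reg 63 + 1 := by
    rw [v4 63 (by omega), rel2.reg 63 (by omega), A2.v 63 (by simp), ← e1]; rfl
  have m4' : ∀ a, a ∉ [34, 35, 38, 39] → ws4.mem a = ws.mem a := fun a ha => by
    rw [m4, rel2.mem a (.inl rfl), A2.arr a ha, ← m1]; rfl
  have st := hr.stamp rfl
  have h72 : ws4.reg 72 = h := by
    have : ws3.reg 4 = h := by
      rw [f3 4 (by omega), ← v4 4 (by omega), v4' 4 (by omega) (by omega) (by omega), hh]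
    rw [hws4]
    simp [WordInstr.act, WordState.setReg, WordOp.eval, this]
    rw [← this]; exact Nat.mod_eq_of_lt (b3.reg 4)
  have z4 : ∀ r, 65 ≤ r → r ≠ 72 → ws4.reg r = ws3.reg r := fun r hr1 hr2 => by
    rw [hws4]; simp [WordInstr.act, WordState.setReg, hr2, show r ≠ 64 by omega]
  let A : Matrix (Fin h) (Fin h) (ZMod p) := fun i j => (s.arr 6 (i * h + j) : ZMod p)
  let B : Matrix (Fin h) (Fin h) (ZMod p) := fun i j => (s.arr 7 (i * h + j) : ZMod p)
  obtain ⟨tP, as', exP, prodP, lP⟩ := hP A B (fun k => ⟨ws4.coins k, b4.coins k⟩)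
  have rm : ∀ (a : ℕ) (k : ℕ), (∀ k < h * h, s.arr a k < p) →
      (rowMajor (fun i j : Fin h => (s.arr a (i * h + j) : ZMod p)) k).val =
        if k < h * h then s.arr a k else 0 := by
    intro a k hlt
    unfold rowMajor
    split_ifs with hk
    · simp only
      rw [Nat.div_add_mod' k h, ZMod.val_natCast, Nat.mod_eq_of_lt (hlt k hk)]
    · simp
  -- The machine state serves as its own base: it only fixes the visible part and the current stamp.
  have sim : Sim w N ws4 (mulInput A B fun k => ws4.coins k) ws4 := by
    refine ⟨b4, fun r hr' => ?_, fun r hr' => ?_, fun a i => ?_, fun a i => ?_, rfl,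
      fun _ _ => rfl, fun _ _ => rfl, fun a ha ha2 i => ?_⟩
    · by_cases h0 : r = 0
      · subst h0; simpa [mulInput] using h72
      · rw [z4 _ (by omega) (by omega), (z3 r hr').1]; simp [mulInput, h0]
    · rw [z4 _ (by omega) (by omega), (z3 r hr').2]; simp [mulInput]
    · have : ws4.mem (33 + 4 * a) i ≠ ws4.reg 63 := by
        rw [m4' _ (by simp; omega), e4]
        have := st (33 + 4 * a) (by omega) (by omega) i
        omega
      simp [mulInput, this]
    · have h67 : ∀ k, ws1.mem 6 k = s.arr 6 k ∧ ws1.mem 7 k = s.arr 7 k := fun k => by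
        rw [m1, hr.mem 6 (.inr (by norm_num)), hr.mem 7 (.inr (by norm_num))]; exact ⟨rfl, rfl⟩
      by_cases h0 : a = 0
      · subst h0
        have := st 35 (by omega) (by omega) i
        simp only [mulInput, m4, rel2.mem _ (.inl rfl), q34, q35, e4, e1, m1, if_true, mul_zero,
          add_zero]
        rw [rm 6 i h6, ← (h67 i).1, m1]
        by_cases hi : i < h * h
        · simp [hi]
        · simp only [hi, if_false]; rw [if_neg (by omega)]
      by_cases h1 : a = 1
      · subst h1
        have := st 39 (by omega) (by omega) i
        simp only [mulInput, m4, rel2.mem _ (.inl rfl), q38, q39, e4, e1, m1, if_true, mul_one,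
          one_ne_zero, if_false, Nat.reduceAdd]
        rw [rm 7 i h7, ← (h67 i).2, m1]
        by_cases hi : i < h * h
        · simp [hi]
        · simp only [hi, if_false]; rw [if_neg (by omega)]
      · have : ws4.mem (35 + 4 * a) i ≠ ws4.reg 63 := by
          rw [m4' _ (by simp; omega), e4]
          have := st (35 + 4 * a) (by omega) (by omega) i
          omega
        simp [mulInput, this, h0, h1]
    · rw [e4]
      by_cases h35 : a = 35
      · subst h35
        rw [m4, rel2.mem _ (.inl rfl), q35, e1, m1]
        have := st 35 (by omega) (by omega) i
        split_ifs <;> omega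
      by_cases h39 : a = 39
      · subst h39
        rw [m4, rel2.mem _ (.inl rfl), q39, e1, m1]
        have := st 39 (by omega) (by omega) i
        split_ifs <;> omega
      · rw [m4' a (by simp; omega)]
        exact (st a ha ha2 i).trans (by omega)
  obtain ⟨t5, ws5, r5, l5, S5⟩ := sim.runs_arithCode hw
    (by rw [v4' 3 (by omega) (by omega) (by omega), hp]) hpw
    (fun x => by rw [m4' 4 (by simp), hr.mem 4 (.inr (by norm_num)), hinv]) hN exP hPN
  have e5 : ws5.reg 63 = ws.reg 63 + 1 := by rw [S5.ureg 63 (by omega), e4]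
  obtain ⟨t6, ws6, s6, r6, l6, g6, rel6, A6, c6, q8⟩ :=
    HT.mulCopyOut (w := w) (s := ws5.toSt) (n := h * h) (Q := fun s' =>
      Agree [62] [8] ws5.toSt s' ∧ s'.coins = ws5.toSt.coins ∧ (∀ k < h * h, s'.arr 8 k =
        if ws5.toSt.arr 43 k = ws5.toSt.v 63 then ws5.toSt.arr 42 k else 0))
      hw (by rw [show ws5.toSt.v 60 = ws5.reg 60 from rfl, S5.ureg 60 (by omega), v4 60 (by omega),
        rel2.reg 60 (by omega), q60]) (fun k => S5.bdd.mem 42 k)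
      (fun s' a b c => ⟨a, b, c⟩) ws5 S5.bdd.rel_toSt (by omega)
  have hrun : Runs w (SensReach.mulP P N) ws _ ws6 :=
    Exec.seq r0 (Exec.seq r1 (Exec.seq r2 (Exec.seq r3 (Exec.seq r4' (Exec.seq r4
      (Exec.seq r5 r6))))))
  have e6 : ws6.reg 63 = ws.reg 63 + 1 := by
    rw [rel6.reg 63 (by omega), A6.v 63 (by simp)]; exact e5
  -- The new visible state takes the hidden registers and arrays and the random words from `s`. In
  -- the restricted view they are unconstrained, and this choice makes `Agree` true at all indices.
  refine ⟨_, ws6, ⟨fun r => if r < 64 then ws6.reg r else s.v r,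
    fun a => if a < 32 then ws6.mem a else s.arr a, s.coins⟩, hrun, by omega, by omega,
    ⟨rel6.bdd, fun r hr' => by simp [hr'], fun a ha => ?_, by simp, fun _ a ha ha2 i => ?_⟩,
    hQ _ ⟨fun r hr' => ?_, fun a ha => ?_⟩ fun i hi j hj => ?_⟩
  · have : a < 32 := by simpa using ha
    simp [this]
  · rw [e6, rel6.mem a (.inl rfl), A6.arr a (by simp; omega), ← e4]
    exact S5.stamp a ha ha2 i
  · simp only
    split_ifs with h64
    · simp at hr'
      rw [rel6.reg r h64, A6.v r (by simp; omega), show ws5.toSt.v r = ws5.reg r from rfl, S5.ureg r h64,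
        v4' r (by omega) (by omega) (by omega)]
    · rfl
  · simp only
    split_ifs with h32
    · rw [rel6.mem a (.inl rfl), A6.arr a ha, show ws5.toSt.arr a = ws5.mem a from rfl, S5.umem a h32,
        m4' a (by simp; omega), hr.mem a (.inr h32)]
    · rfl
  · have hk : i * h + j < h * h := by nlinarith
    have := S5.fmem 2 (i * h + j)
    simp only [show (8 : ℕ) < 32 by norm_num, if_true]
    rw [rel6.mem 8 (.inl rfl), q8 _ hk]
    have e53 : ws5.toSt.v 63 = ws4.reg 63 := e5.trans e4.symm
    rw [e53]
    refine this.symm.trans ?_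
    rw [prodP ⟨i, hi⟩ ⟨j, hj⟩, Matrix.mul_apply, Finset.sum_range]

/-! ## In-place Gauss-Jordan elimination -/

section GaussJordan

variable {F : Type*} [Field F]

/-- Elimination of column `e` with the pivot in row `r`. -/
def gjStep (r e : ℕ) (W : ℕ → ℕ → F) (i j : ℕ) : F :=
  if j = e then (if i = r then (W r e)⁻¹ else -W i e * (W r e)⁻¹)
  else (if i = r then 0 else W i j) +
    (if i = r then (W r e)⁻¹ else -W i e * (W r e)⁻¹) * W r j

/-- The matrix after the elimination of the first `e` columns with the pivots `π`. -/
def gjMat (A : ℕ → ℕ → F) (π : ℕ → ℕ) : ℕ → ℕ → ℕ → F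
  | 0 => A
  | e + 1 => gjStep (π e) e (gjMat A π e)

/-- Only the pivots of eliminated columns matter, so pivots may be chosen while the elimination
proceeds. -/
theorem gjMat_congr (A : ℕ → ℕ → F) {π π' : ℕ → ℕ} {e : ℕ} (h : ∀ c < e, π c = π' c) :
    gjMat A π e = gjMat A π' e := by
  induction e with
  | zero => rfl
  | succ e ih => rw [gjMat, gjMat, ih fun c hc => h c (by omega), h e (by omega)]

theorem gjStep_self (r e : ℕ) (W : ℕ → ℕ → F) (i : ℕ) :
    gjStep r e W i e = if i = r then (W r e)⁻¹ else -W i e * (W r e)⁻¹ := by simp [gjStep]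

/-- Off the pivot column, the step is a rank-one update by the new pivot column and the old pivot
row, after the pivot row has been set to zero. In this form, steps can be combined into blocks. -/
theorem gjStep_ne (r e : ℕ) (W : ℕ → ℕ → F) (i : ℕ) {j : ℕ} (hj : j ≠ e) : gjStep r e W i j =
    (if i = r then 0 else W i j) + gjStep r e W i e * W r j := by simp [gjStep, hj]

/-- The combined effect of the elimination of a block of columns on another column. -/
theorem gjMat_block (A : ℕ → ℕ → F) {π : ℕ → ℕ} {b : ℕ} (h : ℕ)
    (hπ : ∀ c < b + h, ∀ c' < b + h, π c = π c' → c = c') (i j : ℕ) (hj : j < b ∨ b + h ≤ j) :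
    gjMat A π (b + h) i j = (if ∃ c < b + h, b ≤ c ∧ π c = i then 0 else gjMat A π b i j) +
      ∑ c ∈ Finset.Ico b (b + h), gjMat A π (b + h) i c * gjMat A π b (π c) j := by
  induction h generalizing i with
  | zero => rw [if_neg (by rintro ⟨c, h1, h2, -⟩; omega)]; simp
  | succ h ih =>
    have ih' := fun i => ih (fun c hc c' hc' => hπ c (by omega) c' (by omega)) i (by omega)
    have hn : ¬ ∃ c < b + h, b ≤ c ∧ π c = π (b + h) := fun ⟨c, h2, _, h3⟩ => by
      have := hπ c (by omega) (b + h) (by omega) h3; omega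
    rw [← add_assoc, Finset.sum_Ico_succ_top (by omega), gjMat, gjStep_ne _ _ _ _ (by omega),
      ih' i, ih' (π (b + h)), if_neg hn]
    -- The last step changes the earlier block columns by multiples of its own column. These are
    -- precisely the terms that arise when row `π (b + h)` of column `j` is expanded by the
    -- induction hypothesis.
    have hs : ∀ c ∈ Finset.Ico b (b + h), gjStep (π (b + h)) (b + h) (gjMat A π (b + h)) i c *
        gjMat A π b (π c) j =
        ((if i = π (b + h) then 0 else gjMat A π (b + h) i c) +
          gjStep (π (b + h)) (b + h) (gjMat A π (b + h)) i (b + h) *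
            gjMat A π (b + h) (π (b + h)) c) * gjMat A π b (π c) j := fun c hc => by
      rw [gjStep_ne _ _ _ _ (show c ≠ b + h by rw [Finset.mem_Ico] at hc; omega)]
    rw [Finset.sum_congr rfl hs]
    simp only [add_mul, Finset.sum_add_distrib, mul_add, Finset.mul_sum, mul_assoc]
    by_cases hi : i = π (b + h)
    · have : ∃ c < b + h + 1, b ≤ c ∧ π c = i := ⟨b + h, by omega, by omega, hi.symm⟩
      rw [if_pos this]
      simp only [hi, if_true, zero_mul, Finset.sum_const_zero]
      ring
    · have : (∃ c < b + h + 1, b ≤ c ∧ π c = i) ↔ ∃ c < b + h, b ≤ c ∧ π c = i := by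
        constructor
        · rintro ⟨c, h1, h2, h3⟩
          have : c ≠ b + h := by rintro rfl; exact hi h3.symm
          exact ⟨c, by omega, h2, h3⟩
        · rintro ⟨c, h1, h2, h3⟩; exact ⟨c, by omega, h2, h3⟩
      simp only [this, hi, if_false]
      ring

/-- The linear relation between `x` and `y` expressed by row `i` after `e` eliminations. -/
def gjDefect (A : ℕ → ℕ → F) (π : ℕ → ℕ) (m : ℕ) (x y : ℕ → F) (e i : ℕ) : F :=
  (∑ j ∈ Finset.range e, if π j = i then x j else 0) +
    ∑ j ∈ Finset.Ico e m, gjMat A π e i j * x j -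
  ((if ∃ j < e, π j = i then 0 else y i) + ∑ j ∈ Finset.range e, gjMat A π e i j * y (π j))

variable {A : ℕ → ℕ → F} {π : ℕ → ℕ} {m : ℕ} {x y : ℕ → F} {e : ℕ}

/-- Eliminating a column exchanges the unknown `x e` with the right-hand side `y (π e)`. The
relations between `x` and `y` undergo the same row operation as the matrix, invertible because the
pivot is not zero. -/
theorem gjDefect_succ (hem : e < m) (hπ : ∀ c < e, π c ≠ π e) (ha : gjMat A π e (π e) e ≠ 0)
    (i : ℕ) : gjDefect A π m x y (e + 1) i =
      (if i = π e then 0 else gjDefect A π m x y e i) +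
        gjMat A π (e + 1) i e * gjDefect A π m x y e (π e) := by
  unfold gjDefect
  rw [Finset.sum_range_succ, Finset.sum_range_succ (n := e) fun j => gjMat A π (e + 1) i j * _,
    Finset.sum_eq_sum_Ico_succ_bot hem, Finset.sum_eq_sum_Ico_succ_bot hem]
  rw [Finset.sum_congr rfl fun j (hj : j ∈ Finset.Ico (e + 1) m) => by
    rw [gjMat, gjStep_ne _ _ _ _ (show j ≠ e by rw [Finset.mem_Ico] at hj; omega)]]
  rw [Finset.sum_congr (s₁ := Finset.range e) (f := fun j => gjMat A π (e + 1) i j * _) rfl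
    fun j hj => by
      rw [gjMat, gjStep_ne _ _ _ _ (show j ≠ e by rw [Finset.mem_range] at hj; omega)]]
  have h0 : (∑ j ∈ Finset.range e, if π j = π e then x j else 0) = 0 :=
    Finset.sum_eq_zero fun j hj => if_neg (hπ j (Finset.mem_range.1 hj))
  have hn : ¬ ∃ j < e, π j = π e := fun ⟨j, h1, h2⟩ => hπ j h1 h2
  rw [h0, if_neg hn]
  simp only [add_mul, Finset.sum_add_distrib, mul_assoc, ← Finset.mul_sum]
  have hs : gjMat A π (e + 1) i e = if i = π e then (gjMat A π e (π e) e)⁻¹ else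
      -gjMat A π e i e * (gjMat A π e (π e) e)⁻¹ := gjStep_self _ _ _ _
  by_cases hi : i = π e
  · subst hi
    have : ∃ j < e + 1, π j = π e := ⟨e, by omega, rfl⟩
    rw [if_pos this]
    simp only [if_true] at hs ⊢
    have h1 : gjStep (π e) e (gjMat A π e) (π e) e = (gjMat A π e (π e) e)⁻¹ := hs
    rw [h0, h1, hs]
    simp only [zero_mul, Finset.sum_const_zero]
    field_simp
    ring
  · have : (∃ j < e + 1, π j = i) ↔ ∃ j < e, π j = i := by
      constructor
      · rintro ⟨j, h1, h2⟩
        have : j ≠ e := by rintro rfl; exact hi h2.symm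
        exact ⟨j, by omega, h2⟩
      · rintro ⟨j, h1, h2⟩; exact ⟨j, by omega, h2⟩
    have h1 : gjStep (π e) e (gjMat A π e) i e =
      -gjMat A π e i e * (gjMat A π e (π e) e)⁻¹ := by rw [gjStep_self, if_neg hi]
    simp only [this, hi, if_false, Ne.symm hi] at hs ⊢
    rw [h1, hs]
    field_simp
    ring

/-- Nonzero pivots make every exchange reversible: the pivot row of the new relations is a nonzero
multiple of the old one, and from it all other old relations are recovered. -/
theorem gjDefect_iff (hem : e ≤ m) (hπm : ∀ c < m, π c < m)
    (hπ : ∀ c < m, ∀ c' < m, π c = π c' → c = c')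
    (ha : ∀ c < e, gjMat A π c (π c) c ≠ 0) :
    (∀ i < m, gjDefect A π m x y e i = 0) ↔ ∀ i < m, ∑ j ∈ Finset.range m, A i j * x j = y i := by
  induction e with
  | zero => simp [gjDefect, gjMat, sub_eq_zero]
  | succ e ih =>
    rw [← ih (by omega) fun c hc => ha c (by omega)]
    have hs := gjDefect_succ (x := x) (y := y) (A := A) (π := π) (show e < m by omega)
      (fun c hc h => by have := hπ c (by omega) e (by omega) h; omega) (ha e (by omega))
    constructor
    · intro h
      have hr : gjDefect A π m x y e (π e) = 0 := by
        have := h (π e) (hπm e (by omega))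
        rw [hs, if_pos rfl, zero_add, gjMat, gjStep_self, if_pos rfl] at this
        exact (mul_eq_zero.1 this).resolve_left (inv_ne_zero (ha e (by omega)))
      intro i hi
      by_cases hie : i = π e
      · rw [hie, hr]
      · have := h i hi
        rwa [hs, if_neg hie, hr, mul_zero, add_zero] at this
    · intro h i hi
      rw [hs, h _ (hπm e (by omega)), h i hi]
      simp

/-- After `m` exchanges all `x` are expressed by `y`, which is the inverse matrix. Without row
exchanges, its entry in row `c` and column `π j` is stored in row `π c` and column `j`. -/
theorem gjMat_inverse (hπm : ∀ c < m, π c < m)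
    (hπ : ∀ c < m, ∀ c' < m, π c = π c' → c = c')
    (ha : ∀ c < m, gjMat A π c (π c) c ≠ 0) (x y : ℕ → F) :
    (∀ i < m, ∑ j ∈ Finset.range m, A i j * x j = y i) ↔
      ∀ c < m, x c = ∑ j ∈ Finset.range m, gjMat A π m (π c) j * y (π j) := by
  rw [← gjDefect_iff le_rfl hπm hπ ha]
  have hsurj : ∀ i < m, ∃ c < m, π c = i := by
    intro i hi
    have := Finset.surj_on_of_inj_on_of_card_le (s := Finset.range m) (t := Finset.range m)
      (fun c _ => π c) (fun c hc => by simpa using hπm c (by simpa using hc))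
      (fun c c' hc hc' h => hπ c (by simpa using hc) c' (by simpa using hc') h) le_rfl i
      (by simpa using hi)
    obtain ⟨c, hc, h⟩ := this
    exact ⟨c, by simpa using hc, h.symm⟩
  have key : ∀ c < m, gjDefect A π m x y m (π c) =
      x c - ∑ j ∈ Finset.range m, gjMat A π m (π c) j * y (π j) := by
    intro c hc
    have : ∃ j < m, π j = π c := ⟨c, hc, rfl⟩
    rw [gjDefect, if_pos this, Finset.sum_eq_single c]
    · simp
    · intro j hj hjc
      exact if_neg fun h => hjc (hπ j (by simpa using hj) c hc h)
    · simp [hc]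
  constructor
  · intro h c hc
    exact sub_eq_zero.1 ((key c hc).symm.trans (h _ (hπm c hc)))
  · intro h i hi
    obtain ⟨c, hc, rfl⟩ := hsurj i hi
    rw [key c hc, h c hc, sub_self]

/-- At the first zero pivot the current column vanishes in all unused rows. Set its unknown to 1,
the later ones to 0, and read the earlier ones off the pivot rows; all relations then hold with `y =
0`. Zero pivots further on are irrelevant. -/
theorem exists_ker_of_pivot_eq_zero (hπm : ∀ c < m, π c < m)
    (hπ : ∀ c < m, ∀ c' < m, π c = π c' → c = c')
    (hpiv : ∀ c < m, gjMat A π c (π c) c = 0 → ∀ i < m, (∀ c' < c, π c' ≠ i) →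
      gjMat A π c i c = 0) {c : ℕ} (hc : c < m) (h0 : gjMat A π c (π c) c = 0) :
    ∃ x : ℕ → F, (∃ j < m, x j ≠ 0) ∧ ∀ i < m, ∑ j ∈ Finset.range m, A i j * x j = 0 := by
  classical
  have hex : ∃ c, c < m ∧ gjMat A π c (π c) c = 0 := ⟨c, hc, h0⟩
  obtain ⟨hem, he⟩ := Nat.find_spec hex
  have hmin := fun c hc => Nat.find_min hex (m := c) hc
  set e := Nat.find hex
  let x : ℕ → F := fun j => if j < e then -gjMat A π e (π j) e else if j = e then 1 else 0
  refine ⟨x, ⟨e, hem, by simp [x]⟩, ?_⟩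
  rw [← gjDefect_iff (A := A) (π := π) (x := x) (y := fun _ => 0) hem.le hπm hπ fun c hc h =>
    hmin c hc ⟨by omega, h⟩]
  intro i hi
  have h1 : ∑ j ∈ Finset.Ico e m, gjMat A π e i j * x j = gjMat A π e i e := by
    rw [Finset.sum_eq_single e]
    · simp [x]
    · intro j hj hje
      have : ¬ j < e := by rw [Finset.mem_Ico] at hj; omega
      simp [x, this, hje]
    · simp [hem]
  simp only [gjDefect, h1, mul_zero, Finset.sum_const_zero, ite_self, add_zero, sub_zero]
  by_cases hi' : ∃ c < e, π c = i
  · obtain ⟨c, hce, rfl⟩ := hi'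
    rw [Finset.sum_eq_single c]
    · simp [x, hce]
    · intro j hj hjc
      refine if_neg fun h => hjc (hπ j ?_ c (by omega) h)
      rw [Finset.mem_range] at hj; omega
    · simp [hce]
  · rw [Finset.sum_eq_zero fun j hj => if_neg fun h => hi' ⟨j, by simpa using hj, h⟩, zero_add]
    exact hpiv e hem he i hi fun c hc h => hi' ⟨c, hc, h⟩

end GaussJordan

/-! ### The blocked schedule

After `e` eliminations, column `j` has been brought up to date until the time `gjTime e j`: the
number `e` without the digits below the highest binary digit in which it differs from `j`. -/

theorem exists_div_pow_eq (e j : ℕ) : ∃ i, j / 2 ^ i = e / 2 ^ i :=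
  ⟨e + j, by
    rw [Nat.div_eq_of_lt, Nat.div_eq_of_lt]
    · exact (Nat.le_add_right e j).trans_lt Nat.lt_two_pow_self
    · exact (Nat.le_add_left j e).trans_lt Nat.lt_two_pow_self⟩

/-- The number of low binary digits that have to be dropped to make `e` and `j` equal. -/
def diffLevel (e j : ℕ) : ℕ := Nat.find (exists_div_pow_eq e j)

/-- Truncated subtraction treats level 0, that is `j = e`, like level 1. Column `e` is therefore
completely up to date when it is about to be eliminated. -/
def gjTime (e j : ℕ) : ℕ := e / 2 ^ (diffLevel e j - 1) * 2 ^ (diffLevel e j - 1)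

theorem diffLevel_le_iff {e j i : ℕ} : diffLevel e j ≤ i ↔ j / 2 ^ i = e / 2 ^ i := by
  constructor
  · intro h
    have := Nat.find_spec (exists_div_pow_eq e j)
    obtain ⟨k, rfl⟩ := Nat.exists_eq_add_of_le h
    rw [pow_add, ← Nat.div_div_eq_div_mul, ← Nat.div_div_eq_div_mul, diffLevel, this]
  · exact fun h => Nat.find_min' _ h

theorem diffLevel_eq_zero_iff {e j : ℕ} : diffLevel e j = 0 ↔ j = e := by
  rw [← Nat.le_zero, diffLevel_le_iff]; simp

theorem diffLevel_eq_succ_iff {e j k : ℕ} :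
    diffLevel e j = k + 1 ↔ j / 2 ^ (k + 1) = e / 2 ^ (k + 1) ∧ j / 2 ^ k ≠ e / 2 ^ k := by
  rw [← diffLevel_le_iff, Ne, ← diffLevel_le_iff]; omega

theorem succ_div_ne_iff {e q : ℕ} : (e + 1) / q ≠ e / q ↔ q ∣ e + 1 := by
  rw [Nat.succ_div]; split_ifs with h <;> simp [h]

theorem gjTime_zero (j : ℕ) : gjTime 0 j = 0 := by simp [gjTime]

theorem gjTime_self (e : ℕ) : gjTime e e = e := by
  simp [gjTime, diffLevel_eq_zero_iff.2 rfl]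

/-- A carry argument: if the relevant power of two does not divide `e + 1`, passing to `e + 1`
changes only digits that are dropped anyway. Otherwise a block containing `e` has just ended, and
the column is brought completely up to date. -/
theorem gjTime_succ (e j : ℕ) : gjTime (e + 1) j =
    if 2 ^ (diffLevel e j - 1) ∣ e + 1 then e + 1 else gjTime e j := by
  have low : ∀ i, 2 ^ i ∣ e + 1 → ∀ i' ≤ i, (2 : ℕ) ^ i' ∣ e + 1 := fun i h i' hi =>
    (pow_dvd_pow 2 hi).trans h
  split_ifs with h
  · rw [gjTime, Nat.div_mul_cancel]
    by_cases hl : diffLevel (e + 1) j - 1 ≤ diffLevel e j - 1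
    · exact low _ h _ hl
    · obtain ⟨k, hk⟩ : ∃ k, diffLevel (e + 1) j = k + 1 := ⟨diffLevel (e + 1) j - 1, by omega⟩
      have h1 : j / 2 ^ k = e / 2 ^ k := diffLevel_le_iff.1 (by omega)
      have h2 := (diffLevel_eq_succ_iff.1 hk).2
      rw [h1] at h2
      rw [hk]
      exact succ_div_ne_iff.1 h2.symm
  · have hpos : diffLevel e j ≠ 0 := fun h0 => h (by simp [h0])
    obtain ⟨k, hk⟩ := Nat.exists_eq_succ_of_ne_zero hpos
    have hk' : diffLevel e j = k + 1 := hk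
    rw [hk', Nat.add_sub_cancel] at h
    have e1 : (e + 1) / 2 ^ k = e / 2 ^ k := by
      by_contra hne; exact h (succ_div_ne_iff.1 hne)
    have e2 : (e + 1) / 2 ^ (k + 1) = e / 2 ^ (k + 1) := by
      by_contra hne; exact h (low _ (succ_div_ne_iff.1 hne) _ (by omega))
    have hl : diffLevel (e + 1) j = k + 1 := by
      rw [diffLevel_eq_succ_iff, e1, e2, ← diffLevel_eq_succ_iff, hk']
    rw [gjTime, gjTime, hl, hk', Nat.add_sub_cancel, e1]

/-- `2 ^ K` differs from every column index in digit `K`, so in the end no column has a backlog. -/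
theorem gjTime_pow {K j : ℕ} (hj : j < 2 ^ K) : gjTime (2 ^ K) j = 2 ^ K := by
  have : diffLevel (2 ^ K) j = K + 1 := by
    rw [diffLevel_eq_succ_iff, Nat.div_eq_of_lt hj, Nat.div_self (by positivity),
      Nat.div_eq_of_lt (hj.trans (Nat.pow_lt_pow_right (by norm_num) (by omega))),
      Nat.div_eq_of_lt (Nat.pow_lt_pow_right (by norm_num) (by omega))]
    simp
  simp [gjTime, this]

/-- The time of column `j` after the elimination of column `e` and the block operations with blocks
smaller than `2 ^ k`. -/
def gjTime' (e k j : ℕ) : ℕ :=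
  if diffLevel e j ≤ k ∧ 2 ^ (diffLevel e j - 1) ∣ e + 1 then e + 1 else gjTime e j

theorem gjTime'_zero (e j : ℕ) : gjTime' e 0 j = if j = e then e + 1 else gjTime e j := by
  unfold gjTime'
  congr 1
  rw [Nat.le_zero, diffLevel_eq_zero_iff, eq_iff_iff]
  refine ⟨fun h => h.1, fun h => ⟨h, ?_⟩⟩
  simp [diffLevel_eq_zero_iff.2 h]

theorem gjTime'_last {e K j : ℕ} (he : e < 2 ^ K) (hj : j < 2 ^ K) :
    gjTime' e K j = gjTime (e + 1) j := by
  have : diffLevel e j ≤ K := by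
    rw [diffLevel_le_iff, Nat.div_eq_of_lt he, Nat.div_eq_of_lt hj]
  rw [gjTime_succ, gjTime', if_congr (and_iff_right this) rfl rfl]

theorem gjTime'_succ_of_not_dvd {e k : ℕ} (h : ¬ 2 ^ k ∣ e + 1) (j : ℕ) :
    gjTime' e (k + 1) j = gjTime' e k j := by
  unfold gjTime'
  congr 1
  rw [eq_iff_iff]
  constructor
  · rintro ⟨h1, h2⟩
    refine ⟨?_, h2⟩
    by_contra hk
    have : diffLevel e j = k + 1 := by omega
    rw [this] at h2
    exact h h2
  · rintro ⟨h1, h2⟩; exact ⟨by omega, h2⟩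

/-- The sibling of the block of length `h` that starts at `b`. -/
def sibling (b h : ℕ) : ℕ := if b / h % 2 = 1 then b - h else b + h

/-! ### Aligned binary blocks and their siblings. -/

section Sibling

variable {e k : ℕ}

theorem block_mem_iff (hk : 2 ^ k ∣ e + 1) (j : ℕ) :
    (e + 1 - 2 ^ k ≤ j ∧ j < e + 1) ↔ diffLevel e j ≤ k := by
  rw [diffLevel_le_iff]
  obtain ⟨q, hq⟩ := hk
  have hh : 0 < 2 ^ k := by positivity
  generalize 2 ^ k = h at *
  obtain ⟨q, rfl⟩ : ∃ q', q = q' + 1 := ⟨q - 1, by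
    have : q ≠ 0 := by rintro rfl; simp at hq
    omega⟩
  rw [mul_add, mul_one] at hq
  have he : e / h = q := by
    rw [Nat.div_eq_iff hh]; constructor <;> rw [mul_comm] <;> omega
  rw [he, Nat.div_eq_iff hh, mul_comm]
  omega

/-- A block and its sibling are the halves of an aligned block of twice the length; the parity of
the block number tells which half is which. -/
theorem sibling_mem_iff (hk : 2 ^ k ∣ e + 1) (j : ℕ) :
    (sibling (e + 1 - 2 ^ k) (2 ^ k) ≤ j ∧ j < sibling (e + 1 - 2 ^ k) (2 ^ k) + 2 ^ k) ↔
      diffLevel e j = k + 1 := by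
  rw [diffLevel_eq_succ_iff]
  obtain ⟨q, hq⟩ := hk
  rw [pow_succ, ← Nat.div_div_eq_div_mul, ← Nat.div_div_eq_div_mul]
  have hh : 0 < 2 ^ k := by positivity
  generalize 2 ^ k = h at *
  obtain ⟨q, rfl⟩ : ∃ q', q = q' + 1 := ⟨q - 1, by
    have : q ≠ 0 := by rintro rfl; simp at hq
    omega⟩
  rw [mul_add, mul_one] at hq
  have he : e / h = q := by
    rw [Nat.div_eq_iff hh]; constructor <;> rw [mul_comm] <;> omega
  have hb : e + 1 - h = h * q := by omega
  rw [he, hb, sibling, Nat.mul_div_cancel_left _ hh]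
  have key : ∀ q', (h * q' ≤ j ∧ j < h * q' + h) ↔ j / h = q' := fun q' => by
    rw [Nat.div_eq_iff hh, mul_comm]; omega
  split_ifs with hp
  · obtain ⟨q', rfl⟩ : ∃ q', q = q' + 1 := ⟨q - 1, by omega⟩
    rw [mul_add, mul_one, Nat.add_sub_cancel, key]
    omega
  · rw [show h * q + h = h * (q + 1) by ring, key]
    omega

theorem sibling_add_le {K : ℕ} (hk : 2 ^ k ∣ e + 1) (hkK : k < K) (he : e < 2 ^ K) :
    sibling (e + 1 - 2 ^ k) (2 ^ k) + 2 ^ k ≤ 2 ^ K := by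
  have hh : 0 < 2 ^ k := by positivity
  have := (sibling_mem_iff hk (sibling (e + 1 - 2 ^ k) (2 ^ k) + 2 ^ k - 1)).1 (by omega)
  have := diffLevel_le_iff.1 (show diffLevel e _ ≤ K by rw [this]; omega)
  rw [Nat.div_eq_of_lt he, Nat.div_eq_zero_iff] at this
  rcases this with h | h
  · exact absurd h (by positivity)
  · omega

theorem gjTime'_of_block (hk : 2 ^ k ∣ e + 1) {j : ℕ} (hj : diffLevel e j ≤ k) :
    gjTime' e k j = e + 1 :=
  if_pos ⟨hj, (pow_dvd_pow 2 (by omega)).trans hk⟩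

/-- The sibling was last brought up to date exactly when the block began. The steps inside the block
are therefore its whole backlog, to be removed by one block operation. -/
theorem gjTime'_of_sibling (hk : 2 ^ k ∣ e + 1) {j : ℕ} (hj : diffLevel e j = k + 1) :
    gjTime' e k j = e + 1 - 2 ^ k ∧ gjTime' e (k + 1) j = e + 1 := by
  constructor
  · rw [gjTime', if_neg (by omega), gjTime, hj, Nat.add_sub_cancel]
    obtain ⟨q, hq⟩ := hk
    have hh : 0 < 2 ^ k := by positivity
    generalize 2 ^ k = h at *
    obtain ⟨q, rfl⟩ : ∃ q', q = q' + 1 := ⟨q - 1, by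
      have : q ≠ 0 := by rintro rfl; simp at hq
      omega⟩
    rw [mul_add, mul_one] at hq
    have he : e / h = q := by
      rw [Nat.div_eq_iff hh]; constructor <;> rw [mul_comm] <;> omega
    rw [he, mul_comm]; omega
  · exact if_pos ⟨hj.le, by simpa [hj] using hk⟩

theorem gjTime'_of_ne {j : ℕ} (hj : diffLevel e j ≠ k + 1) :
    gjTime' e (k + 1) j = gjTime' e k j := by
  unfold gjTime'
  congr 1
  rw [eq_iff_iff]
  constructor
  · rintro ⟨h1, h2⟩; exact ⟨by omega, h2⟩
  · rintro ⟨h1, h2⟩; exact ⟨by omega, h2⟩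

end Sibling

/-! ## The elimination program

Register `20` holds the size `m = 2 ^ K`, register `21` holds `K`, and array `3` the matrix. Array
`5` receives the pivot rows, array `9` the inverse permutation, increased by one. Register `26` is
`1` in the end if the matrix is invertible, and `0` otherwise. -/

instance : Add Ex := ⟨Ex.bin .add⟩
instance : Sub Ex := ⟨Ex.bin .sub⟩
instance : Mul Ex := ⟨Ex.bin .mul⟩
instance : Div Ex := ⟨Ex.bin .div⟩
instance : Mod Ex := ⟨Ex.bin .mod⟩

namespace Ex

def ltE (a b : Ex) : Ex := .bin .lt a b
def eqE (a b : Ex) : Ex := .bin .eq a b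

section

variable (s : St) (a b : Ex) (k r i : ℕ)

@[simp] theorem ev_var : (var r).ev s = s.v r := rfl
@[simp] theorem ev_lit : (lit k).ev s = k := rfl
@[simp] theorem ev_get : (get i a).ev s = s.arr i (a.ev s) := rfl
@[simp] theorem ev_add : (a + b).ev s = a.ev s + b.ev s := rfl
@[simp] theorem ev_sub : (a - b).ev s = a.ev s - b.ev s := rfl
@[simp] theorem ev_mul : (a * b).ev s = a.ev s * b.ev s := rfl
@[simp] theorem ev_div : (a / b).ev s = a.ev s / b.ev s := rfl
@[simp] theorem ev_mod : (a % b).ev s = a.ev s % b.ev s := rfl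
@[simp] theorem ev_ltE : (a.ltE b).ev s = if a.ev s < b.ev s then 1 else 0 := rfl
@[simp] theorem ev_eqE : (a.eqE b).ev s = if a.ev s = b.ev s then 1 else 0 := rfl

variable (w : ℕ)

@[simp] theorem ok_var : (var r).ok false w s ↔ r < 64 := Iff.rfl
@[simp] theorem ok_lit : (lit k).ok false w s ↔ k < 2 ^ w := Iff.rfl
@[simp] theorem ok_get : (get i a).ok false w s ↔ i < 32 ∧ a.ok false w s := by simp [ok]
@[simp] theorem ok_add : (a + b).ok false w s ↔
    a.ok false w s ∧ b.ok false w s ∧ a.ev s + b.ev s < 2 ^ w := Iff.rfl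
@[simp] theorem ok_sub : (a - b).ok false w s ↔ a.ok false w s ∧ b.ok false w s := by
  change _ ∧ _ ∧ True ↔ _; simp
@[simp] theorem ok_mul : (a * b).ok false w s ↔
    a.ok false w s ∧ b.ok false w s ∧ a.ev s * b.ev s < 2 ^ w := Iff.rfl
@[simp] theorem ok_div : (a / b).ok false w s ↔ a.ok false w s ∧ b.ok false w s := by
  change _ ∧ _ ∧ True ↔ _; simp
@[simp] theorem ok_mod : (a % b).ok false w s ↔ a.ok false w s ∧ b.ok false w s := by
  change _ ∧ _ ∧ True ↔ _; simp
@[simp] theorem ok_ltE : (a.ltE b).ok false w s ↔ a.ok false w s ∧ b.ok false w s ∧ 0 < w := Iff.rfl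
@[simp] theorem ok_eqE : (a.eqE b).ok false w s ↔ a.ok false w s ∧ b.ok false w s ∧ 0 < w := Iff.rfl

end

/-- The time for the evaluation of an expression. -/
def csz : Ex → ℕ
  | var _ => 2
  | lit _ => 1
  | bin _ a b => a.csz + b.csz + 1
  | get _ i => i.csz + 1

section

variable (a b : Ex) (k r i : ℕ)

@[simp] theorem csz_var : (var r).csz = 2 := rfl
@[simp] theorem csz_lit : (lit k).csz = 1 := rfl
@[simp] theorem csz_get : (get i a).csz = a.csz + 1 := rfl
@[simp] theorem csz_add : (a + b).csz = a.csz + b.csz + 1 := rfl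
@[simp] theorem csz_sub : (a - b).csz = a.csz + b.csz + 1 := rfl
@[simp] theorem csz_mul : (a * b).csz = a.csz + b.csz + 1 := rfl
@[simp] theorem csz_div : (a / b).csz = a.csz + b.csz + 1 := rfl
@[simp] theorem csz_mod : (a % b).csz = a.csz + b.csz + 1 := rfl
@[simp] theorem csz_ltE : (a.ltE b).csz = a.csz + b.csz + 1 := rfl
@[simp] theorem csz_eqE : (a.eqE b).csz = a.csz + b.csz + 1 := rfl

@[simp] theorem sz_code : ∀ (a : Ex) (d : ℕ), (a.code d).sz = a.csz
  | var _, _ => rfl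
  | lit _, _ => rfl
  | bin _ a b, d => by simp [code, Prog.sz, csz, sz_code a, sz_code b]
  | get _ a, d => by simp [code, Prog.sz, csz, sz_code a]

end

end Ex

@[simp] theorem sz_asg (x : ℕ) (e : Ex) : (asg x e).sz = e.csz + 2 := by simp [asg, Prog.sz]
@[simp] theorem sz_sto (a : ℕ) (i e : Ex) : (sto a i e).sz = i.csz + e.csz + 1 := by
  simp [sto, Prog.sz, add_assoc]

theorem index_inj {m i j i' j' : ℕ} (hj : j < m) (hj' : j' < m) (h : i * m + j = i' * m + j') :
    i = i' ∧ j = j' := by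
  have h1 : (i * m + j) / m = i := by
    rw [mul_comm, Nat.mul_add_div (by omega), Nat.div_eq_of_lt hj, add_zero]
  have h2 : (i' * m + j') / m = i' := by
    rw [mul_comm, Nat.mul_add_div (by omega), Nat.div_eq_of_lt hj', add_zero]
  have : i = i' := by rw [← h1, h, h2]
  subst this
  exact ⟨rfl, by omega⟩

theorem index_lt {m i j k : ℕ} (hi : i < k) (hj : j < m) : i * m + j < k * m := by
  nlinarith

/-- What the matrix multiplication subroutine needs. -/
structure MulSpec (P : Prog ArithInstr) (N w p : ℕ) (τ : ℕ → ℕ) (m : ℕ) : Prop where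
  mul : ∀ h, 1 ≤ h → h ≤ m → ∀ (_ : Fact p.Prime) (A B : Matrix (Fin h) (Fin h) (ZMod p))
    (coins : ℕ → Fin (2 ^ w)), ∃ (t : ℕ) (s : ArithState (ZMod p)),
      Exec (fun s => s.word.reg) (ArithInstr.act w) P (mulInput A B fun k => coins k) t s ∧
      (∀ i j : Fin h, s.fmem 2 (i * h + j) = (A * B) i j) ∧ t ≤ τ h
  below : ArithBelow N P
  pos : 0 < N
  le : N ≤ 2 ^ w
  size : m * m + 3 * m + p * p + 3 * p + 3 < 2 ^ w

/-- The index of the current row, block `r` and row `i`. -/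
abbrev rowEx : Ex := .var 33 * .var 4 + .var 31

/-- Brings the columns from `d` (register `30`) on up to date with respect to the eliminated columns
from `b` (register `29`) on. Register `4` holds the number `h` of columns. -/
def applyP (P : Prog ArithInstr) (N : ℕ) : WordProg :=
  fill2 31 32 4 4 7 (.var 31 * .var 4 + .var 32)
    (.get 3 (.get 5 (.var 29 + .var 31) * .var 20 + (.var 30 + .var 32))) ;;
  asg 34 (.var 20 / .var 4) ;;
  forP 33 34 (
    fill2 31 32 4 4 6 (.var 31 * .var 4 + .var 32)
      (.get 3 (rowEx * .var 20 + (.var 29 + .var 32))) ;;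
    mulP P N ;;
    fill2 31 32 4 4 3 (rowEx * .var 20 + (.var 30 + .var 32))
      (((.lit 1 - (Ex.var 29).ltE (.get 9 rowEx) * (Ex.get 9 rowEx).ltE (.var 29 + .var 4 + .lit 1)) *
        .get 3 (rowEx * .var 20 + (.var 30 + .var 32)) + .get 8 (.var 31 * .var 4 + .var 32)) %
        .var 3))

-- The rows are cut into `nb` groups of `h`, so that all products have the square format `h × h`.
-- The pivot rows are saved in array `7` beforehand, because the loop overwrites these columns row
-- group by row group. Array `9` stores the pivot time increased by one, so the two comparisons with
-- `b` and `b + h` recognize the pivot rows of the block, whose old entries have to be dropped.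
set_option maxHeartbeats 2000000 in
theorem HT.applyP {P : Prog ArithInstr} {N w p m h nb b d : ℕ} {τ : ℕ → ℕ} [hpp : Fact p.Prime]
    (hS : MulSpec P N w p τ m)
    {s : St} (hp : s.v 3 = p) (hinv : ∀ x : ZMod p, s.arr 4 x.val = (x⁻¹).val)
    (hh : s.v 4 = h) (hm : s.v 20 = m) (hb : s.v 29 = b) (hd : s.v 30 = d)
    (h1 : 1 ≤ h) (hnb : nb * h = m) (hbm : b + h ≤ m) (hdm : d + h ≤ m)
    (hπ : ∀ c < b + h, s.arr 5 c < m)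
    (h9 : ∀ i < m, s.arr 9 i ≤ m)
    {X : ℕ → ℕ → ZMod p} (hX : ∀ i < m, ∀ j < m, s.arr 3 (i * m + j) = (X i j).val)
    {Q : St → Prop}
    (hQ : ∀ s', Agree [31, 32, 33, 34, 60, 62, 63] [3, 6, 7, 8] s s' →
      (∀ i < m, ∀ j < m, s'.arr 3 (i * m + j) =
        (if d ≤ j ∧ j < d + h then (if b < s.arr 9 i ∧ s.arr 9 i ≤ b + h then 0 else X i j) +
          ∑ c ∈ Finset.Ico b (b + h), X i c * X (s.arr 5 c) j else X i j).val) → Q s') :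
    HT false w (applyP P N) s (nb * (4 * τ h + (1000 + 2 * N) * (h * h))) Q := by
  have hsz := hS.size
  have hp1 := hpp.out.one_lt
  have hw : 0 < w := by
    rcases Nat.eq_zero_or_pos w with rfl | h
    · simp at hsz
    · exact h
  have hnb0 : 0 < nb := by rcases Nat.eq_zero_or_pos nb with rfl | h <;> omega
  have hhm : h ≤ m := by omega
  have hhh : h * h ≤ m * m := Nat.mul_le_mul hhm hhm
  have hmm : ∀ i < m, ∀ j < m, i * m + j < m * m := fun i hi j hj => index_lt hi hj
  have hrow : ∀ r < nb, ∀ i < h, r * h + i < m := fun r hr i hi => hnb ▸ index_lt hr hi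
  have hcol : ∀ (r : ℕ) (i j i' j' : ℕ), i < h → j < h → i' < h → j' < h →
      (r * h + i) * m + (d + j) = (r * h + i') * m + (d + j') → i = i' ∧ j = j' := by
    intro r i j i' j' hi hj hi' hj' he
    have := index_inj (by omega) (by omega) he
    omega
  let Y : ℕ → ℕ → ZMod p := fun i j =>
    if d ≤ j ∧ j < d + h then (if b < s.arr 9 i ∧ s.arr 9 i ≤ b + h then 0 else X i j) +
          ∑ c ∈ Finset.Ico b (b + h), X i c * X (s.arr 5 c) j else X i j
  apply HT.time_le
  case h =>
    apply HT.seq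
    refine HT.fill2 (fun i j => i * h + j) (fun i j => (X (s.arr 5 (b + i)) (d + j)).val) hw
      (by norm_num) (by norm_num) (by norm_num) (by norm_num) (by norm_num) (by norm_num)
      (by norm_num) (by norm_num) (by norm_num) hh hh (.inr (by norm_num))
      (fun i hi j hj i' hi' j' hj' he => index_inj hj hj' he) ?_ ?_
    · intro i hi j hj s' hA e1 e2 _
      have hπi := hπ (b + i) (by omega)
      have b1 := hmm _ hπi (d + j) (by omega)
      have b2 : i * h + j < h * h := index_lt hi hj
      have b3 : s.arr 5 (b + i) * m ≤ m * m := Nat.mul_le_mul hπi.le le_rfl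
      have b4 : i * h ≤ h * h := Nat.mul_le_mul hi.le le_rfl
      simp only [Ex.ok_add, Ex.ok_mul, Ex.ok_var, Ex.ok_get, Ex.ev_add, Ex.ev_mul, Ex.ev_var,
        Ex.ev_get, e1, e2, hA.v 4 (by simp), hA.v 20 (by simp), hA.v 29 (by simp),
        hA.v 30 (by simp), hA.arr 5 (by simp), hA.arr 3 (by simp), hh, hm, hb, hd]
      exact ⟨by omega, by omega, trivial, hX _ hπi _ (by omega)⟩
    intro s1 A1 v1 _ _
    apply HT.seq
    refine HT.asg (by simp) (by norm_num) ?_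
    have n34 : s1.v 20 / s1.v 4 = nb := by
      rw [A1.v 20 (by simp), A1.v 4 (by simp), hm, hh, ← hnb, Nat.mul_div_cancel _ h1]
    simp only [Ex.ev_div, Ex.ev_var, n34]
    refine HT.forP (N := nb) (T := fun _ =>
        h * (h * (26 + 12) + 21) + 9 + ((4 * τ h + 125 * (h * h) + 2 * N + 100) +
          (h * (h * (120 + 12) + 21) + 9)))
      (fun r s' => Agree [31, 32, 33, 34, 60, 62, 63] [3, 6, 7, 8] s s' ∧
        (∀ i < h, ∀ j < h, s'.arr 7 (i * h + j) = (X (s.arr 5 (b + i)) (d + j)).val) ∧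
        ∀ i < m, ∀ j < m, s'.arr 3 (i * m + j) = (if i < r * h then Y i j else X i j).val)
      (by norm_num) (by norm_num) (by norm_num) (by simp) hw ⟨?_, ?_, ?_⟩ ?_ ?_
    · exact ((A1.mono (by simp) (by simp)).set (by simp) _).set (by simp) _
    · exact v1
    · intro i hi j hj
      simp [A1.arr 3, hX i hi j hj]
    · rintro r hr s2 ⟨A2, v2, w2⟩ e33 e34
      apply HT.time_le
      case h =>
        apply HT.seq
        refine HT.fill2 (fun i j => i * h + j) (fun i j => (X (r * h + i) (b + j)).val) hw
          (by norm_num) (by norm_num) (by norm_num) (by norm_num) (by norm_num) (by norm_num)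
          (by norm_num) (by norm_num) (by norm_num) ((A2.v 4 (by simp)).trans hh)
          ((A2.v 4 (by simp)).trans hh) (.inr (by norm_num))
          (fun i hi j hj i' hi' j' hj' he => index_inj hj hj' he) ?_ ?_
        · intro i hi j hj s' hA e1 e2 _
          have hri := hrow r hr i hi
          have b1 := hmm _ hri (b + j) (by omega)
          have b2 : i * h + j < h * h := index_lt hi hj
          have b3 : (r * h + i) * m ≤ m * m := Nat.mul_le_mul hri.le le_rfl
          have b4 : i * h ≤ h * h := Nat.mul_le_mul hi.le le_rfl
          simp only [Ex.ok_add, Ex.ok_mul, Ex.ok_var, Ex.ok_get, Ex.ev_add, Ex.ev_mul, Ex.ev_var,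
            Ex.ev_get, e1, e2, hA.v 4 (by simp), hA.v 20 (by simp), hA.v 29 (by simp),
            hA.v 33 (by simp), hA.arr 3 (by simp), A2.v 4 (by simp), A2.v 20 (by simp),
            A2.v 29 (by simp), e33, hh, hm, hb]
          refine ⟨by omega, by omega, trivial, ?_⟩
          rw [w2 _ hri _ (by omega), if_neg (by omega)]
        intro s3 A3 v3 _ _
        apply HT.seq
        have hlt : ∀ k < h * h, s3.arr 6 k < p ∧ s3.arr 7 k < p := by
          intro k hk
          have h1 : k / h < h := Nat.div_lt_of_lt_mul hk
          have h2 : k % h < h := Nat.mod_lt _ (by omega)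
          rw [← Nat.div_add_mod' k h, v3 _ h1 _ h2, A3.arr 7 (by simp), v2 _ h1 _ h2]
          exact ⟨ZMod.val_lt _, ZMod.val_lt _⟩
        refine HT.mulP (p := p) (h := h) (hS.mul h h1 hhm hpp) hS.below hS.pos hS.le hw
          (by rw [A3.v 3 (by simp), A2.v 3 (by simp), hp]) (by omega)
          (fun x => by rw [A3.arr 4 (by simp), A2.arr 4 (by simp), hinv])
          (by rw [A3.v 4 (by simp), A2.v 4 (by simp), hh]) (by omega)
          (fun k hk => (hlt k hk).1) (fun k hk => (hlt k hk).2) ?_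
        intro s4 A4 v4
        have A24 : Agree [31, 32, 60, 62, 63] [6, 8] s2 s4 :=
          (A3.mono (by simp) (by simp)).trans A4 (by simp) (by simp)
        refine HT.fill2 (fun i j => (r * h + i) * m + (d + j))
          (fun i j => (Y (r * h + i) (d + j)).val) hw
          (by norm_num) (by norm_num) (by norm_num) (by norm_num) (by norm_num) (by norm_num)
          (by norm_num) (by norm_num) (by norm_num)
          (by rw [A24.v 4 (by simp), A2.v 4 (by simp), hh])
          (by rw [A24.v 4 (by simp), A2.v 4 (by simp), hh]) (.inr (by norm_num))
          (fun i hi j hj i' hi' j' hj' he => hcol r i j i' j' hi hj hi' hj' he) ?_ ?_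
        · intro i hi j hj s' hA e1 e2 e3
          have hri := hrow r hr i hi
          have b1 := hmm _ hri (d + j) (by omega)
          have b2 : i * h + j < h * h := index_lt hi hj
          have b3 : (r * h + i) * m ≤ m * m := Nat.mul_le_mul hri.le le_rfl
          have b4 : i * h ≤ h * h := Nat.mul_le_mul hi.le le_rfl
          have b5 : r * h ≤ m := by omega
          have h9i := h9 _ hri
          have hX3 : s'.arr 3 ((r * h + i) * m + (d + j)) = (X (r * h + i) (d + j)).val := by
            rw [e3, A24.arr 3 (by simp), w2 _ hri _ (by omega), if_neg (by omega)]
          have hXlt := ZMod.val_lt (X (r * h + i) (d + j))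
          have h8 : s'.arr 8 (i * h + j) = (∑ c ∈ Finset.Ico b (b + h),
              X (r * h + i) c * X (s.arr 5 c) (d + j)).val := by
            rw [hA.arr 8 (by simp), v4 i hi j hj, Finset.sum_Ico_eq_sum_range,
              Nat.add_sub_cancel_left]
            congr 1
            refine Finset.sum_congr rfl fun c hc => ?_
            have hc := Finset.mem_range.1 hc
            rw [v3 i hi c hc, A3.arr 7 (by simp), v2 c hc j hj]
            simp
          have h8lt := ZMod.val_lt (∑ c ∈ Finset.Ico b (b + h),
              X (r * h + i) c * X (s.arr 5 c) (d + j))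
          rw [← h8] at h8lt
          rw [← hX3] at hXlt
          have hY : Y (r * h + i) (d + j) =
              (if b < s.arr 9 (r * h + i) ∧ s.arr 9 (r * h + i) ≤ b + h then 0 else
                X (r * h + i) (d + j)) +
              ∑ c ∈ Finset.Ico b (b + h), X (r * h + i) c * X (s.arr 5 c) (d + j) :=
            if_pos ⟨by omega, by omega⟩
          have e33' : s'.v 33 = r := by rw [hA.v 33 (by simp), A24.v 33 (by simp), e33]
          have e4' : s'.v 4 = h := by
            rw [hA.v 4 (by simp), A24.v 4 (by simp), A2.v 4 (by simp), hh]
          have e20' : s'.v 20 = m := by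
            rw [hA.v 20 (by simp), A24.v 20 (by simp), A2.v 20 (by simp), hm]
          have e29' : s'.v 29 = b := by
            rw [hA.v 29 (by simp), A24.v 29 (by simp), A2.v 29 (by simp), hb]
          have e30' : s'.v 30 = d := by
            rw [hA.v 30 (by simp), A24.v 30 (by simp), A2.v 30 (by simp), hd]
          have e3' : s'.v 3 = p := by
            rw [hA.v 3 (by simp), A24.v 3 (by simp), A2.v 3 (by simp), hp]
          have e9' : s'.arr 9 = s.arr 9 := by
            rw [hA.arr 9 (by simp), A24.arr 9 (by simp), A2.arr 9 (by simp)]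
          simp only [rowEx, Ex.ok_add, Ex.ok_mul, Ex.ok_var, Ex.ok_get, Ex.ok_sub, Ex.ok_lit,
            Ex.ok_mod, Ex.ok_ltE, Ex.ev_add, Ex.ev_mul, Ex.ev_var, Ex.ev_get, Ex.ev_sub, Ex.ev_lit,
            Ex.ev_mod, Ex.ev_ltE, e1, e2, e33', e4', e20', e29', e30', e3', e9']
          rw [hY]
          refine ⟨by omega, ?_, trivial, ?_⟩
          · have l1 : (if b < s.arr 9 (r * h + i) then 1 else 0) ≤ 1 := by split_ifs <;> omega
            have l2 : (if s.arr 9 (r * h + i) < b + h + 1 then 1 else 0) ≤ 1 := by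
              split_ifs <;> omega
            have l3 := Nat.mul_le_mul l1 l2
            have l4 : (1 - (if b < s.arr 9 (r * h + i) then 1 else 0) *
              (if s.arr 9 (r * h + i) < b + h + 1 then 1 else 0)) *
              s'.arr 3 ((r * h + i) * m + (d + j)) ≤ 1 * s'.arr 3 ((r * h + i) * m + (d + j)) :=
              Nat.mul_le_mul (by omega) le_rfl
            omega
          · have l5 : (s.arr 9 (r * h + i) < b + h + 1) ↔ s.arr 9 (r * h + i) ≤ b + h := by omega
            refine mod_eq_val ?_
            rw [hX3, h8]
            by_cases c1 : b < s.arr 9 (r * h + i) <;> by_cases c2 : s.arr 9 (r * h + i) ≤ b + h <;>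
              simp [c1, c2, l5]
        · intro s5 A5 v5 w5 _
          have A25 : Agree [31, 32, 60, 62, 63] [3, 6, 8] s2 s5 :=
            (A24.mono (by simp) (by simp)).trans A5 (by simp) (by simp)
          refine ⟨by rw [A25.v 33 (by simp), e33], by rw [A25.v 34 (by simp), e34],
            (A2.trans A25 (by simp) (by simp)).set (by simp) _, fun i hi j hj => ?_,
            fun i hi j hj => ?_⟩
          · rw [St.set_arr, A25.arr 7 (by simp), v2 i hi j hj]
          · rw [St.set_arr]
            have hr1 : (r + 1) * h = r * h + h := by ring
            by_cases hc : (r * h ≤ i ∧ i < r * h + h) ∧ d ≤ j ∧ j < d + h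
            · obtain ⟨i', rfl⟩ := Nat.exists_eq_add_of_le hc.1.1
              obtain ⟨j', rfl⟩ := Nat.exists_eq_add_of_le hc.2.1
              rw [v5 i' (by omega) j' (by omega), if_pos (by omega)]
            · rw [w5, A24.arr 3 (by simp), w2 i hi j hj, hr1]
              · by_cases h1 : i < r * h
                · rw [if_pos h1, if_pos (by omega)]
                · rw [if_neg h1]
                  split_ifs with h2
                  · have : ¬ (d ≤ j ∧ j < d + h) := fun h => hc ⟨by omega, h⟩
                    simp [Y, this]
                  · rfl
              · intro x hx y hy he
                have := index_inj (show d + y < m by omega) hj he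
                exact hc (by omega)
      simp only [sz_sto, Ex.csz_add, Ex.csz_mul, Ex.csz_var, Ex.csz_get, Ex.csz_sub, Ex.csz_lit,
        Ex.csz_mod, Ex.csz_ltE, rowEx]
      norm_num [mul_add, ← mul_assoc]
      omega
    · rintro s2 ⟨A2, v2, w2⟩ -
      refine hQ s2 A2 fun i hi j hj => ?_
      rw [w2 i hi j hj, if_pos (by omega)]
  have hh1 : 1 ≤ h * h := Nat.mul_pos h1 h1
  have hh2 : h ≤ h * h := Nat.le_mul_of_pos_left h h1
  simp only [sz_sto, sz_asg, Ex.csz_add, Ex.csz_mul, Ex.csz_var, Ex.csz_get, Ex.csz_div,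
    Finset.sum_const, Finset.card_range, smul_eq_mul]
  have hNA : N ≤ N * (h * h) := Nat.le_mul_of_pos_right N hh1
  have h100 := Nat.le_mul_of_pos_left (100 * (h * h)) hnb0
  calc _ = (37 * (h * h) + 21 * h + 25) + nb * (h * (h * (26 + 12) + 21) + 9 +
        (4 * τ h + 125 * (h * h) + 2 * N + 100 + (h * (h * (120 + 12) + 21) + 9)) + 12) := by ring
    _ ≤ nb * (100 * (h * h)) + nb * (h * (h * (26 + 12) + 21) + 9 +
        (4 * τ h + 125 * (h * h) + 2 * N + 100 + (h * (h * (120 + 12) + 21) + 9)) + 12) := by omega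
    _ = nb * (h * (h * (26 + 12) + 21) + 9 + (4 * τ h + 125 * (h * h) + 2 * N + 100 +
        (h * (h * (120 + 12) + 21) + 9)) + 12 + 100 * (h * h)) := by ring
    _ ≤ _ := Nat.mul_le_mul le_rfl (by linarith)

theorem HT.ifP_pos {full : Bool} {w : ℕ} {P P' : WordProg} {s : St} {T : ℕ} {Q : St → Prop}
    {e : Ex} (ho : e.ok full w s) (h0 : e.ev s ≠ 0) (h : HT full w P s T Q) :
    HT full w (SensReach.ifP e P P') s (e.csz + (T + 1)) Q := by
  have := HT.ifP (P' := P') (T' := 0) ho (fun _ => h) fun h1 => absurd h1 h0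
  simpa using this

theorem HT.ifP_neg {full : Bool} {w : ℕ} {P P' : WordProg} {s : St} {T : ℕ} {Q : St → Prop}
    {e : Ex} (ho : e.ok full w s) (h0 : e.ev s = 0) (h : HT full w P' s T Q) :
    HT full w (SensReach.ifP e P P') s (e.csz + (T + 1)) Q := by
  have := HT.ifP (P := P) (T := 0) ho (fun h1 => absurd h0 h1) fun _ => h
  simpa using this

/-- The index of the current row in column `c` (register `22`). -/
abbrev colEx : Ex := .var 24 * .var 20 + .var 22

/-- Chooses an unused row, if possible one with a nonzero entry in the current column. -/
def pivotP : WordProg :=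
  asg 23 (.var 20) ;;
  forP 24 20 (ifP ((Ex.get 9 (.var 24)).eqE (.lit 0) *
    ((Ex.var 23).eqE (.var 20) + (Ex.lit 0).ltE (.get 3 colEx))) (asg 23 (.var 24)) .skip)

/-- Eliminates the current column. -/
def leafP : WordProg :=
  pivotP ;;
  asg 25 (.get 3 (.var 23 * .var 20 + .var 22)) ;;
  asg 26 (.var 26 * (Ex.lit 0).ltE (.var 25)) ;;
  asg 27 (.get 4 (.var 25)) ;;
  sto 5 (.var 22) (.var 23) ;;
  sto 9 (.var 23) (.var 22 + .lit 1) ;;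
  fill1 24 20 3 colEx ((.var 3 - .get 3 colEx) * .var 27 % .var 3) ;;
  sto 3 (.var 23 * .var 20 + .var 22) (.var 27)

/-- The value `m` in register `23` means that no row has been found. The first unused row is
accepted unconditionally and later unused rows only with a nonzero entry; a zero entry in the chosen
row thus means that all unused rows are zero in this column. -/
theorem HT.pivotP {w p m e : ℕ} {s : St} (hw : 0 < w) (hsz : m * m + 3 * m + p * p + 3 * p + 3 < 2 ^ w)
    (hm : s.v 20 = m) (he : s.v 22 = e) (hem : e < m) {X : ℕ → ZMod p}
    (hX : ∀ i < m, s.arr 3 (i * m + e) = (X i).val) (hex : ∃ i < m, s.arr 9 i = 0)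
    {Q : St → Prop}
    (hQ : ∀ s' r, Agree [23, 24] [] s s' → s'.v 23 = r → r < m → s.arr 9 r = 0 →
      (X r = 0 → ∀ i < m, s.arr 9 i = 0 → X i = 0) → Q s') :
    HT false w pivotP s (m * 50 + 50) Q := by
  apply HT.time_le
  case h =>
    apply HT.seq
    refine HT.asg (by simp) (by norm_num) ?_
    simp only [Ex.ev_var, hm]
    refine HT.forP (N := m) (T := fun _ => 30) (fun i s' => Agree [23, 24] [] s s' ∧
      ((s'.v 23 = m ∧ ∀ i' < i, s.arr 9 i' ≠ 0) ∨ (s'.v 23 < m ∧ s.arr 9 (s'.v 23) = 0 ∧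
        (X (s'.v 23) = 0 → ∀ i' < i, s.arr 9 i' = 0 → X i' = 0)))) (by norm_num) (by norm_num)
      (by norm_num) (by simp [St.set_v, hm]) hw ⟨?_, ?_⟩ ?_ ?_
    · exact ((Agree.refl s).set (by simp) _).set (by simp) _
    · left; simp [St.set_v]
    · rintro i hi s1 ⟨A1, I1⟩ e24 e20
      have b1 : i * m + e < m * m := index_lt hi hem
      have e22 : s1.v 22 = e := by rw [A1.v 22 (by simp), he]
      have hle : ∀ (P P' : Prop) [Decidable P] [Decidable P'], (if P then 1 else 0) *
          ((if P' then 1 else 0) + (if 0 < s.arr 3 (i * m + e) then 1 else 0)) < 3 := by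
        intro P P' _ _; split_ifs <;> norm_num
      have hok : ((Ex.get 9 (.var 24)).eqE (.lit 0) *
          ((Ex.var 23).eqE (.var 20) + (Ex.lit 0).ltE (.get 3 colEx))).ok false w s1 := by
        simp only [Ex.ok_mul, Ex.ok_eqE, Ex.ok_get, Ex.ok_var, Ex.ok_lit, Ex.ok_add, Ex.ok_ltE,
          Ex.ev_eqE, Ex.ev_get, Ex.ev_var, Ex.ev_lit, Ex.ev_add, Ex.ev_ltE, Ex.ev_mul, e24, e20,
          e22, A1.arr 9 (by simp), A1.arr 3 (by simp)]
        have h1 := hle (s.arr 9 i = 0) (s1.v 23 = m)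
        have h2 := hle True (s1.v 23 = m)
        simp only [if_true, one_mul] at h2
        have : i * m ≤ m * m := Nat.mul_le_mul hi.le le_rfl
        refine ⟨⟨by simp, by omega, hw⟩, ⟨⟨by norm_num, by norm_num, hw⟩, ⟨by omega, ⟨by norm_num,
          ⟨by norm_num, by norm_num, by omega⟩, by norm_num, by omega⟩, hw⟩, by omega⟩, by omega⟩
      have hev : ((Ex.get 9 (.var 24)).eqE (.lit 0) *
          ((Ex.var 23).eqE (.var 20) + (Ex.lit 0).ltE (.get 3 colEx))).ev s1 = 0 ↔
          ¬ (s.arr 9 i = 0 ∧ (s1.v 23 = m ∨ X i ≠ 0)) := by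
        have hXi : X i = 0 ↔ s.arr 3 (i * m + e) = 0 := by rw [hX i hi, ZMod.val_eq_zero]
        simp only [Ex.ev_eqE, Ex.ev_get, Ex.ev_var, Ex.ev_lit, Ex.ev_add, Ex.ev_ltE, Ex.ev_mul, e24,
          e20, e22, A1.arr 9 (by simp), A1.arr 3 (by simp), Ne, hXi, Nat.pos_iff_ne_zero]
        by_cases c1 : s.arr 9 i = 0 <;> by_cases c2 : s1.v 23 = m <;>
          by_cases c3 : s.arr 3 (i * m + e) = 0 <;> simp [c1, c2, c3]
      by_cases hc : s.arr 9 i = 0 ∧ (s1.v 23 = m ∨ X i ≠ 0)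
      · refine (HT.ifP_pos hok (fun h => hev.1 h hc) (HT.asg (by simp) (by norm_num)
          ⟨by simp [St.set_v, e24], by simp [St.set_v, e20], (A1.set (by simp) _).set (by simp) _,
            Or.inr ?_⟩)).time_le (by simp)
        simp only [St.set_v, Ex.ev_var, e24]
        simp only [Nat.reduceEqDiff, if_true, if_false]
        refine ⟨hi, hc.1, fun hx i' hi' h9 => ?_⟩
        by_cases hii : i' = i
        · rwa [hii]
        · rcases hc.2 with h | h
          · rcases I1 with I1 | I1
            · exact absurd h9 (I1.2 i' (by omega))
            · omega
          · exact absurd hx h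
      · refine (HT.ifP_neg hok (hev.2 hc) (HT.skip
          ⟨e24, e20, A1.set (by simp) _, ?_⟩)).time_le (by simp)
        simp only [St.set_v]
        simp only [Nat.reduceEqDiff, if_false]
        rcases I1 with ⟨I1, I2⟩ | ⟨I1, I2, I3⟩
        · refine Or.inl ⟨I1, fun i' hi' => ?_⟩
          by_cases hii : i' = i
          · rw [hii]; exact fun h => hc ⟨h, .inl I1⟩
          · exact I2 i' (by omega)
        · refine Or.inr ⟨I1, I2, fun hx i' hi' h9 => ?_⟩
          by_cases hii : i' = i
          · subst hii
            by_contra hne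
            exact hc ⟨h9, .inr hne⟩
          · exact I3 hx i' (by omega) h9
    · rintro s1 ⟨A1, I1⟩ -
      rcases I1 with ⟨I1, I2⟩ | ⟨I1, I2, I3⟩
      · obtain ⟨i, hi, h9⟩ := hex
        exact absurd h9 (I2 i hi)
      · exact hQ s1 _ A1 rfl I1 I2 I3
  simp; omega

/-- A zero pivot needs no special treatment: the table yields `0` as its inverse, in accordance with
`gjStep` under `0⁻¹ = 0`, and only the flag in register `26` is cleared. The loop also overwrites
the pivot entry, which the last store corrects. -/
theorem HT.leafP {w p m e : ℕ} [hpp : Fact p.Prime] {s : St} (hw : 0 < w)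
    (hsz : m * m + 3 * m + p * p + 3 * p + 3 < 2 ^ w)
    (hp : s.v 3 = p) (hinv : ∀ x : ZMod p, s.arr 4 x.val = (x⁻¹).val)
    (hm : s.v 20 = m) (he : s.v 22 = e) (hem : e < m) (h26 : s.v 26 ≤ 1) {X : ℕ → ZMod p}
    (hX : ∀ i < m, s.arr 3 (i * m + e) = (X i).val) (hex : ∃ i < m, s.arr 9 i = 0)
    {Q : St → Prop}
    (hQ : ∀ s' r, Agree [23, 24, 25, 26, 27] [3, 5, 9] s s' → r < m → s.arr 9 r = 0 →
      (X r = 0 → ∀ i < m, s.arr 9 i = 0 → X i = 0) →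
      s'.arr 5 = Function.update (s.arr 5) e r → s'.arr 9 = Function.update (s.arr 9) r (e + 1) →
      (s'.v 26 = if X r = 0 then 0 else s.v 26) →
      (∀ i < m, s'.arr 3 (i * m + e) = (if i = r then (X r)⁻¹ else -X i * (X r)⁻¹).val) →
      (∀ i < m, ∀ j < m, j ≠ e → s'.arr 3 (i * m + j) = s.arr 3 (i * m + j)) → Q s') :
    HT false w leafP s (m * 100 + 200) Q := by
  have hp2 := hpp.out.two_le
  apply HT.time_le
  case h =>
    apply HT.seq
    refine HT.pivotP (p := p) (m := m) (e := e) (X := X) hw hsz hm he hem hX hex ?_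
    intro s1 r A1 e1 hr h9r hpiv
    have b1 : r * m + e < m * m := index_lt hr hem
    have b2 : r * m ≤ m * m := Nat.mul_le_mul hr.le le_rfl
    apply HT.seq
    refine HT.asg ?_ (by norm_num) ?_
    · simp only [Ex.ok_get, Ex.ok_add, Ex.ok_mul, Ex.ok_var, Ex.ev_var, Ex.ev_mul, e1,
        A1.v 20 (by simp), A1.v 22 (by simp), hm, he]
      omega
    simp only [Ex.ev_get, Ex.ev_add, Ex.ev_mul, Ex.ev_var, e1, A1.v 20 (by simp),
      A1.v 22 (by simp), hm, he, A1.arr 3 (by simp), hX r hr]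
    apply HT.seq
    refine HT.asg ?_ (by norm_num) ?_
    · simp only [Ex.ok_mul, Ex.ok_var, Ex.ok_ltE, Ex.ok_lit, Ex.ev_var, Ex.ev_ltE, Ex.ev_lit,
        St.set_v]
      simp only [Nat.reduceEqDiff, if_false, A1.v 26 (by simp)]
      refine ⟨by norm_num, ⟨by omega, by norm_num, hw⟩, ?_⟩
      split_ifs <;> omega
    have ev26 : (Ex.var 26 * (Ex.lit 0).ltE (Ex.var 25)).ev (s1.set 25 (X r).val) =
        if X r = 0 then 0 else s.v 26 := by
      simp [St.set_v, A1.v 26, Nat.pos_iff_ne_zero]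
    rw [ev26]
    apply HT.seq
    refine HT.asg (by simp) (by norm_num) ?_
    have ev27 : (Ex.get 4 (.var 25)).ev ((s1.set 25 (X r).val).set 26
        (if X r = 0 then 0 else s.v 26)) = ((X r)⁻¹).val := by
      simp [St.set_v, A1.arr 4, hinv]
    rw [ev27]
    apply HT.seq
    refine HT.sto (by simp) (by simp) (.inr (by norm_num)) ?_
    apply HT.seq
    refine HT.sto (by simp) ?_ (.inr (by norm_num)) ?_
    · simp [St.set_v, A1.v 22, he]; omega
    obtain ⟨s2, hs2⟩ : ∃ s2, s2 = ((((((s1.set 25 (X r).val).set 26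
      (if X r = 0 then 0 else s.v 26)).set 27 ((X r)⁻¹).val).put 5 e r).put 9 r (e + 1))) :=
      ⟨_, rfl⟩
    have hs2' := hs2
    simp only [Ex.ev_var, Ex.ev_add, Ex.ev_lit, St.put_v, St.set_v]
    simp only [Nat.reduceEqDiff, if_false, e1, A1.v 22 (by simp), he]
    rw [← hs2]
    have A2 : Agree [23, 24, 25, 26, 27] [5, 9] s s2 := by
      rw [hs2]
      exact (((((A1.mono (by simp) (by simp)).set (by simp) _).set (by simp) _).set
        (by simp) _).put (by simp) _ _).put (by simp) _ _
    have v23 : s2.v 23 = r := by simp [hs2, St.set_v, e1]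
    have v26 : s2.v 26 = if X r = 0 then 0 else s.v 26 := by simp [hs2, St.set_v]
    have v27 : s2.v 27 = ((X r)⁻¹).val := by simp [hs2]
    have a5 : s2.arr 5 = Function.update (s.arr 5) e r := by
      simp [hs2, St.put_arr, A1.arr 5]
    have a9 : s2.arr 9 = Function.update (s.arr 9) r (e + 1) := by
      simp [hs2, St.put_arr, A1.arr 9]
    clear hs2 hs2'
    apply HT.seq
    refine HT.fill1 (n := m) (fun i => i * m + e) (fun i => (-X i * (X r)⁻¹).val) hw (by norm_num)
      (by norm_num) (by norm_num) (by rw [A2.v 20 (by simp), hm]) (.inr (by norm_num))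
      (fun i hi i' hi' h => (index_inj hem hem h).1) ?_ ?_
    · intro i hi s' hA e24 h3 _
      have c1 : i * m + e < m * m := index_lt hi hem
      have c2 : i * m ≤ m * m := Nat.mul_le_mul hi.le le_rfl
      have h3 : s'.arr 3 (i * m + e) = (X i).val := by
        rw [h3 i hi, if_neg (by omega), A2.arr 3 (by simp), hX i hi]
      have hXi := ZMod.val_lt (X i)
      have hXr := ZMod.val_lt (X r)⁻¹
      have c3 : (p - (X i).val) * ((X r)⁻¹).val ≤ p * p := Nat.mul_le_mul (by omega) hXr.le
      simp only [colEx, Ex.ok_add, Ex.ok_mul, Ex.ok_var, Ex.ok_mod, Ex.ok_sub, Ex.ok_get, Ex.ev_add,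
        Ex.ev_mul, Ex.ev_var, Ex.ev_mod, Ex.ev_sub, Ex.ev_get, e24, hA.v 20 (by simp),
        hA.v 22 (by simp), hA.v 27 (by simp), hA.v 3 (by simp), A2.v 20 (by simp),
        A2.v 22 (by simp), A2.v 3 (by simp), hm, he, hp, v27, h3]
      refine ⟨by omega, ⟨⟨⟨by norm_num, by norm_num, by omega⟩, by norm_num, by omega⟩,
        by norm_num⟩, trivial, mod_eq_val ?_⟩
      rw [Nat.cast_mul, Nat.cast_sub hXi.le]
      simp
    · intro s3 A3 v3 w3 _
      have A23 : Agree [23, 24, 25, 26, 27] [3, 5, 9] s s3 :=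
        (A2.mono (by simp) (by simp)).trans A3 (by simp) (by simp)
      refine HT.sto ?_ (by simp) (.inr (by norm_num)) ?_
      · simp only [Ex.ok_add, Ex.ok_mul, Ex.ok_var, Ex.ev_mul, Ex.ev_var, A3.v 23 (by simp), v23,
          A23.v 20 (by simp), A23.v 22 (by simp), hm, he]
        omega
      simp only [Ex.ev_add, Ex.ev_mul, Ex.ev_var, A3.v 23 (by simp), v23, A23.v 20 (by simp),
        A23.v 22 (by simp), hm, he, A3.v 27 (by simp), v27]
      refine hQ _ r (A23.put (by simp) _ _) hr h9r hpiv ?_ ?_ ?_ (fun i hi => ?_)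
        fun i hi j hj hje => ?_
      · simp [St.put_arr, A3.arr 5, a5]
      · simp [St.put_arr, A3.arr 9, a9]
      · rw [St.put_v, A3.v 26 (by simp), v26]
      · rw [St.put_arr_self]
        by_cases hir : i = r
        · subst hir; simp
        · rw [Function.update_of_ne fun h => hir (index_inj hem hem h).1, v3 i hi, if_neg hir]
      · rw [St.put_arr_self, Function.update_of_ne fun h => hje (index_inj hj hem h).2, w3,
          A2.arr 3 (by simp)]
        intro i' hi' h
        exact hje (index_inj hem hj h).2.symm
  simp [colEx]; omega

/-- One block operation of the elimination, if it is due. -/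
def blockP (P : Prog ArithInstr) (N : ℕ) : WordProg :=
  ifP (((Ex.var 22 + .lit 1) % .var 4).eqE (.lit 0))
    (asg 29 (.var 22 + .lit 1 - .var 4) ;;
      ifP ((.var 29 / .var 4 % .lit 2 : Ex).eqE (.lit 1)) (asg 30 (.var 29 - .var 4))
        (asg 30 (.var 29 + .var 4)) ;;
      applyP P N) .skip ;;
  asg 4 (.var 4 * .lit 2)

/-- Eliminates all columns. -/
def gjP (P : Prog ArithInstr) (N : ℕ) : WordProg :=
  asg 26 (.lit 1) ;;
  fill1 24 20 9 (.var 24) (.lit 0) ;;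
  forP 22 20 (leafP ;; asg 4 (.lit 1) ;; forP 28 21 (blockP P N))

/-- The state of the elimination of `A` after the columns below `e`, where column `j` is up to date
with respect to the columns below `σ j`. -/
structure GjInv {p : ℕ} [Fact p.Prime] (A : ℕ → ℕ → ZMod p) (m e : ℕ) (σ : ℕ → ℕ) (s : St) :
    Prop where
  lt : ∀ c < e, s.arr 5 c < m
  inv : ∀ c < e, s.arr 9 (s.arr 5 c) = c + 1
  used : ∀ i < m, s.arr 9 i ≠ 0 → ∃ c < e, s.arr 5 c = i
  piv : ∀ c < e, gjMat A (s.arr 5) c (s.arr 5 c) c = 0 → ∀ i < m, (∀ c' < c, s.arr 5 c' ≠ i) →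
    gjMat A (s.arr 5) c i c = 0
  le : s.v 26 ≤ 1
  flag : s.v 26 = 0 ↔ ∃ c < e, gjMat A (s.arr 5) c (s.arr 5 c) c = 0
  time_le : ∀ j < m, σ j ≤ e
  col : ∀ i < m, ∀ j < m, s.arr 3 (i * m + j) = (gjMat A (s.arr 5) (σ j) i j).val

/-! ### The invariant of the elimination and its preservation. -/

namespace GjInv

variable {p : ℕ} [hpp : Fact p.Prime] {A : ℕ → ℕ → ZMod p} {m e : ℕ} {σ : ℕ → ℕ} {s : St}

theorem inj (h : GjInv A m e σ s) {c c' : ℕ} (hc : c < e) (hc' : c' < e)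
    (heq : s.arr 5 c = s.arr 5 c') : c = c' := by
  have h1 := h.inv c hc
  have h2 := h.inv c' hc'
  rw [heq, h2] at h1
  omega

/-- Fewer than `m` pivots cannot occupy all `m` rows. -/
theorem exists_unused (h : GjInv A m e σ s) (hem : e < m) : ∃ i < m, s.arr 9 i = 0 := by
  by_contra! hne
  have hcard : (Finset.range m).card ≤ ((Finset.range e).image (s.arr 5)).card := by
    refine Finset.card_le_card fun i hi => ?_
    obtain ⟨c, hc, h5⟩ := h.used i (Finset.mem_range.1 hi) (hne i (Finset.mem_range.1 hi))
    exact Finset.mem_image.2 ⟨c, Finset.mem_range.2 hc, h5⟩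
  have := hcard.trans Finset.card_image_le
  simp at this
  omega

theorem inv_le (h : GjInv A m e σ s) {i : ℕ} (hi : i < m) : s.arr 9 i ≤ e := by
  by_cases h0 : s.arr 9 i = 0
  · omega
  · obtain ⟨c, hc, rfl⟩ := h.used i hi h0
    rw [h.inv c hc]; omega

theorem between_iff (h : GjInv A m e σ s) {i b : ℕ} (hi : i < m) :
    (b < s.arr 9 i ∧ s.arr 9 i ≤ e) ↔ ∃ c < e, b ≤ c ∧ s.arr 5 c = i := by
  constructor
  · rintro ⟨h1, h2⟩
    obtain ⟨c, hc, rfl⟩ := h.used i hi (by omega)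
    rw [h.inv c hc] at h1
    exact ⟨c, hc, by omega, rfl⟩
  · rintro ⟨c, hc, hb, rfl⟩
    rw [h.inv c hc]; omega

theorem congr (h : GjInv A m e σ s) {s' : St} {σ' : ℕ → ℕ} (h5 : s'.arr 5 = s.arr 5)
    (h9 : s'.arr 9 = s.arr 9) (h26 : s'.v 26 = s.v 26) (hσ : ∀ j < m, σ' j ≤ e)
    (hcol : ∀ i < m, ∀ j < m, s'.arr 3 (i * m + j) = (gjMat A (s.arr 5) (σ' j) i j).val) :
    GjInv A m e σ' s' :=
  ⟨by rw [h5]; exact h.lt, by rw [h5, h9]; exact h.inv, by rw [h5, h9]; exact h.used,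
    by rw [h5]; exact h.piv, by rw [h26]; exact h.le, by rw [h5, h26]; exact h.flag, hσ,
    by rw [h5]; exact hcol⟩

/-- Column `e` alone moves on to time `e + 1`. The other columns are at times at most `e`, and
matrices at these times do not depend on the new pivot. -/
theorem leaf (h : GjInv A m e (gjTime e) s) (hem : e < m) {r : ℕ} (hr : r < m)
    (h9r : s.arr 9 r = 0) {s' : St}
    (hpiv : gjMat A (s.arr 5) e r e = 0 → ∀ i < m, s.arr 9 i = 0 → gjMat A (s.arr 5) e i e = 0)
    (h5 : s'.arr 5 = Function.update (s.arr 5) e r)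
    (h9 : s'.arr 9 = Function.update (s.arr 9) r (e + 1))
    (h26 : s'.v 26 = if gjMat A (s.arr 5) e r e = 0 then 0 else s.v 26)
    (hcol : ∀ i < m, s'.arr 3 (i * m + e) = (if i = r then (gjMat A (s.arr 5) e r e)⁻¹ else
      -gjMat A (s.arr 5) e i e * (gjMat A (s.arr 5) e r e)⁻¹).val)
    (hcol' : ∀ i < m, ∀ j < m, j ≠ e → s'.arr 3 (i * m + j) = s.arr 3 (i * m + j)) :
    GjInv A m (e + 1) (gjTime' e 0) s' := by
  have hne : ∀ c < e, s.arr 5 c ≠ r := fun c hc hcr => by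
    have := h.inv c hc
    rw [hcr] at this; omega
  have h5c : ∀ c < e, s'.arr 5 c = s.arr 5 c := fun c hc => by
    rw [h5, Function.update_of_ne (by omega)]
  have h5e : s'.arr 5 e = r := by rw [h5, Function.update_self]
  have hg : ∀ c ≤ e, gjMat A (s'.arr 5) c = gjMat A (s.arr 5) c := fun c hc =>
    gjMat_congr A fun c' hc' => h5c c' (by omega)
  have htime : ∀ j, gjTime e j ≤ e := fun j => Nat.div_mul_le_self _ _
  refine ⟨fun c hc => ?_, fun c hc => ?_, fun i hi hi0 => ?_, fun c hc h0 i hi hci => ?_, ?_, ?_,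
    fun j hj => ?_, fun i hi j hj => ?_⟩
  · rcases Nat.lt_succ_iff_lt_or_eq.1 hc with hc | rfl
    · rw [h5c c hc]; exact h.lt c hc
    · rwa [h5e]
  · rcases Nat.lt_succ_iff_lt_or_eq.1 hc with hc | rfl
    · rw [h5c c hc, h9, Function.update_of_ne (hne c hc), h.inv c hc]
    · rw [h5e, h9, Function.update_self]
  · by_cases hir : i = r
    · exact ⟨e, by omega, by rw [h5e, hir]⟩
    · rw [h9, Function.update_of_ne hir] at hi0
      obtain ⟨c, hc, h5i⟩ := h.used i hi hi0
      exact ⟨c, by omega, by rw [h5c c hc, h5i]⟩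
  · rcases Nat.lt_succ_iff_lt_or_eq.1 hc with hc | rfl
    · rw [hg c hc.le, h5c c hc] at h0
      rw [hg c hc.le]
      exact h.piv c hc h0 i hi fun c' hc' => by rw [← h5c c' (by omega)]; exact hci c' hc'
    · rw [hg c le_rfl, h5e] at h0
      rw [hg c le_rfl]
      refine hpiv h0 i hi ?_
      by_contra h9i
      obtain ⟨c', hc', h5'⟩ := h.used i hi h9i
      exact hci c' hc' (by rw [h5c c' hc', h5'])
  · rw [h26]
    have := h.le
    split_ifs <;> omega
  · have hl : (∃ c < e + 1, gjMat A (s'.arr 5) c (s'.arr 5 c) c = 0) ↔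
        (∃ c < e, gjMat A (s.arr 5) c (s.arr 5 c) c = 0) ∨ gjMat A (s.arr 5) e r e = 0 := by
      constructor
      · rintro ⟨c, hc, h0⟩
        rcases Nat.lt_succ_iff_lt_or_eq.1 hc with hc | rfl
        · rw [hg c hc.le, h5c c hc] at h0
          exact .inl ⟨c, hc, h0⟩
        · rw [hg c le_rfl, h5e] at h0
          exact .inr h0
      · rintro (⟨c, hc, h0⟩ | h0)
        · exact ⟨c, by omega, by rwa [hg c hc.le, h5c c hc]⟩
        · exact ⟨e, by omega, by rwa [hg e le_rfl, h5e]⟩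
    rw [hl, h26, ← h.flag]
    split_ifs with h0 <;> simp [h0]
  · rw [gjTime'_zero]
    split_ifs
    · exact le_rfl
    · have := htime j
      omega
  · by_cases hje : j = e
    · subst hje
      rw [hcol i hi, gjTime'_zero, if_pos rfl]
      rw [gjMat, h5e, gjStep_self, hg j le_rfl]
    · rw [hcol' i hi j hj hje, h.col i hi j hj, gjTime'_zero, if_neg hje, hg _ (htime j)]

/-- This is `gjMat_block` for the block that ends with column `e`: its columns are at time `e + 1`,
and the sibling is still at the time when the block began. -/
theorem block (h : GjInv A m (e + 1) (gjTime' e k) s) (hk : 2 ^ k ∣ e + 1)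
    {s' : St} (h5 : s'.arr 5 = s.arr 5) (h9 : s'.arr 9 = s.arr 9) (h26 : s'.v 26 = s.v 26)
    (hcol : ∀ i < m, ∀ j < m, s'.arr 3 (i * m + j) =
      (if sibling (e + 1 - 2 ^ k) (2 ^ k) ≤ j ∧ j < sibling (e + 1 - 2 ^ k) (2 ^ k) + 2 ^ k then
        (if e + 1 - 2 ^ k < s.arr 9 i ∧ s.arr 9 i ≤ e + 1 - 2 ^ k + 2 ^ k then 0 else
          gjMat A (s.arr 5) (gjTime' e k j) i j) +
          ∑ c ∈ Finset.Ico (e + 1 - 2 ^ k) (e + 1 - 2 ^ k + 2 ^ k),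
            gjMat A (s.arr 5) (gjTime' e k c) i c *
              gjMat A (s.arr 5) (gjTime' e k j) (s.arr 5 c) j
        else gjMat A (s.arr 5) (gjTime' e k j) i j).val) :
    GjInv A m (e + 1) (gjTime' e (k + 1)) s' := by
  have hle : 2 ^ k ≤ e + 1 := Nat.le_of_dvd (by omega) hk
  refine h.congr h5 h9 h26 (fun j hj => ?_) fun i hi j hj => ?_
  · by_cases hd : diffLevel e j = k + 1
    · rw [(gjTime'_of_sibling hk hd).2]
    · rw [gjTime'_of_ne hd]; exact h.time_le j hj
  · rw [hcol i hi j hj]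
    congr 1
    by_cases hd : diffLevel e j = k + 1
    · rw [if_pos ((sibling_mem_iff hk j).2 hd)]
      obtain ⟨t1, t2⟩ := gjTime'_of_sibling hk hd
      rw [t1, t2]
      have hb : e + 1 - 2 ^ k + 2 ^ k = e + 1 := by omega
      have hnb : ¬ (e + 1 - 2 ^ k ≤ j ∧ j < e + 1) := by
        rw [block_mem_iff hk]; omega
      have hsum : ∀ c ∈ Finset.Ico (e + 1 - 2 ^ k) (e + 1),
          gjMat A (s.arr 5) (gjTime' e k c) i c = gjMat A (s.arr 5) (e + 1) i c := fun c hc => by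
        rw [Finset.mem_Ico, block_mem_iff hk] at hc
        rw [gjTime'_of_block hk hc]
      have hblock := gjMat_block A (π := s.arr 5) (b := e + 1 - 2 ^ k) (2 ^ k)
        (fun c hc c' hc' => h.inj (by omega) (by omega)) i j (by omega)
      have hbt := h.between_iff (b := e + 1 - 2 ^ k) hi
      rw [hb] at hblock ⊢
      rw [hblock, Finset.sum_congr rfl fun c hc => by rw [hsum c hc]]
      by_cases h1 : e + 1 - 2 ^ k < s.arr 9 i ∧ s.arr 9 i ≤ e + 1
      · rw [if_pos h1, if_pos (hbt.1 h1)]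
      · rw [if_neg h1, if_neg fun h2 => h1 (hbt.2 h2)]
    · rw [if_neg fun h1 => hd ((sibling_mem_iff hk j).1 h1), gjTime'_of_ne hd]

end GjInv

/-- The time of the operation of a block of `h` columns on another block. -/
def blockTime (τ : ℕ → ℕ) (N m h : ℕ) : ℕ := m / h * (4 * τ h + (1000 + 2 * N) * (h * h))

section

variable {P : Prog ArithInstr} {N w p m K : ℕ} {τ : ℕ → ℕ} [hpp : Fact p.Prime] {s : St}
  {A : ℕ → ℕ → ZMod p} {Q : St → Prop}

theorem HT.blockP {e k : ℕ} (hS : MulSpec P N w p τ m) (hp : s.v 3 = p)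
    (hinv : ∀ x : ZMod p, s.arr 4 x.val = (x⁻¹).val) (hm : s.v 20 = m) (hmK : m = 2 ^ K)
    (he : s.v 22 = e) (hem : e < m) (hk : s.v 4 = 2 ^ k) (hkK : k < K)
    (hG : GjInv A m (e + 1) (gjTime' e k) s)
    (hQ : ∀ s', Agree [4, 29, 30, 31, 32, 33, 34, 60, 62, 63] [3, 6, 7, 8] s s' →
      s'.v 4 = 2 ^ (k + 1) → GjInv A m (e + 1) (gjTime' e (k + 1)) s' → Q s') :
    HT false w (blockP P N) s (50 + if 2 ^ k ∣ e + 1 then blockTime τ N m (2 ^ k) else 0) Q := by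
  have hsz := hS.size
  have hw : 0 < w := by
    rcases Nat.eq_zero_or_pos w with rfl | h
    · simp at hsz
    · exact h
  have hkm : 2 ^ k * 2 ≤ m := by
    rw [hmK, ← pow_succ]; exact Nat.pow_le_pow_right (by norm_num) hkK
  have hok : (((Ex.var 22 + .lit 1) % .var 4 : Ex).eqE (.lit 0)).ok false w s := by
    simp only [Ex.ok_eqE, Ex.ok_mod, Ex.ok_add, Ex.ok_var, Ex.ok_lit, Ex.ev_var, Ex.ev_lit, he]
    omega
  have hev : (((Ex.var 22 + .lit 1) % .var 4 : Ex).eqE (.lit 0)).ev s ≠ 0 ↔ 2 ^ k ∣ e + 1 := by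
    simp [he, hk, Nat.dvd_iff_mod_eq_zero]
  have hQ' : ∀ s', Agree [4, 29, 30, 31, 32, 33, 34, 60, 62, 63] [3, 6, 7, 8] s s' →
      s'.v 4 = 2 ^ k → GjInv A m (e + 1) (gjTime' e (k + 1)) s' →
      HT false w (SensReach.asg 4 (.var 4 * .lit 2)) s' 6 Q := by
    intro s' hA h4 hG'
    refine (HT.asg ?_ (by norm_num) ?_).time_le (by simp)
    · simp only [Ex.ok_mul, Ex.ok_var, Ex.ok_lit, Ex.ev_var, Ex.ev_lit, h4]
      omega
    · refine hQ _ (hA.set (by simp) _) (by simp [h4, pow_succ]) ?_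
      exact hG'.congr rfl rfl (by simp [St.set_v]) hG'.time_le hG'.col
  by_cases hdvd : 2 ^ k ∣ e + 1
  · rw [if_pos hdvd]
    have hle : 2 ^ k ≤ e + 1 := Nat.le_of_dvd (by omega) hdvd
    have hsib := sibling_add_le hdvd hkK (hmK ▸ hem)
    rw [← hmK] at hsib
    apply HT.time_le
    case h =>
      apply HT.seq
      apply HT.ifP_pos hok (hev.2 hdvd)
      apply HT.seq
      refine HT.asg (by simp [he]; omega) (by norm_num) ?_
      simp only [Ex.ev_sub, Ex.ev_add, Ex.ev_var, Ex.ev_lit, he, hk]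
      apply HT.seq
      have hif : HT false w (SensReach.ifP ((.var 29 / .var 4 % .lit 2 : Ex).eqE (.lit 1))
          (SensReach.asg 30 (.var 29 - .var 4)) (SensReach.asg 30 (.var 29 + .var 4)))
          (s.set 29 (e + 1 - 2 ^ k)) 25 fun s' => HT false w (SensReach.applyP P N) s'
            (m / 2 ^ k * (4 * τ (2 ^ k) + (1000 + 2 * N) * (2 ^ k * 2 ^ k))) fun s' =>
              HT false w (SensReach.asg 4 (.var 4 * .lit 2)) s' 6 Q := by
        have hcont : HT false w (SensReach.applyP P N)
            ((s.set 29 (e + 1 - 2 ^ k)).set 30 (sibling (e + 1 - 2 ^ k) (2 ^ k)))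
            (m / 2 ^ k * (4 * τ (2 ^ k) + (1000 + 2 * N) * (2 ^ k * 2 ^ k))) fun s' =>
              HT false w (SensReach.asg 4 (.var 4 * .lit 2)) s' 6 Q := by
          refine HT.applyP (s := (s.set 29 (e + 1 - 2 ^ k)).set 30 (sibling (e + 1 - 2 ^ k) (2 ^ k)))
            (b := e + 1 - 2 ^ k) (d := sibling (e + 1 - 2 ^ k) (2 ^ k))
            (X := fun i j => gjMat A (s.arr 5) (gjTime' e k j) i j) hS
            hp hinv hk hm rfl rfl
            Nat.one_le_two_pow
            ?_ (by omega) hsib (fun c hc => hG.lt c (by omega))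
            (fun i hi => (hG.inv_le hi).trans hem) hG.col ?_
          · rw [hmK]; exact Nat.div_mul_cancel (Nat.pow_dvd_pow 2 hkK.le)
          · intro s' hA hcol
            have hA' := (((Agree.refl s).set (R := [4, 29, 30, 31, 32, 33, 34, 60, 62, 63])
              (A := [3, 6, 7, 8]) (x := 29) (by simp) (e + 1 - 2 ^ k)).set (x := 30) (by simp)
              (sibling (e + 1 - 2 ^ k) (2 ^ k))).trans hA (by simp) (by simp)
            refine hQ' s' hA' ?_ ?_
            · rw [hA.v 4 (by simp)]; simp [St.set_v, hk]
            · exact hG.block hdvd (hA'.arr 5 (by simp)) (hA'.arr 9 (by simp)) (hA'.v 26 (by simp))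
                hcol
        have ev1 : ((.var 29 / .var 4 % .lit 2 : Ex).eqE (.lit 1)).ev (s.set 29 (e + 1 - 2 ^ k)) =
            if (e + 1 - 2 ^ k) / 2 ^ k % 2 = 1 then 1 else 0 := by simp [St.set_v, hk]
        by_cases hodd : (e + 1 - 2 ^ k) / 2 ^ k % 2 = 1
        · refine (HT.ifP_pos (by simp; omega) (by simp [ev1, hodd]) (HT.asg (by simp) (by norm_num)
            ?_)).time_le (by simp)
          have : (Ex.var 29 - Ex.var 4).ev (s.set 29 (e + 1 - 2 ^ k)) =
              sibling (e + 1 - 2 ^ k) (2 ^ k) := by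
            simp [sibling, hodd, St.set_v, hk]
          rw [this]; exact hcont
        · refine (HT.ifP_neg (by simp; omega) (by simp [ev1, hodd]) (HT.asg
            (by simp [St.set_v, hk]; omega) (by norm_num) ?_)).time_le (by simp)
          have : (Ex.var 29 + Ex.var 4).ev (s.set 29 (e + 1 - 2 ^ k)) =
              sibling (e + 1 - 2 ^ k) (2 ^ k) := by
            rw [sibling, if_neg hodd]
            simp [St.set_v, hk]
          rw [this]; exact hcont
      exact hif
    simp [blockTime]; omega
  · rw [if_neg hdvd]
    apply HT.time_le
    case h =>
      apply HT.seq
      refine HT.ifP_neg hok (not_not.1 fun h => hdvd (hev.1 h)) (HT.skip ?_)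
      refine hQ' s (Agree.refl s) hk (hG.congr rfl rfl rfl (fun j hj => ?_) fun i hi j hj => ?_)
      · rw [gjTime'_succ_of_not_dvd hdvd]; exact hG.time_le j hj
      · rw [gjTime'_succ_of_not_dvd hdvd]; exact hG.col i hi j hj
    simp

/-- The time of the elimination. -/
def elimTime (τ : ℕ → ℕ) (N m K : ℕ) : ℕ :=
  m * (m * 100 + 300 + K * 62) + m * 20 + 50 +
    ∑ k ∈ Finset.range K, m / 2 ^ k * blockTime τ N m (2 ^ k)

/-- During the elimination of `m` columns, a block of length `q` is completed `m / q` times. -/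
theorem sum_dvd_succ (m q t : ℕ) :
    ∑ e ∈ Finset.range m, (if q ∣ e + 1 then t else 0) = m / q * t := by
  rw [← Finset.sum_filter, Finset.sum_const, smul_eq_mul, Nat.card_multiples]

/-- After the elimination, either the matrix is invertible and the inverse is known, or a vector in
the kernel exists. -/
theorem HT.gjP (hS : MulSpec P N w p τ m) (hp : s.v 3 = p)
    (hinv : ∀ x : ZMod p, s.arr 4 x.val = (x⁻¹).val) (hm : s.v 20 = m) (hK : s.v 21 = K)
    (hmK : m = 2 ^ K) (hA : ∀ i < m, ∀ j < m, s.arr 3 (i * m + j) = (A i j).val)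
    (hQ : ∀ s', Agree [4, 22, 23, 24, 25, 26, 27, 28, 29, 30, 31, 32, 33, 34, 60, 62, 63]
        [3, 5, 6, 7, 8, 9] s s' →
      (s'.v 26 = 1 ∧ (∀ c < m, s'.arr 5 c < m) ∧
        (∀ c < m, ∀ c' < m, s'.arr 5 c = s'.arr 5 c' → c = c') ∧
        ∃ W : ℕ → ℕ → ZMod p, (∀ i < m, ∀ j < m, s'.arr 3 (i * m + j) = (W i j).val) ∧
          ∀ x y : ℕ → ZMod p, (∀ i < m, ∑ j ∈ Finset.range m, A i j * x j = y i) ↔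
            ∀ c < m, x c = ∑ j ∈ Finset.range m, W (s'.arr 5 c) j * y (s'.arr 5 j)) ∨
      (s'.v 26 = 0 ∧ (∃ x : ℕ → ZMod p, (∃ j < m, x j ≠ 0) ∧
        ∀ i < m, ∑ j ∈ Finset.range m, A i j * x j = 0)) → Q s') :
    HT false w (gjP P N) s (elimTime τ N m K) Q := by
  have hsz := hS.size
  have hw : 0 < w := by
    rcases Nat.eq_zero_or_pos w with rfl | h
    · simp at hsz
    · exact h
  apply HT.time_le
  case h =>
    apply HT.seq
    refine HT.asg (by simp; omega) (by norm_num) ?_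
    apply HT.seq
    refine HT.fill1 (n := m) (fun i => i) (fun _ => 0) hw (by norm_num) (by norm_num) (by norm_num)
      (by simp [St.set_v, hm]) (.inr (by norm_num)) (fun _ _ _ _ h => h)
      (fun i hi s' _ h _ _ => by simp [h]) ?_
    intro s1 A1 z1 _ _
    have A1' : Agree [4, 22, 23, 24, 25, 26, 27, 28, 29, 30, 31, 32, 33, 34, 60, 62, 63]
        [3, 5, 6, 7, 8, 9] s s1 :=
      ((Agree.refl s).set (by simp) _).trans A1 (by simp) (by simp)
    refine HT.forP (N := m) (T := fun e => (m * 100 + 200) + (3 + (∑ k ∈ Finset.range K,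
      ((50 + if 2 ^ k ∣ e + 1 then blockTime τ N m (2 ^ k) else 0) + 12) + 9)))
      (fun e s' => Agree [4, 22, 23, 24, 25, 26, 27, 28, 29, 30, 31, 32, 33, 34, 60, 62, 63]
        [3, 5, 6, 7, 8, 9] s s' ∧ GjInv A m e (gjTime e) s') (by norm_num) (by norm_num)
      (by norm_num) (by rw [A1'.v 20 (by simp), hm]) hw ⟨A1'.set (by simp) _, ?_⟩ ?_ ?_
    · refine ⟨by simp, by simp, fun i hi h => absurd (z1 i hi) h, by simp, ?_, ?_, fun j hj => ?_,
        fun i hi j hj => ?_⟩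
      · simp [St.set_v, A1.v 26]
      · simp [St.set_v, A1.v 26]
      · simp [gjTime]
      · rw [gjTime_zero]
        simp [A1.arr 3, hA i hi j hj, gjMat]
    · rintro e he s2 ⟨A2, G2⟩ e22 e20
      have hcast : ∀ i < m, s2.arr 3 (i * m + e) = (gjMat A (s2.arr 5) e i e).val := fun i hi => by
        rw [G2.col i hi e he, gjTime_self]
      apply HT.seq
      refine HT.leafP (p := p) (m := m) (e := e) (X := fun i => gjMat A (s2.arr 5) e i e) hw hsz
        (by rw [A2.v 3 (by simp), hp]) (by rw [A2.arr 4 (by simp)]; exact hinv) e20 e22 he G2.le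
        hcast (G2.exists_unused he) ?_
      intro s3 r A3 hr h9r hpiv h5 h9 h26 hcol hcol'
      have G3 := G2.leaf he hr h9r hpiv h5 h9 h26 hcol hcol'
      have A3' := A2.trans A3 (by simp) (by simp)
      apply HT.seq
      refine (HT.asg (by simp; omega) (by norm_num) ?_).time_le (show _ ≤ 3 by simp)
      refine HT.forP (N := K) (T := fun k => 50 + if 2 ^ k ∣ e + 1 then blockTime τ N m (2 ^ k)
        else 0) (fun k s' =>
          Agree [4, 22, 23, 24, 25, 26, 27, 28, 29, 30, 31, 32, 33, 34, 60, 62, 63]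
            [3, 5, 6, 7, 8, 9] s s' ∧ s'.v 22 = e ∧ s'.v 4 = 2 ^ k ∧
          GjInv A m (e + 1) (gjTime' e k) s') (by norm_num) (by norm_num) (by norm_num)
        (by simp [St.set_v, A3'.v 21, hK]) hw ⟨(A3'.set (by simp) _).set (by simp) _, ?_, ?_, ?_⟩
        ?_ ?_
      · simp [St.set_v, A3.v 22, e22]
      · simp [St.set_v]
      · exact G3.congr rfl rfl (by simp [St.set_v]) G3.time_le G3.col
      · rintro k hk s4 ⟨A4, e22', e4, G4⟩ e28 e21
        refine HT.blockP hS (by rw [A4.v 3 (by simp), hp])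
          (by rw [A4.arr 4 (by simp)]; exact hinv) (by rw [A4.v 20 (by simp), hm]) hmK e22' he
          e4 hk G4 ?_
        intro s5 A5 e4' G5
        refine ⟨by rw [A5.v 28 (by simp), e28], by rw [A5.v 21 (by simp), e21],
          (A4.trans A5 (by simp) (by simp)).set (by simp) _, ?_, ?_, ?_⟩
        · simp [St.set_v, A5.v 22, e22']
        · simp [St.set_v, e4']
        · exact G5.congr rfl rfl (by simp [St.set_v]) G5.time_le G5.col
      · rintro s4 ⟨A4, e22', e4, G4⟩ -
        refine ⟨e22', by rw [A4.v 20 (by simp), hm], A4.set (by simp) _, ?_⟩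
        refine G4.congr rfl rfl (by simp [St.set_v]) (fun j hj => ?_) fun i hi j hj => ?_
        · rw [← gjTime'_last (hmK ▸ he) (hmK ▸ hj)]; exact G4.time_le j hj
        · rw [← gjTime'_last (hmK ▸ he) (hmK ▸ hj)]; exact G4.col i hi j hj
    · rintro s2 ⟨A2, G2⟩ -
      refine hQ s2 A2 ?_
      have hinj : ∀ c < m, ∀ c' < m, s2.arr 5 c = s2.arr 5 c' → c = c' := fun c hc c' hc' =>
        G2.inj hc hc'
      by_cases hz : ∃ c < m, gjMat A (s2.arr 5) c (s2.arr 5 c) c = 0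
      · refine .inr ⟨G2.flag.2 hz, ?_⟩
        obtain ⟨c, hc, h0⟩ := hz
        exact exists_ker_of_pivot_eq_zero G2.lt hinj G2.piv hc h0
      · have hne : s2.v 26 ≠ 0 := fun h => hz (G2.flag.1 h)
        have := G2.le
        refine .inl ⟨by omega, G2.lt, hinj, gjMat A (s2.arr 5) m, fun i hi j hj => ?_, ?_⟩
        · rw [G2.col i hi j hj]
          congr 2
          rw [hmK] at hj ⊢
          rw [gjTime_pow hj]
        · push Not at hz
          exact gjMat_inverse G2.lt hinj hz
  simp only [Finset.sum_add_distrib, Finset.sum_const, Finset.card_range, smul_eq_mul]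
  -- The cost is summed level by level instead of column by column, so that the completed blocks of
  -- each length can be counted.
  rw [Finset.sum_comm]
  simp only [sum_dvd_succ, elimTime, sz_sto, sz_asg, Ex.csz_var, Ex.csz_lit, mul_add, ← mul_assoc]
  nlinarith

end

/-! ## Reachability by linear algebra -/

section Walk

open Matrix

variable {n : ℕ}

open Classical in
/-- The identity minus the weighted adjacency matrix. -/
noncomputable def walkMat {F : Type*} [CommRing F] (G : Digraph (Fin n)) (R : Fin n → Fin n → F) :
    Matrix (Fin n) (Fin n) F :=
  1 - Matrix.of fun i j => if G.Adj i j then R i j else 0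

/-- The matrix bordered by the column `e_v` and the row `e_u`. -/
noncomputable def borderMat {F : Type*} [CommRing F] (G : Digraph (Fin n)) (R : Fin n → Fin n → F)
    (u v : Fin n) : Matrix (Fin n ⊕ Unit) (Fin n ⊕ Unit) F :=
  Matrix.fromBlocks (walkMat G R) (Matrix.of fun i _ => if i = v then 1 else 0)
    (Matrix.of fun _ j => if j = u then 1 else 0) 0

open Classical in
theorem walkMat_mulVec {F : Type*} [CommRing F] (G : Digraph (Fin n)) (R : Fin n → Fin n → F)
    (x : Fin n → F) (i : Fin n) :
    (walkMat G R *ᵥ x) i = x i - ∑ j, if G.Adj i j then R i j * x j else 0 := by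
  rw [walkMat, Matrix.sub_mulVec, one_mulVec]
  simp [mulVec, dotProduct, ite_mul]

theorem det_borderMat_ne_zero_iff {F : Type*} [Field F] (G : Digraph (Fin n))
    (R : Fin n → Fin n → F) (u v : Fin n) : (borderMat G R u v).det ≠ 0 ↔
      ∀ (x : Fin n → F) (a : F), (∀ i, (walkMat G R *ᵥ x) i + (if i = v then a else 0) = 0) →
        x u = 0 → x = 0 ∧ a = 0 := by
  have hmul : ∀ y : Fin n ⊕ Unit → F, borderMat G R u v *ᵥ y = 0 ↔
      (∀ i, (walkMat G R *ᵥ (y ∘ Sum.inl)) i + (if i = v then y (.inr ()) else 0) = 0) ∧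
        y (.inl u) = 0 := by
    intro y
    rw [borderMat, fromBlocks_mulVec]
    simp [funext_iff, mulVec, dotProduct, ite_mul]
  rw [Ne, ← Matrix.exists_mulVec_eq_zero_iff]
  constructor
  · intro h x a h1 h2
    by_contra hne
    refine h ⟨Sum.elim x fun _ => a, fun h0 => hne ?_, (hmul _).2 ⟨by simpa using h1, h2⟩⟩
    exact ⟨funext fun i => congrFun h0 (.inl i), congrFun h0 (.inr ())⟩
  · rintro h ⟨y, hy, h0⟩
    obtain ⟨h1, h2⟩ := (hmul y).1 h0
    obtain ⟨h3, h4⟩ := h _ _ h1 h2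
    refine hy (funext fun i => ?_)
    rcases i with i | i
    · exact congrFun h3 i
    · exact h4

/-- Let T be the set of nodes that reach v. A vector supported on T satisfies the equations of all
rows outside T, since no edge leads from outside into T. The rows in T give |T| equations for |T| +
1 unknowns, the extra one being `a`, and the condition at u is automatic because u is not in T. -/
theorem exists_ker_of_not_reachable {F : Type*} [Field F] {G : Digraph (Fin n)} {u v : Fin n}
    (h : ¬ Reachable G u v) (R : Fin n → Fin n → F) : ∃ (x : Fin n → F) (a : F),
      (x ≠ 0 ∨ a ≠ 0) ∧ (∀ i, (walkMat G R *ᵥ x) i + (if i = v then a else 0) = 0) ∧ x u = 0 := by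
  classical
  let T := {i : Fin n // Reachable G i v}
  let ext : (T → F) →ₗ[F] (Fin n → F) :=
    { toFun := fun x i => if hi : Reachable G i v then x ⟨i, hi⟩ else 0
      map_add' := fun x y => by ext i; by_cases hi : Reachable G i v <;> simp [hi]
      map_smul' := fun c x => by ext i; by_cases hi : Reachable G i v <;> simp [hi] }
  have hext : ∀ x i, ext x i = if hi : Reachable G i v then x ⟨i, hi⟩ else 0 := fun _ _ => rfl
  let f : ((T → F) × F) →ₗ[F] (T → F) :=
    { toFun := fun x i => (walkMat G R *ᵥ ext x.1) i + (if (i : Fin n) = v then x.2 else 0)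
      map_add' := fun x y => by
        ext i
        simp only [Prod.fst_add, Prod.snd_add, map_add, mulVec_add, Pi.add_apply]
        split_ifs <;> ring
      map_smul' := fun c x => by
        ext i
        simp only [Prod.smul_fst, Prod.smul_snd, map_smul, mulVec_smul, Pi.smul_apply, smul_eq_mul,
          RingHom.id_apply]
        split_ifs <;> ring }
  -- The domain has dimension |T| + 1 and the codomain |T|.
  have hker : LinearMap.ker f ≠ ⊥ := f.ker_ne_bot_of_finrank_lt (by simp)
  obtain ⟨⟨x, a⟩, hx, hne⟩ := (Submodule.ne_bot_iff _).1 hker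
  have hx : ∀ i : T, (walkMat G R *ᵥ ext x) i + (if (i : Fin n) = v then a else 0) = 0 := fun i =>
    congrFun (LinearMap.mem_ker.1 hx) i
  refine ⟨ext x, a, ?_, fun i => ?_, by rw [hext, dif_neg h]⟩
  · by_contra! h0
    refine hne (Prod.ext (funext fun i => ?_) h0.2)
    have := congrFun h0.1 i
    rwa [hext, dif_pos i.2] at this
  · by_cases hi : Reachable G i v
    · exact hx ⟨i, hi⟩
    · have hiv : i ≠ v := by rintro rfl; exact hi .refl
      rw [walkMat_mulVec, hext, dif_neg hi, if_neg hiv, Finset.sum_eq_zero, sub_zero, add_zero]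
      intro j _
      split_ifs with hij
      · rw [hext, dif_neg (show ¬ Reachable G j v from fun hj => hi (.head hij hj)), mul_zero]
      · rfl

/-- Walk lengths provide the distance to `v`, along which successors are chosen. -/
def WalkLen (G : Digraph (Fin n)) (v : Fin n) : ℕ → Fin n → Prop
  | 0, x => x = v
  | k + 1, x => ∃ y, G.Adj x y ∧ WalkLen G v k y

theorem exists_walkLen {G : Digraph (Fin n)} {x v : Fin n} (h : Reachable G x v) :
    ∃ k, WalkLen G v k x := by
  refine Relation.ReflTransGen.head_induction_on h ⟨0, rfl⟩ ?_
  rintro a b hab - ⟨k, hk⟩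
  exact ⟨k + 1, b, hab, hk⟩

theorem WalkLen.reachable {G : Digraph (Fin n)} {v : Fin n} {k : ℕ} {x : Fin n}
    (h : WalkLen G v k x) : Reachable G x v := by
  induction k generalizing x with
  | zero => rw [show x = v from h]; exact .refl
  | succ k ih =>
    obtain ⟨y, hxy, hy⟩ := h
    exact .head hxy (ih hy)

/-- Let every node that reaches v, other than v itself, point to a neighbour closer to v. With
weight 1 on these edges and 0 elsewhere, a kernel vector is constant along the pointers, hence equal
to its value `-a` at v; the condition at u forces `a = 0`, and then everything vanishes. -/
theorem exists_det_borderMat_ne_zero {F : Type*} [Field F] {G : Digraph (Fin n)} {u v : Fin n}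
    (h : Reachable G u v) : ∃ R : Fin n → Fin n → F, (borderMat G R u v).det ≠ 0 := by
  classical
  have hnext : ∀ x, Reachable G x v → x ≠ v → ∃ y, G.Adj x y ∧ ∃ hy : Reachable G y v,
      ∀ hx : Reachable G x v, Nat.find (exists_walkLen hy) < Nat.find (exists_walkLen hx) := by
    intro x hx hxv
    have hs := Nat.find_spec (exists_walkLen hx)
    obtain ⟨k, hk⟩ : ∃ k, Nat.find (exists_walkLen hx) = k + 1 :=
      Nat.exists_eq_succ_of_ne_zero fun h0 => by rw [h0] at hs; exact hxv hs
    rw [hk] at hs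
    obtain ⟨y, hxy, hy⟩ := hs
    refine ⟨y, hxy, hy.reachable, fun hx => ?_⟩
    rw [hk]
    exact Nat.lt_succ_of_le (Nat.find_min' _ hy)
  choose! next hadj hnreach hlt using hnext
  -- The weights need not vanish off the graph: only pairs (i, next i), which are edges, get weight
  -- 1.
  refine ⟨fun i j => if (Reachable G i v ∧ i ≠ v) ∧ j = next i then 1 else 0,
    (det_borderMat_ne_zero_iff G _ u v).2 fun x a h1 h2 => ?_⟩
  have hrow : ∀ i, x i = (if Reachable G i v ∧ i ≠ v then x (next i) else 0) -
      (if i = v then a else 0) := by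
    intro i
    have := h1 i
    rw [walkMat_mulVec] at this
    have hs : ∑ j, (if G.Adj i j then (if (Reachable G i v ∧ i ≠ v) ∧ j = next i then 1 else 0) *
        x j else 0) = if Reachable G i v ∧ i ≠ v then x (next i) else 0 := by
      by_cases hi : Reachable G i v ∧ i ≠ v
      · rw [Finset.sum_eq_single (next i)]
        · simp [hi, hadj i hi.1 hi.2]
        · intro j _ hj
          simp [hj]
        · simp
      · simp [hi]
    rw [hs] at this
    linear_combination this
  -- Induction on the distance to `v`, which decreases along the pointers.
  have hval : ∀ k i, (hi : Reachable G i v) → Nat.find (exists_walkLen hi) ≤ k → x i = -a := by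
    intro k
    induction k with
    | zero =>
      intro i hi h0
      have hs := Nat.find_spec (exists_walkLen hi)
      rw [Nat.le_zero.1 h0] at hs
      have hs : i = v := hs
      rw [hrow]
      simp [hs]
    | succ k ih =>
      intro i hi hk
      by_cases hiv : i = v
      · rw [hrow]; simp [hiv]
      · rw [hrow, if_pos ⟨hi, hiv⟩, if_neg hiv, sub_zero]
        have := hlt i hi hiv hi
        exact ih _ (hnreach i hi hiv) (by omega)
  have ha : a = 0 := by
    have := hval _ u h le_rfl
    rw [h2] at this
    exact neg_eq_zero.1 this.symm
  refine ⟨funext fun i => ?_, ha⟩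
  by_cases hi : Reachable G i v
  · rw [hval _ i hi le_rfl, ha, neg_zero]; rfl
  · have hiv : i ≠ v := by rintro rfl; exact hi .refl
    rw [hrow, if_neg fun h => hi h.1, if_neg hiv, sub_zero]; rfl

/-- The weights are suitable for the query `(u, v)` in `G'` after the preprocessing of `G`. -/
def GoodWeights {F : Type*} [Field F] (G G' : Digraph (Fin n)) (u v : Fin n)
    (R : Fin n → Fin n → F) : Prop :=
  (walkMat G R).det ≠ 0 ∧ (borderMat G' R u v).det ≠ 0

theorem totalDegree_det_le {σ R : Type*} [CommRing R] {ι : Type*} [Fintype ι]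
    [DecidableEq ι] (M : Matrix ι ι (MvPolynomial σ R)) (h : ∀ i j, (M i j).totalDegree ≤ 1) :
    M.det.totalDegree ≤ Fintype.card ι := by
  rw [det_apply]
  refine MvPolynomial.totalDegree_finsetSum_le fun π _ => ?_
  rw [Units.smul_def]
  refine (MvPolynomial.totalDegree_smul_le _ _).trans
    ((MvPolynomial.totalDegree_finsetProd _ _).trans ?_)
  refine (Finset.sum_le_sum fun i _ => h _ _).trans ?_
  simp

/-- The weights that are given by their row-major layout. -/
def weights {F : Type*} (f : Fin (n * n) → F) (i j : Fin n) : F := f (finProdFinEquiv (i, j))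

-- Schwartz-Zippel for the product of the two determinants, of degree at most n + (n + 1). The first
-- factor is not the zero polynomial because zero weights give the identity matrix, and the second
-- because of the weights along shortest paths.
open Classical in
theorem card_not_goodWeights {F : Type*} [Field F] [Fintype F] {G G' : Digraph (Fin n)}
    {u v : Fin n} (h : Reachable G' u v) :
    (Finset.univ.filter fun f : Fin (n * n) → F => ¬ GoodWeights G G' u v (weights f)).card *
      Fintype.card F ≤ (2 * n + 1) * Fintype.card F ^ (n * n) := by
  let X : Fin n → Fin n → MvPolynomial (Fin (n * n)) F := weights MvPolynomial.X
  have ev : ∀ (f : Fin (n * n) → F) (H : Digraph (Fin n)) (i j : Fin n),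
      MvPolynomial.eval f (walkMat H X i j) = walkMat H (weights f) i j := by
    intro f H i j
    simp only [walkMat, Matrix.sub_apply, Matrix.of_apply, map_sub, Matrix.one_apply]
    split_ifs <;> simp [X, weights]
  have ev1 : ∀ f : Fin (n * n) → F, MvPolynomial.eval f (walkMat G X).det =
      (walkMat G (weights f)).det := by
    intro f
    rw [RingHom.map_det]
    congr 1
    ext i j
    exact ev f G i j
  have ev2 : ∀ f : Fin (n * n) → F, MvPolynomial.eval f (borderMat G' X u v).det =
      (borderMat G' (weights f) u v).det := by
    intro f
    rw [RingHom.map_det]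
    congr 1
    ext i j
    rcases i with i | i <;> rcases j with j | j
    · exact ev f G' i j
    all_goals simp only [borderMat, RingHom.mapMatrix_apply, Matrix.map_apply, fromBlocks_apply₁₂,
      fromBlocks_apply₂₁, fromBlocks_apply₂₂, Matrix.of_apply, Matrix.zero_apply]
    all_goals try split_ifs
    all_goals simp
  have hne1 : (walkMat G X).det ≠ 0 := by
    intro h0
    have := ev1 0
    have h1 : walkMat G (weights (0 : Fin (n * n) → F)) = 1 := by
      ext i j
      simp [walkMat, weights]
    rw [h0, h1] at this
    simp at this
  have hne2 : (borderMat G' X u v).det ≠ 0 := by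
    intro h0
    obtain ⟨R, hR⟩ := exists_det_borderMat_ne_zero (F := F) h
    have := ev2 fun k => R (finProdFinEquiv.symm k).1 (finProdFinEquiv.symm k).2
    have hw : weights (fun k => R (finProdFinEquiv.symm k).1 (finProdFinEquiv.symm k).2) = R := by
      ext i j
      simp [weights]
    rw [h0, hw, map_zero] at this
    exact hR this.symm
  have hdeg : ∀ (H : Digraph (Fin n)) i j, (walkMat H X i j).totalDegree ≤ 1 := by
    intro H i j
    rw [walkMat, Matrix.sub_apply]
    refine (MvPolynomial.totalDegree_sub _ _).trans (max_le ?_ ?_)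
    · rw [Matrix.one_apply]; split_ifs <;> simp
    · simp only [Matrix.of_apply]
      split_ifs <;> simp [X, weights]
  have hdeg1 := totalDegree_det_le (walkMat G X) (hdeg G)
  have hdeg2 := totalDegree_det_le (borderMat G' X u v) fun i j => by
    rcases i with i | i <;> rcases j with j | j
    · exact hdeg G' i j
    all_goals simp only [borderMat, fromBlocks_apply₁₂, fromBlocks_apply₂₁, fromBlocks_apply₂₂,
      Matrix.of_apply, Matrix.zero_apply]
    all_goals try split_ifs
    all_goals simp
  have hdeg3 : ((walkMat G X).det * (borderMat G' X u v).det).totalDegree ≤ 2 * n + 1 := by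
    refine (MvPolynomial.totalDegree_mul _ _).trans ?_
    simp at hdeg1 hdeg2
    omega
  have hsz := MvPolynomial.schwartz_zippel_totalDegree (mul_ne_zero hne1 hne2) Finset.univ
  have hset : (Finset.univ.filter fun f : Fin (n * n) → F =>
      ¬ GoodWeights G G' u v (weights f)) =
      {f ∈ Fintype.piFinset fun _ : Fin (n * n) => (Finset.univ : Finset F) |
        MvPolynomial.eval f ((walkMat G X).det * (borderMat G' X u v).det) = 0} := by
    ext f
    simp [GoodWeights, ev1, ev2, not_and_or, -not_and]
  rw [← hset, Finset.card_univ] at hsz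
  have hF : (0 : ℚ≥0) < Fintype.card F := by exact_mod_cast Fintype.card_pos
  rw [div_le_div_iff₀ (by positivity) hF] at hsz
  have hsz' : (Finset.univ.filter fun f : Fin (n * n) → F =>
      ¬ GoodWeights G G' u v (weights f)).card * Fintype.card F ≤
      ((walkMat G X).det * (borderMat G' X u v).det).totalDegree * Fintype.card F ^ (n * n) := by
    exact_mod_cast hsz
  exact hsz'.trans (Nat.mul_le_mul hdeg3 le_rfl)

end Walk

/-! ## Probabilities -/

-- A union bound over the patterns in `T`, each of which fixes the words at distinct positions.
open scoped ENNReal in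
theorem randomWords_le {w : ℕ} {ι : Type*} [Fintype ι] {idx : ι → ℕ}
    (hidx : Function.Injective idx) (T : Finset (ι → Fin (2 ^ w))) :
    randomWords w {coins | (fun i => coins (idx i)) ∈ T} ≤
      T.card * (((2 ^ w : ℕ) : ℝ≥0∞)⁻¹) ^ Fintype.card ι := by
  classical
  have hsub : {coins : ℕ → Fin (2 ^ w) | (fun i => coins (idx i)) ∈ T} ⊆
      ⋃ g ∈ T, {coins | ∀ i, coins (idx i) = g i} := by
    intro coins h
    simp only [Set.mem_iUnion]
    exact ⟨_, h, fun i => rfl⟩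
  refine (measure_mono hsub).trans ((measure_biUnion_finset_le T _).trans ?_)
  rw [← nsmul_eq_mul]
  refine Finset.sum_le_card_nsmul _ _ _ fun g _ => ?_
  have hset : {coins : ℕ → Fin (2 ^ w) | ∀ i, coins (idx i) = g i} =
      Set.pi (Finset.univ.image idx : Finset ℕ)
        fun k => {x | ∀ i, idx i = k → x = g i} := by
    ext coins
    simp only [Set.mem_ofPred_eq, Set.mem_pi, Finset.coe_image, Finset.coe_univ, Set.image_univ,
      Set.forall_mem_range]
    exact ⟨fun h i j hj => by rw [← h j, hj], fun h i => h i i rfl⟩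
  rw [hset, randomWords, Measure.infinitePi_pi _ fun i _ => (Set.toFinite _).measurableSet,
    Finset.prod_image fun i _ j _ h => hidx h]
  have hone : ∀ i, {x | ∀ j, idx j = idx i → x = g j} = {g i} := by
    intro i
    ext x
    exact ⟨fun h => h i rfl, fun h j hj => by rw [hidx hj]; exact h⟩
  have hpt : ∀ x : Fin (2 ^ w), (PMF.uniformOfFintype (Fin (2 ^ w))).toMeasure {x} =
      ((2 ^ w : ℕ) : ℝ≥0∞)⁻¹ := by
    intro x
    rw [PMF.toMeasure_apply_singleton _ _ (measurableSet_singleton x),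
      PMF.uniformOfFintype_apply, Fintype.card_fin]
  simp only [hone, hpt, Finset.prod_const, Finset.card_univ, le_refl]

/-- Within a residue class modulo `p`, a number is determined by its quotient by `p`. -/
theorem card_fiber_le {W p : ℕ} (a : ZMod p) :
    (Finset.univ.filter fun x : Fin W => ((x : ℕ) : ZMod p) = a).card ≤ W / p + 1 := by
  rw [← Finset.card_range (W / p + 1)]
  refine Finset.card_le_card_of_injOn (fun x => (x : ℕ) / p) (fun x _ => ?_) fun x hx y hy h => ?_
  · simp only [Finset.coe_range, Set.mem_Iio]
    exact Nat.lt_succ_of_le (Nat.div_le_div_right x.2.le)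
  · simp only [Finset.coe_filter, Finset.mem_univ, true_and, Set.mem_ofPred_eq] at hx hy
    have hmod := (ZMod.natCast_eq_natCast_iff' (x : ℕ) y p).1 (hx.trans hy.symm)
    have h : (x : ℕ) / p = (y : ℕ) / p := h
    exact Fin.ext (by rw [← Nat.div_add_mod (x : ℕ) p, ← Nat.div_add_mod (y : ℕ) p, h, hmod])

open Classical in
theorem card_words_le {W p N : ℕ} [NeZero p] (S : Finset (Fin N → ZMod p)) :
    (Finset.univ.filter fun g : Fin N → Fin W => (fun k => ((g k : ℕ) : ZMod p)) ∈ S).card ≤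
      S.card * (W / p + 1) ^ N := by
  have hsub : (Finset.univ.filter fun g : Fin N → Fin W => (fun k => ((g k : ℕ) : ZMod p)) ∈ S) ⊆
      S.biUnion fun f => Fintype.piFinset fun k =>
        Finset.univ.filter fun x : Fin W => ((x : ℕ) : ZMod p) = f k := by
    intro g hg
    simp only [Finset.mem_filter, Finset.mem_univ, true_and] at hg
    simp only [Finset.mem_biUnion, Fintype.mem_piFinset, Finset.mem_filter, Finset.mem_univ,
      true_and]
    exact ⟨_, hg, fun _ => rfl⟩
  refine (Finset.card_le_card hsub).trans (Finset.card_biUnion_le.trans ?_)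
  refine Finset.sum_le_card_nsmul _ _ _ fun f _ => ?_
  rw [Fintype.card_piFinset]
  refine (Finset.prod_le_prod' fun k _ => card_fiber_le (f k)).trans ?_
  simp

/-- (1 + p / W) ^ N ≤ exp (p N / W) ≤ e ≤ 3. This bounds the bias of random words reduced modulo
`p`: for long words, no event becomes more than three times as likely as under uniform residues. -/
theorem add_pow_le_three_mul {W p N : ℕ} (h : p * N ≤ W) : (W + p) ^ N ≤ 3 * W ^ N := by
  rcases Nat.eq_zero_or_pos W with rfl | hW
  · rcases Nat.eq_zero_or_pos N with rfl | hN
    · simp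
    · have : p = 0 := by
        rcases Nat.eq_zero_or_pos p with h0 | h0
        · exact h0
        · have := Nat.mul_pos h0 hN; omega
      subst this
      simp [hN.ne']
  have hW' : (0 : ℝ) < W := by exact_mod_cast hW
  have key : ((1 : ℝ) + p / W) ^ N ≤ 3 := by
    calc ((1 : ℝ) + p / W) ^ N ≤ Real.exp (p / W) ^ N := by
          refine pow_le_pow_left₀ (by positivity) ?_ _
          rw [add_comm]; exact Real.add_one_le_exp _
      _ = Real.exp (N * (p / W)) := (Real.exp_nat_mul _ _).symm
      _ ≤ Real.exp 1 := by
          refine Real.exp_le_exp.2 ?_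
          rw [← mul_div_assoc, div_le_one hW', mul_comm]
          exact_mod_cast h
      _ ≤ 3 := (Real.exp_one_lt_d9.trans (by norm_num)).le
  have : ((W : ℝ) + p) ^ N ≤ 3 * (W : ℝ) ^ N := by
    calc ((W : ℝ) + p) ^ N = ((1 : ℝ) + p / W) ^ N * (W : ℝ) ^ N := by
          rw [← mul_pow]; congr 1; field_simp
      _ ≤ _ := by gcongr
  exact_mod_cast this

theorem block_index_inj {L reps : ℕ} :
    Function.Injective fun x : Fin reps × Fin L => (x.1 : ℕ) * L + x.2 := by
  rintro ⟨a, b⟩ ⟨a', b'⟩ h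
  have := index_inj b.2 b'.2 h
  exact Prod.ext (Fin.ext this.1) (Fin.ext this.2)

open scoped ENNReal in
/-- With high probability, some of the weight functions are good. -/
theorem randomWords_bad_le {w n p q : ℕ} (c : ℕ) [hpp : Fact p.Prime] (hn : 1 ≤ n) (hq : n ≤ q ^ 3)
    (hp : 9 * q ^ 4 < p) (hw : p * (n * n) ≤ 2 ^ w) {G G' : Digraph (Fin n)} {u v : Fin n}
    (h : Reachable G' u v) :
    randomWords w {coins | ∀ r < 3 * c, ¬ GoodWeights G G' u v
      (weights fun k : Fin (n * n) => (((coins (r * (n * n) + k) : Fin (2 ^ w)) : ℕ) : ZMod p))} ≤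
      ((n : ℝ≥0∞) ^ c)⁻¹ := by
  classical
  have : NeZero p := ⟨hpp.out.ne_zero⟩
  have hq0 : 0 < q := by
    rcases Nat.eq_zero_or_pos q with rfl | h
    · simp at hq; omega
    · exact h
  set S := Finset.univ.filter fun f : Fin (n * n) → ZMod p => ¬ GoodWeights G G' u v (weights f)
    with hS
  have hScard := card_not_goodWeights (F := ZMod p) (G := G) h
  rw [ZMod.card, ← hS] at hScard
  set B := Finset.univ.filter fun g : Fin (n * n) → Fin (2 ^ w) =>
    (fun k => ((g k : ℕ) : ZMod p)) ∈ S with hB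
  have hBcard : B.card ≤ S.card * (2 ^ w / p + 1) ^ (n * n) := card_words_le S
  -- A single repetition fails with probability at most 3 (2 n + 1) / p ≤ 9 q ^ 3 / (9 q ^ 4) = 1 /
  -- q.
  have hBq : B.card * q ≤ (2 ^ w) ^ (n * n) := by
    have h1 : (p * (2 ^ w / p + 1)) ^ (n * n) ≤ 3 * (2 ^ w) ^ (n * n) := by
      refine (Nat.pow_le_pow_left ?_ _).trans (add_pow_le_three_mul hw)
      rw [mul_add, mul_one]
      exact Nat.add_le_add_right (Nat.mul_div_le _ _) _
    have h2 : B.card * p ≤ (2 * n + 1) * (3 * (2 ^ w) ^ (n * n)) := by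
      calc B.card * p ≤ S.card * (2 ^ w / p + 1) ^ (n * n) * p := Nat.mul_le_mul hBcard le_rfl
        _ = S.card * p * (2 ^ w / p + 1) ^ (n * n) := by ring
        _ ≤ (2 * n + 1) * p ^ (n * n) * (2 ^ w / p + 1) ^ (n * n) :=
            Nat.mul_le_mul hScard le_rfl
        _ = (2 * n + 1) * (p * (2 ^ w / p + 1)) ^ (n * n) := by rw [mul_pow]; ring
        _ ≤ _ := Nat.mul_le_mul le_rfl h1
    have h3 : B.card * (9 * q ^ 4) ≤ 3 * q ^ 3 * (3 * (2 ^ w) ^ (n * n)) :=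
      (Nat.mul_le_mul le_rfl hp.le).trans (h2.trans (Nat.mul_le_mul (by omega) le_rfl))
    have h4 : 9 * q ^ 3 * (B.card * q) ≤ 9 * q ^ 3 * (2 ^ w) ^ (n * n) := by
      calc _ = B.card * (9 * q ^ 4) := by ring
        _ ≤ _ := h3
        _ = _ := by ring
    exact Nat.le_of_mul_le_mul_left h4 (by positivity)
  -- Repetitions use disjoint segments of the random words, so the patterns that are bad throughout
  -- form a power of `B`. The exponent `3 * c` turns 1 / q into at most n ^ (-c), since n ≤ q ^ 3.
  let T : Finset (Fin (3 * c) × Fin (n * n) → Fin (2 ^ w)) :=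
    Finset.univ.filter fun g => ∀ r, (fun k => g (r, k)) ∈ B
  have hT : T.card = B.card ^ (3 * c) := by
    have := Fintype.card_piFinset fun _ : Fin (3 * c) => B
    rw [Finset.prod_const, Finset.card_univ, Fintype.card_fin] at this
    rw [← this]
    refine Finset.card_bij (fun g _ r k => g (r, k)) (fun g hg => ?_) (fun g _ g' _ he => ?_)
      fun f hf => ⟨fun x => f x.1 x.2, ?_, rfl⟩
    · exact Fintype.mem_piFinset.2 (Finset.mem_filter.1 hg).2
    · exact funext fun x => congrFun (congrFun he x.1) x.2
    · exact Finset.mem_filter.2 ⟨Finset.mem_univ _, Fintype.mem_piFinset.1 hf⟩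
  have hsub : {coins : ℕ → Fin (2 ^ w) | ∀ r < 3 * c, ¬ GoodWeights G G' u v
      (weights fun k : Fin (n * n) => (((coins (r * (n * n) + k) : Fin (2 ^ w)) : ℕ) : ZMod p))} ⊆
      {coins | (fun x : Fin (3 * c) × Fin (n * n) => coins ((x.1 : ℕ) * (n * n) + x.2)) ∈ T} := by
    intro coins hc
    refine Finset.mem_filter.2 ⟨Finset.mem_univ _, fun r => ?_⟩
    refine Finset.mem_filter.2 ⟨Finset.mem_univ _, ?_⟩
    exact Finset.mem_filter.2 ⟨Finset.mem_univ _, hc r r.2⟩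
  refine (measure_mono hsub).trans ((randomWords_le block_index_inj T).trans ?_)
  rw [hT, Fintype.card_prod, Fintype.card_fin, Fintype.card_fin, mul_comm (3 * c) (n * n),
    pow_mul _ (n * n), Nat.cast_pow, ← mul_pow]
  have hle : (B.card : ℝ≥0∞) * (((2 ^ w : ℕ) : ℝ≥0∞)⁻¹) ^ (n * n) ≤ (q : ℝ≥0∞)⁻¹ := by
    rw [← ENNReal.inv_pow, ← div_eq_mul_inv, ENNReal.div_le_iff (by simp) (by finiteness),
      mul_comm (q : ℝ≥0∞)⁻¹, ← div_eq_mul_inv, ENNReal.le_div_iff_mul_le (by simp [hq0.ne']) (by simp)]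
    exact_mod_cast hBq
  refine (pow_le_pow_left' hle _).trans ?_
  rw [pow_mul, ← ENNReal.inv_pow, ← ENNReal.inv_pow]
  refine ENNReal.inv_le_inv.2 (pow_le_pow_left' ?_ _)
  exact_mod_cast hq

/-! ## The exponent is at least two -/

/-- Field memory changes only by `store`, one cell per step. -/
theorem card_changed_le {K : Type} [Field K] [DecidableEq K] {w : ℕ} {P : Prog ArithInstr}
    {s s' : ArithState K} {t : ℕ}
    (h : Exec (fun s => s.word.reg) (ArithInstr.act w) P s t s') (a : ℕ) (F : Finset ℕ) :
    (F.filter fun i => s'.fmem a i ≠ s.fmem a i).card ≤ t := by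
  have trans : ∀ {s s' s'' : ArithState K} {t t' : ℕ},
      (F.filter fun i => s'.fmem a i ≠ s.fmem a i).card ≤ t →
      (F.filter fun i => s''.fmem a i ≠ s'.fmem a i).card ≤ t' →
      (F.filter fun i => s''.fmem a i ≠ s.fmem a i).card ≤ t + t' := by
    intro s s' s'' t t' h1 h2
    refine le_trans (Finset.card_le_card fun i hi => ?_) ((Finset.card_union_le _ _).trans
      (Nat.add_le_add h1 h2))
    simp only [Finset.mem_union, Finset.mem_filter] at hi ⊢
    by_cases hc : s'.fmem a i = s.fmem a i
    · exact .inr ⟨hi.1, by rw [hc]; exact hi.2⟩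
    · exact .inl ⟨hi.1, hc⟩
  induction h with
  | skip s => simp
  | instr i s =>
    cases i with
    | store b j r =>
      refine (Finset.card_le_card (t := {s.word.reg j}) fun i hi => ?_).trans (by simp)
      have hi := (Finset.mem_filter.1 hi).2
      by_contra hne
      rw [Finset.mem_singleton] at hne
      refine hi ?_
      by_cases hab : a = b
      · subst hab; simp [ArithInstr.act, hne]
      · simp [ArithInstr.act, hab]
    | _ => simp [ArithInstr.act]
  | seq _ _ ih1 ih2 => exact trans ih1 ih2
  | ite_true _ _ ih => omega
  | ite_false _ _ ih => omega
  | loop_done => simp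
  | loop_step _ _ _ ih1 ih2 => exact (trans ih1 ih2).trans (by omega)

/-- The product is the all-ones matrix, while the output array is initially zero, so every one of
its cells has to change. -/
theorem sq_le_of_mul {P : Prog ArithInstr} {w n t : ℕ} {s : ArithState (ZMod 2)} {coins : ℕ → ℕ}
    (h : Exec (fun s => s.word.reg) (ArithInstr.act w) P
      (mulInput (Matrix.of fun _ _ => 1 : Matrix (Fin n) (Fin n) (ZMod 2)) 1 coins) t s)
    (hs : ∀ i j : Fin n, s.fmem 2 (i * n + j) =
      ((Matrix.of fun _ _ => 1 : Matrix (Fin n) (Fin n) (ZMod 2)) *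
        (1 : Matrix (Fin n) (Fin n) (ZMod 2))) i j) : n * n ≤ t := by
  refine le_trans ?_ (card_changed_le h 2 (Finset.range (n * n)))
  rw [Finset.filter_true_of_mem, Finset.card_range]
  intro k hk
  have hk := Finset.mem_range.1 hk
  have hn : 0 < n := Nat.pos_of_ne_zero fun h0 => by simp [h0] at hk
  have := hs ⟨k / n, Nat.div_lt_of_lt_mul hk⟩ ⟨k % n, Nat.mod_lt _ hn⟩
  rw [Nat.div_add_mod'] at this
  rw [this]
  simp [mulInput]

/-- Otherwise n ^ 2 ≤ C n ^ ω would fail for large n. The bound is needed to absorb all quadratic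
overheads and to balance the levels of the elimination. -/
theorem two_le_of_isMatMulExponent {ω : ℝ} (hω : IsMatMulExponent ω) : 2 ≤ ω := by
  obtain ⟨P, κ, C, h⟩ := hω
  by_contra! hlt
  have : Fact (Nat.Prime 2) := ⟨Nat.prime_two⟩
  have hC : ∀ n : ℕ, 1 ≤ n → (n : ℝ) ^ (2 - ω) ≤ C := by
    intro n hn
    obtain ⟨w, hw⟩ : ∃ w, (n + 2) ^ κ ≤ 2 ^ w := ⟨_, Nat.lt_two_pow_self.le⟩
    obtain ⟨t, s, h1, h2, h3⟩ := h 2 n w hn hw (Matrix.of fun _ _ => 1) 1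
      fun _ => ⟨0, by positivity⟩
    have h4 : ((n * n : ℕ) : ℝ) ≤ t := by exact_mod_cast sq_le_of_mul h1 h2
    have hn0 : (0 : ℝ) < n := by exact_mod_cast hn
    rw [Real.rpow_sub hn0, div_le_iff₀ (Real.rpow_pos_of_pos hn0 ω)]
    refine le_trans (le_of_eq ?_) (h4.trans h3)
    push_cast
    rw [Real.rpow_two]; ring
  have ht : Filter.Tendsto (fun n : ℕ => (n : ℝ) ^ (2 - ω)) Filter.atTop Filter.atTop :=
    (tendsto_rpow_atTop (by linarith)).comp tendsto_natCast_atTop_atTop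
  obtain ⟨n, h1, h2⟩ := ((ht.eventually_gt_atTop C).and (Filter.eventually_ge_atTop 1)).exists
  exact absurd (hC n h2) (not_le.2 h1)

/-! ## The prime, the inverse table, and the size -/

attribute [simp] St.set_v

/-- Register `14` := the least `q ≥ 1` whose cube is at least the content of register `10`. -/
def cbrtP : WordProg :=
  asg 14 (.lit 1) ;;
  forP 22 10 (ifP ((Ex.var 14 * .var 14 * .var 14 : Ex).ltE (.var 10)) (asg 14 (.var 14 + .lit 1))
    .skip)

/-- Register `3` := a prime above `9 * q ^ 4`. -/
def primeP : WordProg :=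
  asg 15 (.lit 5 * (.var 14 * .var 14)) ;;
  asg 17 (.lit 9 * (.var 14 * .var 14 * (.var 14 * .var 14))) ;;
  asg 3 (.lit 0) ;;
  forP 22 17 (
    asg 23 (.var 17 + .lit 1 + .var 22) ;;
    asg 25 (.lit 1) ;;
    forP 24 15 (asg 25 (.var 25 * (Ex.lit 0).ltE (.var 23 % (.var 24 + .lit 2)))) ;;
    ifP (.var 25) (asg 3 (.var 23)) .skip)

/-- Array `4` := the table of inverses modulo the prime in register `3`. -/
def tableP : WordProg :=
  forP 22 3 (ifP ((Ex.var 22).ltE (.lit 2)) (sto 4 (.var 22) (.var 22))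
    (sto 4 (.var 22) ((.var 3 - .var 3 / .var 22) * .get 4 (.var 3 % .var 22) % .var 3)))

/-- Register `20` := the least power of two that is at least the content of register `l`. -/
def powP (l : ℕ) : WordProg :=
  asg 20 (.lit 1) ;; asg 21 (.lit 0) ;;
  forP 22 l (ifP ((Ex.var 20).ltE (.var l)) (asg 20 (.var 20 * .lit 2) ;; asg 21 (.var 21 + .lit 1))
    .skip)

theorem exists_le_cube (n : ℕ) : ∃ q, 1 ≤ q ∧ n ≤ q ^ 3 :=
  ⟨n + 1, by omega, (Nat.le_succ n).trans (Nat.le_self_pow (by norm_num) _)⟩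

/-- The least `q ≥ 1` with `n ≤ q ^ 3`. -/
def cubeRoot (n : ℕ) : ℕ := Nat.find (exists_le_cube n)

/-- The characteristic of the field for graphs with `n` nodes. -/
def fieldChar (n : ℕ) : ℕ := Nat.findGreatest Nat.Prime (18 * cubeRoot n ^ 4)

section

variable {w : ℕ} {s : St} {Q : St → Prop}

/-- As long as the cube is too small, the candidate grows in every round, so `n` rounds suffice. An
increase at most doubles the candidate, whence the factor 8 in the bound for its cube. -/
theorem HT.cbrtP {n : ℕ} (hw : (n + 1) ^ 3 + 2 < 2 ^ w) (hn : s.v 10 = n)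
    (hQ : ∀ s' q, Agree [14, 22] [] s s' → s'.v 14 = q → 1 ≤ q → n ≤ q ^ 3 → q ^ 3 ≤ 8 * n + 1 →
      q = cubeRoot n → Q s') :
    HT false w cbrtP s (n * 40 + 20) Q := by
  have hw0 : 0 < w := Nat.pos_of_ne_zero fun h => by subst h; simp at hw
  have hn1 : n ≤ (n + 1) ^ 3 := (Nat.le_succ n).trans (Nat.le_self_pow (by norm_num) _)
  apply HT.time_le
  case h =>
    apply HT.seq
    refine HT.asg (by simp; omega) (by norm_num) ?_
    refine HT.forP (N := n) (T := fun _ => 20) (fun i s' => Agree [14, 22] [] s s' ∧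
      1 ≤ s'.v 14 ∧ (n ≤ s'.v 14 ^ 3 ∨ s'.v 14 = i + 1) ∧ s'.v 14 ≤ i + 1 ∧
      s'.v 14 ^ 3 ≤ 8 * n + 1 ∧ ∀ q, 1 ≤ q → n ≤ q ^ 3 → s'.v 14 ≤ q) (by norm_num) (by norm_num) (by norm_num)
      (by simp [hn]) hw0 ⟨((Agree.refl s).set (by simp) _).set (by simp) _, by simp +contextual⟩
      ?_ ?_
    · rintro i hi s1 ⟨A1, h1, h2, h3, h4, hmin⟩ e22 e10
      have hq3 : s1.v 14 ^ 3 ≤ (n + 1) ^ 3 := Nat.pow_le_pow_left (by omega) 3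
      have hq2 : s1.v 14 * s1.v 14 ≤ s1.v 14 ^ 3 := by
        rw [show s1.v 14 ^ 3 = s1.v 14 * s1.v 14 * s1.v 14 by ring]
        exact Nat.le_mul_of_pos_right _ h1
      have hcube : s1.v 14 * s1.v 14 * s1.v 14 = s1.v 14 ^ 3 := by ring
      have hok : ((Ex.var 14 * .var 14 * .var 14 : Ex).ltE (.var 10)).ok false w s1 := by
        simp; omega
      by_cases hc : s1.v 14 ^ 3 < n
      · refine (HT.ifP_pos hok (by simp [hcube, e10, hc]) (HT.asg (by simp; omega) (by norm_num)
          ⟨by simp [e22], by simp [e10], (A1.set (by simp) _).set (by simp) _, ?_⟩)).time_le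
          (by simp)
        have h5 : (s1.v 14 + 1) ^ 3 ≤ 8 * s1.v 14 ^ 3 := by
          calc (s1.v 14 + 1) ^ 3 ≤ (2 * s1.v 14) ^ 3 := Nat.pow_le_pow_left (by omega) 3
            _ = _ := by ring
        have h6 : ∀ q, 1 ≤ q → n ≤ q ^ 3 → s1.v 14 + 1 ≤ q := fun q _ hq =>
          lt_of_pow_lt_pow_left₀ 3 (by omega) (hc.trans_le hq)
        simp
        exact ⟨by omega, h3, by omega, h6⟩
      · refine (HT.ifP_neg hok (by simp [hcube, e10, hc]) (HT.skip
          ⟨e22, e10, A1.set (by simp) _, ?_⟩)).time_le (by simp)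
        simp
        exact ⟨h1, by omega, by omega, h4, hmin⟩
    · rintro s1 ⟨A1, h1, h2, h3, h4, hmin⟩ -
      have h5 : n ≤ s1.v 14 ^ 3 := by
        rcases h2 with h2 | h2
        · exact h2
        · rw [h2]; exact hn1
      have hf := Nat.find_spec (exists_le_cube n)
      exact hQ s1 _ A1 rfl h1 h5 h4 (le_antisymm (hmin _ hf.1 hf.2)
        (Nat.find_min' (exists_le_cube n) ⟨h1, h5⟩))
  simp; omega

/-- Bertrand's postulate provides a prime in the range. Trial divisors up to 5 q ^ 2 + 1 suffice,
since a composite number up to 18 q ^ 4 has a factor whose square is at most 18 q ^ 4 < (5 q ^ 2) ^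
2. The search continues to the end and keeps the last prime, so the modulus is the greatest prime in
the range, a function of `n` alone. -/
theorem HT.primeP {q : ℕ} (hw : 18 * q ^ 4 + 2 < 2 ^ w) (hq : 1 ≤ q) (h14 : s.v 14 = q)
    (hQ : ∀ s' p, Agree [3, 15, 17, 22, 23, 24, 25] [] s s' → s'.v 3 = p → p.Prime →
      9 * q ^ 4 < p → p ≤ 18 * q ^ 4 → p = Nat.findGreatest Nat.Prime (18 * q ^ 4) → Q s') :
    HT false w primeP s (2000 * q ^ 6) Q := by
  have hw0 : 0 < w := Nat.pos_of_ne_zero fun h => by subst h; simp at hw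
  have hq2 : 1 ≤ q ^ 2 := Nat.one_le_pow _ _ hq
  have hq24 : q ^ 2 ≤ q ^ 4 := Nat.pow_le_pow_right hq (by norm_num)
  have e2 : q * q = q ^ 2 := by ring
  have e4 : q ^ 2 * q ^ 2 = q ^ 4 := by ring
  apply HT.time_le
  case h =>
    apply HT.seq
    refine HT.asg (by simp [h14, e2]; omega) (by norm_num) ?_
    simp only [Ex.ev_mul, Ex.ev_lit, Ex.ev_var, h14, e2]
    apply HT.seq
    refine HT.asg (by simp [h14, e2, e4]; omega) (by norm_num) ?_
    have ev17 : (Ex.lit 9 * (.var 14 * .var 14 * (.var 14 * .var 14))).ev (s.set 15 (5 * q ^ 2)) =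
        9 * q ^ 4 := by simp [h14, e2, e4]
    rw [ev17]
    apply HT.seq
    refine HT.asg (by simp) (by norm_num) ?_
    refine HT.forP (N := 9 * q ^ 4) (T := fun _ => 9 + (3 + ((5 * q ^ 2 * 26 + 9) + 8)))
      (fun i s' => Agree [3, 15, 17, 22, 23, 24, 25] [] s s' ∧ s'.v 15 = 5 * q ^ 2 ∧
        (∀ z < i, (9 * q ^ 4 + 1 + z).Prime → 9 * q ^ 4 + 1 + z ≤ s'.v 3) ∧
        ((s'.v 3).Prime ∧ 9 * q ^ 4 < s'.v 3 ∧ s'.v 3 ≤ 18 * q ^ 4 ∨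
          ∀ z < i, ¬ (9 * q ^ 4 + 1 + z).Prime)) (by norm_num) (by norm_num) (by norm_num)
      (by simp) hw0 ⟨?_, by simp, by simp⟩ ?_ ?_
    · exact ((((Agree.refl s).set (by simp) _).set (by simp) _).set (by simp) _).set (by simp) _
    · rintro i hi s1 ⟨A1, e15, hmax, h1⟩ e22 e17
      apply HT.seq
      refine (HT.asg (by simp [e17, e22]; omega) (by norm_num) ?_).time_le (show _ ≤ 9 by simp)
      simp only [Ex.ev_add, Ex.ev_lit, Ex.ev_var, e17, e22]
      obtain ⟨z, hz⟩ : ∃ z, z = 9 * q ^ 4 + 1 + i := ⟨_, rfl⟩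
      rw [← hz]
      apply HT.seq
      refine (HT.asg (by simp; omega) (by norm_num) ?_).time_le (show _ ≤ 3 by simp)
      apply HT.seq
      refine (HT.forP (N := 5 * q ^ 2) (T := fun _ => 14)
        (fun y s' => Agree [24, 25] [] (s1.set 23 z) s' ∧
          s'.v 25 ≤ 1 ∧ (s'.v 25 = 0 ↔ ∃ d < y, (d + 2) ∣ z)) (by norm_num) (by norm_num)
        (by norm_num) (by simp [e15]) hw0 ⟨?_, by simp, by simp⟩ ?_ ?_).time_le (by simp)
      · exact ((Agree.refl _).set (by simp) _).set (by simp) _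
      · rintro y hy s2 ⟨A2, g1, g2⟩ e24 e15'
        have e23 : s2.v 23 = z := by rw [A2.v 23 (by simp)]; simp
        refine (HT.asg ?_ (by norm_num) ⟨by simp [e24], by simp [e15'],
          (A2.set (by simp) _).set (by simp) _, ?_, ?_⟩).time_le (by simp)
        · simp only [Ex.ok_mul, Ex.ok_var, Ex.ok_ltE, Ex.ok_lit, Ex.ok_mod, Ex.ok_add, Ex.ev_var,
            Ex.ev_ltE, Ex.ev_lit, Ex.ev_mod, Ex.ev_add, e23, e24]
          refine ⟨by norm_num, ⟨by omega, ⟨by norm_num, by norm_num, by omega, by omega⟩, hw0⟩, ?_⟩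
          split_ifs <;> omega
        · simp only [Ex.ev_mul, Ex.ev_ltE, Ex.ev_var]
          rw [St.set_v_ne _ _ (by norm_num), St.set_v_self]
          split_ifs <;> omega
        · rw [St.set_v_ne _ _ (by norm_num), St.set_v_self]
          simp only [Ex.ev_mul, Ex.ev_ltE, Ex.ev_var, Ex.ev_lit, Ex.ev_mod, Ex.ev_add, e23, e24,
            Nat.lt_succ_iff_lt_or_eq, or_and_right, exists_or, exists_eq_left, ← g2]
          rw [Nat.dvd_iff_mod_eq_zero]
          by_cases hd : z % (y + 2) = 0 <;> simp [hd, Nat.pos_iff_ne_zero]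
      · rintro s2 ⟨A2, g1, g2⟩ -
        have hprime : z.Prime ↔ s2.v 25 ≠ 0 := by
          rw [Ne, g2]
          constructor
          · rintro hp ⟨d, hd, hdz⟩
            rcases (Nat.dvd_prime hp).1 hdz with h | h <;> omega
          · intro h
            by_contra hnp
            have hz2 : 2 ≤ z := by omega
            have h1 := Nat.minFac_sq_le_self (by omega) hnp
            have h2 := (Nat.minFac_prime (n := z) (by omega)).two_le
            have h3 : z.minFac < 5 * q ^ 2 + 1 := by
              by_contra! h3
              have := Nat.pow_le_pow_left h3 2
              nlinarith
            refine h ⟨z.minFac - 2, by omega, ?_⟩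
            rw [Nat.sub_add_cancel h2]
            exact Nat.minFac_dvd z
        have A3 : Agree [3, 15, 17, 22, 23, 24, 25] [] s s2 :=
          (A1.set (by simp) _).trans A2 (by simp) (by simp)
        have e23 : s2.v 23 = z := by rw [A2.v 23 (by simp)]; simp
        have e3 : s2.v 3 = s1.v 3 := by rw [A2.v 3 (by simp)]; simp
        have e15' : s2.v 15 = 5 * q ^ 2 := by rw [A2.v 15 (by simp)]; simp [e15]
        have e22' : s2.v 22 = i := by rw [A2.v 22 (by simp)]; simp [e22]
        have e17' : s2.v 17 = 9 * q ^ 4 := by rw [A2.v 17 (by simp)]; simp [e17]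
        by_cases hp : z.Prime
        · refine (HT.ifP_pos (e := .var 25) (by simp) (hprime.1 hp) (HT.asg (by simp) (by norm_num)
            ⟨by simp [e22'], by simp [e17'], (A3.set (by simp) _).set (by simp) _, by simp [e15'],
              fun x hx _ => ?_, .inl ?_⟩)).time_le (by simp)
          · simp [e23]
            omega
          · simp [e23, hp]
            omega
        · refine (HT.ifP_neg (e := .var 25) (by simp) (not_not.1 fun h => hp (hprime.2 h)) (HT.skip
            ⟨e22', e17', A3.set (by simp) _, by simp [e15'], fun x hx hxp => ?_, ?_⟩)).time_le
              (by simp)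
          · rcases Nat.lt_succ_iff_lt_or_eq.1 hx with hx | rfl
            · simpa [e3] using hmax x hx hxp
            · exact absurd (hz ▸ hxp) hp
          refine h1.imp (fun h => by simpa [e3] using h) fun h x hx => ?_
          rcases Nat.lt_succ_iff_lt_or_eq.1 hx with hx | rfl
          · exact h x hx
          · rwa [← hz]
    · rintro s1 ⟨A1, e15, hmax, h1⟩ -
      rcases h1 with ⟨h1, h2, h3⟩ | h1
      · refine hQ s1 _ A1 rfl h1 h2 h3 (((Nat.findGreatest_eq_iff).2 ⟨h3, fun _ => h1,
          fun z hz1 hz2 hzp => ?_⟩).symm)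
        have := hmax (z - (9 * q ^ 4 + 1)) (by omega)
        rw [Nat.add_sub_cancel' (by omega)] at this
        exact absurd (this hzp) (by omega)
      · obtain ⟨p, hp, h2, h3⟩ := Nat.exists_prime_lt_and_le_two_mul (9 * q ^ 4) (by positivity)
        refine absurd hp ?_
        have := h1 (p - (9 * q ^ 4 + 1)) (by omega)
        rwa [Nat.add_sub_cancel' (by omega)] at this
  have e6 : q ^ 4 * q ^ 2 = q ^ 6 := by ring
  have h46 : q ^ 4 ≤ q ^ 6 := Nat.pow_le_pow_right hq (by norm_num)
  have h1 : 1 ≤ q ^ 6 := Nat.one_le_pow _ _ hq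
  simp only [Finset.sum_const, Finset.card_range, smul_eq_mul, sz_asg, Ex.csz_mul, Ex.csz_lit,
    Ex.csz_var]
  have : 9 * q ^ 4 * (9 + (3 + (5 * q ^ 2 * 26 + 9 + 8)) + 12) = 1170 * q ^ 6 + 369 * q ^ 4 := by
    ring
  omega

/-- From p = i (p / i) + p % i one gets i⁻¹ = -(p / i) (p % i)⁻¹, where p % i < i is already
tabulated and nonzero. -/
theorem HT.tableP {p : ℕ} [hpp : Fact p.Prime] (hw : p * p + 2 < 2 ^ w) (hp : s.v 3 = p)
    (hQ : ∀ s', Agree [22] [4] s s' → (∀ x : ZMod p, s'.arr 4 x.val = (x⁻¹).val) → Q s') :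
    HT false w tableP s (p * 40 + 9) Q := by
  have hw0 : 0 < w := Nat.pos_of_ne_zero fun h => by subst h; simp at hw
  have hp2 := hpp.out.two_le
  refine (HT.forP (N := p) (T := fun _ => 26) (fun i s' => Agree [22] [4] s s' ∧
    ∀ x < i, s'.arr 4 x = ((x : ZMod p)⁻¹).val) (by norm_num) (by norm_num) (by norm_num)
    hp hw0 ⟨(Agree.refl s).set (by simp) _, by simp⟩ ?_ ?_).time_le (by simp; omega)
  · rintro i hi s1 ⟨A1, h1⟩ e22 e3
    have hpost : ∀ y, y = ((i : ZMod p)⁻¹).val → ∀ x < i + 1, ((s1.put 4 i y).set 22 (i + 1)).arr 4 x =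
        ((x : ZMod p)⁻¹).val := by
      intro y hy x hx
      rw [St.set_arr, St.put_arr_self]
      rcases Nat.lt_succ_iff_lt_or_eq.1 hx with hx | rfl
      · rw [Function.update_of_ne hx.ne, h1 x hx]
      · rw [Function.update_self, hy]
    have hok : ((Ex.var 22).ltE (.lit 2)).ok false w s1 := by simp; omega
    by_cases hi2 : i < 2
    · refine (HT.ifP_pos hok (by simp [e22, hi2]) (HT.sto (by simp) (by simp)
        (.inr (by norm_num)) ⟨by simp [e22], by simp [e3], (A1.put (by simp) _ _).set (by simp) _,
          ?_⟩)).time_le (by simp)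
      simp only [Ex.ev_var, e22]
      refine hpost i ?_
      interval_cases i
      · simp
      · have : Fact (1 < p) := ⟨hp2⟩
        simp [ZMod.val_one]
    · have hmod : p % i < i := Nat.mod_lt _ (by omega)
      have hdiv : p / i ≤ p := Nat.div_le_self _ _
      have h4 := h1 _ hmod
      have h4lt := ZMod.val_lt ((p % i : ℕ) : ZMod p)⁻¹
      refine (HT.ifP_neg hok (by simp [e22, hi2]) (HT.sto (by simp) ?_
        (.inr (by norm_num)) ⟨by simp [e22], by simp [e3], (A1.put (by simp) _ _).set (by simp) _,
          ?_⟩)).time_le (by simp)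
      · have := Nat.mul_le_mul (Nat.sub_le p (p / i)) h4lt.le
        simp [e22, e3, h4]
        omega
      · simp only [Ex.ev_mod, Ex.ev_mul, Ex.ev_sub, Ex.ev_div, Ex.ev_get, Ex.ev_var, e22, e3, h4]
        refine hpost _ (mod_eq_val ?_)
        have hi0 : (i : ZMod p) ≠ 0 := by
          rw [Ne, ZMod.natCast_eq_zero_iff]
          exact Nat.not_dvd_of_pos_of_lt (by omega) hi
        have hr0 : ((p % i : ℕ) : ZMod p) ≠ 0 := by
          rw [Ne, ZMod.natCast_eq_zero_iff]
          refine Nat.not_dvd_of_pos_of_lt (Nat.pos_of_ne_zero fun h0 => ?_) (by omega)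
          rcases (Nat.dvd_prime hpp.out).1 (Nat.dvd_of_mod_eq_zero h0) with h | h <;> omega
        have hsum : ((i * (p / i) + p % i : ℕ) : ZMod p) = 0 := by
          rw [Nat.div_add_mod]; simp
        push_cast at hsum
        rw [Nat.cast_mul, Nat.cast_sub hdiv, ZMod.natCast_self, ZMod.natCast_val, ZMod.cast_id]
        field_simp
        linear_combination -hsum
  · rintro s1 ⟨A1, h1⟩ -
    refine hQ s1 A1 fun x => ?_
    rw [h1 _ (ZMod.val_lt x), ZMod.natCast_val, ZMod.cast_id]

theorem HT.powP {l n : ℕ} (hw : 2 * n + 2 < 2 ^ w) (hl : l < 63) (hl' : l ∉ [20, 21, 22])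
    (hn : s.v l = n) (hQ : ∀ s' m K, Agree [20, 21, 22] [] s s' → s'.v 20 = m → s'.v 21 = K →
      m = 2 ^ K → n ≤ m → m ≤ 2 * n + 1 → Q s') :
    HT false w (powP l) s (n * 40 + 20) Q := by
  have hw0 : 0 < w := Nat.pos_of_ne_zero fun h => by subst h; simp at hw
  simp only [List.mem_cons, not_or] at hl'
  obtain ⟨l20, l21, l22, -⟩ := hl'
  apply HT.time_le
  case h =>
    apply HT.seq
    refine HT.asg (by simp; omega) (by norm_num) ?_
    apply HT.seq
    refine HT.asg (by simp) (by norm_num) ?_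
    refine HT.forP (N := n) (T := fun _ => 20) (fun i s' => Agree [20, 21, 22] [] s s' ∧
      s'.v 20 = 2 ^ s'.v 21 ∧ (n ≤ s'.v 20 ∨ i < s'.v 20) ∧ s'.v 20 ≤ 2 * n + 1)
      (by norm_num) hl l22 (by simp [l20, l21, hn]) hw0
      ⟨(((Agree.refl s).set (by simp) _).set (by simp) _).set (by simp) _, by simp, by simp,
        by simp⟩ ?_ ?_
    · rintro i hi s1 ⟨A1, h1, h2, h3⟩ e22 el
      have hok : ((Ex.var 20).ltE (.var l)).ok false w s1 := by simp; omega
      have h21 : s1.v 21 < s1.v 20 := by rw [h1]; exact Nat.lt_two_pow_self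
      by_cases hc : s1.v 20 < n
      · refine (HT.ifP_pos (T := 12) hok (by simp [el, hc]) ?_).time_le (by simp)
        apply HT.time_le
        case h =>
          apply HT.seq
          refine HT.asg (by simp; omega) (by norm_num) ?_
          refine HT.asg (by simp; omega) (by norm_num) ⟨by simp [e22], by simp [l20, l21, el],
            ((A1.set (by simp) _).set (by simp) _).set (by simp) _, ?_, ?_, ?_⟩
          · simp [h1, pow_succ]
          · simp; omega
          · simp; omega
        simp
      · refine (HT.ifP_neg hok (by simp [el, hc]) (HT.skip
          ⟨e22, el, A1.set (by simp) _, ?_⟩)).time_le (by simp)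
        simp [h1] at *
        omega
    · rintro s1 ⟨A1, h1, h2, h3⟩ -
      exact hQ s1 _ _ A1 rfl rfl h1 (by omega) h3
  simp; omega

end

/-! ## The preprocessing -/

/-- Register `10` := `n`, register `12` := the number of repetitions; draws the random words. -/
def drawP (reps : ℕ) : WordProg :=
  asg 10 (.var 0) ;; asg 12 (.lit reps) ;; asg 13 (.var 12 * (.var 10 * .var 10)) ;;
  forP 22 13 (stoRand 2 (.var 22))

/-- Writes the matrix for the current repetition to array `3`. -/
def buildP : WordProg :=
  fill2 24 25 20 20 3 (.var 24 * .var 20 + .var 25)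
    (((Ex.var 24).eqE (.var 25) + (.var 3 - (Ex.var 24).ltE (.var 10) * (Ex.var 25).ltE (.var 10) *
      .get 0 (.var 24 * .var 10 + .var 25) *
        .get 2 (.var 11 * (.var 10 * .var 10) + (.var 24 * .var 10 + .var 25)) % .var 3)) % .var 3)

def repP (P : Prog ArithInstr) (N : ℕ) : WordProg :=
  buildP ;; gjP P N ;; sto 11 (.var 11) (.var 26) ;;
  ifP (.var 26) (fill2 24 25 20 20 10 ((.var 11 * .var 16 + .var 24) * .var 16 + .get 5 (.var 25))
    (.get 3 (.get 5 (.var 24) * .var 20 + .var 25))) .skip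

def prepP (P : Prog ArithInstr) (N : ℕ) : WordProg :=
  cbrtP ;; primeP ;; tableP ;; powP 10 ;; asg 16 (.var 20) ;; forP 11 12 (repP P N)

/-- The matrix for weights `R` and the adjacency matrix `a`, both in row-major layout, extended by
the identity. -/
def prepMat (p n : ℕ) (a R : ℕ → ℕ) (i j : ℕ) : ZMod p :=
  (if i = j then 1 else 0) -
    if i < n ∧ j < n then (a (i * n + j) : ZMod p) * (R (i * n + j) : ZMod p) else 0

/-- `B` inverts `A`, as a matrix with `m` rows and columns. -/
def IsInverse {F : Type*} [Field F] (m : ℕ) (A B : ℕ → ℕ → F) : Prop :=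
  ∀ x y : ℕ → F, (∀ i < m, ∑ j ∈ Finset.range m, A i j * x j = y i) ↔
    ∀ i < m, x i = ∑ j ∈ Finset.range m, B i j * y j

def HasKernel {F : Type*} [Field F] (m : ℕ) (A : ℕ → ℕ → F) : Prop :=
  ∃ x : ℕ → F, (∃ j < m, x j ≠ 0) ∧ ∀ i < m, ∑ j ∈ Finset.range m, A i j * x j = 0

theorem IsInverse.not_hasKernel {F : Type*} [Field F] {m : ℕ} {A B : ℕ → ℕ → F}
    (h : IsInverse m A B) : ¬ HasKernel m A := by
  rintro ⟨x, ⟨j, hj, hne⟩, hx⟩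
  exact hne (by simpa using (h x fun _ => 0).1 hx j hj)

/-- The elimination leaves the inverse with permuted rows and columns; `B` undoes the column
permutation, after the rows have been read through the pivots. -/
theorem isInverse_of_pivots {F : Type*} [Field F] {m : ℕ} {A W : ℕ → ℕ → F} {π : ℕ → ℕ}
    (hπm : ∀ c < m, π c < m) (hπ : ∀ c < m, ∀ c' < m, π c = π c' → c = c')
    (h : ∀ x y : ℕ → F, (∀ i < m, ∑ j ∈ Finset.range m, A i j * x j = y i) ↔
      ∀ c < m, x c = ∑ j ∈ Finset.range m, W (π c) j * y (π j)) :
    ∃ B : ℕ → ℕ → F, (∀ c, ∀ j < m, B c (π j) = W (π c) j) ∧ IsInverse m A B := by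
  refine ⟨fun c i => ∑ j ∈ Finset.range m, if π j = i then W (π c) j else 0, fun c j hj => ?_,
    fun x y => (h x y).trans ?_⟩
  · dsimp only
    rw [Finset.sum_eq_single j]
    · simp
    · intro j' hj' hne
      exact if_neg fun he => hne (hπ _ (Finset.mem_range.1 hj') _ hj he)
    · exact fun hn => absurd (Finset.mem_range.2 hj) hn
  · refine forall_congr' fun c => imp_congr_right fun hc => ?_
    have : ∑ i ∈ Finset.range m, (∑ j ∈ Finset.range m, if π j = i then W (π c) j else 0) * y i =
        ∑ j ∈ Finset.range m, W (π c) j * y (π j) := by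
      simp only [Finset.sum_mul, ite_mul, zero_mul]
      rw [Finset.sum_comm]
      refine Finset.sum_congr rfl fun j hj => ?_
      rw [Finset.sum_ite_eq, if_pos (Finset.mem_range.2 (hπm j (Finset.mem_range.1 hj)))]
    rw [this]

theorem exists_eq_of_injOn {m : ℕ} {π : ℕ → ℕ} (hπm : ∀ c < m, π c < m)
    (hπ : ∀ c < m, ∀ c' < m, π c = π c' → c = c') {i : ℕ} (hi : i < m) : ∃ c < m, π c = i := by
  have hinj : Function.Injective fun c : Fin m => (⟨π c, hπm c c.2⟩ : Fin m) := fun c c' h =>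
    Fin.ext (hπ c c.2 c' c'.2 (by simpa using h))
  obtain ⟨c, hc⟩ := Finite.surjective_of_injective hinj ⟨i, hi⟩
  exact ⟨c, c.2, by simpa using hc⟩

/-- The result of the first `r` repetitions of the preprocessing. -/
def RepsDone (p n m : ℕ) (a R : ℕ → ℕ) (r : ℕ) (s : St) : Prop :=
  ∀ k < r, (s.arr 11 k = 1 ∧ ∃ B : ℕ → ℕ → ZMod p,
      (∀ i < m, ∀ j < m, s.arr 10 ((k * m + i) * m + j) = (B i j).val) ∧
      ∃ _ : Fact p.Prime, IsInverse m (prepMat p n a fun x => R (k * (n * n) + x)) B) ∨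
    (s.arr 11 k = 0 ∧ ∃ _ : Fact p.Prime,
      HasKernel m (prepMat p n a fun x => R (k * (n * n) + x)))

section

variable {P : Prog ArithInstr} {N w p m K n reps : ℕ} {τ : ℕ → ℕ} {s : St} {Q : St → Prop}

/-- All weights are drawn before the first multiplication, which could itself consume random words.
They are therefore the initial segment of the random sequence, and this part runs in the full view.
-/
theorem HT.drawP (hw : 0 < w) (hr : reps < 2 ^ w) (hn : s.v 0 = n) (hsz : n * n < 2 ^ w)
    (hsz' : reps * (n * n) < 2 ^ w)
    (hQ : ∀ s', Agree [10, 12, 13, 22] [2] s s' → s'.v 10 = n → s'.v 12 = reps →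
      (∀ k < reps * (n * n), s'.arr 2 k = s.coins k) → Q s') :
    HT true w (drawP reps) s (reps * (n * n) * 16 + 40) Q := by
  apply HT.time_le
  case h =>
    apply HT.seq
    refine HT.asg (show 0 < 64 by norm_num) (by norm_num) ?_
    apply HT.seq
    refine HT.asg (show reps < 2 ^ w from hr) (by norm_num) ?_
    simp only [Ex.ev_var, Ex.ev_lit, hn]
    apply HT.seq
    refine HT.asg ⟨show 12 < 64 by norm_num, ⟨show 10 < 64 by norm_num, show 10 < 64 by norm_num,
      ?_⟩, ?_⟩ (by norm_num) ?_
    · simpa [WordOp.safe, Ex.ev] using hsz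
    · change (Ex.var 12).ev _ * (Ex.var 10 * Ex.var 10).ev _ < 2 ^ w
      simpa using hsz'
    simp only [Ex.ev_var, Ex.ev_mul]
    refine HT.forP (N := reps * (n * n)) (T := fun _ => 4) (fun i s' =>
      Agree [10, 12, 13, 22] [2] s s' ∧ s'.v 10 = n ∧ s'.v 12 = reps ∧
      (∀ k < i, s'.arr 2 k = s.coins k) ∧ ∀ k, s'.coins k = s.coins (k + i))
      (by norm_num) (by norm_num) (by norm_num) (by simp) hw ⟨?_, by simp, by simp, by simp,
        by simp⟩ ?_ ?_
    · exact ((((Agree.refl s).set (by simp) _).set (by simp) _).set (by simp) _).set (by simp) _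
    · rintro i hi s1 ⟨A1, h10, h12, h2, hc⟩ e22 e13
      refine (HT.stoRand (i := .var 22) (show 22 < 64 by norm_num) ⟨e22, e13, ?_, h10, h12, ?_, ?_⟩).time_le
        (by simp [SensReach.stoRand, Prog.sz])
      · have A2 := (A1.put (a := 2) (by simp) ((Ex.var 22).ev s1) (s1.coins 0)).set
          (x := 22) (by simp) (i + 1)
        exact ⟨A2.v, A2.arr⟩
      · intro k hk
        change ((s1.put 2 (s1.v 22) (s1.coins 0))).arr 2 k = _
        rw [e22, St.put_arr_self]
        rcases Nat.lt_succ_iff_lt_or_eq.1 hk with hk | rfl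
        · rw [Function.update_of_ne hk.ne, h2 k hk]
        · rw [Function.update_self, hc, zero_add]
      · intro k
        change s1.coins (k + 1) = _
        rw [hc]; congr 1; omega
    · rintro s1 ⟨A1, h10, h12, h2, hc⟩ -
      exact hQ s1 A1 h10 h12 h2
  simp; omega

theorem HT.buildP {a R : ℕ → ℕ} {r : ℕ} [hpp : Fact p.Prime] (hw : 0 < w) (hp : s.v 3 = p)
    (hn : s.v 10 = n) (hr : s.v 11 = r) (hm : s.v 20 = m) (hnm : n ≤ m)
    (ha : s.arr 0 = a) (ha1 : ∀ k, a k ≤ 1) (hR : ∀ x < n * n, s.arr 2 (r * (n * n) + x) = R x)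
    (hRw : ∀ k, s.arr 2 k < 2 ^ w) (hsz : r * (n * n) + m * m + 2 * m + p + 2 < 2 ^ w)
    (hQ : ∀ s', Agree [24, 25] [3] s s' →
      (∀ i < m, ∀ j < m, s'.arr 3 (i * m + j) = (prepMat p n a R i j).val) → Q s') :
    HT false w buildP s (m * (m * 80 + 21) + 9) Q := by
  have hp1 := hpp.out.one_lt
  refine (HT.fill2 (fun i j => i * m + j) (fun i j => (prepMat p n a R i j).val) hw
      (by norm_num) (by norm_num) (by norm_num) (by norm_num) (by norm_num) (by norm_num)
      (by norm_num) (by norm_num) (by norm_num) hm hm (.inr (by norm_num))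
      (fun i hi j hj i' hi' j' hj' he => index_inj hj hj' he) ?_
      fun s' hA h _ _ => hQ s' hA h).time_le
        (by simp [mul_add, ← mul_assoc]; omega)
  intro i hi j hj s' hA e1 e2 _
  have b1 : i * m + j < m * m := index_lt hi hj
  have b2 : i * n ≤ i * m := Nat.mul_le_mul le_rfl hnm
  have b3 : n * n ≤ m * m := Nat.mul_le_mul hnm hnm
  have ha2 := ha1 (i * n + j)
  have hR2 := hRw (r * (n * n) + (i * n + j))
  have hle : ∀ (c d : Prop) [Decidable c] [Decidable d],
      (if c then 1 else 0) * (if d then 1 else 0) ≤ 1 := by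
    intro c d _ _; split_ifs <;> simp
  have hle1 := hle (i < n) (j < n)
  have hle2 := Nat.mul_le_mul hle1 ha2
  have hle3 := Nat.mul_le_mul hle2 (le_refl (s.arr 2 (r * (n * n) + (i * n + j))))
  rw [one_mul, one_mul] at hle3
  simp only [Ex.ok_add, Ex.ok_mul, Ex.ok_var, Ex.ok_get, Ex.ok_sub, Ex.ok_eqE, Ex.ok_mod, Ex.ok_ltE,
    Ex.ev_add, Ex.ev_mul, Ex.ev_var, Ex.ev_get, Ex.ev_sub, Ex.ev_eqE, Ex.ev_mod, Ex.ev_ltE, e1, e2,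
    hA.v 3 (by simp), hA.v 10 (by simp), hA.v 11 (by simp), hA.v 20 (by simp), hA.arr 0 (by simp),
    hA.arr 2 (by simp), hp, hn, hr, hm, ha]
  refine ⟨by omega, ?_, trivial, mod_eq_val ?_⟩
  · have : (if i = j then 1 else 0) ≤ 1 := by split_ifs <;> simp
    refine ⟨⟨⟨by norm_num, by norm_num, hw⟩, ⟨by norm_num, ⟨⟨⟨⟨by norm_num, by norm_num, hw⟩,
      ⟨by norm_num, by norm_num, hw⟩, by omega⟩, ⟨by norm_num, by omega⟩, by omega⟩,
      ⟨by norm_num, by omega⟩, by omega⟩, by norm_num⟩, by omega⟩, by norm_num⟩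
  · have hmod : ∀ k : ℕ, ((p - k % p : ℕ) : ZMod p) = -(k : ZMod p) := by
      intro k
      rw [Nat.cast_sub (Nat.mod_lt _ (by omega)).le]
      simp
    rw [Nat.cast_add, hmod, prepMat, sub_eq_add_neg]
    congr 1
    · split_ifs <;> simp
    · congr 1
      by_cases h1 : i < n <;> by_cases h2 : j < n
      · rw [hR _ (index_lt h1 h2)]
        simp [h1, h2]
      all_goals simp [h1, h2]

theorem HT.repP {a R : ℕ → ℕ} {r : ℕ} [hpp : Fact p.Prime] (hS : MulSpec P N w p τ m)
    (hp : s.v 3 = p) (hinv : ∀ x : ZMod p, s.arr 4 x.val = (x⁻¹).val)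
    (hn : s.v 10 = n) (hr : s.v 11 = r) (hm : s.v 20 = m) (hm' : s.v 16 = m) (hK : s.v 21 = K)
    (hmK : m = 2 ^ K) (hnm : n ≤ m)
    (ha : s.arr 0 = a) (ha1 : ∀ k, a k ≤ 1)
    (hR : ∀ x < n * n, s.arr 2 (r * (n * n) + x) = R (r * (n * n) + x))
    (hRw : ∀ k, s.arr 2 k < 2 ^ w) (hsz : (r + 1) * (m * m) + 2 * m + p + 2 < 2 ^ w)
    (hdone : RepsDone p n m a R r s)
    (hQ : ∀ s', Agree [4, 22, 23, 24, 25, 26, 27, 28, 29, 30, 31, 32, 33, 34, 60, 62, 63]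
        [3, 5, 6, 7, 8, 9, 10, 11] s s' → RepsDone p n m a R (r + 1) s' → Q s') :
    HT false w (repP P N) s (m * (m * 200 + 100) + 50 + elimTime τ N m K) Q := by
  have hsz' := hS.size
  have hw : 0 < w := by
    rcases Nat.eq_zero_or_pos w with rfl | h
    · simp at hsz'
    · exact h
  have hr1 : (r + 1) * (m * m) = r * (m * m) + m * m := by ring
  have hrn : r * (n * n) ≤ r * (m * m) := Nat.mul_le_mul le_rfl (Nat.mul_le_mul hnm hnm)
  have hm0 : 0 < m := by rw [hmK]; positivity
  have hrm : r ≤ r * (m * m) := Nat.le_mul_of_pos_right _ (Nat.mul_pos hm0 hm0)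
  apply HT.time_le
  case h =>
    apply HT.seq
    refine HT.buildP (p := p) (R := fun x => R (r * (n * n) + x)) hw hp hn hr hm hnm ha ha1 hR hRw
      (by omega) ?_
    intro s1 A1 h3
    apply HT.seq
    refine HT.gjP hS (by rw [A1.v 3 (by simp), hp]) (by rw [A1.arr 4 (by simp)]; exact hinv)
      (by rw [A1.v 20 (by simp), hm]) (by rw [A1.v 21 (by simp), hK]) hmK h3 ?_
    intro s2 A2 h2
    have A3 : Agree [4, 22, 23, 24, 25, 26, 27, 28, 29, 30, 31, 32, 33, 34, 60, 62, 63]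
        [3, 5, 6, 7, 8, 9, 10, 11] s s2 :=
      (A1.mono (by simp) (by simp)).trans A2 (by simp) (by simp)
    apply HT.seq
    refine HT.sto (by simp) (by simp) (.inr (by norm_num)) ?_
    simp only [Ex.ev_var, A3.v 11 (by simp), hr]
    have A4 := A3.put (a := 11) (by simp) r (s2.v 26)
    have h11 : ∀ k < r, (s2.put 11 r (s2.v 26)).arr 11 k = s.arr 11 k := fun k hk => by
      rw [St.put_arr_self, Function.update_of_ne hk.ne, A2.arr 11 (by simp), A1.arr 11 (by simp)]
    have h10 : (s2.put 11 r (s2.v 26)).arr 10 = s.arr 10 := by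
      rw [St.put_arr_ne _ _ _ (by norm_num), A2.arr 10 (by simp), A1.arr 10 (by simp)]
    have hT : HT false w (SensReach.ifP (.var 26) (SensReach.fill2 24 25 20 20 10
        ((.var 11 * .var 16 + .var 24) * .var 16 + .get 5 (.var 25))
        (.get 3 (.get 5 (.var 24) * .var 20 + .var 25))) .skip) (s2.put 11 r (s2.v 26))
        (m * (m * 40 + 21) + 20) Q := by
      rcases h2 with ⟨h26, hπm, hπ, W, hW, hinvW⟩ | ⟨h26, hker⟩
      · obtain ⟨B, hB, hBinv⟩ := isInverse_of_pivots hπm hπ hinvW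
        -- Column `j` of the eliminated matrix goes to position `π j`, so the inverse is stored in
        -- its natural order and queries need no pivots.
        refine (HT.ifP_pos (by simp) (by simp [h26]) (HT.fill2
          (fun c j => (r * m + c) * m + s2.arr 5 j) (fun c j => (W (s2.arr 5 c) j).val) hw
          (by norm_num) (by norm_num) (by norm_num) (by norm_num) (by norm_num) (by norm_num)
          (by norm_num) (by norm_num) (by norm_num) ((A4.v 20 (by simp)).trans hm)
          ((A4.v 20 (by simp)).trans hm) (.inr (by norm_num)) ?_ ?_ ?_)).time_le
          (by simp [mul_add, ← mul_assoc]; omega)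
        · intro c hc j hj c' hc' j' hj' he
          have := index_inj (hπm j hj) (hπm j' hj') he
          exact ⟨by omega, hπ j hj j' hj' this.2⟩
        · intro c hc j hj s' hA e1 e2 _
          have b1 : s2.arr 5 c * m + j < m * m := index_lt (hπm c hc) hj
          have b2 := hπm j hj
          have b3 : (r * m + c) * m + s2.arr 5 j < ((r + 1) * m) * m :=
            index_lt (by rw [add_mul]; omega) b2
          have b4 : ((r + 1) * m) * m = (r + 1) * (m * m) := by ring
          have b5 : r * m + c ≤ (r * m + c) * m := Nat.le_mul_of_pos_right _ hm0
          have hA5 : s'.arr 5 = s2.arr 5 := by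
            rw [hA.arr 5 (by simp), St.put_arr_ne _ _ _ (by norm_num)]
          have hA3 : s'.arr 3 = s2.arr 3 := by
            rw [hA.arr 3 (by simp), St.put_arr_ne _ _ _ (by norm_num)]
          simp only [Ex.ok_add, Ex.ok_mul, Ex.ok_var, Ex.ok_get, Ex.ev_add, Ex.ev_mul, Ex.ev_var,
            Ex.ev_get, e1, e2, hA.v 11 (by simp), hA.v 16 (by simp), hA.v 20 (by simp),
            A4.v 11 (by simp), A4.v 16 (by simp), A4.v 20 (by simp), hA5, hA3, hr, hm, hm']
          exact ⟨by omega, by omega, trivial, hW _ (hπm c hc) j hj⟩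
        · intro s3 A5 v5 w5 _
          refine hQ s3 (A4.trans A5 (by simp) (by simp)) fun k hk => ?_
          rcases Nat.lt_succ_iff_lt_or_eq.1 hk with hk | rfl
          · have h10' : ∀ i < m, ∀ j < m, s3.arr 10 ((k * m + i) * m + j) =
                s.arr 10 ((k * m + i) * m + j) := by
              intro i hi j hj
              rw [w5, h10]
              intro c hc j' hj' he
              have e1 := index_inj (hπm j' hj') hj he
              have e2 := index_inj hc hi e1.1
              omega
            rw [A5.arr 11 (by simp), h11 k hk]
            refine (hdone k hk).imp (fun ⟨g1, B, g2, g3⟩ => ⟨g1, B, fun i hi j hj => ?_, g3⟩) id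
            rw [h10' i hi j hj, g2 i hi j hj]
          · refine .inl ⟨?_, B, fun i hi j hj => ?_, hpp, hBinv⟩
            · rw [A5.arr 11 (by simp), St.put_arr_self, Function.update_self, h26]
            · obtain ⟨c, hc, rfl⟩ := exists_eq_of_injOn hπm hπ hj
              rw [v5 i hi c hc, hB i c hc]
      · refine (HT.ifP_neg (by simp) (by simp [h26]) (HT.skip ?_)).time_le (by simp)
        refine hQ _ A4 fun k hk => ?_
        rcases Nat.lt_succ_iff_lt_or_eq.1 hk with hk | rfl
        · rw [h11 k hk, h10]
          exact hdone k hk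
        · refine .inr ⟨?_, hpp, hker⟩
          rw [St.put_arr_self, Function.update_self, h26]
    exact hT
  simp only [sz_sto, Ex.csz_var, mul_add, ← mul_assoc]
  omega

end

/-- The state after the preprocessing. -/
structure Prepared (p n m reps : ℕ) (a R : ℕ → ℕ) (s : St) : Prop where
  prime : p.Prime
  p_eq : s.v 3 = p
  n_eq : s.v 10 = n
  reps_eq : s.v 12 = reps
  m_eq : s.v 16 = m
  le : n ≤ m
  table : ∀ x : ZMod p, ∃ _ : Fact p.Prime, s.arr 4 x.val = (x⁻¹).val
  adj : s.arr 0 = a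
  rand : ∀ k < reps * (n * n), s.arr 2 k = R k
  done : RepsDone p n m a R reps s

theorem HT.prepP {P : Prog ArithInstr} {N w n reps L E : ℕ} {τ : ℕ → ℕ} {s : St} {a R : ℕ → ℕ}
    {Q : St → Prop} (hL : L = (8 * n + 1) ^ 2) (hsz : 400 * L ^ 2 + (reps + 10) * L + 100 < 2 ^ w)
    (hS : ∀ p m, p.Prime → p ≤ 18 * L → m ≤ 2 * n + 1 → MulSpec P N w p τ m)
    (hE : ∀ m K, m = 2 ^ K → m ≤ 2 * n + 1 → elimTime τ N m K ≤ E)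
    (hn : s.v 10 = n) (hr : s.v 12 = reps) (ha : s.arr 0 = a) (ha1 : ∀ k, a k ≤ 1)
    (hR : ∀ k < reps * (n * n), s.arr 2 k = R k)
    (hQ : ∀ s' m, Prepared (fieldChar n) n m reps a R s' → m ≤ 2 * n + 1 → Q s') :
    HT false w (prepP P N) s (3000 * L + reps * (350 * L + E + 62) + 100) Q := by
  have hnL : 8 * n + 1 ≤ L := by rw [hL]; exact Nat.le_self_pow (by norm_num) _
  have hL2 : L ≤ L ^ 2 := Nat.le_self_pow (by norm_num) _
  have hw : 0 < w := Nat.pos_of_ne_zero fun h => by subst h; simp at hsz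
  have hn3 : (n + 1) ^ 3 ≤ L ^ 2 := by
    rw [hL, ← pow_mul]
    exact (Nat.pow_le_pow_left (by omega) 3).trans (Nat.pow_le_pow_right (by omega) (by norm_num))
  refine HT.bdd fun _ hbdd => ?_
  have hRw := hbdd 2 (by norm_num)
  apply HT.time_le
  case h =>
    apply HT.seq
    refine HT.cbrtP (n := n) (by omega) hn ?_
    intro s1 q A1 e14 hq1 hq3 hq8 hq
    -- This fixes the scale of `q`: the prime search costs q ^ 6, and that must be quadratic in `n`.
    have hq6 : q ^ 6 ≤ L := by
      rw [hL, show q ^ 6 = (q ^ 3) ^ 2 by ring]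
      exact Nat.pow_le_pow_left hq8 2
    have hq46 : q ^ 4 ≤ q ^ 6 := Nat.pow_le_pow_right hq1 (by norm_num)
    apply HT.seq
    refine (HT.primeP (q := q) (by omega) hq1 e14 ?_).time_le (show _ ≤ 2000 * L by omega)
    intro s2 p A2 e3 hp hp9 hp18 hpq
    have : Fact p.Prime := ⟨hp⟩
    have hpn : p = fieldChar n := by rw [hpq, hq]; rfl
    have hpL : p ≤ 18 * L := by omega
    have hpp : p * p ≤ 324 * L ^ 2 := (Nat.mul_le_mul hpL hpL).trans (by
      rw [show 18 * L * (18 * L) = 324 * L ^ 2 by ring])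
    apply HT.seq
    refine (HT.tableP (p := p) (by omega) e3 ?_).time_le (show _ ≤ 720 * L + 9 by omega)
    intro s3 A3 htab
    have A13 : Agree [3, 14, 15, 17, 22, 23, 24, 25] [4] s s3 :=
      ((A1.mono (by simp) (by simp)).trans A2 (by simp) (by simp)).trans A3 (by simp) (by simp)
    apply HT.seq
    refine HT.powP (n := n) (by omega) (by norm_num) (by simp) (by rw [A13.v 10 (by simp), hn]) ?_
    intro s4 m K A4 e20 e21 hmK hnm hm2
    have A14 : Agree [3, 14, 15, 16, 17, 20, 21, 22, 23, 24, 25] [4] s s4 :=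
      (A13.mono (by simp) (by simp)).trans A4 (by simp) (by simp)
    have hmL : m ≤ 8 * n + 1 := by omega
    have hmm : m * m ≤ L := by rw [hL, sq]; exact Nat.mul_le_mul hmL hmL
    apply HT.seq
    refine HT.asg (by simp) (by norm_num) ?_
    simp only [Ex.ev_var, e20]
    refine HT.forP (N := reps) (T := fun _ => 300 * L + 50 + E) (fun r s' =>
      Agree [3, 4, 11, 14, 15, 16, 17, 20, 21, 22, 23, 24, 25, 26, 27, 28, 29, 30, 31, 32, 33, 34,
        60, 62, 63] [3, 4, 5, 6, 7, 8, 9, 10, 11] s s' ∧ s'.v 3 = p ∧ s'.v 16 = m ∧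
      s'.v 20 = m ∧ s'.v 21 = K ∧ s'.arr 4 = s3.arr 4 ∧ RepsDone p n m a R r s')
      (by norm_num) (by norm_num) (by norm_num) (by simp [A14.v 12, hr]) hw ⟨?_, ?_, by simp, ?_, ?_,
        ?_, by simp [RepsDone]⟩ ?_ ?_
    · exact (((A14.mono (by simp) (by simp))).set (by simp) _).set (by simp) _
    · simp [A4.v 3, A3.v 3, e3]
    · simp [e20]
    · simp [e21]
    · simp [A4.arr 4]
    · rintro r hr' s5 ⟨A5, h3, h16, h20, h21, h4, hd⟩ e11 e12
      have hrr : (r + 1) * (m * m) ≤ reps * L := Nat.mul_le_mul hr' hmm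
      refine (HT.repP (p := p) (m := m) (K := K) (a := a) (R := R) (r := r) (n := n)
        (hS p m hp hpL hm2) h3 (by rw [h4]; exact htab) (by rw [A5.v 10 (by simp), hn]) e11 h20 h16
        h21 hmK hnm (by rw [A5.arr 0 (by simp), ha]) ha1 (fun x hx => ?_)
        (by rw [A5.arr 2 (by simp)]; exact hRw) ?_ hd ?_).time_le ?_
      · rw [A5.arr 2 (by simp), hR]
        calc r * (n * n) + x < r * (n * n) + n * n := by omega
          _ = (r + 1) * (n * n) := by ring
          _ ≤ _ := Nat.mul_le_mul hr' le_rfl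
      · rw [add_mul reps 10 L] at hsz
        omega
      · intro s6 A6 hd6
        refine ⟨by rw [A6.v 11 (by simp), e11], by rw [A6.v 12 (by simp), e12],
          (A5.trans A6 (by simp) (by simp)).set (by simp) _, by simp [A6.v 3, h3],
          by simp [A6.v 16, h16], by simp [A6.v 20, h20], by simp [A6.v 21, h21],
          by simp [A6.arr 4, h4], hd6⟩
      · have h1 := hE m K hmK hm2
        have h2 : m * (m * 200 + 100) = m * m * 200 + m * 100 := by ring
        have h3 : m ≤ m * m := Nat.le_mul_self m
        omega
    · rintro s5 ⟨A5, h3, h16, h20, h21, h4, hd⟩ -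
      refine hQ s5 m (hpn ▸ ⟨hp, h3, by rw [A5.v 10 (by simp), hn], by rw [A5.v 12 (by simp), hr], h16,
        hnm, fun x => ⟨this, by rw [h4, htab]⟩, by rw [A5.arr 0 (by simp), ha],
        fun k hk => by rw [A5.arr 2 (by simp), hR k hk], hd⟩) hm2
  simp only [Finset.sum_const, Finset.card_range, smul_eq_mul, sz_asg, Ex.csz_var]
  have h1 : reps * (300 * L + 50 + E + 12) ≤ reps * (350 * L + E + 62) :=
    Nat.mul_le_mul le_rfl (by omega)
  omega

/-! ## The matrix of a query -/

section

variable {F : Type*} [Field F]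

/-- The matrix of a query: entry `s, t` for the updates `t < f`, which change the weight of the edge
from `ci t` to `ri t` by `D t`. -/
def queryMat (f : ℕ) (ri ci : ℕ → ℕ) (D : ℕ → F) (N : ℕ → ℕ → F) (s t : ℕ) : F :=
  (if s = t ∧ s ≠ f then 1 else 0) - N (ri s) (ci t) * D t

/-- The updated matrix is A' = A - Σ D_t e_{ci t} e_{ri t}ᵀ. In the bordered system, A x is a
combination of the vectors e_{ci t} with coefficients D_t z_t, where z_t = x (ri t) for an update
and z_f = -α for the border. Applying N and reading the coordinates ri s gives a closed system for
z: row s < f says z_s = x (ri s), and row f says x (ri f) = 0, which is why its diagonal entry lacks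
the 1. Indices beyond f have D = 0 and merely define their own z_s. -/
theorem hasKernel_queryMat_iff {m m' f : ℕ} {ri ci : ℕ → ℕ} {D : ℕ → F} {A A' N : ℕ → ℕ → F}
    (hN : IsInverse m' A N) (hf : f < m) (hri : ∀ t < m, ri t < m') (hci : ∀ t < m, ci t < m')
    (hD : D f = 1) (hD' : ∀ t < m, f < t → D t = 0)
    (hA : ∀ i < m', ∀ j < m', A' i j =
      A i j - ∑ t ∈ Finset.range f, if i = ci t ∧ j = ri t then D t else 0) :
    HasKernel m (queryMat f ri ci D N) ↔ ∃ (x : ℕ → F) (α : F), ((∃ j < m', x j ≠ 0) ∨ α ≠ 0) ∧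
      (∀ i < m', ∑ j ∈ Finset.range m', A' i j * x j + (if i = ci f then α else 0) = 0) ∧
      x (ri f) = 0 := by
  have hAx : ∀ (x : ℕ → F), ∀ i < m', ∑ j ∈ Finset.range m', A' i j * x j =
      ∑ j ∈ Finset.range m', A i j * x j -
        ∑ t ∈ Finset.range f, if i = ci t then D t * x (ri t) else 0 := by
    intro x i hi
    have : ∑ j ∈ Finset.range m', (∑ t ∈ Finset.range f, if i = ci t ∧ j = ri t then D t else 0) *
        x j = ∑ t ∈ Finset.range f, if i = ci t then D t * x (ri t) else 0 := by
      simp only [Finset.sum_mul]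
      rw [Finset.sum_comm]
      refine Finset.sum_congr rfl fun t ht => ?_
      have ht := hri t ((Finset.mem_range.1 ht).trans hf)
      by_cases h : i = ci t
      · simp [h, ht]
      · simp [h]
    rw [← this, ← Finset.sum_sub_distrib]
    refine Finset.sum_congr rfl fun j hj => ?_
    rw [hA i hi j (Finset.mem_range.1 hj), sub_mul]
  have hsplit : ∀ (z : ℕ → F) (i : ℕ), ∑ t ∈ Finset.range m, (if i = ci t then D t * z t else 0) =
      ∑ t ∈ Finset.range f, (if i = ci t then D t * z t else 0) +
        if i = ci f then z f else 0 := by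
    intro z i
    rw [← Finset.sum_range_add_sum_Ico _ hf.le, Finset.sum_eq_sum_Ico_succ_bot hf, hD, one_mul,
      Finset.sum_eq_zero (s := Finset.Ico (f + 1) m), add_zero]
    intro t ht
    rw [Finset.mem_Ico] at ht
    rw [hD' t ht.2 ht.1, zero_mul, ite_self]
  have hNy : ∀ (z : ℕ → F) (i : ℕ), ∑ j ∈ Finset.range m', N i j *
      (∑ t ∈ Finset.range m, if j = ci t then D t * z t else 0) =
      ∑ t ∈ Finset.range m, N i (ci t) * D t * z t := by
    intro z i
    simp only [Finset.mul_sum]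
    rw [Finset.sum_comm]
    refine Finset.sum_congr rfl fun t ht => ?_
    have ht := hci t (Finset.mem_range.1 ht)
    simp [ht, mul_assoc]
  have hq : ∀ (z : ℕ → F), ∀ s < m, ∑ t ∈ Finset.range m, queryMat f ri ci D N s t * z t =
      (if s ≠ f then z s else 0) - ∑ t ∈ Finset.range m, N (ri s) (ci t) * D t * z t := by
    intro z s hs
    simp only [queryMat, sub_mul, Finset.sum_sub_distrib]
    congr 1
    by_cases h : s = f
    · simp [h]
    · simp [h, hs]
  constructor
  · rintro ⟨z, ⟨j, hj, hzj⟩, hz⟩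
    have hx := (hN (fun i => ∑ t ∈ Finset.range m, N i (ci t) * D t * z t)
      fun i => ∑ t ∈ Finset.range m, if i = ci t then D t * z t else 0).2 fun i hi => (hNy z i).symm
    have hxz : ∀ s < m, ∑ t ∈ Finset.range m, N (ri s) (ci t) * D t * z t =
        if s ≠ f then z s else 0 := by
      intro s hs
      have := hz s hs
      rw [hq z s hs] at this
      linear_combination -this
    refine ⟨fun i => ∑ t ∈ Finset.range m, N i (ci t) * D t * z t, -z f, ?_, fun i hi => ?_, ?_⟩
    · by_contra! h
      refine hzj ?_
      by_cases hjf : j = f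
      · rw [hjf]; exact neg_eq_zero.1 h.2
      · have := hxz j hj
        rw [h.1 _ (hri j hj), if_pos hjf] at this
        exact this.symm
    · rw [hAx _ i hi, hx i hi, hsplit]
      have : ∑ t ∈ Finset.range f, (if i = ci t then
          D t * ∑ t' ∈ Finset.range m, N (ri t) (ci t') * D t' * z t' else 0) =
          ∑ t ∈ Finset.range f, if i = ci t then D t * z t else 0 := by
        refine Finset.sum_congr rfl fun t ht => ?_
        have ht := Finset.mem_range.1 ht
        rw [hxz t (ht.trans hf), if_pos ht.ne]
      rw [this]
      split_ifs <;> ring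
    · simpa using hxz f hf
  · rintro ⟨x, α, hne, hx, hu⟩
    -- The border unknown changes sign because its term moves to the other side of the equation.
    let z : ℕ → F := fun s => if s = f then -α else x (ri s)
    have hy : ∀ i < m', ∑ j ∈ Finset.range m', A i j * x j =
        ∑ t ∈ Finset.range m, if i = ci t then D t * z t else 0 := by
      intro i hi
      have h1 := hx i hi
      rw [hAx x i hi] at h1
      have : ∑ t ∈ Finset.range f, (if i = ci t then D t * z t else 0) =
          ∑ t ∈ Finset.range f, if i = ci t then D t * x (ri t) else 0 := by
        refine Finset.sum_congr rfl fun t ht => ?_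
        simp [z, (Finset.mem_range.1 ht).ne]
      rw [hsplit, this]
      have hzf : z f = -α := if_pos rfl
      rw [hzf]
      split_ifs at h1 ⊢ <;> linear_combination h1
    have hx' := (hN x _).1 hy
    simp only [hNy] at hx'
    refine ⟨z, ?_, fun s hs => ?_⟩
    · by_contra! h
      rcases hne with ⟨j, hj, hj0⟩ | hα
      · refine hj0 ?_
        rw [hx' j hj]
        exact Finset.sum_eq_zero fun t ht => by rw [h t (Finset.mem_range.1 ht), mul_zero]
      · have := h f hf
        simp only [z, if_true, neg_eq_zero] at this
        exact hα this
    · rw [hq z s hs, ← hx' _ (hri s hs)]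
      by_cases h : s = f
      · simp [h, hu]
      · simp [h, z]

end

/-! ### Padded matrices in row-major layout versus matrices indexed by nodes. -/

section

variable {p n m : ℕ} [hpp : Fact p.Prime]

/-- `a` is the adjacency matrix in row-major layout. -/
def IsAdj (G : Digraph (Fin n)) (a : ℕ → ℕ) : Prop :=
  ∀ i j : Fin n, (G.Adj i j → a (i * n + j) = 1) ∧ (¬ G.Adj i j → a (i * n + j) = 0)

/-- The padding is an identity block: rows below `n` act as `walkMat`, and the others return their
own coordinate. Kernels and bordered kernels are therefore not affected by it. -/
theorem sum_prepMat {G : Digraph (Fin n)} {a R : ℕ → ℕ} (hnm : n ≤ m) (ha : IsAdj G a)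
    (x : ℕ → ZMod p) {i : ℕ} (hi : i < m) :
    (∀ h : i < n, ∑ j ∈ Finset.range m, prepMat p n a R i j * x j =
      (Matrix.mulVec (walkMat G (weights fun k : Fin (n * n) => (R k : ZMod p)))
        fun j : Fin n => x j) ⟨i, h⟩) ∧
    (n ≤ i → ∑ j ∈ Finset.range m, prepMat p n a R i j * x j = x i) := by
  have hsum : ∑ j ∈ Finset.range m, prepMat p n a R i j * x j = x i -
      ∑ j ∈ Finset.range m, (if i < n ∧ j < n then (a (i * n + j) : ZMod p) * R (i * n + j) else 0) *
        x j := by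
    simp only [prepMat, sub_mul, Finset.sum_sub_distrib]
    congr 1
    simp [hi]
  rw [hsum]
  refine ⟨fun h => ?_, fun h => ?_⟩
  · rw [walkMat_mulVec]
    congr 1
    rw [← Finset.sum_range_add_sum_Ico _ hnm, Finset.sum_range, Finset.sum_eq_zero
      (s := Finset.Ico n m), add_zero]
    · refine Finset.sum_congr rfl fun j _ => ?_
      have hw : weights (fun k : Fin (n * n) => (R k : ZMod p)) ⟨i, h⟩ j = R (i * n + j) := by
        simp only [weights, finProdFinEquiv_apply_val]
        congr 2
        ring
      obtain ⟨h1, h2⟩ := ha ⟨i, h⟩ j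
      by_cases hadj : G.Adj ⟨i, h⟩ j
      · rw [if_pos hadj, if_pos ⟨h, j.2⟩, h1 hadj, hw]; simp
      · rw [if_neg hadj, if_pos ⟨h, j.2⟩, h2 hadj]; simp
    · intro j hj
      rw [Finset.mem_Ico] at hj
      rw [if_neg (by omega), zero_mul]
  · simp [not_lt.2 h]

theorem hasKernel_prepMat_iff {G : Digraph (Fin n)} {a R : ℕ → ℕ} (hnm : n ≤ m) (ha : IsAdj G a) :
    HasKernel m (prepMat p n a R) ↔
      (walkMat G (weights fun k : Fin (n * n) => (R k : ZMod p))).det = 0 := by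
  rw [← Matrix.exists_mulVec_eq_zero_iff]
  constructor
  · rintro ⟨x, ⟨j, hj, hne⟩, hx⟩
    refine ⟨fun j : Fin n => x j, fun h0 => ?_, funext fun i => ?_⟩
    · by_cases hjn : j < n
      · exact hne (congrFun h0 ⟨j, hjn⟩)
      · exact hne ((((sum_prepMat hnm ha x hj).2 (by omega)).symm).trans (hx j hj))
    · have him := i.2.trans_le hnm
      rw [← (sum_prepMat hnm ha x him).1 i.2]
      exact hx i him
  · rintro ⟨x, hne, hx⟩
    have hxx : (fun j : Fin n => (fun k : ℕ => if h : k < n then x ⟨k, h⟩ else 0) j) = x := by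
      ext j; simp
    refine ⟨fun k => if h : k < n then x ⟨k, h⟩ else 0, ?_, fun i hi => ?_⟩
    · obtain ⟨j, hj⟩ := Function.ne_iff.1 hne
      exact ⟨j, j.2.trans_le hnm, by simpa using hj⟩
    · by_cases hin : i < n
      · rw [(sum_prepMat hnm ha _ hi).1 hin, hxx, hx]; rfl
      · rw [(sum_prepMat hnm ha _ hi).2 (by omega), dif_neg hin]

theorem det_borderMat_eq_zero_iff {G : Digraph (Fin n)} {a R : ℕ → ℕ} (hnm : n ≤ m)
    (ha : IsAdj G a) (u v : Fin n) :
    (∃ (x : ℕ → ZMod p) (α : ZMod p), ((∃ j < m, x j ≠ 0) ∨ α ≠ 0) ∧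
      (∀ i < m, ∑ j ∈ Finset.range m, prepMat p n a R i j * x j +
        (if i = (v : ℕ) then α else 0) = 0) ∧ x u = 0) ↔
      (borderMat G (weights fun k : Fin (n * n) => (R k : ZMod p)) u v).det = 0 := by
  rw [← not_iff_not, ← Ne, det_borderMat_ne_zero_iff]
  constructor
  · intro h x α h1 h2
    have hxx : (fun j : Fin n => (fun k : ℕ => if h : k < n then x ⟨k, h⟩ else 0) j) = x := by
      ext j; simp
    by_contra hne
    refine h ⟨fun k => if h : k < n then x ⟨k, h⟩ else 0, α, ?_, fun i hi => ?_, ?_⟩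
    · by_cases hα : α = 0
      · have hx0 : x ≠ 0 := fun h0 => hne ⟨h0, hα⟩
        obtain ⟨j, hj⟩ := Function.ne_iff.1 hx0
        exact .inl ⟨j, j.2.trans_le hnm, by simpa using hj⟩
      · exact .inr hα
    · by_cases hin : i < n
      · rw [(sum_prepMat hnm ha _ hi).1 hin, hxx]
        simpa [Fin.ext_iff] using h1 ⟨i, hin⟩
      · rw [(sum_prepMat hnm ha _ hi).2 (by omega), dif_neg hin, if_neg (by omega), add_zero]
    · simpa using h2
  · rintro h ⟨x, α, hne, h1, h2⟩
    have h5 : ∀ i : Fin n, (Matrix.mulVec (walkMat G (weights fun k : Fin (n * n) =>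
        (R k : ZMod p))) fun j : Fin n => x j) i + (if i = v then α else 0) = 0 := by
      intro i
      have him := i.2.trans_le hnm
      have := h1 i him
      rw [(sum_prepMat hnm ha x him).1 i.2] at this
      simpa [Fin.ext_iff] using this
    obtain ⟨h3, h4⟩ := h _ α h5 h2
    rcases hne with ⟨j, hj, hj0⟩ | hα
    · by_cases hjn : j < n
      · exact hj0 (congrFun h3 ⟨j, hjn⟩)
      · have := h1 j hj
        rw [(sum_prepMat hnm ha _ hj).2 (by omega), if_neg (by omega), add_zero] at this
        exact hj0 this
    · exact hα h4

end

/-! ## The query -/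

/-- Reads the updates and the query: array `12` receives the heads of the changed edges, array `13`
the tails, and array `14` the changes. -/
def readP : WordProg :=
  fill1 22 20 12 (.var 22) (.lit 0) ;; fill1 22 20 13 (.var 22) (.lit 0) ;;
  fill1 22 20 14 (.var 22) (.lit 0) ;;
  forP 22 13 (
    asg 23 (.get 1 (.var 22 * .lit 3)) ;; asg 24 (.get 1 (.var 22 * .lit 3 + .lit 1)) ;;
    asg 25 (.get 1 (.var 22 * .lit 3 + .lit 2)) ;;
    sto 12 (.var 22) (.var 24) ;; sto 13 (.var 22) (.var 23) ;;
    sto 14 (.var 22) ((.var 25 + (.var 3 - .get 0 (.var 23 * .var 10 + .var 24))) % .var 3) ;;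
    sto 0 (.var 23 * .var 10 + .var 24) (.var 25)) ;;
  sto 12 (.var 13) (.var 1) ;; sto 13 (.var 13) (.var 2) ;; sto 14 (.var 13) (.lit 1)

/-- The adjacency matrix after the first `t` updates. -/
def adjSeq (n : ℕ) (a upd : ℕ → ℕ) : ℕ → ℕ → ℕ
  | 0 => a
  | t + 1 => Function.update (adjSeq n a upd t) (upd (t * 3) * n + upd (t * 3 + 1)) (upd (t * 3 + 2))

/-- The change by update `t`. -/
def adjDelta (p n : ℕ) (a upd : ℕ → ℕ) (t : ℕ) : ZMod p :=
  (upd (t * 3 + 2) : ZMod p) - adjSeq n a upd t (upd (t * 3) * n + upd (t * 3 + 1))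

/-- Each change is taken relative to the current entry, so the changes of an edge that is updated
several times telescope, and redundant updates contribute zero. Batches need no normalization. -/
theorem adjSeq_eq_sum (p n : ℕ) (a upd : ℕ → ℕ) (t k : ℕ) : (adjSeq n a upd t k : ZMod p) =
    a k + ∑ t' ∈ Finset.range t,
      if upd (t' * 3) * n + upd (t' * 3 + 1) = k then adjDelta p n a upd t' else 0 := by
  induction t with
  | zero => simp [adjSeq]
  | succ t ih =>
    rw [Finset.sum_range_succ, ← add_assoc, ← ih, adjSeq, Function.update_apply]
    by_cases h : k = upd (t * 3) * n + upd (t * 3 + 1)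
    · subst h; simp [adjDelta]
    · rw [if_neg h, if_neg fun h' => h h'.symm, add_zero]

theorem adjSeq_le_one {n f : ℕ} {a upd : ℕ → ℕ} (ha : ∀ k, a k ≤ 1)
    (hu : ∀ t < f, upd (t * 3 + 2) ≤ 1) {t : ℕ} (ht : t ≤ f) (k : ℕ) : adjSeq n a upd t k ≤ 1 := by
  induction t with
  | zero => exact ha k
  | succ t ih =>
    rw [adjSeq, Function.update_apply]
    split_ifs
    · exact hu t ht
    · exact ih (by omega)

/-- The updates have been read. -/
structure UpdatesRead (p n f m u v : ℕ) (a a' : ℕ → ℕ) (de : ℕ → ZMod p) (s : St) : Prop where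
  head_lt : ∀ t < m, s.arr 12 t < n
  tail_lt : ∀ t < m, s.arr 13 t < n
  head_eq : s.arr 12 f = u
  tail_eq : s.arr 13 f = v
  delta : ∀ t < m, s.arr 14 t = (de t).val
  delta_eq : de f = 1
  delta_zero : ∀ t < m, f < t → de t = 0
  adj : ∀ i < n, ∀ j < n, (a' (i * n + j) : ZMod p) =
    a (i * n + j) + ∑ t ∈ Finset.range f, if i = s.arr 13 t ∧ j = s.arr 12 t then de t else 0

section

variable {P : Prog ArithInstr} {N w p m K n f : ℕ} {τ : ℕ → ℕ} {s : St} {Q : St → Prop}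

/-- The matrix in array `0` is modified along the way, so that later updates of the same edge see
the current entry. Indices beyond `f` keep head, tail and change `0`, which is harmless padding;
node `0` exists because `u < n`. -/
theorem HT.readP {u v : ℕ} {a upd : ℕ → ℕ} [hpp : Fact p.Prime] (hw : 0 < w)
    (hsz : n * n + p + 3 * m + 10 < 2 ^ w)
    (hp : s.v 3 = p) (hn : s.v 10 = n) (hf : s.v 13 = f) (hm : s.v 20 = m) (hfm : f < m)
    (hu : s.v 1 = u) (hv : s.v 2 = v) (hun : u < n) (hvn : v < n)
    (ha : s.arr 0 = a) (ha1 : ∀ k, a k ≤ 1) (hupd : s.arr 1 = upd)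
    (h0 : ∀ t < f, upd (t * 3) < n) (h1 : ∀ t < f, upd (t * 3 + 1) < n)
    (h2 : ∀ t < f, upd (t * 3 + 2) ≤ 1)
    (hQ : ∀ s' de, Agree [22, 23, 24, 25] [0, 12, 13, 14] s s' →
      s'.arr 0 = adjSeq n a upd f → UpdatesRead p n f m u v a (adjSeq n a upd f) de s' → Q s') :
    HT false w readP s (m * 150 + 100) Q := by
  have hp1 := hpp.out.two_le
  have hfill : ∀ (b : ℕ) (s1 : St) (Q' : St → Prop), b < 32 → s1.v 20 = m →
      (∀ s', Agree [22] [b] s1 s' → (∀ t < m, s'.arr b t = 0) → Q' s') →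
      HT false w (SensReach.fill1 22 20 b (.var 22) (.lit 0)) s1 (m * 16 + 9) Q' := by
    intro b s1 Q' hb e20 hQ'
    exact (HT.fill1 (n := m) (fun t => t) (fun _ => 0) hw (by norm_num) (by norm_num) (by norm_num)
      e20 (.inr hb) (fun _ _ _ _ h => h) (fun t ht s' _ h _ _ => by simp [h])
      fun s' hA h _ _ => hQ' s' hA h).time_le (by simp)
  apply HT.time_le
  case h =>
    apply HT.seq
    refine hfill 12 s _ (by norm_num) hm fun s1 A1 z1 => ?_
    apply HT.seq
    refine hfill 13 s1 _ (by norm_num) (by rw [A1.v 20 (by simp), hm]) fun s2 A2 z2 => ?_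
    have A12 : Agree [22] [12, 13] s s2 :=
      (A1.mono (by simp) (by simp)).trans A2 (by simp) (by simp)
    apply HT.seq
    refine hfill 14 s2 _ (by norm_num) (by rw [A12.v 20 (by simp), hm]) fun s3 A3 z3 => ?_
    have A13 : Agree [22, 23, 24, 25] [0, 12, 13, 14] s s3 :=
      (A12.mono (by simp) (by simp)).trans A3 (by simp) (by simp)
    apply HT.seq
    refine HT.forP (N := f) (T := fun _ => 80) (fun t s' =>
      Agree [22, 23, 24, 25] [0, 12, 13, 14] s s' ∧ s'.arr 0 = adjSeq n a upd t ∧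
      ∀ x < m, s'.arr 12 x = (if x < t then upd (x * 3 + 1) else 0) ∧
        s'.arr 13 x = (if x < t then upd (x * 3) else 0) ∧
        s'.arr 14 x = if x < t then (adjDelta p n a upd x).val else 0)
      (by norm_num) (by norm_num) (by norm_num) (by rw [A13.v 13 (by simp), hf]) hw
      ⟨A13.set (by simp) _, ?_, fun x hx => ?_⟩ ?_ ?_
    · simp [A3.arr 0, A12.arr 0, ha, adjSeq]
    · simp [A3.arr 12, A3.arr 13, A2.arr 12, z1 x hx, z2 x hx, z3 x hx]
    · rintro t ht s4 ⟨A4, e0, e1⟩ e22 e13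
      have l0 := h0 t ht
      have l1 := h1 t ht
      have l2 := h2 t ht
      have b1 : upd (t * 3) * n + upd (t * 3 + 1) < n * n := index_lt l0 l1
      have hle := adjSeq_le_one (n := n) ha1 h2 ht.le (upd (t * 3) * n + upd (t * 3 + 1))
      apply HT.time_le
      case h =>
        apply HT.seq
        refine HT.asg (by simp [e22]; omega) (by norm_num) ?_
        apply HT.seq
        refine HT.asg (by simp [e22]; omega) (by norm_num) ?_
        apply HT.seq
        refine HT.asg (by simp [e22]; omega) (by norm_num) ?_
        simp only [Ex.ev_get, Ex.ev_add, Ex.ev_mul, Ex.ev_var, Ex.ev_lit, St.set_arr, St.set_v,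
          A4.arr 1 (by simp), hupd, e22]
        simp only [Nat.reduceEqDiff, if_false]
        apply HT.seq
        refine HT.sto (by simp) (by simp) (.inr (by norm_num)) ?_
        apply HT.seq
        refine HT.sto (by simp) (by simp) (.inr (by norm_num)) ?_
        apply HT.seq
        refine HT.sto (by simp) ?_ (.inr (by norm_num)) ?_
        · simp [A4.v 10, A4.v 3, hn, hp]
          omega
        refine HT.sto ?_ (by simp) (.inr (by norm_num)) ?_
        · simp [A4.v 10, hn]
          omega
        simp only [Ex.ev_get, Ex.ev_add, Ex.ev_mul, Ex.ev_var, Ex.ev_sub, Ex.ev_mod, St.put_v,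
          St.set_v]
        simp only [Nat.reduceEqDiff, if_false, if_true, e22]
        refine ⟨by simp, by simp [e13], ?_, ?_, fun x hx => ?_⟩
        · exact ((((((((A4.set (by simp) _).set (by simp) _).set (by simp) _).put (by simp) _ _).put
            (by simp) _ _).put (by simp) _ _).put (by simp) _ _).set (by simp) _)
        · simp [St.put_arr, e0, adjSeq, A4.v 10, hn]
        · obtain ⟨g1, g2, g3⟩ := e1 x hx
          rcases Nat.lt_trichotomy x t with h | h | h
          · simp [St.put_arr, g1, g2, g3, h, h.ne, Nat.lt_succ_of_lt h]
          · subst h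
            simp [St.put_arr]
            rw [e0, A4.v 3 (by simp), A4.v 10 (by simp), hn, hp]
            refine mod_eq_val ?_
            rw [Nat.cast_add, Nat.cast_sub (by omega), ZMod.natCast_self, adjDelta]
            ring
          · have h' : ¬ x < t + 1 := by omega
            simp [St.put_arr, g1, g2, g3, h', h.ne', not_lt.2 h.le]
      simp
    -- The query is appended as index `f`, with head `u`, tail `v` and change `1`.
    · rintro s4 ⟨A4, e0, e1⟩ -
      apply HT.seq
      refine HT.sto (by simp) (by simp) (.inr (by norm_num)) ?_
      apply HT.seq
      refine HT.sto (by simp) (by simp) (.inr (by norm_num)) ?_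
      refine HT.sto (by simp) (by simp; omega) (.inr (by norm_num)) ?_
      simp only [Ex.ev_var, Ex.ev_lit, St.put_v, A4.v 13 (by simp), A4.v 1 (by simp),
        A4.v 2 (by simp), hf, hu, hv]
      refine hQ _ (fun t => if t < f then adjDelta p n a upd t else if t = f then 1 else 0)
        (((A4.put (by simp) _ _).put (by simp) _ _).put (by simp) _ _)
        (by simp [St.put_arr, e0]) ⟨fun t ht => ?_, fun t ht => ?_, ?_, ?_, fun t ht => ?_, ?_,
          fun t ht hft => ?_, fun i hi j hj => ?_⟩
      · obtain ⟨g1, g2, g3⟩ := e1 t ht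
        simp only [St.put_arr, Nat.reduceEqDiff, if_false, if_true, Function.update_apply, g1]
        split_ifs
        · exact hun
        · exact h1 t (by assumption)
        · omega
      · obtain ⟨g1, g2, g3⟩ := e1 t ht
        simp only [St.put_arr, Nat.reduceEqDiff, if_false, if_true, Function.update_apply, g2]
        split_ifs
        · exact hvn
        · exact h0 t (by assumption)
        · omega
      · simp [St.put_arr]
      · simp [St.put_arr]
      · obtain ⟨g1, g2, g3⟩ := e1 t ht
        have : Fact (1 < p) := ⟨hp1⟩
        simp only [St.put_arr, Nat.reduceEqDiff, if_false, if_true, Function.update_apply, g3]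
        rcases Nat.lt_trichotomy t f with h | h | h
        · rw [if_neg h.ne, if_pos h, if_pos h]
        · rw [if_pos h, if_neg (by omega), if_pos h, ZMod.val_one]
        · rw [if_neg h.ne', if_neg (by omega), if_neg (by omega), if_neg h.ne', ZMod.val_zero]
      · simp
      · rw [if_neg (by omega), if_neg (by omega)]
      · rw [adjSeq_eq_sum]
        congr 1
        refine Finset.sum_congr rfl fun t ht => ?_
        have ht := Finset.mem_range.1 ht
        obtain ⟨g1, g2, g3⟩ := e1 t (ht.trans hfm)
        simp only [St.put_arr, Nat.reduceEqDiff, if_false, if_true, Function.update_apply, g1, g2,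
          if_neg ht.ne, if_pos ht]
        by_cases hc : i = upd (t * 3) ∧ j = upd (t * 3 + 1)
        · rw [if_pos hc, if_pos (by rw [hc.1, hc.2])]
        · rw [if_neg hc, if_neg]
          intro he
          have := index_inj (h1 t ht) hj he
          exact hc ⟨this.1.symm, this.2.symm⟩
  simp; omega

end

/-- Array `15` := the changes of the weights. -/
def weightP : WordProg :=
  fill1 22 20 15 (.var 22) (.get 14 (.var 22) * ((Ex.var 22).eqE (.var 13) +
    (Ex.var 22).ltE (.var 13) * (.get 2 (.var 11 * (.var 10 * .var 10) +
      (.get 13 (.var 22) * .var 10 + .get 12 (.var 22))) % .var 3)) % .var 3)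

/-- Writes the matrix of the query for the current repetition to array `3`. -/
def queryMatP : WordProg :=
  fill2 24 25 20 20 3 (.var 24 * .var 20 + .var 25)
    (((Ex.var 24).eqE (.var 25) * (.lit 1 - (Ex.var 24).eqE (.var 13)) + (.var 3 -
      .get 10 ((.var 11 * .var 16 + .get 12 (.var 24)) * .var 16 + .get 13 (.var 25)) *
        .get 15 (.var 25) % .var 3)) % .var 3)

def queryRepP (P : Prog ArithInstr) (N : ℕ) : WordProg :=
  ifP (.get 11 (.var 11))
    (weightP ;; queryMatP ;; gjP P N ;; asg 14 (.var 14 + .var 26)) .skip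

def queryP (P : Prog ArithInstr) (N : ℕ) : WordProg :=
  asg 13 (.var 0) ;; asg 14 (.lit 0) ;; asg 15 (.var 13 + .lit 1) ;; powP 15 ;; readP ;;
  forP 11 12 (queryRepP P N) ;; asg 0 ((Ex.lit 0).ltE (.var 14))

section

variable {P : Prog ArithInstr} {N w p m m' K n f u v r : ℕ} {τ : ℕ → ℕ} {s : St} {Q : St → Prop}

/-- The weight changes of a query. -/
def weightDelta (n f : ℕ) (ri ci R : ℕ → ℕ) (de : ℕ → ZMod p) (t : ℕ) : ZMod p :=
  de t * if t = f then 1 else if t < f then (R (ci t * n + ri t) : ZMod p) else 0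

theorem HT.weightP {a a' R : ℕ → ℕ} {de : ℕ → ZMod p} [hpp : Fact p.Prime] (hw : 0 < w)
    (hsz : p * p + 3 * p + r * (n * n) + n * n + m + 10 < 2 ^ w)
    (hp : s.v 3 = p) (hn : s.v 10 = n) (hr : s.v 11 = r) (hf : s.v 13 = f) (hm : s.v 20 = m)
    (hU : UpdatesRead p n f m u v a a' de s)
    (hR : ∀ x < n * n, s.arr 2 (r * (n * n) + x) = R x)
    (hQ : ∀ s', Agree [22] [15] s s' →
      (∀ t < m, s'.arr 15 t = (weightDelta n f (s.arr 12) (s.arr 13) R de t).val) → Q s') :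
    HT false w weightP s (m * 70 + 9) Q := by
  have hp1 := hpp.out.pos
  refine (HT.fill1 (n := m) (fun t => t)
    (fun t => (weightDelta n f (s.arr 12) (s.arr 13) R de t).val) hw (by norm_num) (by norm_num)
    (by norm_num) hm (.inr (by norm_num)) (fun _ _ _ _ h => h) ?_
    fun s' hA h _ _ => hQ s' hA h).time_le (by simp; omega)
  intro t ht s' hA e22 _ _
  have h12 := hU.head_lt t ht
  have h13 := hU.tail_lt t ht
  have hidx : s.arr 13 t * n + s.arr 12 t < n * n := index_lt h13 h12
  have hde := ZMod.val_lt (de t)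
  have hmod : s.arr 2 (r * (n * n) + (s.arr 13 t * n + s.arr 12 t)) % p < p := Nat.mod_lt _ hp1
  have hle : (if t < f then 1 else 0) *
      (s.arr 2 (r * (n * n) + (s.arr 13 t * n + s.arr 12 t)) % p) ≤ 1 * p :=
    Nat.mul_le_mul (by split_ifs <;> simp) hmod.le
  have hle1 : (if t = f then 1 else 0) ≤ 1 := by split_ifs <;> simp
  have hle2 : (de t).val * ((if t = f then 1 else 0) + (if t < f then 1 else 0) *
      (s.arr 2 (r * (n * n) + (s.arr 13 t * n + s.arr 12 t)) % p)) ≤ p * (1 + p) :=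
    Nat.mul_le_mul hde.le (by omega)
  rw [show p * (1 + p) = p + p * p by ring] at hle2
  simp only [Ex.ok_add, Ex.ok_mul, Ex.ok_var, Ex.ok_get, Ex.ok_eqE, Ex.ok_mod, Ex.ok_ltE,
    Ex.ev_add, Ex.ev_mul, Ex.ev_var, Ex.ev_get, Ex.ev_eqE, Ex.ev_mod, Ex.ev_ltE, e22,
    hA.v 3 (by simp), hA.v 10 (by simp), hA.v 11 (by simp), hA.v 13 (by simp), hA.arr 2 (by simp),
    hA.arr 12 (by simp), hA.arr 13 (by simp), hA.arr 14 (by simp), hp, hn, hr, hf, hU.delta t ht]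
  refine ⟨by norm_num, ?_, trivial, mod_eq_val ?_⟩
  · have : s.arr 13 t * n ≤ n * n := Nat.mul_le_mul h13.le le_rfl
    repeat' apply And.intro
    all_goals first | exact hw | omega
  · rw [hR _ hidx, weightDelta]
    rcases Nat.lt_trichotomy t f with h | h | h
    · simp [h, h.ne]
    · simp [h]
    · simp [h.ne', not_lt.2 h.le]

theorem HT.queryMatP {a a' ri ci : ℕ → ℕ} {de D : ℕ → ZMod p} {B : ℕ → ℕ → ZMod p}
    [hpp : Fact p.Prime]
    (hw : 0 < w) (hsz : p * p + 3 * p + (r + 1) * (m' * m') + m * m + m + 10 < 2 ^ w)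
    (hp : s.v 3 = p) (hnm : n ≤ m') (hr : s.v 11 = r) (hf : s.v 13 = f) (hm' : s.v 16 = m')
    (hm : s.v 20 = m) (hU : UpdatesRead p n f m u v a a' de s) (hri : s.arr 12 = ri)
    (hci : s.arr 13 = ci) (hD : ∀ t < m, s.arr 15 t = (D t).val)
    (hB : ∀ i < m', ∀ j < m', s.arr 10 ((r * m' + i) * m' + j) = (B i j).val)
    (hQ : ∀ s', Agree [24, 25] [3] s s' →
      (∀ i < m, ∀ j < m, s'.arr 3 (i * m + j) = (queryMat f ri ci D B i j).val) → Q s') :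
    HT false w queryMatP s (m * (m * 80 + 21) + 9) Q := by
  have hp1 := hpp.out.one_lt
  refine (HT.fill2 (fun i j => i * m + j) (fun i j => (queryMat f ri ci D B i j).val) hw
      (by norm_num) (by norm_num) (by norm_num) (by norm_num) (by norm_num) (by norm_num)
      (by norm_num) (by norm_num) (by norm_num) hm hm (.inr (by norm_num))
      (fun i hi j hj i' hi' j' hj' he => index_inj hj hj' he) ?_
      fun s' hA h _ _ => hQ s' hA h).time_le (by simp [mul_add, ← mul_assoc]; omega)
  intro i hi j hj s' hA e1 e2 _
  have b1 : i * m + j < m * m := index_lt hi hj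
  have h12 := hU.head_lt i hi
  have h13 := hU.tail_lt j hj
  rw [hri] at h12
  rw [hci] at h13
  have b2 : r * m' + ri i < (r + 1) * m' := by rw [add_mul]; omega
  have b3 : (r * m' + ri i) * m' + ci j < (r + 1) * m' * m' := index_lt b2 (by omega)
  have b4 : (r + 1) * m' * m' = (r + 1) * (m' * m') := by ring
  have b5 : r * m' + ri i ≤ (r * m' + ri i) * m' := Nat.le_mul_of_pos_right _ (by omega)
  have hBv := hB (ri i) (by omega) (ci j) (by omega)
  have hBlt := ZMod.val_lt (B (ri i) (ci j))
  have hDlt := ZMod.val_lt (D j)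
  have hBD := Nat.mul_le_mul hBlt.le hDlt.le
  have hle1 : (if i = j then 1 else 0) * (1 - if i = f then 1 else 0) ≤ 1 * 1 :=
    Nat.mul_le_mul (by split_ifs <;> simp) (by split_ifs <;> simp)
  simp only [Ex.ok_add, Ex.ok_mul, Ex.ok_var, Ex.ok_get, Ex.ok_sub, Ex.ok_eqE, Ex.ok_mod, Ex.ok_lit,
    Ex.ev_add, Ex.ev_mul, Ex.ev_var, Ex.ev_get, Ex.ev_sub, Ex.ev_eqE, Ex.ev_mod, Ex.ev_lit, e1, e2,
    hA.v 3 (by simp), hA.v 11 (by simp), hA.v 13 (by simp), hA.v 16 (by simp), hA.v 20 (by simp),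
    hA.arr 10 (by simp), hA.arr 12 (by simp), hA.arr 13 (by simp), hA.arr 15 (by simp), hp, hr, hf,
    hm, hm', hri, hci, hBv, hD j hj]
  refine ⟨by omega, ?_, trivial, mod_eq_val ?_⟩
  · repeat' apply And.intro
    all_goals first | exact hw | omega
  · have hmod : ∀ k : ℕ, ((p - k % p : ℕ) : ZMod p) = -(k : ZMod p) := by
      intro k
      rw [Nat.cast_sub (Nat.mod_lt _ (by omega)).le]
      simp
    rw [Nat.cast_add, hmod, queryMat, sub_eq_add_neg]
    congr 1
    · by_cases h1 : i = j
      · subst h1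
        by_cases h2 : i = f <;> simp [h2]
      · simp [h1]
    · simp

/-- Changes of the adjacency matrix become changes of `prepMat` after multiplication with the edge
weights. The existence of an inverse says that the first determinant in `GoodWeights` is nonzero, so
the test decides the second one. -/
theorem not_hasKernel_queryMat_iff {u v : Fin n} {G G' : Digraph (Fin n)} {a a' R : ℕ → ℕ}
    {de : ℕ → ZMod p} {B : ℕ → ℕ → ZMod p} [hpp : Fact p.Prime] (hnm : n ≤ m') (hfm : f < m)
    (hU : UpdatesRead p n f m u v a a' de s) (ha : IsAdj G a) (ha' : IsAdj G' a')
    (hB : IsInverse m' (prepMat p n a R) B) :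
    ¬ HasKernel m (queryMat f (s.arr 12) (s.arr 13)
      (weightDelta n f (s.arr 12) (s.arr 13) R de) B) ↔
      GoodWeights G G' u v (weights fun k : Fin (n * n) => (R k : ZMod p)) := by
  have h1 := hB.not_hasKernel
  rw [hasKernel_prepMat_iff hnm ha] at h1
  rw [hasKernel_queryMat_iff (A' := prepMat p n a' R) hB hfm
    (fun t ht => (hU.head_lt t ht).trans_le hnm)
    (fun t ht => (hU.tail_lt t ht).trans_le hnm) (by simp [weightDelta, hU.delta_eq])
    (fun t ht hft => by simp [weightDelta, hU.delta_zero t ht hft]), hU.tail_eq, hU.head_eq,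
    det_borderMat_eq_zero_iff hnm ha' u v, GoodWeights]
  · simp [h1]
  · intro i hi j hj
    by_cases hij : i < n ∧ j < n
    · simp only [prepMat, if_pos hij]
      rw [hU.adj i hij.1 j hij.2, add_mul, Finset.sum_mul, ← sub_sub]
      congr 1
      refine Finset.sum_congr rfl fun t ht => ?_
      have ht := Finset.mem_range.1 ht
      by_cases hc : i = s.arr 13 t ∧ j = s.arr 12 t
      · rw [if_pos hc, if_pos hc, weightDelta, if_neg ht.ne, if_pos ht, hc.1, hc.2]
      · rw [if_neg hc, if_neg hc, zero_mul]
    · simp only [prepMat, if_neg hij]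
      refine ((sub_eq_self (a := _ - (0 : ZMod p))).2 (Finset.sum_eq_zero fun t ht => ?_)).symm
      have ht := (Finset.mem_range.1 ht).trans hfm
      have h2 := hU.head_lt t ht
      have h3 := hU.tail_lt t ht
      rw [if_neg]
      rintro ⟨rfl, rfl⟩
      exact hij ⟨h3, h2⟩

end

section

variable {P : Prog ArithInstr} {N w p m m' K n f r reps : ℕ} {τ : ℕ → ℕ} {s : St} {Q : St → Prop}
  {u v : Fin n} {G G' : Digraph (Fin n)} {a a' R : ℕ → ℕ} {de : ℕ → ZMod p}

/-- A repetition whose matrix was singular in the preprocessing has no inverse to work with and is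
skipped. Its weights are not good, so this is consistent. -/
theorem HT.queryRepP [hpp : Fact p.Prime] (hS : MulSpec P N w p τ m)
    (hsz : p * p + 3 * p + (r + 1) * (m' * m') + n * n + m * m + m + 10 < 2 ^ w)
    (hp : s.v 3 = p) (hinv : ∀ x : ZMod p, s.arr 4 x.val = (x⁻¹).val)
    (hn : s.v 10 = n) (hnm : n ≤ m') (hr : s.v 11 = r) (hf : s.v 13 = f) (hm' : s.v 16 = m')
    (hm : s.v 20 = m) (hK : s.v 21 = K) (hmK : m = 2 ^ K) (hfm : f < m)
    (h14 : s.v 14 + 1 < 2 ^ w) (hU : UpdatesRead p n f m u v a a' de s)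
    (hR : ∀ x < n * n, s.arr 2 (r * (n * n) + x) = R (r * (n * n) + x))
    (ha : IsAdj G a) (ha' : IsAdj G' a') (hdone : RepsDone p n m' a R (r + 1) s)
    (hQ : ∀ s', Agree [4, 14, 22, 23, 24, 25, 26, 27, 28, 29, 30, 31, 32, 33, 34, 60, 62, 63]
        [3, 5, 6, 7, 8, 9, 15] s s' →
      (GoodWeights G G' u v (weights fun k : Fin (n * n) => (R (r * (n * n) + k) : ZMod p)) ∧
          s'.v 14 = s.v 14 + 1 ∨
        ¬ GoodWeights G G' u v (weights fun k : Fin (n * n) => (R (r * (n * n) + k) : ZMod p)) ∧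
          s'.v 14 = s.v 14) → Q s') :
    HT false w (queryRepP P N) s (m * (m * 80 + 100) + 50 + elimTime τ N m K) Q := by
  have hsz' := hS.size
  have hw : 0 < w := by
    rcases Nat.eq_zero_or_pos w with rfl | h
    · simp at hsz'
    · exact h
  have hr1 : (r + 1) * (m' * m') = r * (m' * m') + m' * m' := by ring
  have hrn : r * (n * n) ≤ r * (m' * m') := Nat.mul_le_mul le_rfl (Nat.mul_le_mul hnm hnm)
  rcases hdone r (Nat.lt_succ_self r) with ⟨h11, B, hB, _, hBinv⟩ | ⟨h11, _, hker⟩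
  · have hiff := not_hasKernel_queryMat_iff hnm hfm hU ha ha' hBinv
    apply HT.time_le
    case h =>
      apply HT.ifP_pos (by simp) (by simp [hr, h11])
      apply HT.seq
      refine HT.weightP (p := p) (R := fun x => R (r * (n * n) + x)) hw (by omega) hp hn hr hf hm hU
        hR fun s1 A1 h15 => ?_
      apply HT.seq
      have hU1 : UpdatesRead p n f m u v a a' de s1 := by
        obtain ⟨g1, g2, g3, g4, g5, g6, g7, g8⟩ := hU
        rw [← A1.arr 12 (by simp)] at g1 g3 g8
        rw [← A1.arr 13 (by simp)] at g2 g4 g8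
        rw [← A1.arr 14 (by simp)] at g5
        exact ⟨g1, g2, g3, g4, g5, g6, g7, g8⟩
      refine HT.queryMatP (r := r) hw (by omega) (by rw [A1.v 3 (by simp), hp]) hnm
        (by rw [A1.v 11 (by simp), hr]) (by rw [A1.v 13 (by simp), hf])
        (by rw [A1.v 16 (by simp), hm']) (by rw [A1.v 20 (by simp), hm]) hU1
        (A1.arr 12 (by simp)) (A1.arr 13 (by simp)) h15
        (fun i hi j hj => by rw [A1.arr 10 (by simp), hB i hi j hj]) fun s2 A2 h3 => ?_
      have A12 : Agree [22, 24, 25] [3, 15] s s2 :=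
        (A1.mono (by simp) (by simp)).trans A2 (by simp) (by simp)
      apply HT.seq
      refine HT.gjP hS (by rw [A12.v 3 (by simp), hp]) (by rw [A12.arr 4 (by simp)]; exact hinv)
        (by rw [A12.v 20 (by simp), hm]) (by rw [A12.v 21 (by simp), hK]) hmK h3
        fun s3 A3 hres => ?_
      have A13 := (A12.mono (R := [4, 14, 22, 23, 24, 25, 26, 27, 28, 29, 30, 31, 32, 33, 34, 60,
        62, 63]) (A := [3, 5, 6, 7, 8, 9, 15]) (by simp) (by simp)).trans A3 (by simp) (by simp)
      have e14 : s3.v 14 = s.v 14 := by rw [A3.v 14 (by simp), A12.v 14 (by simp)]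
      have h26 : s3.v 26 ≤ 1 := by rcases hres with h | h <;> omega
      refine HT.asg (by simp; omega) (by norm_num) (hQ _ (A13.set (by simp) _) ?_)
      simp only [Ex.ev_add, Ex.ev_var, St.set_v, if_true, e14]
      rcases hres with ⟨g26, hπm, hπ, W, -, hW⟩ | ⟨g26, hk⟩
      · obtain ⟨B', -, hB'⟩ := isInverse_of_pivots hπm hπ hW
        exact .inl ⟨hiff.1 hB'.not_hasKernel, by rw [g26]⟩
      · exact .inr ⟨fun hg => hiff.2 hg hk, by rw [g26, add_zero]⟩
    simp [mul_add, ← mul_assoc]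
    omega
  · refine (HT.ifP_neg (by simp) (by simp [hr, h11]) (HT.skip (hQ s (Agree.refl s)
      (.inr ⟨fun hg => ?_, rfl⟩)))).time_le (by simp; omega)
    rw [hasKernel_prepMat_iff hnm ha] at hker
    exact hg.1 hker

/-- Register `14` counts the repetitions with good weights; by one-sidedness, a single one justifies
a positive answer. -/
theorem HT.queryP [hpp : Fact p.Prime] {upd : ℕ → ℕ} {E : ℕ} (hP : Prepared p n m' reps a R s)
    (hS : ∀ m ≤ 2 * f + 3, MulSpec P N w p τ m)
    (hE : ∀ m K, m = 2 ^ K → m ≤ 2 * f + 3 → elimTime τ N m K ≤ E)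
    (hsz : p * p + 3 * p + reps * (m' * m') + n * n + reps + (2 * f + 3) * (2 * f + 3) +
      6 * (2 * f + 3) + 100 < 2 ^ w)
    (hf : s.v 0 = f) (hu : s.v 1 = u) (hv : s.v 2 = v) (hupd : s.arr 1 = upd)
    (h0 : ∀ t < f, upd (t * 3) < n) (h1 : ∀ t < f, upd (t * 3 + 1) < n)
    (h2 : ∀ t < f, upd (t * 3 + 2) ≤ 1) (ha1 : ∀ k, a k ≤ 1) (ha : IsAdj G a)
    (ha' : IsAdj G' (adjSeq n a upd f))
    (hQ : ∀ s', ((∃ r < reps, GoodWeights G G' u v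
        (weights fun k : Fin (n * n) => (R (r * (n * n) + k) : ZMod p))) ∧ s'.v 0 = 1 ∨
      (∀ r < reps, ¬ GoodWeights G G' u v
        (weights fun k : Fin (n * n) => (R (r * (n * n) + k) : ZMod p))) ∧ s'.v 0 = 0) → Q s') :
    HT false w (queryP P N) s
      (200 * (2 * f + 3) + reps * (200 * ((2 * f + 3) * (2 * f + 3)) + E + 100) + 200) Q := by
  have hw : 0 < w := Nat.pos_of_ne_zero fun h => by subst h; simp at hsz
  obtain ⟨M, hM⟩ : ∃ M, M = 2 * f + 3 := ⟨_, rfl⟩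
  rw [← hM] at hS hE hsz ⊢
  apply HT.time_le
  case h =>
    apply HT.seq
    refine HT.asg (by simp) (by norm_num) ?_
    apply HT.seq
    refine HT.asg (by simp) (by norm_num) ?_
    apply HT.seq
    refine HT.asg (by simp [hf]; omega) (by norm_num) ?_
    simp only [Ex.ev_var, Ex.ev_lit, Ex.ev_add, St.set_v, hf]
    obtain ⟨s1, hs1⟩ : ∃ s1, s1 = ((s.set 13 f).set 14 0).set 15 (f + 1) := ⟨_, rfl⟩
    have A1 : Agree [13, 14, 15] [] s s1 := by
      rw [hs1]
      exact (((Agree.refl s).set (by simp) _).set (by simp) _).set (by simp) _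
    norm_num
    rw [← hs1]
    apply HT.seq
    refine HT.powP (n := f + 1) (by omega) (by norm_num) (by simp) (by simp [hs1]) ?_
    intro s2 m K A2 e20 e21 hmK hfm hm2
    have hmM : m ≤ M := by omega
    have hmm : m * m ≤ M * M := Nat.mul_le_mul hmM hmM
    have A12 : Agree [13, 14, 15, 20, 21, 22] [] s s2 :=
      (A1.mono (by simp) (by simp)).trans A2 (by simp) (by simp)
    have e13 : s2.v 13 = f := by rw [A2.v 13 (by simp)]; simp [hs1]
    have e14 : s2.v 14 = 0 := by rw [A2.v 14 (by simp)]; simp [hs1]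
    apply HT.seq
    refine (HT.readP (p := p) (n := n) (m := m) (u := u) (v := v) (upd := upd) hw (by omega)
      (by rw [A12.v 3 (by simp), hP.p_eq]) (by rw [A12.v 10 (by simp), hP.n_eq]) e13 e20 (by omega)
      (by rw [A12.v 1 (by simp), hu]) (by rw [A12.v 2 (by simp), hv]) u.2 v.2
      (by rw [A12.arr 0 (by simp), hP.adj]) ha1 (by rw [A12.arr 1 (by simp), hupd]) h0 h1 h2 ?_).time_le
      (show _ ≤ M * 150 + 100 by omega)
    intro s3 de A3 _ hU
    have A13 : Agree [13, 14, 15, 20, 21, 22, 23, 24, 25] [0, 12, 13, 14] s s3 :=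
      (A12.mono (by simp) (by simp)).trans A3 (by simp) (by simp)
    apply HT.seq
    refine HT.forP (N := reps) (T := fun _ => 200 * (M * M) + E + 60) (fun r s' =>
      Agree [4, 11, 14, 22, 23, 24, 25, 26, 27, 28, 29, 30, 31, 32, 33, 34, 60, 62, 63]
        [3, 5, 6, 7, 8, 9, 15] s3 s' ∧ s'.v 14 ≤ r ∧ (0 < s'.v 14 ↔ ∃ k < r,
        GoodWeights G G' u v (weights fun x : Fin (n * n) => (R (k * (n * n) + x) : ZMod p))))
      (by norm_num) (by norm_num) (by norm_num) (by rw [A13.v 12 (by simp), hP.reps_eq]) hw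
      ⟨(Agree.refl s3).set (by simp) _, ?_⟩ ?_ ?_
    · have : s3.v 14 = 0 := by rw [A3.v 14 (by simp), e14]
      simp [this]
    · rintro r hr s4 ⟨A4, hle, hiff⟩ e11 e12
      have A14 : Agree [4, 11, 13, 14, 15, 20, 21, 22, 23, 24, 25, 26, 27, 28, 29, 30, 31, 32, 33,
        34, 60, 62, 63] [0, 3, 5, 6, 7, 8, 9, 12, 13, 14, 15] s s4 :=
        (A13.mono (by simp) (by simp)).trans A4 (by simp) (by simp)
      have hrr : (r + 1) * (m' * m') ≤ reps * (m' * m') := Nat.mul_le_mul hr le_rfl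
      have hrn : (r + 1) * (n * n) ≤ reps * (n * n) := Nat.mul_le_mul hr le_rfl
      have hU4 : UpdatesRead p n f m u v a (adjSeq n a upd f) de s4 := by
        obtain ⟨g1, g2, g3, g4, g5, g6, g7, g8⟩ := hU
        rw [← A4.arr 12 (by simp)] at g1 g3 g8
        rw [← A4.arr 13 (by simp)] at g2 g4 g8
        rw [← A4.arr 14 (by simp)] at g5
        exact ⟨g1, g2, g3, g4, g5, g6, g7, g8⟩
      refine (HT.queryRepP (p := p) (n := n) (m := m) (m' := m') (K := K) (f := f) (r := r)
        (a := a) (R := R) (hS m hmM) (by omega)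
        (by rw [A14.v 3 (by simp), hP.p_eq]) (fun x => ?_) (by rw [A14.v 10 (by simp), hP.n_eq])
        hP.le e11 (by rw [A4.v 13 (by simp), A3.v 13 (by simp), e13])
        (by rw [A14.v 16 (by simp), hP.m_eq]) (by rw [A4.v 20 (by simp), A3.v 20 (by simp), e20])
        (by rw [A4.v 21 (by simp), A3.v 21 (by simp), e21]) hmK (by omega) (by omega) hU4
        (fun x hx => ?_) ha ha' (fun k hk => ?_) ?_).time_le ?_
      · obtain ⟨_, hx⟩ := hP.table x
        rw [A14.arr 4 (by simp), hx]
      · rw [A14.arr 2 (by simp), hP.rand]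
        rw [add_mul] at hrn
        omega
      · rw [A14.arr 10 (by simp), A14.arr 11 (by simp)]
        exact hP.done k (by omega)
      · intro s5 A5 hres
        refine ⟨by rw [A5.v 11 (by simp), e11], by rw [A5.v 12 (by simp), e12],
          (A4.trans A5 (by simp) (by simp)).set (by simp) _, ?_, ?_⟩
        · simp only [St.set_v]
          norm_num
          rcases hres with ⟨-, h⟩ | ⟨-, h⟩ <;> omega
        · simp only [St.set_v, Nat.lt_succ_iff_lt_or_eq, or_and_right, exists_or, exists_eq_left,
            ← hiff]
          norm_num
          rcases hres with ⟨hg, h⟩ | ⟨hg, h⟩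
          · simp [h, hg]
          · simp [h, hg]
      · have h3 := hE m K hmK hmM
        have h4 : m * (m * 80 + 100) = m * m * 80 + m * 100 := by ring
        have h5 : m ≤ m * m := Nat.le_mul_self m
        omega
    · rintro s4 ⟨A4, hle, hiff⟩ -
      refine HT.asg (by simpa using hw) (by norm_num) (hQ _ ?_)
      simp only [Ex.ev_ltE, Ex.ev_lit, Ex.ev_var, St.set_v_self]
      by_cases hg : 0 < s4.v 14
      · exact .inl ⟨hiff.1 hg, by simp [hg]⟩
      · exact .inr ⟨fun r hr h => hg (hiff.2 ⟨r, hr, h⟩), by simp [hg]⟩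
  simp only [Finset.sum_const, Finset.card_range, smul_eq_mul, sz_asg, Ex.csz_var, Ex.csz_lit,
    Ex.csz_add, Ex.csz_ltE]
  have h1 : reps * (200 * (M * M) + E + 60 + 12) ≤ reps * (200 * (M * M) + E + 100) :=
    Nat.mul_le_mul le_rfl (by omega)
  omega

end

/-! ## Inputs -/

section

variable {n : ℕ} {G : Digraph (Fin n)}

theorem updateWords_getD (ups : List (EdgeUpdate n)) {t : ℕ} (ht : t < ups.length) :
    let upd := fun k =>
      (ups.flatMap fun e => [(e.1 : ℕ), (e.2.1 : ℕ), if e.2.2 then 1 else 0]).getD k 0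
    upd (t * 3) = ups[t].1 ∧ upd (t * 3 + 1) = ups[t].2.1 ∧
      upd (t * 3 + 2) = if ups[t].2.2 then 1 else 0 := by
  induction ups generalizing t with
  | nil => simp at ht
  | cons e ups ih =>
    cases t with
    | zero => simp
    | succ t =>
      have := ih (t := t) (by simpa using ht)
      have e : (t + 1) * 3 = t * 3 + 1 + 1 + 1 := by ring
      rw [e]
      exact this

theorem updateWords_lt {ups : List (EdgeUpdate n)} {w : ℕ} (hn : n ≤ 2 ^ w) (h2 : 1 < 2 ^ w) (k : ℕ) :
    (ups.flatMap fun e => [(e.1 : ℕ), (e.2.1 : ℕ), if e.2.2 then 1 else 0]).getD k 0 < 2 ^ w := by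
  rw [List.getD_eq_getElem?_getD]
  rcases h : (ups.flatMap fun e => [(e.1 : ℕ), (e.2.1 : ℕ), if e.2.2 then 1 else 0])[k]? with _ | x
  · rw [h, Option.getD_none]
    omega
  · rw [h, Option.getD_some]
    obtain ⟨e, -, he⟩ := List.mem_flatMap.1 (List.mem_of_getElem? h)
    simp only [List.mem_cons, List.not_mem_nil, or_false] at he
    rcases he with rfl | rfl | rfl
    · exact e.1.2.trans_le hn
    · exact e.2.1.2.trans_le hn
    · split_ifs <;> omega

theorem IsAdj.applyUpdate {a : ℕ → ℕ} (ha : IsAdj G a) (e : EdgeUpdate n) :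
    IsAdj (applyUpdate G e) (Function.update a (e.1 * n + e.2.1) (if e.2.2 then 1 else 0)) := by
  intro i j
  have hij : (i * n + j : ℕ) = e.1 * n + e.2.1 ↔ i = e.1 ∧ j = e.2.1 := by
    refine ⟨fun h => ?_, fun h => by rw [h.1, h.2]⟩
    have h1 : (finProdFinEquiv (i, j) : Fin (n * n)) = finProdFinEquiv (e.1, e.2.1) := by
      ext
      simp only [finProdFinEquiv_apply_val]
      rw [mul_comm n, mul_comm n]
      omega
    simpa using finProdFinEquiv.injective h1
  simp only [SensReach.applyUpdate, Function.update_apply, hij]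
  by_cases h : i = e.1 ∧ j = e.2.1
  · simp [h]
  · simpa [h] using ha i j

theorem IsAdj.applyUpdates {a : ℕ → ℕ} (ha : IsAdj G a) (ups : List (EdgeUpdate n)) {upd : ℕ → ℕ}
    (h : ∀ (t : ℕ) (ht : t < ups.length), upd (t * 3) = ups[t].1 ∧ upd (t * 3 + 1) = ups[t].2.1 ∧
      upd (t * 3 + 2) = if ups[t].2.2 then 1 else 0) {f : ℕ} (hf : f = ups.length) :
    IsAdj (applyUpdates G ups) (adjSeq n a upd f) := by
  have key : ∀ t ≤ ups.length, IsAdj (SensReach.applyUpdates G (ups.take t)) (adjSeq n a upd t) := by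
    intro t
    induction t with
    | zero => exact fun _ => ha
    | succ t ih =>
      intro ht
      obtain ⟨h1, h2, h3⟩ := h t ht
      rw [adjSeq, h1, h2, h3, List.take_add_one, List.getElem?_eq_getElem ht]
      have := (ih (by omega)).applyUpdate ups[t]
      rw [SensReach.applyUpdates, List.foldl_append]
      exact this
  simpa [hf] using key ups.length le_rfl

open Classical in
/-- The adjacency matrix in row-major layout. -/
noncomputable def adjWords (G : Digraph (Fin n)) : ℕ → ℕ :=
  rowMajor fun i j => if G.Adj i j then 1 else 0

theorem adjWords_le_one (k : ℕ) : adjWords G k ≤ 1 := by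
  rw [adjWords, rowMajor]
  split_ifs <;> simp

theorem isAdj_adjWords : IsAdj G (adjWords G) := by
  intro i j
  rw [adjWords, rowMajor_lt _ i.2 j.2]
  simp +contextual

end

/-- This is the one-sidedness: without a path, the bordered matrix is singular for all weights, and
the answer is never wrong. -/
theorem goodWeights_false_of_not_reachable {F : Type*} [Field F] {n : ℕ} {G G' : Digraph (Fin n)}
    {u v : Fin n} (h : ¬ Reachable G' u v) (R : Fin n → Fin n → F) : ¬ GoodWeights G G' u v R := by
  rintro ⟨-, hd⟩
  obtain ⟨x, a, hne, h1, h2⟩ := exists_ker_of_not_reachable h R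
  obtain ⟨rfl, rfl⟩ := (det_borderMat_ne_zero_iff _ _ _ _).1 hd x a h1 h2
  simp at hne

/-! ## The characteristic -/

theorem le_cubeRoot_pow (n : ℕ) : n ≤ cubeRoot n ^ 3 := (Nat.find_spec (exists_le_cube n)).2

theorem one_le_cubeRoot (n : ℕ) : 1 ≤ cubeRoot n := (Nat.find_spec (exists_le_cube n)).1

theorem fieldChar_spec (n : ℕ) : (fieldChar n).Prime ∧ 9 * cubeRoot n ^ 4 < fieldChar n := by
  have hq := one_le_cubeRoot n
  obtain ⟨p, hp, h1, h2⟩ := Nat.exists_prime_lt_and_le_two_mul (9 * cubeRoot n ^ 4) (by positivity)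
  have h3 : p ≤ 18 * cubeRoot n ^ 4 := by omega
  exact ⟨Nat.findGreatest_spec h3 hp, h1.trans_le (Nat.le_findGreatest h3 hp)⟩

instance (n : ℕ) : Fact (fieldChar n).Prime := ⟨(fieldChar_spec n).1⟩

theorem fieldChar_le (n : ℕ) : fieldChar n ≤ 18 * (8 * n + 1) ^ 2 := by
  have h1 := one_le_cubeRoot n
  have h2 : cubeRoot n ^ 3 ≤ 8 * n + 1 := by
    rcases h1.eq_or_lt with h | h
    · rw [← h]; omega
    · have := Nat.find_min (exists_le_cube n) (m := cubeRoot n - 1)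
        (Nat.sub_lt (by omega) (by omega))
      simp only [not_and, not_le] at this
      have h3 := this (by omega)
      obtain ⟨z, hz⟩ : ∃ z, cubeRoot n = z + 1 := ⟨cubeRoot n - 1, by omega⟩
      rw [hz] at h3 h ⊢
      simp only [add_tsub_cancel_right] at h3
      calc (z + 1) ^ 3 ≤ (2 * z) ^ 3 := Nat.pow_le_pow_left (by omega) 3
        _ = 8 * z ^ 3 := by ring
        _ ≤ _ := by omega
  calc fieldChar n ≤ 18 * cubeRoot n ^ 4 := Nat.findGreatest_le _
    _ ≤ 18 * cubeRoot n ^ 6 := Nat.mul_le_mul le_rfl (Nat.pow_le_pow_right h1 (by norm_num))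
    _ = 18 * (cubeRoot n ^ 3) ^ 2 := by ring
    _ ≤ _ := Nat.mul_le_mul le_rfl (Nat.pow_le_pow_left h2 2)

/-! ## The two programs -/

def preP (P : Prog ArithInstr) (N reps : ℕ) : WordProg := drawP reps ;; prepP P N

section

variable {P : Prog ArithInstr} {N w n m reps L E T : ℕ} {τ : ℕ → ℕ}

theorem Prepared.congr {p n m reps : ℕ} {a R : ℕ → ℕ} {s s' : St} (h : Prepared p n m reps a R s)
    (hv : ∀ r ∈ [3, 10, 12, 16], s'.v r = s.v r)
    (ha : ∀ b ∈ [0, 2, 4, 10, 11], s'.arr b = s.arr b) : Prepared p n m reps a R s' := by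
  obtain ⟨h1, h2, h3, h4, h5, h6, h7, h8, h9, h10⟩ := h
  rw [RepsDone, ← ha 10 (by simp), ← ha 11 (by simp)] at h10
  rw [← hv _ (by simp)] at h2 h3 h4 h5
  rw [← ha _ (by simp)] at h8
  simp only [← ha 4 (by simp)] at h7
  simp only [← ha 2 (by simp)] at h9
  exact ⟨h1, h2, h3, h4, h5, h6, h7, h8, h9, h10⟩

theorem wordBounded_graphInput (G : Digraph (Fin n)) (hn : n < 2 ^ w) (h1 : 1 < 2 ^ w)
    (coins : ℕ → Fin (2 ^ w)) : WordBounded w (graphInput G fun i => coins i) where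
  reg r := by
    simp only [graphInput]
    split_ifs <;> omega
  mem b i := by
    by_cases hb : b = 0
    · subst hb
      exact (adjWords_le_one (G := G) i).trans_lt h1
    · simp only [graphInput, hb, if_false]
      omega
  coins i := (coins i).2

theorem exists_runs_preP (G : Digraph (Fin n)) (hL : L = (8 * n + 1) ^ 2)
    (hsz : 400 * L ^ 2 + (reps + 10) * L + 100 < 2 ^ w)
    (hS : ∀ p m, p.Prime → p ≤ 18 * L → m ≤ 2 * n + 1 → MulSpec P N w p τ m)
    (hE : ∀ m K, m = 2 ^ K → m ≤ 2 * n + 1 → elimTime τ N m K ≤ E)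
    (hT : reps * (n * n) * 16 + 40 + (3000 * L + reps * (350 * L + E + 62) + 100) ≤ T)
    (hTw : T < 2 ^ w) (coins : ℕ → Fin (2 ^ w)) :
    ∃ t ws s m, Runs w (preP P N reps) (graphInput G fun i => coins i) t ws ∧ t ≤ T ∧
      ws.reg 63 ≤ T ∧ Rel false w s ws ∧ m ≤ 2 * n + 1 ∧
      Prepared (fieldChar n) n m reps (adjWords G) (fun k => coins k) s := by
  have hw : 0 < w := Nat.pos_of_ne_zero fun h => by subst h; simp at hsz
  have h1w : 1 < 2 ^ w := by omega
  have hnn : n * n ≤ L := by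
    rw [hL, sq]
    exact Nat.mul_le_mul (by omega) (by omega)
  have hnL : 8 * n + 1 ≤ L := by rw [hL]; exact Nat.le_self_pow (by norm_num) _
  have hrn : reps * (n * n) ≤ reps * L := Nat.mul_le_mul le_rfl hnn
  have hL0 : reps ≤ reps * L := Nat.le_mul_of_pos_right _ (by omega)
  rw [add_mul] at hsz
  have hb := wordBounded_graphInput G (by omega) h1w coins
  obtain ⟨t1, ws1, s1, r1, ht1, he1, hr1, A1, e10, e12, hR⟩ := HT.drawP (reps := reps) (n := n)
    (Q := fun s' => Agree [10, 12, 13, 22] [2] (graphInput G fun i => coins i).toSt s' ∧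
      s'.v 10 = n ∧ s'.v 12 = reps ∧ ∀ k < reps * (n * n), s'.arr 2 k = coins k) hw (by omega)
    (by simp [WordState.toSt, graphInput]) (by omega) (by omega)
    (fun s' h1 h2 h3 h4 => ⟨h1, h2, h3, h4⟩) _ hb.rel_toSt
    (by simp only [graphInput]; norm_num; omega)
  -- Change to the restricted view: the private arrays are still zero, so no stamp exceeds the
  -- counter.
  have hr1' : Rel false w s1 ws1 := by
    refine ⟨hr1.bdd, hr1.reg, fun b _ => hr1.mem b (.inl rfl), by simp, fun _ b hb _ i => ?_⟩
    rw [hr1.mem b (.inl rfl), A1.arr b (by simp; omega)]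
    have : b ≠ 0 := by omega
    simp [WordState.toSt, graphInput, this]
  have he1' : ws1.reg 63 ≤ t1 := by simpa [graphInput] using he1
  obtain ⟨t2, ws2, s2, r2, ht2, he2, hr2, m, hP, hm⟩ := HT.prepP (reps := reps) (n := n)
    (a := adjWords G) (R := fun k => coins k) (E := E) (s := s1)
    (Q := fun s' => ∃ m, Prepared (fieldChar n) n m reps (adjWords G) (fun k => coins k) s' ∧
      m ≤ 2 * n + 1) hL (by rw [add_mul]; omega) hS hE e10 e12
    (by rw [A1.arr 0 (by simp)]; rfl) adjWords_le_one hR (fun s' m h1 h2 => ⟨m, h1, h2⟩) ws1 hr1'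
    (by omega)
  exact ⟨_, ws2, s2, m, Exec.seq r1 r2, by omega, by omega, hr2, hm, hP⟩

/-- Writing the query into the memory touches only registers `0` to `2` and array `1`, none of which
is used by `Prepared` or holds stamps. The call counter goes on from its value after the
preprocessing, so both time bounds together must fit into a word. -/
theorem exists_runs_queryP {a R : ℕ → ℕ} {ws : WordState} {s : St} {p T' : ℕ}
    {G : Digraph (Fin n)} [Fact p.Prime]
    (ups : List (EdgeUpdate n)) (u v : Fin n) {M : ℕ} (hM : M = 2 * ups.length + 3)
    (hrel : Rel false w s ws) (hP : Prepared p n m reps a R s) (he : ws.reg 63 ≤ T)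
    (ha1 : ∀ k, a k ≤ 1) (ha : IsAdj G a)
    (hS : ∀ m ≤ M, MulSpec P N w p τ m)
    (hE : ∀ m K, m = 2 ^ K → m ≤ M → elimTime τ N m K ≤ E)
    (hsz : p * p + 3 * p + reps * (m * m) + n * n + reps + M * M + 6 * M + 100 < 2 ^ w)
    (hT : 200 * M + reps * (200 * (M * M) + E + 100) + 200 ≤ T') (hTw : T + T' < 2 ^ w) :
    ∃ t ws', Runs w (queryP P N) (queryInput ws ups u v) t ws' ∧ t ≤ T' ∧
      ((∃ r < reps, GoodWeights G (applyUpdates G ups) u v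
        (weights fun k : Fin (n * n) => (R (r * (n * n) + k) : ZMod p))) ∧ ws'.reg 0 = 1 ∨
      (∀ r < reps, ¬ GoodWeights G (applyUpdates G ups) u v
        (weights fun k : Fin (n * n) => (R (r * (n * n) + k) : ZMod p))) ∧ ws'.reg 0 = 0) := by
  have hnn : n ≤ n * n := Nat.le_mul_self n
  have hu := u.2
  have hv := v.2
  have hupd := fun t ht => updateWords_getD ups (t := t) ht
  obtain ⟨upd, hupd'⟩ : ∃ upd, upd = fun k =>
    (ups.flatMap fun e => [(e.1 : ℕ), (e.2.1 : ℕ), if e.2.2 then 1 else 0]).getD k 0 := ⟨_, rfl⟩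
  simp only [← congrFun hupd'] at hupd
  have hin : WordBounded w (queryInput ws ups u v) := by
    refine ⟨fun r => ?_, fun b i => ?_, hrel.bdd.coins⟩
    · simp only [queryInput]
      split_ifs
      · omega
      · omega
      · omega
      · exact hrel.bdd.reg r
    · simp only [queryInput, Function.update_apply]
      split_ifs
      · exact updateWords_lt (by omega) (by omega) i
      · exact hrel.bdd.mem b i
  obtain ⟨s0, hs0⟩ : ∃ s0, s0 = (queryInput ws ups u v).toSt := ⟨_, rfl⟩
  have hrel0 : Rel false w s0 (queryInput ws ups u v) := by
    rw [hs0]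
    refine ⟨hin, fun _ _ => rfl, fun _ _ => rfl, by simp, fun _ b hb hb2 i => ?_⟩
    have : b ≠ 1 := by omega
    simpa [queryInput, this] using hrel.stamp rfl b hb hb2 i
  have hP0 : Prepared p n m reps a R s0 := by
    rw [hs0]
    refine hP.congr (fun r hr => ?_) fun b hb => ?_
    · simp only [List.mem_cons, List.not_mem_nil, or_false] at hr
      rw [← hrel.reg r (by omega)]
      simp only [WordState.toSt, queryInput]
      rw [if_neg (by omega), if_neg (by omega), if_neg (by omega)]
    · simp only [List.mem_cons, List.not_mem_nil, or_false] at hb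
      rw [← hrel.mem b (.inr (by omega))]
      have : b ≠ 1 := by omega
      simp [WordState.toSt, queryInput, this]
  subst hM
  obtain ⟨t, ws', s', r1, ht, -, hr', hres⟩ := HT.queryP (f := ups.length) (u := u) (v := v) (G := G)
    (G' := applyUpdates G ups) (upd := upd) (E := E)
    (Q := fun s' => (∃ r < reps, GoodWeights G (applyUpdates G ups) u v
        (weights fun k : Fin (n * n) => (R (r * (n * n) + k) : ZMod p))) ∧ s'.v 0 = 1 ∨
      (∀ r < reps, ¬ GoodWeights G (applyUpdates G ups) u v
        (weights fun k : Fin (n * n) => (R (r * (n * n) + k) : ZMod p))) ∧ s'.v 0 = 0)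
    hP0 hS hE hsz (by rw [hs0]; rfl) (by rw [hs0]; rfl) (by rw [hs0]; rfl)
    (by rw [hs0, hupd']; simp [WordState.toSt, queryInput])
    (fun t ht => by rw [(hupd t ht).1]; exact Fin.is_lt _)
    (fun t ht => by rw [(hupd t ht).2.1]; exact Fin.is_lt _)
    (fun t ht => by rw [(hupd t ht).2.2]; split_ifs <;> omega) ha1 ha
    (ha.applyUpdates ups hupd rfl) (fun _ h => h) _ hrel0
    (by simp only [queryInput]; norm_num; omega)
  refine ⟨t, ws', r1, ht.trans hT, ?_⟩
  rwa [hr'.reg 0 (by norm_num)]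

end

/-! ## Bounds -/

section

variable {ω C : ℝ} {τ : ℕ → ℕ}

theorem sq_le_rpow (hω : 2 ≤ ω) {x : ℝ} (hx : 1 ≤ x) : x ^ 2 ≤ x ^ ω := by
  rw [← Real.rpow_natCast]
  exact Real.rpow_le_rpow_of_exponent_le hx (by exact_mod_cast hω)

/-- With y = 2 ^ k, level k costs (m / y) ^ 2 block products of O(y ^ ω) steps. As ω ≥ 2, this is at
most O((m / y) ^ ω y ^ ω) = O(m ^ ω), the same for all K levels. -/
theorem elimTime_le (hω : 2 ≤ ω) (hC : 0 ≤ C) (hτ : ∀ h, (τ h : ℝ) ≤ C * (h : ℝ) ^ ω) (N : ℕ)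
    {m K : ℕ} (hm : m = 2 ^ K) :
    (elimTime τ N m K : ℝ) ≤ (4 * C + 1500 + 2 * N) * (m : ℝ) ^ ω * (K + 1) := by
  have hm1 : (1 : ℝ) ≤ m := by exact_mod_cast hm ▸ Nat.one_le_two_pow
  have hm2 := sq_le_rpow hω hm1
  have hterm : ∀ k ∈ Finset.range K, ((m / 2 ^ k * blockTime τ N m (2 ^ k) : ℕ) : ℝ) ≤
      (4 * C + 1000 + 2 * N) * (m : ℝ) ^ ω := by
    intro k hk
    have hk : k < K := Finset.mem_range.1 hk
    obtain ⟨x, hx⟩ : ∃ x : ℕ, x = 2 ^ (K - k) := ⟨_, rfl⟩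
    obtain ⟨y, hy⟩ : ∃ y : ℕ, y = 2 ^ k := ⟨_, rfl⟩
    have hxy : m = x * y := by rw [hm, hx, hy, ← pow_add, Nat.sub_add_cancel hk.le]
    have hy0 : 0 < y := by rw [hy]; positivity
    have hx1 : (1 : ℝ) ≤ x := by exact_mod_cast hx ▸ Nat.one_le_two_pow
    have hy1 : (1 : ℝ) ≤ y := by exact_mod_cast hy0
    have hdiv : m / y = x := by rw [hxy, Nat.mul_div_cancel _ hy0]
    rw [← hy, blockTime, hdiv]
    have h1 := sq_le_rpow hω hx1
    have h2 := sq_le_rpow hω hy1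
    have h3 := hτ y
    have hmr : (m : ℝ) ^ ω = (x : ℝ) ^ ω * (y : ℝ) ^ ω := by
      rw [hxy, Nat.cast_mul, Real.mul_rpow (by positivity) (by positivity)]
    have hN : (0 : ℝ) ≤ N := by positivity
    have h4 : 4 * (τ y : ℝ) + (1000 + 2 * N) * (y : ℝ) ^ 2 ≤
        (4 * C + 1000 + 2 * N) * (y : ℝ) ^ ω := by
      have := mul_le_mul_of_nonneg_left h2 (show (0 : ℝ) ≤ 1000 + 2 * N by positivity)
      linarith
    rw [hmr]
    push_cast
    calc (x : ℝ) * (x * (4 * τ y + (1000 + 2 * N) * (y * y)))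
        = (x : ℝ) ^ 2 * (4 * τ y + (1000 + 2 * N) * (y : ℝ) ^ 2) := by ring
      _ ≤ (x : ℝ) ^ ω * ((4 * C + 1000 + 2 * N) * (y : ℝ) ^ ω) :=
        mul_le_mul h1 h4 (by positivity) (by positivity)
      _ = _ := by ring
  have hsum := Finset.sum_le_sum hterm
  rw [Finset.sum_const, Finset.card_range, nsmul_eq_mul] at hsum
  rw [elimTime, Nat.cast_add, Nat.cast_sum]
  have hK : (0 : ℝ) ≤ K := by positivity
  have hfirst : ((m * (m * 100 + 300 + K * 62) + m * 20 + 50 : ℕ) : ℝ) ≤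
      500 * (m : ℝ) ^ ω * (K + 1) := by
    have h5 : (m : ℝ) ≤ (m : ℝ) ^ 2 := by nlinarith
    have h6 : (m : ℝ) * K ≤ (m : ℝ) ^ 2 * K := mul_le_mul_of_nonneg_right h5 hK
    have h7 : 0 ≤ (m : ℝ) ^ 2 * K := by positivity
    push_cast
    calc (m : ℝ) * (m * 100 + 300 + K * 62) + m * 20 + 50 ≤ 500 * (m : ℝ) ^ 2 * (K + 1) := by
          nlinarith
      _ ≤ _ := by gcongr
  have h8 : 0 ≤ (4 * C + 1000 + 2 * N) * (m : ℝ) ^ ω := by positivity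
  linarith

/-- A bound for the time of an elimination of at most `M` columns. -/
noncomputable def elimBound (ω B : ℝ) (M : ℕ) : ℕ := ⌊B * (M : ℝ) ^ ω * (Nat.log 2 M + 1)⌋₊

theorem elimTime_le_elimBound (hω : 2 ≤ ω) (hC : 0 ≤ C) (hτ : ∀ h, (τ h : ℝ) ≤ C * (h : ℝ) ^ ω)
    (N : ℕ) {m K M : ℕ} (hm : m = 2 ^ K) (hmM : m ≤ M) :
    elimTime τ N m K ≤ elimBound ω (4 * C + 1500 + 2 * N) M := by
  refine Nat.le_floor ((elimTime_le hω hC hτ N hm).trans ?_)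
  have hK : K ≤ Nat.log 2 M := by
    have := Nat.log_mono_right (b := 2) hmM
    rwa [hm, Nat.log_pow (by norm_num)] at this
  gcongr

/-- `M ≤ 3 * (x + 1)` serves for the power and `M ≤ 2 * (x + 2)` for the logarithm. -/
theorem elimBound_le (hω : 2 ≤ ω) {B : ℝ} (hB : 0 ≤ B) {M x : ℕ} (hM0 : 1 ≤ M)
    (hM : M ≤ 3 * (x + 1)) (hM2 : M ≤ 2 * (x + 2)) :
    (elimBound ω B M : ℝ) ≤
      3 * B * 3 ^ ω * (((x : ℝ) + 1) ^ ω * (Real.log ((x : ℝ) + 2) / Real.log 2)) := by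
  have hl2 : 0 < Real.log 2 := Real.log_pos (by norm_num)
  have hlx : Real.log 2 ≤ Real.log ((x : ℝ) + 2) :=
    Real.log_le_log (by norm_num) (by linarith [(Nat.cast_nonneg x : (0 : ℝ) ≤ x)])
  have hl1 : 1 ≤ Real.log ((x : ℝ) + 2) / Real.log 2 := by rwa [one_le_div hl2]
  have hlog : (Nat.log 2 M : ℝ) ≤ 1 + Real.log ((x : ℝ) + 2) / Real.log 2 := by
    have h1 : ((2 ^ Nat.log 2 M : ℕ) : ℝ) ≤ 2 * ((x : ℝ) + 2) := by
      exact_mod_cast (Nat.pow_log_le_self 2 (by omega)).trans hM2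
    have h2 := Real.log_le_log (by positivity) h1
    rw [Real.log_mul (by norm_num) (by positivity)] at h2
    push_cast at h2
    rw [Real.log_pow] at h2
    rw [← sub_le_iff_le_add', le_div_iff₀ hl2]
    linarith
  have hMx : (M : ℝ) ^ ω ≤ 3 ^ ω * ((x : ℝ) + 1) ^ ω := by
    rw [← Real.mul_rpow (by norm_num) (by positivity)]
    exact Real.rpow_le_rpow (by positivity) (by exact_mod_cast hM) (by linarith)
  calc (elimBound ω B M : ℝ) ≤ B * (M : ℝ) ^ ω * (Nat.log 2 M + 1) := Nat.floor_le (by positivity)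
    _ ≤ B * (3 ^ ω * ((x : ℝ) + 1) ^ ω) * (3 * (Real.log ((x : ℝ) + 2) / Real.log 2)) := by
      gcongr
      linarith
    _ = _ := by ring

/-- A constant factor is absorbed by the exponent: a ≤ 2 ^ a ≤ X ^ a. -/
theorem const_mul_pow_le {a b B X : ℕ} (hX : 2 ≤ X) (hb : b ≤ B) : a * X ^ b ≤ X ^ (a + B) := by
  rw [pow_add]
  exact Nat.mul_le_mul (a.lt_two_pow_self.le.trans (Nat.pow_le_pow_left hX a))
    (Nat.pow_le_pow_right (by omega) hb)

/-- Bounds for the running times of the preprocessing and of the query, and the space they need. -/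
noncomputable def preTime (ω B : ℝ) (reps n : ℕ) : ℕ :=
  reps * (n * n) * 16 + 40 + (3000 * (8 * n + 1) ^ 2 +
    reps * (350 * (8 * n + 1) ^ 2 + elimBound ω B (2 * n + 1) + 62) + 100)

noncomputable def queryTime (ω B : ℝ) (reps f : ℕ) : ℕ :=
  200 * (2 * f + 3) + reps * (200 * ((2 * f + 3) * (2 * f + 3)) + elimBound ω B (2 * f + 3) + 100) +
    200

theorem preTime_le (hω : 2 ≤ ω) {B : ℝ} (hB : 0 ≤ B) (reps n : ℕ) :
    (preTime ω B reps n : ℝ) ≤ (200000 + reps * (30000 + 3 * B * 3 ^ ω)) *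
      (((n : ℝ) + 1) ^ ω * (Real.log ((n : ℝ) + 2) / Real.log 2)) := by
  have hE := elimBound_le hω hB (M := 2 * n + 1) (x := n) (by omega) (by omega) (by omega)
  obtain ⟨Z, hZ⟩ : ∃ Z, Z = ((n : ℝ) + 1) ^ ω * (Real.log ((n : ℝ) + 2) / Real.log 2) := ⟨_, rfl⟩
  have hn : (0 : ℝ) ≤ n := by positivity
  have hl2 : 0 < Real.log 2 := Real.log_pos (by norm_num)
  have hl1 : 1 ≤ Real.log ((n : ℝ) + 2) / Real.log 2 := by
    rw [one_le_div hl2]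
    exact Real.log_le_log (by norm_num) (by linarith)
  have hnZ : ((n : ℝ) + 1) ^ 2 ≤ Z := by
    rw [hZ]
    exact (sq_le_rpow hω (by linarith)).trans (le_mul_of_one_le_right (by positivity) hl1)
  rw [← hZ] at hE ⊢
  have hr : (0 : ℝ) ≤ reps := by positivity
  rw [preTime]
  push_cast
  have h1 : 1 ≤ ((n : ℝ) + 1) ^ 2 := by nlinarith
  have h2 : (8 * (n : ℝ) + 1) ^ 2 ≤ 64 * Z := by nlinarith
  have h3 : (n : ℝ) * n ≤ Z := by nlinarith
  have h4 : (n : ℝ) * n * 16 + (350 * (8 * (n : ℝ) + 1) ^ 2 + elimBound ω B (2 * n + 1) + 62) ≤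
      (30000 + 3 * B * 3 ^ ω) * Z := by linarith
  have h5 := mul_le_mul_of_nonneg_left h4 hr
  linarith

theorem queryTime_le (hω : 2 ≤ ω) {B : ℝ} (hB : 0 ≤ B) (reps f : ℕ) :
    (queryTime ω B reps f : ℝ) ≤ (200000 + reps * (30000 + 3 * B * 3 ^ ω)) *
      (((f : ℝ) + 1) ^ ω * (Real.log ((f : ℝ) + 2) / Real.log 2)) := by
  have hE := elimBound_le hω hB (M := 2 * f + 3) (x := f) (by omega) (by omega) (by omega)
  obtain ⟨Z, hZ⟩ : ∃ Z, Z = ((f : ℝ) + 1) ^ ω * (Real.log ((f : ℝ) + 2) / Real.log 2) := ⟨_, rfl⟩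
  have hn : (0 : ℝ) ≤ f := by positivity
  have hl2 : 0 < Real.log 2 := Real.log_pos (by norm_num)
  have hl1 : 1 ≤ Real.log ((f : ℝ) + 2) / Real.log 2 := by
    rw [one_le_div hl2]
    exact Real.log_le_log (by norm_num) (by linarith)
  have hnZ : ((f : ℝ) + 1) ^ 2 ≤ Z := by
    rw [hZ]
    exact (sq_le_rpow hω (by linarith)).trans (le_mul_of_one_le_right (by positivity) hl1)
  rw [← hZ] at hE ⊢
  have hr : (0 : ℝ) ≤ reps := by positivity
  rw [queryTime]
  push_cast
  have h1 : 1 ≤ ((f : ℝ) + 1) ^ 2 := by nlinarith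
  have h2 : (2 * (f : ℝ) + 3) * (2 * f + 3) ≤ 9 * Z := by nlinarith
  have h3 : 2 * (f : ℝ) + 3 ≤ 3 * Z := by nlinarith
  have h4 : 200 * ((2 * (f : ℝ) + 3) * (2 * f + 3)) + elimBound ω B (2 * f + 3) + 100 ≤
      (30000 + 3 * B * 3 ^ ω) * Z := by linarith
  have h5 := mul_le_mul_of_nonneg_left h4 hr
  linarith

/-- The time bounds are polynomial. -/
theorem exists_time_le_pow (hω : 2 ≤ ω) {B : ℝ} (hB : 0 ≤ B) (reps : ℕ) : ∃ A b : ℕ,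
    ∀ x X : ℕ, x + 2 ≤ X → preTime ω B reps x ≤ A * X ^ b ∧ queryTime ω B reps x ≤ A * X ^ b := by
  have hl2 : 0 < Real.log 2 := Real.log_pos (by norm_num)
  obtain ⟨D, hD⟩ : ∃ D, D = 200000 + reps * (30000 + 3 * B * 3 ^ ω) := ⟨_, rfl⟩
  have hD0 : 0 ≤ D := by rw [hD]; positivity
  refine ⟨⌈D / Real.log 2⌉₊, ⌈ω⌉₊ + 1, fun x X hX => ?_⟩
  have hXr : (x : ℝ) + 2 ≤ X := by exact_mod_cast hX
  have hx0 : (0 : ℝ) ≤ x := by positivity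
  have key : D * (((x : ℝ) + 1) ^ ω * (Real.log ((x : ℝ) + 2) / Real.log 2)) ≤
      ((⌈D / Real.log 2⌉₊ * X ^ (⌈ω⌉₊ + 1) : ℕ) : ℝ) := by
    have h1 : ((x : ℝ) + 1) ^ ω ≤ (X : ℝ) ^ ⌈ω⌉₊ := by
      rw [← Real.rpow_natCast]
      exact (Real.rpow_le_rpow (by positivity) (by linarith) (by linarith)).trans
        (Real.rpow_le_rpow_of_exponent_le (by linarith) (Nat.le_ceil ω))
    have h2 : Real.log ((x : ℝ) + 2) ≤ X :=
      (Real.log_le_self (by positivity)).trans hXr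
    have h2' : 0 ≤ Real.log ((x : ℝ) + 2) := Real.log_nonneg (by linarith)
    push_cast
    calc D * (((x : ℝ) + 1) ^ ω * (Real.log ((x : ℝ) + 2) / Real.log 2))
        = D / Real.log 2 * (((x : ℝ) + 1) ^ ω * Real.log ((x : ℝ) + 2)) := by ring
      _ ≤ ⌈D / Real.log 2⌉₊ * ((X : ℝ) ^ ⌈ω⌉₊ * X) := by
        gcongr
        exact Nat.le_ceil _
      _ = _ := by ring
  exact ⟨by exact_mod_cast (hD ▸ preTime_le hω hB reps x).trans key,
    by exact_mod_cast (hD ▸ queryTime_le hω hB reps x).trans key⟩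

end

/-! ## The word size and the correctness -/

section

variable {ω C : ℝ}

/-- Everything that must fit into a word is polynomial in `X`; the sum of all coefficients enters
the exponent, so one `κ` covers all requirements at once. -/
theorem exists_wordSize (hω : 2 ≤ ω) {B : ℝ} (hB : 0 ≤ B) (κ₀ N reps : ℕ) : ∃ κ : ℕ,
    ∀ X w : ℕ, 2 ≤ X → X ^ κ ≤ 2 ^ w → (2 * X) ^ κ₀ ≤ 2 ^ w ∧ N ≤ 2 ^ w ∧
      10000000 * (reps + 1) * X ^ 4 < 2 ^ w ∧
      ∀ x y, x + 2 ≤ X → y + 2 ≤ X → preTime ω B reps x + queryTime ω B reps y < 2 ^ w := by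
  obtain ⟨A, b, hA⟩ := exists_time_le_pow hω hB reps
  refine ⟨(2 ^ κ₀ + N + 10000000 * (reps + 1) + 2 * A + 1) + (κ₀ + 4 + b), fun X w hX hw => ?_⟩
  have h := (const_mul_pow_le (a := 2 ^ κ₀ + N + 10000000 * (reps + 1) + 2 * A + 1) hX
    (le_refl (κ₀ + 4 + b))).trans hw
  have hX1 : 1 ≤ X := by omega
  obtain ⟨Z, hZ⟩ : ∃ Z, Z = X ^ (κ₀ + 4 + b) := ⟨_, rfl⟩
  have hZ1 : 1 ≤ Z := hZ ▸ Nat.one_le_pow _ _ hX1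
  have e : (2 ^ κ₀ + N + 10000000 * (reps + 1) + 2 * A + 1) * Z =
      2 ^ κ₀ * Z + N * Z + 10000000 * (reps + 1) * Z + 2 * (A * Z) + Z := by ring
  rw [← hZ, e] at h
  refine ⟨?_, ?_, ?_, fun x y hx hy => ?_⟩
  · rw [mul_pow]
    have : 2 ^ κ₀ * X ^ κ₀ ≤ 2 ^ κ₀ * Z :=
      Nat.mul_le_mul le_rfl (hZ ▸ Nat.pow_le_pow_right hX1 (by omega))
    omega
  · have : N ≤ N * Z := Nat.le_mul_of_pos_right _ hZ1
    omega
  · have : 10000000 * (reps + 1) * X ^ 4 ≤ 10000000 * (reps + 1) * Z :=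
      Nat.mul_le_mul le_rfl (hZ ▸ Nat.pow_le_pow_right hX1 (by omega))
    omega
  · have h1 := (hA x X hx).1
    have h2 := (hA y X hy).2
    have h3 : A * X ^ b ≤ A * Z :=
      Nat.mul_le_mul le_rfl (hZ ▸ Nat.pow_le_pow_right hX1 (by omega))
    omega

/-- The elimination works with padded sizes, so the index words must suffice for `2 * X` instead of
`X`. The time is rounded down to a natural number, and `max C 0` keeps it meaningful for negative
constants. -/
theorem mulSpec_of_bound {P : Prog ArithInstr} {κ₀ N w p m X reps : ℕ}
    (hP : ∀ (p : ℕ) [Fact p.Prime] (n w : ℕ), 1 ≤ n → (n + 2) ^ κ₀ ≤ 2 ^ w →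
      ∀ (A B : Matrix (Fin n) (Fin n) (ZMod p)) (coins : ℕ → Fin (2 ^ w)),
        ∃ (t : ℕ) (s : ArithState (ZMod p)),
          Exec (fun s => s.word.reg) (ArithInstr.act w) P (mulInput A B fun k => coins k) t s ∧
          (∀ i j : Fin n, s.fmem 2 (i * n + j) = (A * B) i j) ∧ (t : ℝ) ≤ C * (n : ℝ) ^ ω)
    (hN : 0 < N) (hbelow : ArithBelow N P) (hNw : N ≤ 2 ^ w) (hX : (2 * X) ^ κ₀ ≤ 2 ^ w)
    (hX4 : 10000000 * (reps + 1) * X ^ 4 < 2 ^ w) (hm : m + 2 ≤ 2 * X) (hp : p ≤ 1152 * (X * X)) :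
    MulSpec P N w p (fun h => ⌊max C 0 * (h : ℝ) ^ ω⌋₊) m := by
  refine ⟨fun h h1 hh hpp A B coins => ?_, hbelow, hN, hNw, ?_⟩
  · obtain ⟨t, s, hex, hmul, ht⟩ :=
      hP p h w h1 ((Nat.pow_le_pow_left (by omega) κ₀).trans hX) A B coins
    refine ⟨t, s, hex, hmul, Nat.le_floor (ht.trans ?_)⟩
    gcongr
    exact le_max_left _ _
  · have hpp := Nat.mul_le_mul hp hp
    have e : 1152 * (X * X) * (1152 * (X * X)) = 1327104 * X ^ 4 := by ring
    have hmm : m * m ≤ 2 * X * (2 * X) := Nat.mul_le_mul (by omega) (by omega)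
    have e2 : 2 * X * (2 * X) = 4 * (X * X) := by ring
    have hXX : X ≤ X * X := Nat.le_mul_self X
    have hXX4 : X * X ≤ X ^ 4 := by
      rw [show X ^ 4 = X * X * (X * X) by ring]
      exact Nat.le_mul_self _
    have h1 : X ^ 4 ≤ (reps + 1) * X ^ 4 := Nat.le_mul_of_pos_left _ (by omega)
    rw [mul_assoc] at hX4
    omega

theorem fieldChar_le_sq {n X : ℕ} (hX : n + 2 ≤ X) : (8 * n + 1) ^ 2 ≤ 64 * (X * X) ∧
    fieldChar n ≤ 1152 * (X * X) := by
  have h1 : (8 * n + 1) ^ 2 ≤ 64 * (X * X) := by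
    calc (8 * n + 1) ^ 2 ≤ (8 * X) ^ 2 := Nat.pow_le_pow_left (by omega) 2
      _ = _ := by ring
  have := fieldChar_le n
  omega

/-- Whether the query answers correctly is decided by the weights. -/
theorem prob_not_answersCorrectly_le {w n c : ℕ} {pre query : WordProg} {G : Digraph (Fin n)}
    {ups : List (EdgeUpdate n)} {u v : Fin n} (hw : fieldChar n * (n * n) ≤ 2 ^ w)
    (h : ∀ coins : ℕ → Fin (2 ^ w), ∃ t t' s s', Runs w pre (graphInput G fun i => coins i) t s ∧
      Runs w query (queryInput s ups u v) t' s' ∧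
      ((∃ r < 3 * c, GoodWeights G (applyUpdates G ups) u v (weights fun k : Fin (n * n) =>
        (((coins (r * (n * n) + k) : Fin (2 ^ w)) : ℕ) : ZMod (fieldChar n)))) ∧ s'.reg 0 = 1 ∨
      (∀ r < 3 * c, ¬ GoodWeights G (applyUpdates G ups) u v (weights fun k : Fin (n * n) =>
        (((coins (r * (n * n) + k) : Fin (2 ^ w)) : ℕ) : ZMod (fieldChar n)))) ∧
          s'.reg 0 = 0)) :
    randomWords w {coins | ¬ AnswersCorrectly w pre query G ups u v fun i => coins i} ≤
      ((n : ENNReal) ^ c)⁻¹ := by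
  have hn : 1 ≤ n := by have := u.2; omega
  -- For a reachable pair an error means that all repetitions have bad weights; for an unreachable
  -- pair the set of errors is empty.
  by_cases hreach : Reachable (applyUpdates G ups) u v
  · refine (measure_mono fun coins hc => ?_).trans (randomWords_bad_le (G := G) (u := u) (v := v) c
      hn (le_cubeRoot_pow n) (fieldChar_spec n).2 hw hreach)
    obtain ⟨t, t', s, s', h1, h2, h3⟩ := h coins
    rcases h3 with ⟨-, h3⟩ | ⟨h3, -⟩
    · exact absurd ⟨t, t', s, s', h1, h2, by rw [h3, if_pos hreach]⟩ hc
    · exact h3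
  · have : {coins : ℕ → Fin (2 ^ w) |
        ¬ AnswersCorrectly w pre query G ups u v fun i => coins i} = ∅ := by
      refine Set.eq_empty_of_forall_notMem fun coins hc => hc ?_
      obtain ⟨t, t', s, s', h1, h2, h3⟩ := h coins
      refine ⟨t, t', s, s', h1, h2, ?_⟩
      rcases h3 with ⟨⟨r, -, h3⟩, -⟩ | ⟨-, h3⟩
      · exact absurd h3 (goodWeights_false_of_not_reachable hreach _)
      · rw [h3, if_neg hreach]
    rw [this, measure_empty]
    exact zero_le

end

end SensReach

/-! ### Assembly: constants, word size, the two programs. -/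

open SensReach in
theorem mainTheorem8 (ω : ℝ) (hω : IsMatMulExponent ω) (c : ℕ) :
    ∃ (pre query : WordProg) (κ k : ℕ) (C : ℝ),
      ∀ (w n : ℕ) (G : Digraph (Fin n)), (n + 2) ^ κ ≤ 2 ^ w →
        (∀ coins : ℕ → Fin (2 ^ w), ∃ (t : ℕ) (s : WordState),
          Runs w pre (graphInput G fun i => coins i) t s ∧
            (t : ℝ) ≤ C * ((n : ℝ) + 1) ^ ω * Real.log ((n : ℝ) + 2) ^ k) ∧
        ∀ (ups : List (EdgeUpdate n)) (u v : Fin n), (n + ups.length + 2) ^ κ ≤ 2 ^ w →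
          (∀ (coins : ℕ → Fin (2 ^ w)) (t : ℕ) (s : WordState),
            Runs w pre (graphInput G fun i => coins i) t s →
              ∃ (t' : ℕ) (s' : WordState),
                Runs w query (queryInput s ups u v) t' s' ∧
                  (t' : ℝ) ≤
                    C * ((ups.length : ℝ) + 1) ^ ω * Real.log ((ups.length : ℝ) + 2) ^ k) ∧
          randomWords w
              {coins | ¬ AnswersCorrectly w pre query G ups u v fun i => coins i} ≤
            ((n : ENNReal) ^ c)⁻¹ := by
  have hω2 := two_le_of_isMatMulExponent hω
  obtain ⟨P, κ₀, C₀, hP⟩ := hω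
  obtain ⟨N₀, hN₀⟩ := exists_arithBelow P
  obtain ⟨N, hN⟩ : ∃ N, N = N₀ + 1 := ⟨_, rfl⟩
  have hC : (0 : ℝ) ≤ max C₀ 0 := le_max_right _ _
  have hτ : ∀ h : ℕ, ((⌊max C₀ 0 * (h : ℝ) ^ ω⌋₊ : ℕ) : ℝ) ≤ max C₀ 0 * (h : ℝ) ^ ω :=
    fun h => Nat.floor_le (by positivity)
  -- The coefficient of m ^ ω in the bound for the elimination.
  obtain ⟨B, hBdef⟩ : ∃ B, B = 4 * max C₀ 0 + 1500 + 2 * (N : ℝ) := ⟨_, rfl⟩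
  have hB : 0 ≤ B := by rw [hBdef]; positivity
  have hE : ∀ M m K : ℕ, m = 2 ^ K → m ≤ M →
      elimTime (fun h => ⌊max C₀ 0 * (h : ℝ) ^ ω⌋₊) N m K ≤ elimBound ω B M := fun M m K hm hmM =>
    hBdef ▸ elimTime_le_elimBound hω2 hC hτ N hm hmM
  obtain ⟨reps, hreps⟩ : ∃ reps, reps = 3 * c := ⟨_, rfl⟩
  obtain ⟨κ, hκ⟩ := exists_wordSize hω2 hB κ₀ N reps
  obtain ⟨D, hD⟩ : ∃ D, D = 200000 + reps * (30000 + 3 * B * 3 ^ ω) := ⟨_, rfl⟩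
  -- The factor 1 / log 2 of the binary logarithm moves into the constant; a single logarithm
  -- remains, so `k = 1`.
  have hreal : ∀ (t : ℕ) (x : ℝ),
      (t : ℝ) ≤ D * ((x + 1) ^ ω * (Real.log (x + 2) / Real.log 2)) →
      (t : ℝ) ≤ D / Real.log 2 * (x + 1) ^ ω * Real.log (x + 2) ^ 1 := fun t x h =>
    h.trans_eq (by ring)
  refine ⟨preP P N reps, queryP P N, κ, 1, D / Real.log 2, fun w n G hw => ?_⟩
  have hpre : ∀ coins : ℕ → Fin (2 ^ w), ∃ t ws s m,
      Runs w (preP P N reps) (graphInput G fun i => coins i) t ws ∧ t ≤ preTime ω B reps n ∧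
      ws.reg 63 ≤ preTime ω B reps n ∧ Rel false w s ws ∧ m ≤ 2 * n + 1 ∧
      Prepared (fieldChar n) n m reps (adjWords G) (fun k => coins k) s := by
    obtain ⟨k1, k2, k3, k4⟩ := hκ (n + 2) w (by omega) hw
    obtain ⟨hL, -⟩ := fieldChar_le_sq (n := n) le_rfl
    have e4 : (n + 2) ^ 4 = (n + 2) * (n + 2) * ((n + 2) * (n + 2)) := by ring
    have hX4 : (n + 2) * (n + 2) ≤ (n + 2) ^ 4 := e4 ▸ Nat.le_mul_self _
    have h1 : 1 ≤ (n + 2) ^ 4 := Nat.one_le_pow _ _ (by omega)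
    refine exists_runs_preP G rfl ?_ (fun p m hp hpL hm => ?_) (hE (2 * n + 1)) le_rfl ?_
    · have h2 : ((8 * n + 1) ^ 2) ^ 2 ≤ 4096 * (n + 2) ^ 4 := by
        calc ((8 * n + 1) ^ 2) ^ 2 ≤ (64 * ((n + 2) * (n + 2))) ^ 2 := Nat.pow_le_pow_left hL 2
          _ = _ := by ring
      have h3 : (reps + 10) * (8 * n + 1) ^ 2 ≤ (reps + 10) * (64 * (n + 2) ^ 4) :=
        Nat.mul_le_mul le_rfl (hL.trans (Nat.mul_le_mul le_rfl hX4))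
      have e5 : 10000000 * (reps + 1) * (n + 2) ^ 4 =
        10000000 * (reps * (n + 2) ^ 4) + 10000000 * (n + 2) ^ 4 := by ring
      have e6 : (reps + 10) * (64 * (n + 2) ^ 4) =
        64 * (reps * (n + 2) ^ 4) + 640 * (n + 2) ^ 4 := by ring
      omega
    · exact mulSpec_of_bound hP (by omega) (hN₀ N (by omega)) k2 k1 k3 (by omega) (by omega)
    · have := k4 n 0 le_rfl (by omega)
      omega
  refine ⟨fun coins => ?_, fun ups u v hw' => ?_⟩
  · obtain ⟨t, ws, s, m, h1, h2, -⟩ := hpre coins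
    exact ⟨t, ws, h1, hreal t n (le_trans (by exact_mod_cast h2) (hD ▸ preTime_le hω2 hB reps n))⟩
  obtain ⟨k1, k2, k3, k4⟩ := hκ (n + ups.length + 2) w (by omega) hw'
  obtain ⟨X, hX⟩ : ∃ X, X = n + ups.length + 2 := ⟨_, rfl⟩
  rw [← hX] at k1 k3
  -- The node `u` forces `n ≥ 1`, which is needed for the padded query size: `2 * f + 5 ≤ 2 * X`.
  have hn := u.2
  obtain ⟨-, hp⟩ := fieldChar_le_sq (n := n) (X := X) (by omega)
  have e4 : X ^ 4 = X * X * (X * X) := by ring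
  have hX4 : X * X ≤ X ^ 4 := e4 ▸ Nat.le_mul_self _
  have hXX : X ≤ X * X := Nat.le_mul_self X
  have hnn : n * n ≤ X * X := Nat.mul_le_mul (by omega) (by omega)
  have e5 : 10000000 * (reps + 1) * X ^ 4 = 10000000 * (reps * X ^ 4) + 10000000 * X ^ 4 := by ring
  have hquery : ∀ (coins : ℕ → Fin (2 ^ w)) (t : ℕ) (s : WordState),
      Runs w (preP P N reps) (graphInput G fun i => coins i) t s → ∃ t' s',
        Runs w (queryP P N) (queryInput s ups u v) t' s' ∧ t' ≤ queryTime ω B reps ups.length ∧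
        ((∃ r < reps, GoodWeights G (applyUpdates G ups) u v (weights fun k : Fin (n * n) =>
          (((coins (r * (n * n) + k) : Fin (2 ^ w)) : ℕ) : ZMod (fieldChar n)))) ∧ s'.reg 0 = 1 ∨
        (∀ r < reps, ¬ GoodWeights G (applyUpdates G ups) u v (weights fun k : Fin (n * n) =>
          (((coins (r * (n * n) + k) : Fin (2 ^ w)) : ℕ) : ZMod (fieldChar n)))) ∧
            s'.reg 0 = 0) := by
    intro coins t s hrun
    obtain ⟨t₀, ws, s₀, m, h1, h2, h3, h4, h5, h6⟩ := hpre coins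
    -- Runs are deterministic, so any halting run of the preprocessing ends in the state that has
    -- been analysed.
    obtain ⟨-, rfl⟩ := Exec.unique hrun h1
    refine exists_runs_queryP (T := preTime ω B reps n) (T' := queryTime ω B reps ups.length)
      (E := elimBound ω B (2 * ups.length + 3)) (R := fun k => coins k) ups u v rfl h4 h6 h3
      adjWords_le_one isAdj_adjWords (fun m' hm' => ?_) (hE (2 * ups.length + 3)) ?_
      (by rw [queryTime]) (k4 n ups.length (by omega) (by omega))
    · exact mulSpec_of_bound hP (by omega) (hN₀ N (by omega)) k2 k1 k3 (by omega) hp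
    · have hpp := Nat.mul_le_mul hp hp
      have e6 : 1152 * (X * X) * (1152 * (X * X)) = 1327104 * X ^ 4 := by ring
      have hmm : reps * (m * m) ≤ reps * (2 * X * (2 * X)) :=
        Nat.mul_le_mul le_rfl (Nat.mul_le_mul (by omega) (by omega))
      have e7 : reps * (2 * X * (2 * X)) = 4 * (reps * (X * X)) := by ring
      have hr4 : reps * (X * X) ≤ reps * X ^ 4 := Nat.mul_le_mul le_rfl hX4
      have hr1 : reps ≤ reps * (X * X) := Nat.le_mul_of_pos_right _
        (Nat.mul_pos (by omega) (by omega))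
      have hMM : (2 * ups.length + 3) * (2 * ups.length + 3) ≤ 2 * X * (2 * X) :=
        Nat.mul_le_mul (by omega) (by omega)
      have e8 : 2 * X * (2 * X) = 4 * (X * X) := by ring
      omega
  refine ⟨fun coins t s hrun => ?_, ?_⟩
  · obtain ⟨t', s', h1, h2, -⟩ := hquery coins t s hrun
    exact ⟨t', s', h1, hreal t' ups.length
      (le_trans (by exact_mod_cast h2) (hD ▸ queryTime_le hω2 hB reps ups.length))⟩
  · refine prob_not_answersCorrectly_le ?_ fun coins => ?_
    · have h1 := Nat.mul_le_mul hp hnn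
      have e6 : 1152 * (X * X) * (X * X) = 1152 * X ^ 4 := by ring
      omega
    · obtain ⟨t, s, -, -, h1, -⟩ := hpre coins
      obtain ⟨t', s', h2, -, h3⟩ := hquery coins t s h1
      exact ⟨t, t', s, s', h1, h2, hreps ▸ h3⟩
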